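/- **Virasoro constraints up to genus 2 for two-primary models.** *Conventions.* Primary labels are $a\in\{0,1\}$, $\eta_{ab}=\eta^{ab}=\delta_{a+b,1}$, $d\in\mathbb C\setminus\{-1\}$, $\mu_0=-d/2$, $\mu_1=d/2$. Put $$\phi(u)=\begin{cases}u^{(1+d)/(1-d)}\\ e^u\end{cases}\quad \psi(u)=\begin{cases}\frac{d(3d-1)}{24(d-1)}\log u\\ -\frac{u}{24}\end{cases}\quad h_0(u)=\begin{cases}-\frac{d(3d-1)(3d-5)(d-2)}{5760(d+1)}u^{(d-3)/(1-d)}& (d\neq1)\\ 0&(d=1).\end{cases}$$ Fix a base point $(p^0,p^1)\in\mathbb C^2$ with $p^1\notin(-\infty,0]$ ($p^1$ is arbitrary if $d\in\{0,\frac13,1\}$, when these functions are entire). Functions on the large phase space are formal power series in the variables $t^a_k-p^a\delta_{k,0}$ ($k\ge0$); $\partial_{k,a}=\partial/\partial t^a_k$, $\partial=\partial_{0,0}$, $\tilde t^a_k=t^a_k-\delta_{k,1}\delta^a_0$, $\langle\langle\tau_{k_1,a_1}\cdots\tau_{k_n,a_n}\rangle\rangle_g=\partial_{k_1,a_1}\cdots\partial_{k_n,a_n}\mathcal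 F_g$, $\mathcal O_a=\tau_{0,a}$, and repeated primary labels are summed. Let $R[\ell]=(R[\ell]_a^b)$, $\ell\ge1$, be $2\times2$ complex matrices, finitely many nonzero, with $(\mu_b-\mu_a)R[\ell]_a^b=\ell R[\ell]_a^b$ and $R[\ell]_{ab}+(-1)^\ell R[\ell]_{ba}=0$, where $R[\ell]_{ab}=R[\ell]_a^c\eta_{cb}$. *Virasoro operators.* For $n\ge-1$, $k\in\mathbb Z$, $\ell\ge0$ let $$A_n(k,\ell)_a^b=\sum_{i=0}^{n+1}e_{n+1-i}\bigl(\mu_a+k+\tfrac12,\dots,\mu_a+k+\tfrac12+n\bigr)\sum_{\ell_1+\dots+\ell_i=\ell}(R[\ell_1]\cdots R[\ell_i])_a^b,$$ $e_j$ being the $j$-th elementary symmetric polynomial (for $i=0$ the inner sum is $\delta_{\ell,0}\delta_a^b$), and $$\begin{aligned}L_n={}&\frac1{2\hbar}\sum_{\substack{k,m,\ell\ge0\\k+m+n+1=\ell}}(-1)^mA_n(k,\ell)_a^b\,\eta_{bc}\,\tilde t^a_k\tilde t^c_m+\sum_{\substack{k,\ell\ge0\\ \ell\le k+n}}A_n(k,\ell)_a^b\,\tilde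 t^a_k\,\partial_{k+n-\ell,b}\\&+\frac\hbar2\sum_{\substack{j,m,\ell\ge0\\j+m+\ell=n-1}}(-1)^{j+1}A_n(-1-j,\ell)_c^b\,\eta^{ca}\,\partial_{j,a}\partial_{m,b}+\frac{\delta_{n,0}}4\sum_a\bigl(\tfrac14-\mu_a^2\bigr).\end{aligned}$$ With $Z=\exp\sum_g\hbar^{g-1}\mathcal F_g$, the genus $g$ part of $L_nZ=0$ is the vanishing of the coefficient of $\hbar^{g-1}$ in $Z^{-1}L_nZ$. *The potentials.* $\mathcal F_0$ satisfies: the genus 0 parts of $L_{-1}Z=0$ (string equation) and of $L_0Z=0$ (homogeneity); the dilaton equation $\sum\tilde t^a_k\partial_{k,a}\mathcal F_0=2\mathcal F_0$; the recursion $\langle\langle\tau_{k+1,a}\tau_{l,b}\tau_{m,c}\rangle\rangle_0=\langle\langle\tau_{k,a}\mathcal O_e\rangle\rangle_0\,\eta^{ef}\langle\langle\mathcal O_f\tau_{l,b}\tau_{m,c}\rangle\rangle_0$; and $\langle\langle\mathcal O_1\mathcal O_1\rangle\rangle_0=\phi(u)$, where $u=\langle\langle\mathcal O_0\mathcal O_0\rangle\rangle_0$,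 $v=\langle\langle\mathcal O_0\mathcal O_1\rangle\rangle_0$. Let $\Delta=(\partial v)^2-\phi'(u)(\partial u)^2$ and let $(\mathcal C^{ab})$ be the inverse of the matrix $(\partial\langle\langle\mathcal O_a\mathcal O_b\rangle\rangle_0)$. Then $\mathcal F_1=\frac1{24}\log\Delta+\psi(u)$ and $\mathcal F_2=\mathcal F_{2,0}+\mathcal F_{2,1}+f_2$, where $$\begin{aligned}\mathcal F_{2,0}={}&\tfrac1{1152}\partial^2\langle\langle\mathcal O_a\mathcal O_b\mathcal O_c\mathcal O_e\rangle\rangle_0\mathcal C^{ab}\mathcal C^{ce}-\tfrac1{1152}\partial^2\langle\langle\mathcal O_a\mathcal O_b\rangle\rangle_0\,\partial\langle\langle\mathcal O_c\mathcal O_e\mathcal O_f\mathcal O_g\rangle\rangle_0\mathcal C^{ac}\mathcal C^{be}\mathcal C^{fg}\\&-\tfrac1{360}\partial^2\langle\langle\mathcal O_a\mathcal O_b\mathcal O_c\rangle\rangle_0\,\partial\langle\langle\mathcal O_e\mathcal O_f\mathcal O_g\rangle\rangle_0\mathcal C^{ae}\mathcal C^{bf}\mathcal C^{cg}\\&+\tfrac1{360}\partial^2\langle\langle\mathcal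 O_a\mathcal O_b\rangle\rangle_0\,\partial\langle\langle\mathcal O_c\mathcal O_e\mathcal O_f\rangle\rangle_0\,\partial\langle\langle\mathcal O_g\mathcal O_h\mathcal O_k\rangle\rangle_0\mathcal C^{ac}\mathcal C^{bg}\mathcal C^{eh}\mathcal C^{fk},\end{aligned}$$ and, with $s=24\psi$ and $s_{a_1\dots a_n}=\partial_{0,a_1}\cdots\partial_{0,a_n}\bigl(s(u)\bigr)$, $$\begin{aligned}576\,\mathcal F_{2,1}={}&\bigl(\tfrac12\partial s_{ab}+\tfrac45\,\partial s_a\,s_b\bigr)\mathcal C^{ab}+\partial^2\langle\langle\mathcal O_a\mathcal O_b\rangle\rangle_0\bigl(\tfrac65s_{ce}-\tfrac1{10}s_cs_e\bigr)\mathcal C^{ac}\mathcal C^{be}\\&+\bigl(\tfrac7{10}\partial^2\langle\langle\mathcal O_a\mathcal O_b\mathcal O_c\rangle\rangle_0\,s_e-\tfrac3{10}\partial\langle\langle\mathcal O_a\mathcal O_b\mathcal O_c\rangle\rangle_0\,\partial s_e\bigr)\mathcal C^{ab}\mathcal C^{ce}\\&+\partial^2\langle\langle\mathcal O_a\mathcal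 O_b\rangle\rangle_0\,\partial\langle\langle\mathcal O_c\mathcal O_e\mathcal O_f\rangle\rangle_0\,s_g\bigl(\tfrac3{10}\mathcal C^{ag}\mathcal C^{bc}\mathcal C^{ef}-\tfrac{23}{10}\mathcal C^{ac}\mathcal C^{be}\mathcal C^{fg}\bigr)\\&+\tfrac1{10}(\partial u)^4\phi''(u)\,s''(u)\,\Delta^{-1},\end{aligned}$$ $$f_2=\tfrac12\bigl((\partial v)^2+\phi'(u)(\partial u)^2\bigr)h_0(u).$$ **Theorem.** For all such $d$, base points, matrices $R[\ell]$ and $\mathcal F_0$: (i) $\mathcal F_2$ satisfies the genus 2 part of $L_2Z=0$; (ii) for every value $\hbar\neq0$, each $L_n$ with $n\ge-1$ lies in the Lie algebra of operators generated by $L_{-1}$ and $L_2$; (iii) the genus $g$ part of $L_nZ=0$ holds for all $n\ge-1$ and all $g\le2$. -/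

import Mathlib

open MvPowerSeries

noncomputable section

namespace TwoPrimary

/-! ### Formal functions on the large phase space

Indices are pairs `(a, k)` with `a` a primary label and `k` a descendant level. The variable `X (a, k)`
is `t^a_k - p^a δ_{k,0}`, where `p` is the base point on the small phase space. -/

/-- Formal power series in the coordinates of the large phase space, centred at the base point. -/
abbrev LPS : Type := MvPowerSeries (Fin 2 × ℕ) ℂ

/-- `∂_{k,a} = ∂/∂t^a_k`. -/
abbrev pd (a : Fin 2) (k : ℕ) (F : LPS) : LPS := pderiv ℂ (a, k) F

/-- `∂_{0,a₁} ⋯ ∂_{0,aₙ} F` for a list `[a₁, …, aₙ]` of primary labels. -/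
def prim (F : LPS) (l : List (Fin 2)) : LPS := l.foldr (fun a G => pd a 0 G) F

/-- The intersection form `η_{ab} = δ_{a+b,1}`; its inverse `η^{ab}` has the same entries. -/
def eta (a b : Fin 2) : ℂ := if (a : ℕ) + (b : ℕ) = 1 then 1 else 0

/-- `f(G)`, for `f` holomorphic near the constant term of `G`: the Taylor series of `f` at that point,
with `G` minus its constant term substituted. -/
def comp (f : ℂ → ℂ) (G : LPS) : LPS :=
  PowerSeries.subst (G - C (constantCoeff G))
    (PowerSeries.mk fun n => iteratedDeriv n f (constantCoeff G) / (n.factorial : ℂ))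

/-- The infinite sum `∑ᵢ Xᵢ Gᵢ`, which is finite in every coefficient. -/
def sumX (G : Fin 2 × ℕ → LPS) : LPS :=
  fun m => ∑ i ∈ m.support, coeff (m - Finsupp.single i 1) (G i)

/-- `sumX G` is the coefficientwise limit of the finite partial sums of `∑ᵢ Xᵢ Gᵢ`. -/
theorem coeff_sumX (G : Fin 2 × ℕ → LPS) (m : (Fin 2 × ℕ) →₀ ℕ) (s : Finset (Fin 2 × ℕ))
    (hs : m.support ⊆ s) : coeff m (sumX G) = coeff m (∑ i ∈ s, X i * G i) := by
  classical
  rw [map_sum, ← Finset.sum_subset hs]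
  · change ∑ i ∈ m.support, coeff (m - Finsupp.single i 1) (G i) = _
    refine Finset.sum_congr rfl fun i hi => ?_
    have h1 : Finsupp.single i 1 ≤ m := by
      rw [Finsupp.single_le_iff]
      exact Nat.one_le_iff_ne_zero.mpr (Finsupp.mem_support_iff.mp hi)
    rw [X_def, coeff_monomial_mul, if_pos h1, one_mul]
  · intro i _ hi
    have h1 : ¬ Finsupp.single i 1 ≤ m := by
      rw [Finsupp.single_le_iff, Finsupp.notMem_support_iff.mp hi]
      omega
    rw [X_def, coeff_monomial_mul, if_neg h1]

theorem sumX_add (G H : Fin 2 × ℕ → LPS) :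
    sumX (fun i => G i + H i) = sumX G + sumX H := by
  ext m
  change ∑ i ∈ m.support, coeff (m - Finsupp.single i 1) (G i + H i) =
    ∑ i ∈ m.support, coeff (m - Finsupp.single i 1) (G i) +
      ∑ i ∈ m.support, coeff (m - Finsupp.single i 1) (H i)
  simp [Finset.sum_add_distrib]

theorem sumX_smul (c : ℂ) (G : Fin 2 × ℕ → LPS) : sumX (fun i => c • G i) = c • sumX G := by
  ext m
  change ∑ i ∈ m.support, coeff (m - Finsupp.single i 1) (c • G i) =
    c * ∑ i ∈ m.support, coeff (m - Finsupp.single i 1) (G i)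
  simp [Finset.mul_sum]

/-! ### Backgrounds with two primary fields -/

/-- The eigenvalues `μ_0 = -d/2`, `μ_1 = d/2`. -/
def mu (d : ℂ) (a : Fin 2) : ℂ := if a = 0 then -d / 2 else d / 2

/-- Data of a two-primary background: the charge `d`; a base point `(p^0, p^1) = (v, u)` of the small
phase space at which the structure functions below are holomorphic; and the matrices
`R[ℓ] = (R[ℓ]_a^b)` (row `a`, column `b`), `ℓ > 0`, collected in a polynomial `∑ R[ℓ] z^ℓ`. -/
structure Background where
  d : ℂ
  d_ne : d ≠ -1
  base : Fin 2 → ℂ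
  base_mem : base 1 ∈ Complex.slitPlane ∨ d = 0 ∨ d = 1 / 3 ∨ d = 1
  R : Polynomial (Matrix (Fin 2) (Fin 2) ℂ)
  R_zero : R.coeff 0 = 0
  /-- `[μ, R[ℓ]] = ℓ R[ℓ]` for the operators `μ O_a = μ_a O_a`, `R[ℓ] O_a = R[ℓ]_a^b O_b`. -/
  R_grading : ∀ (l : ℕ) (a b : Fin 2),
    (mu d b - mu d a) * R.coeff l a b = (l : ℂ) * R.coeff l a b
  /-- `R[ℓ]_{ab} + (-1)^ℓ R[ℓ]_{ba} = 0`, where `R[ℓ]_{ab} = R[ℓ]_a^c η_{cb}`. -/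
  R_symm : ∀ (l : ℕ) (a b : Fin 2),
    ∑ c, R.coeff l a c * eta c b + (-1) ^ l * ∑ c, R.coeff l b c * eta c a = 0

/-- The function `φ(u)`. -/
def phi (d u : ℂ) : ℂ := if d = 1 then Complex.exp u else u ^ ((1 + d) / (1 - d))

/-- The function `ψ(u)`. -/
def psi (d u : ℂ) : ℂ :=
  if d = 1 then -u / 24 else d * (3 * d - 1) / (24 * (d - 1)) * Complex.log u

/-- The function `h_0(u)`. -/
def hZero (d u : ℂ) : ℂ :=
  if d = 1 then 0
  else -(d * (3 * d - 1) * (3 * d - 5) * (d - 2) / (5760 * (d + 1))) * u ^ ((d - 3) / (1 - d))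

variable (B : Background)

/-- The shifted coordinate `t̃^a_k = t^a_k - δ_{k,1} δ^a_0`. -/
def tt (a : Fin 2) (k : ℕ) : LPS :=
  X (a, k) + C ((if k = 0 then B.base a else 0) - (if k = 1 ∧ a = 0 then 1 else 0))

/-- The infinite sum `∑_{a,k} t̃^a_k G(a,k)`. -/
def sumT (G : Fin 2 × ℕ → LPS) : LPS :=
  sumX G + ∑ a, B.base a • G (a, 0) - G (0, 1)

/-! ### The Virasoro operators

In what follows `N = n + 1` is the number of factors in the coefficients of `L_n`. -/

/-- `e_{N-i}(x, x+1, …, x+N-1)`, that is the coefficient of `s^i` in `(s+x)(s+x+1)⋯(s+x+N-1)`. -/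
def elem (N i : ℕ) (x : ℂ) : ℂ :=
  (∏ j ∈ Finset.range N, (Polynomial.X + Polynomial.C (x + (j : ℂ)))).coeff i

/-- `A_n(k,ℓ)_a^b = ∑_i e_{n+1-i}(μ_a+k+1/2, …, μ_a+k+1/2+n) (R^i)[ℓ]_a^b`, where `(R^i)[ℓ]` is the
sum of `R[ℓ₁] ⋯ R[ℓᵢ]` over `ℓ₁ + ⋯ + ℓᵢ = ℓ`. -/
def virCoeff (N : ℕ) (k : ℤ) (l : ℕ) (a b : Fin 2) : ℂ :=
  ∑ i ∈ Finset.range (N + 1), elem N i (mu B.d a + (k : ℂ) + 1 / 2) * (B.R ^ i).coeff l a b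

/-- The coefficients `virCoeff B N k l a b` vanish for `l > degBound B N`. -/
def degBound (N : ℕ) : ℕ := N * B.R.natDegree

/-- The part of `L_n` that is quadratic in the coordinates (the coefficient of `ħ⁻¹`):
`1/2 ∑ A_n(k,ℓ)_a^b (-1)^m η_{bc} t̃^a_k t̃^c_m` over `k, m ≥ 0` with `k + m + n + 1 = ℓ`. -/
def virQuad (N : ℕ) : LPS :=
  (1 / 2 : ℂ) • ∑ k ∈ Finset.range (degBound B N + 1), ∑ l ∈ Finset.range (degBound B N + 1),
    if k + N ≤ l then
      ∑ a, ∑ b, ∑ c, (virCoeff B N k l a b * (-1) ^ (l - k - N) * eta b c) •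
        (tt B a k * tt B c (l - k - N))
    else 0

/-- The part of `L_n` that is a vector field:
`∑ A_n(k,ℓ)_a^b t̃^a_k ∂_{k+n-ℓ,b}` over `k ≥ 0` and `ℓ ≤ k + n`. -/
def virVec (N : ℕ) (F : LPS) : LPS :=
  sumT B fun i => ∑ l ∈ Finset.range (degBound B N + 1),
    if l + 1 ≤ i.2 + N then
      ∑ b, virCoeff B N i.2 l i.1 b • pd b (i.2 + N - (l + 1)) F
    else 0

/-- The part of `L_n` that is of second order (the coefficient of `ħ`), as a bilinear expression:
`1/2 ∑ (-1)^{j+1} A_n(-1-j,ℓ)_c^b η^{ca} G((a,j),(b,m))` over `j, m ≥ 0` with `j + m + ℓ = n - 1`.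
With `G((a,j),(b,m)) = ∂_{j,a} ∂_{m,b} F` it is the operator itself. -/
def virPair (N : ℕ) (G : Fin 2 × ℕ → Fin 2 × ℕ → LPS) : LPS :=
  (1 / 2 : ℂ) • ∑ j ∈ Finset.range N, ∑ l ∈ Finset.range (degBound B N + 1),
    if j + l + 2 ≤ N then
      ∑ a, ∑ b, ∑ c, ((-1) ^ (j + 1) * virCoeff B N (-1 - (j : ℤ)) l c b * eta c a) •
        G (a, j) (b, N - 2 - j - l)
    else 0

/-- The constant in `L_n`, namely `δ_{n,0} Tr(1/4 - μ²) / 4`. -/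
def virConst (N : ℕ) : ℂ := if N = 1 then 1 / 4 * ∑ a, (1 / 4 - mu B.d a ^ 2) else 0

theorem sumT_add (G H : Fin 2 × ℕ → LPS) :
    sumT B (fun i => G i + H i) = sumT B G + sumT B H := by
  simp only [sumT, sumX_add, smul_add, Finset.sum_add_distrib]
  abel

theorem sumT_smul (c : ℂ) (G : Fin 2 × ℕ → LPS) :
    sumT B (fun i => c • G i) = c • sumT B G := by
  simp only [sumT, sumX_smul, smul_sub, smul_add, Finset.smul_sum, smul_comm c]

/-- The vector field part of `L_n` as a linear map. -/
def virVecLin (N : ℕ) : LPS →ₗ[ℂ] LPS where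
  toFun := virVec B N
  map_add' F G := by
    simp only [virVec, ← sumT_add]
    congr 1
    funext i
    rw [← Finset.sum_add_distrib]
    refine Finset.sum_congr rfl fun l _ => ?_
    split_ifs <;> simp [pd, smul_add, add_add_add_comm]
  map_smul' c F := by
    simp only [virVec, RingHom.id_apply, ← sumT_smul]
    congr 1
    funext i
    rw [Finset.smul_sum]
    refine Finset.sum_congr rfl fun l _ => ?_
    split_ifs <;> simp [pd, smul_comm c]

/-- The second order part of `L_n` as a linear map. -/
def virBiLin (N : ℕ) : LPS →ₗ[ℂ] LPS where
  toFun F := virPair B N fun i j => pderiv ℂ i (pderiv ℂ j F)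
  map_add' F G := by
    simp only [virPair, ← smul_add, ← Finset.sum_add_distrib]
    congr 1
    refine Finset.sum_congr rfl fun j _ => Finset.sum_congr rfl fun l _ => ?_
    split_ifs
    · simp only [map_add, smul_add, Finset.sum_add_distrib]
    · simp
  map_smul' c F := by
    simp only [virPair, RingHom.id_apply]
    rw [smul_comm c (1 / 2 : ℂ)]
    refine congrArg (fun x => (1 / 2 : ℂ) • x) ?_
    rw [Finset.smul_sum]
    refine Finset.sum_congr rfl fun j _ => ?_
    rw [Finset.smul_sum]
    refine Finset.sum_congr rfl fun l _ => ?_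
    split_ifs
    · simp only [Derivation.map_smul, Finset.smul_sum, smul_comm c]
    · simp

/-- The differential operator `L_n`, `n ≥ -1`, for a value `ħ ≠ 0` of the loop parameter. -/
def virasoroOperator (hbar : ℂ) (n : ℤ) : Module.End ℂ LPS :=
  hbar⁻¹ • LinearMap.mulLeft ℂ (virQuad B (n + 1).toNat) + virVecLin B (n + 1).toNat +
    hbar • virBiLin B (n + 1).toNat + virConst B (n + 1).toNat • LinearMap.id

section

attribute [local instance] LieRing.ofAssociativeRing

/-- The Lie algebra of operators, with the commutator as bracket, generated by a set `S`. -/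
def generatedLieAlgebra (S : Set (Module.End ℂ LPS)) : Submodule ℂ (Module.End ℂ LPS) :=
  (LieSubalgebra.lieSpan ℂ (Module.End ℂ LPS) S).toSubmodule

end

/-- The coefficient of `ħ^{g-1}` in `Z⁻¹ L_n Z`, where `Z = exp (∑_g ħ^{g-1} F_g)`. The genus `g` part
of the constraint `L_n Z = 0` is the equation `virasoroPart B F n g = 0`. -/
def virasoroPart (F : ℕ → LPS) (n : ℤ) (g : ℕ) : LPS :=
  (if g = 0 then virQuad B (n + 1).toNat else 0) +
  virVec B (n + 1).toNat (F g) +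
  virPair B (n + 1).toNat (fun i j =>
    ∑ h ∈ Finset.range (g + 1), pderiv ℂ i (F h) * pderiv ℂ j (F (g - h))) +
  (if g = 0 then 0
    else virPair B (n + 1).toNat (fun i j => pderiv ℂ i (pderiv ℂ j (F (g - 1))))) +
  (if g = 1 then C (virConst B (n + 1).toNat) else 0)

/-! ### The potentials in genus 0, 1 and 2 -/

/-- The genus 0 potential of a two-primary model. -/
structure IsGenusZeroPotential (F : ℕ → LPS) : Prop where
  /-- The string equation `L_{-1} F_0 + 1/2 η_{ab} t^a_0 t^b_0 = 0`. -/
  string : virasoroPart B F (-1) 0 = 0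
  /-- The dilaton equation `D F_0 = -2 F_0`. -/
  dilaton : -sumT B (fun i => pd i.1 i.2 (F 0)) = -2 * F 0
  /-- The genus 0 topological recursion relation. -/
  trr : ∀ (a b c : Fin 2) (k l m : ℕ),
    pd a (k + 1) (pd b l (pd c m (F 0))) =
      ∑ e, ∑ f, eta e f • (pd a k (pd e 0 (F 0)) * pd f 0 (pd b l (pd c m (F 0))))
  /-- Quasi-homogeneity: the genus 0 part of `L_0 Z = 0`. -/
  homogeneity : virasoroPart B F 0 0 = 0
  /-- `⟪O_1 O_1⟫_0 = φ(⟪O_0 O_0⟫_0)`. -/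
  structure_function : prim (F 0) [1, 1] = comp (phi B.d) (prim (F 0) [0, 0])

/-- `u = ⟪O_0 O_0⟫_0`. -/
def uFun (F₀ : LPS) : LPS := prim F₀ [0, 0]

/-- `v = ⟪O_0 O_1⟫_0`. -/
def vFun (F₀ : LPS) : LPS := prim F₀ [0, 1]

/-- The matrix `∂𝒰`, where `𝒰_a^b = ⟪O_a O^b⟫_0`. -/
def dU (F₀ : LPS) : Matrix (Fin 2) (Fin 2) LPS :=
  Matrix.of fun a b => ∑ c, eta c b • prim F₀ [0, a, c]

/-- `Δ = det ∂𝒰`. -/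
def Delta (F₀ : LPS) : LPS := (dU F₀).det

/-- `𝒞^{ab}`: the inverse `𝒞` of `∂𝒰` with its lower index raised, that is the inverse of the matrix
`∂⟪O_a O_b⟫_0`. -/
def CC (F₀ : LPS) : Matrix (Fin 2) (Fin 2) LPS :=
  (Matrix.of fun a b => prim F₀ [0, a, b])⁻¹

/-- `F_1 = log(Δ)/24 + ψ(u)`; as `Δ` has constant term `1`, its logarithm is a formal one. -/
def genusOne (F₀ : LPS) : LPS :=
  (1 / 24 : ℂ) • (PowerSeries.log ℂ).subst (Delta F₀ - 1) + comp (psi B.d) (uFun F₀)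

/-- The universal part `F_{2,0}`. -/
def genusTwoZero (F₀ : LPS) : LPS :=
  (1 / 1152 : ℂ) • (∑ a, ∑ b, ∑ c, ∑ e,
    prim F₀ [0, 0, a, b, c, e] * CC F₀ a b * CC F₀ c e) -
  (1 / 1152 : ℂ) • (∑ a, ∑ b, ∑ c, ∑ e, ∑ f, ∑ g,
    prim F₀ [0, 0, a, b] * prim F₀ [0, c, e, f, g] * CC F₀ a c * CC F₀ b e * CC F₀ f g) -
  (1 / 360 : ℂ) • (∑ a, ∑ b, ∑ c, ∑ e, ∑ f, ∑ g,
    prim F₀ [0, 0, a, b, c] * prim F₀ [0, e, f, g] * CC F₀ a e * CC F₀ b f * CC F₀ c g) +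
  (1 / 360 : ℂ) • (∑ a, ∑ b, ∑ c, ∑ e, ∑ f, ∑ g, ∑ h, ∑ k,
    prim F₀ [0, 0, a, b] * prim F₀ [0, c, e, f] * prim F₀ [0, g, h, k] *
      CC F₀ a c * CC F₀ b g * CC F₀ e h * CC F₀ f k)

/-- The part `F_{2,1}`, written in terms of the function `s = 24 ψ`. -/
def genusTwoOne (F₀ : LPS) : LPS :=
  let s : ℂ → ℂ := fun x => 24 * psi B.d x
  let S : List (Fin 2) → LPS := prim (comp s (uFun F₀))
  (1 / 576 : ℂ) • (
    (∑ a, ∑ b, ((1 / 2 : ℂ) • S [0, a, b] + (4 / 5 : ℂ) • (S [0, a] * S [b])) * CC F₀ a b) +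
    (∑ a, ∑ b, ∑ c, ∑ e, prim F₀ [0, 0, a, b] *
      ((6 / 5 : ℂ) • S [c, e] - (1 / 10 : ℂ) • (S [c] * S [e])) * CC F₀ a c * CC F₀ b e) +
    (∑ a, ∑ b, ∑ c, ∑ e, ((7 / 10 : ℂ) • (prim F₀ [0, 0, a, b, c] * S [e]) -
      (3 / 10 : ℂ) • (prim F₀ [0, a, b, c] * S [0, e])) * CC F₀ a b * CC F₀ c e) +
    (∑ a, ∑ b, ∑ c, ∑ e, ∑ f, ∑ g, prim F₀ [0, 0, a, b] * prim F₀ [0, c, e, f] * S [g] *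
      ((3 / 10 : ℂ) • (CC F₀ a g * CC F₀ b c * CC F₀ e f) -
        (23 / 10 : ℂ) • (CC F₀ a c * CC F₀ b e * CC F₀ f g))) +
    (1 / 10 : ℂ) • (pd 0 0 (uFun F₀) ^ 4 * comp (iteratedDeriv 2 (phi B.d)) (uFun F₀) *
      comp (iteratedDeriv 2 s) (uFun F₀) * (Delta F₀)⁻¹))

/-- The part `f_2 = ((∂v)² + φ'(u) (∂u)²) h_0(u) / 2`. -/
def genusTwoTwo (F₀ : LPS) : LPS :=
  (1 / 2 : ℂ) • ((pd 0 0 (vFun F₀) ^ 2 + comp (deriv (phi B.d)) (uFun F₀) *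
    pd 0 0 (uFun F₀) ^ 2) * comp (hZero B.d) (uFun F₀))

/-- `F_2 = F_{2,0} + F_{2,1} + f_2`. -/
def genusTwo (F₀ : LPS) : LPS := genusTwoZero F₀ + genusTwoOne B F₀ + genusTwoTwo B F₀

end TwoPrimary

end

open MvPowerSeries

noncomputable section

namespace TwoPrimary

set_option linter.unusedSectionVars false
set_option linter.unusedSimpArgs false

section

/-! ### Infinite sums over the coordinates -/

/-! Regard a two-sided sequence (`Seq`) as a series in a variable z with two components, `sh 1`
being multiplication by z. The grading of R turns the recursion for the coefficients A_n into `ls B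
(N+1) = ls B N ∘ sh (-1) ∘ ls B 1` (`ls_succ`). With `lower = sh (-1) ∘ ls B 1`, which satisfies
[`lower`, `sh 1`] = 1, the transformation underlying L_{N-1} is z·lowerᴺ, and the brackets of these
transformations are computed in a Weyl algebra (`ls_ls`). The symmetry of R makes them
infinitesimally symplectic (`virCoeff_flip`).

Genus 0. The values t̃_k in degrees k ≥ 0 and the signed derivatives of F₀ in negative degrees are
the coordinates of a point of a cone. The derivative in t_i of the genus 0 constraint is the pairing
of this point with `ls B N (sq F i)`, so the constraint amounts to tangency. The string equation and
homogeneity are the cases N = 0, 1; the topological recursion passes from N to N + 1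
(`Tangent.succ`); the dilaton equation integrates the derivatives (`genusZeroPart_eq_zero`).

Genus 1 and 2 for L₋₁ and L₂. Derivations extend uniquely to the algebraic closure of the field of
fractions, where φ'(u) has a square root κ. Let w be the off-diagonal entry of multiplication by the
Euler field and r = κw. The canonical coordinates v ± r are the eigenvalues of this multiplication
and `frame F (±κ)` its eigenvectors. The vector field of L₂ sends a canonical coordinate x to -x³,
and its commutator with ∂ is an explicit residue, so its action on the jets p, q, p₁, q₁, … is found
recursively. The second order part of L₂ has constant coefficients, so its values on jets follow
from its value on F₀. The matrix 𝒞 is diagonal in the frame, and F₂ and the gradient of F₁ become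
rational in finitely many jets (`Jets.emb_genusTwo`, `Jets.gradK_genusOne`). The constraints for L₂
are then identities of rational functions (`Jets.genus_one`, `Jets.genus_two`); those for L₋₁ hold
because the string field annihilates all the jets that occur.

Commutators. The defect of a Virasoro relation commutes with all coordinates and derivatives, hence
is a scalar (`defect_eq_smul`). For brackets with L₋₁ homogeneity forces the scalar to vanish, and
the Jacobi identity propagates this to the brackets with L₀ and L₁. So L₋₁ and L₂ produce L₁ and L₀,
and then L₁ raises L₂ to all higher L_n.

All n. Conjugating a relation by exp(ħ⁻¹F₀ + F₁ + ħF₂) and comparing powers of ħ transfers the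
vanishing in genus 1 and 2 from two operators to their bracket (`virasoroPart_eq_zero_of_comm`). -/

theorem sumX_mul (H : LPS) (G : Fin 2 × ℕ → LPS) : sumX (fun i => H * G i) = H * sumX G := by
  classical
  ext m
  rw [coeff_sumX _ m m.support subset_rfl]
  have h : ∑ i ∈ m.support, X i * (H * G i) = H * ∑ i ∈ m.support, X i * G i := by
    rw [Finset.mul_sum]
    exact Finset.sum_congr rfl fun i _ => by ring
  rw [h, coeff_mul, coeff_mul]
  refine Finset.sum_congr rfl fun p hp => ?_
  rw [coeff_sumX G p.2 m.support]
  rw [← Finset.HasAntidiagonal.mem_antidiagonal.mp hp]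
  exact Finsupp.support_mono (self_le_add_left _ _)

theorem sumX_zero : sumX (fun _ => 0) = 0 := by
  simpa using sumX_mul 0 (fun _ => 0)

theorem sumX_sum {ι : Type*} (s : Finset ι) (G : ι → Fin 2 × ℕ → LPS) :
    sumX (fun i => ∑ j ∈ s, G j i) = ∑ j ∈ s, sumX (G j) := by
  classical
  induction s using Finset.induction_on with
  | empty => simpa using sumX_zero
  | insert a s ha ih => simp only [Finset.sum_insert ha, sumX_add, ih]

/-- The product rule term by term: the derivative of the factor X i contributes the extra summand G
i. -/
theorem pderiv_sumX (i : Fin 2 × ℕ) (G : Fin 2 × ℕ → LPS) :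
    pderiv ℂ i (sumX G) = G i + sumX (fun j => pderiv ℂ i (G j)) := by
  classical
  ext m
  -- A coefficient of a derivative at m is one at m plus the unit vector of i, so the index set has
  -- to contain i.
  set s := insert i m.support with hs
  have h1 : (m + Finsupp.single i 1).support ⊆ s := by
    intro j hj
    have := Finsupp.support_add hj
    rw [hs, Finset.mem_insert]
    rcases Finset.mem_union.mp this with h | h
    · exact Or.inr h
    · exact Or.inl (by simpa using Finsupp.support_single_subset h)
  rw [coeff_pderiv, coeff_sumX G _ s h1, map_add,
    coeff_sumX _ m s (Finset.subset_insert _ _), ← coeff_pderiv, ← map_add]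
  congr 1
  rw [map_sum]
  have h2 : ∀ j ∈ s, pderiv ℂ i (X j * G j) =
      (if j = i then G i else 0) + X j * pderiv ℂ i (G j) := by
    intro j _
    rw [Derivation.leibniz, smul_eq_mul, smul_eq_mul, add_comm]
    congr 1
    split_ifs with h
    · subst h; simp
    · rw [pderiv_X_of_ne h, mul_zero]
  rw [Finset.sum_congr rfl h2, Finset.sum_add_distrib, Finset.sum_ite_eq' s i,
    if_pos (Finset.mem_insert_self _ _)]

/-- In a fixed coefficient m only pairs of indices from `m.support` matter, so this is an
interchange of finite sums. -/
theorem sumX_comm (G : Fin 2 × ℕ → Fin 2 × ℕ → LPS) :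
    sumX (fun i => sumX (fun j => G i j)) = sumX (fun j => sumX (fun i => G i j)) := by
  classical
  have key : ∀ (H : Fin 2 × ℕ → Fin 2 × ℕ → LPS) (m : (Fin 2 × ℕ) →₀ ℕ),
      coeff m (sumX (fun i => sumX (fun j => H i j))) =
        coeff m (∑ i ∈ m.support, ∑ j ∈ m.support, X i * (X j * H i j)) := by
    intro H m
    change ∑ i ∈ m.support, coeff (m - Finsupp.single i 1) (sumX (fun j => H i j)) = _
    rw [map_sum]
    refine Finset.sum_congr rfl fun i hi => ?_
    have h1 : Finsupp.single i 1 ≤ m := by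
      rw [Finsupp.single_le_iff]
      exact Nat.one_le_iff_ne_zero.mpr (Finsupp.mem_support_iff.mp hi)
    rw [← Finset.mul_sum, X_def (R := ℂ) i, coeff_monomial_mul, if_pos h1, one_mul]
    exact coeff_sumX _ _ _ (Finsupp.support_mono tsub_le_self)
  ext m
  rw [key, key (fun i j => G j i), Finset.sum_comm]
  congr 1
  exact Finset.sum_congr rfl fun i _ => Finset.sum_congr rfl fun j _ => by ring

variable (B : Background)

theorem sumT_mul (H : LPS) (G : Fin 2 × ℕ → LPS) :
    sumT B (fun i => H * G i) = H * sumT B G := by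
  simp only [sumT, sumX_mul, mul_sub, mul_add, Finset.mul_sum, mul_smul_comm]

theorem sumT_zero : sumT B (fun _ => 0) = 0 := by
  simpa using sumT_mul B 0 (fun _ => 0)

theorem sumT_sum {ι : Type*} (s : Finset ι) (G : ι → Fin 2 × ℕ → LPS) :
    sumT B (fun i => ∑ j ∈ s, G j i) = ∑ j ∈ s, sumT B (G j) := by
  classical
  induction s using Finset.induction_on with
  | empty => simpa using sumT_zero B
  | insert a s ha ih => simp only [Finset.sum_insert ha, sumT_add, ih]

theorem pderiv_sumT (i : Fin 2 × ℕ) (G : Fin 2 × ℕ → LPS) :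
    pderiv ℂ i (sumT B G) = G i + sumT B (fun j => pderiv ℂ i (G j)) := by
  simp only [sumT, map_sub, map_add, map_sum, pderiv_sumX, Derivation.map_smul]
  ring

theorem sumT_comm (G : Fin 2 × ℕ → Fin 2 × ℕ → LPS) :
    sumT B (fun i => sumT B (fun j => G i j)) = sumT B (fun j => sumT B (fun i => G i j)) := by
  have h1 : ∀ G : Fin 2 × ℕ → Fin 2 × ℕ → LPS,
      sumX (fun i => sumT B (fun j => G i j)) =
      sumX (fun i => sumX (fun j => G i j)) + ∑ a, B.base a • sumX (fun i => G i (a, 0)) -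
        sumX (fun i => G i (0, 1)) := by
    intro G
    have : (fun i => sumT B (fun j => G i j)) = fun i =>
        (sumX (fun j => G i j) + ∑ a, B.base a • G i (a, 0)) + (-1 : ℂ) • G i (0, 1) := by
      funext i; simp [sumT, sub_eq_add_neg]
    rw [this, sumX_add, sumX_add, sumX_smul, sumX_sum]
    simp only [sumX_smul, neg_one_smul, sub_eq_add_neg]
  have h2 : ∀ G : Fin 2 × ℕ → Fin 2 × ℕ → LPS,
      sumT B (fun i => sumT B (fun j => G i j)) =
      sumX (fun i => sumT B (fun j => G i j)) + ∑ a, B.base a • sumT B (fun j => G (a, 0) j) -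
        sumT B (fun j => G (0, 1) j) := fun G => rfl
  rw [h2, h2, h1, h1, sumX_comm]
  simp only [sumT, Fin.sum_univ_two, smul_add, smul_sub, smul_smul, mul_comm (B.base 1)]
  abel

theorem pderiv_tt (i : Fin 2 × ℕ) (a : Fin 2) (k : ℕ) :
    pderiv ℂ i (tt B a k) = if i = (a, k) then 1 else 0 := by
  rw [tt, map_add, pderiv_C, add_zero]
  split_ifs with h
  · rw [h, pderiv_X_self]
  · exact pderiv_X_of_ne fun h' => h h'.symm

/-- A sum with finitely many terms is an ordinary one. -/
theorem sumT_single (i : Fin 2 × ℕ) (H : LPS) :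
    sumT B (fun j => if j = i then H else 0) = tt B i.1 i.2 * H := by
  classical
  have h : sumX (fun j => if j = i then H else 0) = X i * H := by
    ext m
    rw [coeff_sumX _ m (insert i m.support) (Finset.subset_insert _ _)]
    congr 1
    simp
  rw [sumT, h, tt, add_mul, ← smul_eq_C_mul, add_sub_assoc]
  congr 1
  obtain ⟨a, k⟩ := i
  rw [sub_smul]
  congr 1
  · rcases k with _ | k
    · simp [Prod.ext_iff]
    · simp [Prod.ext_iff]
  · simp only [Prod.mk.injEq]
    by_cases h : k = 1 ∧ a = 0
    · rw [if_pos h, if_pos ⟨h.2.symm, h.1.symm⟩, one_smul]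
    · rw [if_neg h, if_neg fun h' => h ⟨h'.2.symm, h'.1.symm⟩, zero_smul]

/-! ### Substitution into power series of one variable -/

/-- Divisibility by Gⁿ forces order at least n. This allows identities of substituted series to be
checked modulo all powers of G. -/
theorem eq_zero_of_forall_pow_dvd {G x : LPS} (hG : constantCoeff G = 0)
    (h : ∀ n : ℕ, G ^ n ∣ x) : x = 0 := by
  rw [← order_eq_top_iff, ENat.eq_top_iff_forall_ge]
  intro n
  obtain ⟨y, rfl⟩ := h n
  exact (le_order_pow_of_constantCoeff_eq_zero n hG).trans
    (le_self_add.trans le_order_mul)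

/-- Writing f = f(0) + X g, the defect of the chain rule for f is G times the defect for g;
iterating, it is divisible by every power of G. -/
theorem pderiv_subst {G : LPS} (hG : constantCoeff G = 0) (f : PowerSeries ℂ) (i : Fin 2 × ℕ) :
    pderiv ℂ i (f.subst G) = (PowerSeries.derivative ℂ f).subst G * pderiv ℂ i G := by
  have hs : PowerSeries.HasSubst G := PowerSeries.HasSubst.of_constantCoeff_zero hG
  rw [← sub_eq_zero]
  refine eq_zero_of_forall_pow_dvd hG fun n => ?_
  induction n generalizing f with
  | zero => simp
  | succ n ih =>
    obtain ⟨g, hg⟩ := PowerSeries.X_dvd_iff.mpr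
      (show PowerSeries.constantCoeff (f - PowerSeries.C (PowerSeries.constantCoeff f)) = 0 by simp)
    rw [sub_eq_iff_eq_add] at hg
    obtain ⟨y, hy⟩ := ih g
    refine ⟨y, ?_⟩
    rw [hg, PowerSeries.subst_add hs, PowerSeries.subst_mul hs, PowerSeries.subst_X hs,
      PowerSeries.subst_C, map_add, map_add, Derivation.leibniz, Derivation.leibniz,
      PowerSeries.derivative_X, PowerSeries.derivative_C, pderiv_C, smul_eq_mul, smul_eq_mul,
      smul_eq_mul, smul_eq_mul, PowerSeries.subst_add hs, PowerSeries.subst_add hs,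
      PowerSeries.subst_mul hs, PowerSeries.subst_X hs, mul_one, pow_succ]
    have h0 : (0 : PowerSeries ℂ).subst G = (0 : LPS) := by
      simpa using PowerSeries.subst_C (S := ℂ) (a := G) (0 : ℂ)
    rw [h0]
    linear_combination G * hy

/-- The witness is the exponential of F minus its constant term, for which the substitution is
defined. The scalar that is lost is invisible in Z⁻¹ L Z. -/
theorem exists_exp (F : LPS) :
    ∃ E : LPS, IsUnit E ∧ ∀ i, pderiv ℂ i E = pderiv ℂ i F * E := by
  have h0 : constantCoeff (F - C (constantCoeff F)) = 0 := by simp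
  refine ⟨(PowerSeries.exp ℂ).subst (F - C (constantCoeff F)), ?_, fun i => ?_⟩
  · rw [MvPowerSeries.isUnit_iff_constantCoeff]
    have h1 : PowerSeries.constantCoeff (PowerSeries.exp ℂ - PowerSeries.C 1) = 0 := by simp
    have h2 := PowerSeries.constantCoeff_subst_eq_zero h0 _ h1
    rw [PowerSeries.subst_sub (PowerSeries.HasSubst.of_constantCoeff_zero h0),
      PowerSeries.subst_C, map_sub, sub_eq_zero] at h2
    rw [h2]
    simp
  · rw [pderiv_subst h0, map_sub, pderiv_C, sub_zero, mul_comm]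
    congr 2
    ext n
    rw [PowerSeries.coeff_derivative, PowerSeries.coeff_exp, PowerSeries.coeff_exp,
      Nat.factorial_succ]
    have : ((n : ℂ) + 1) ≠ 0 := by exact_mod_cast Nat.succ_ne_zero n
    have : ((n.factorial : ℕ) : ℂ) ≠ 0 := by exact_mod_cast n.factorial_ne_zero
    simp only [one_div, map_inv₀, map_natCast]
    push_cast
    field_simp

/-- The differential equation (1 + X) log' = 1, substituted at D - 1. -/
theorem mul_pderiv_log {D : LPS} (hD : constantCoeff D = 1) (i : Fin 2 × ℕ) :
    D * pderiv ℂ i ((PowerSeries.log ℂ).subst (D - 1)) = pderiv ℂ i D := by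
  have h0 : constantCoeff (D - 1) = 0 := by simp [hD]
  have hs := PowerSeries.HasSubst.of_constantCoeff_zero h0
  rw [pderiv_subst h0, ← mul_assoc, map_sub, pderiv_one, sub_zero]
  have h1 : (1 + PowerSeries.X) * PowerSeries.derivative ℂ (PowerSeries.log ℂ) =
      PowerSeries.C 1 := by
    rw [PowerSeries.deriv_log]
    ext n
    rw [add_mul, one_mul, map_add, PowerSeries.coeff_mk]
    rcases n with _ | n
    · simp
    · rw [PowerSeries.coeff_succ_X_mul, PowerSeries.coeff_mk, map_one, PowerSeries.coeff_one]
      simp [pow_succ]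
  have h2 := congrArg (fun f : PowerSeries ℂ => f.subst (D - 1)) h1
  rw [PowerSeries.subst_mul hs, PowerSeries.subst_add hs, PowerSeries.subst_X hs,
    ← map_one (PowerSeries.C (R := ℂ)), PowerSeries.subst_C] at h2
  simp only [map_one, add_sub_cancel] at h2
  rw [h2, one_mul]

theorem pderiv_comp (f : ℂ → ℂ) (G : LPS) (i : Fin 2 × ℕ) :
    pderiv ℂ i (comp f G) = comp (deriv f) G * pderiv ℂ i G := by
  rw [comp, pderiv_subst (by simp), map_sub, pderiv_C, sub_zero, comp]
  congr 2
  ext n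
  rw [PowerSeries.coeff_derivative, PowerSeries.coeff_mk, PowerSeries.coeff_mk,
    iteratedDeriv_succ', Nat.factorial_succ]
  have : ((n : ℂ) + 1) ≠ 0 := by exact_mod_cast Nat.succ_ne_zero n
  have : ((n.factorial : ℕ) : ℂ) ≠ 0 := by exact_mod_cast n.factorial_ne_zero
  push_cast
  field_simp

/-- Only the germ at the constant term enters, so identities valid near the base point suffice. -/
theorem comp_congr {f g : ℂ → ℂ} {G : LPS} (h : f =ᶠ[nhds (constantCoeff G)] g) :
    comp f G = comp g G := by
  unfold comp
  congr 2
  funext n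
  rw [h.iteratedDeriv_eq n]

/-- The Leibniz formula for the n-th derivative, divided by n!, is the Cauchy product of Taylor
coefficients. -/
theorem comp_mul {f g : ℂ → ℂ} {G : LPS} (hf : AnalyticAt ℂ f (constantCoeff G))
    (hg : AnalyticAt ℂ g (constantCoeff G)) : comp (f * g) G = comp f G * comp g G := by
  unfold comp
  rw [← PowerSeries.subst_mul (PowerSeries.HasSubst.of_constantCoeff_zero (by simp))]
  congr 1
  ext n
  rw [PowerSeries.coeff_mk, PowerSeries.coeff_mul,
    iteratedDeriv_mul hf.contDiffAt hg.contDiffAt, Finset.sum_div,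
    Finset.Nat.sum_antidiagonal_eq_sum_range_succ_mk]
  refine Finset.sum_congr rfl fun k hk => ?_
  have hk' : k ≤ n := Nat.lt_succ_iff.mp (Finset.mem_range.mp hk)
  rw [PowerSeries.coeff_mk, PowerSeries.coeff_mk, Nat.choose_eq_factorial_div_factorial hk',
    Nat.cast_div (Nat.factorial_mul_factorial_dvd_factorial hk')
      (by exact_mod_cast (Nat.mul_ne_zero k.factorial_ne_zero (n - k).factorial_ne_zero))]
  have h1 : ((n.factorial : ℕ) : ℂ) ≠ 0 := by exact_mod_cast n.factorial_ne_zero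
  have h2 : ((k.factorial : ℕ) : ℂ) ≠ 0 := by exact_mod_cast k.factorial_ne_zero
  have h3 : (((n - k).factorial : ℕ) : ℂ) ≠ 0 := by exact_mod_cast (n - k).factorial_ne_zero
  push_cast
  field_simp

theorem comp_const (c : ℂ) (G : LPS) : comp (fun _ => c) G = C c := by
  have h : (PowerSeries.mk fun n => iteratedDeriv n (fun _ : ℂ => c) (constantCoeff G) /
      (n.factorial : ℂ)) = PowerSeries.C c := by
    ext n
    rw [PowerSeries.coeff_mk, PowerSeries.coeff_C, iteratedDeriv_const]
    split_ifs with h <;> simp [h]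
  rw [comp, h, PowerSeries.subst_C]

theorem constantCoeff_comp (f : ℂ → ℂ) (G : LPS) :
    constantCoeff (comp f G) = f (constantCoeff G) := by
  have h0 : constantCoeff (G - C (constantCoeff G)) = 0 := by simp
  set p := (PowerSeries.mk fun n => iteratedDeriv n f (constantCoeff G) / (n.factorial : ℂ))
  have h1 : PowerSeries.constantCoeff (p - PowerSeries.C (f (constantCoeff G))) = 0 := by
    rw [← PowerSeries.coeff_zero_eq_constantCoeff_apply, map_sub]; simp [p, PowerSeries.coeff_mk]
  have h2 := PowerSeries.constantCoeff_subst_eq_zero h0 _ h1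
  rw [PowerSeries.subst_sub (PowerSeries.HasSubst.of_constantCoeff_zero h0),
    PowerSeries.subst_C, map_sub, sub_eq_zero] at h2
  simpa [comp] using h2

theorem comp_id (G : LPS) : comp (fun x => x) G = G := by
  refine pderiv.ext (fun i => ?_) (constantCoeff_comp _ G)
  rw [pderiv_comp]
  have : deriv (fun x : ℂ => x) = fun _ => 1 := by funext x; simp
  rw [this, comp_const]
  simp

end

section

/-! ### The coefficients of the Virasoro operators -/

theorem elem_zero (i : ℕ) (x : ℂ) : elem 0 i x = if i = 0 then 1 else 0 := by
  simp [elem, Polynomial.coeff_one]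

theorem elem_succ_zero (N : ℕ) (x : ℂ) : elem (N + 1) 0 x = (x + N) * elem N 0 x := by
  rw [elem, Finset.prod_range_succ, mul_add, Polynomial.coeff_add, Polynomial.coeff_mul_C,
    Polynomial.coeff_mul_X_zero, zero_add, mul_comm]
  rfl

theorem elem_succ_succ (N i : ℕ) (x : ℂ) :
    elem (N + 1) (i + 1) x = (x + N) * elem N (i + 1) x + elem N i x := by
  rw [elem, Finset.prod_range_succ, mul_add, Polynomial.coeff_add, Polynomial.coeff_mul_C,
    Polynomial.coeff_mul_X, mul_comm, add_comm]
  rfl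

theorem elem_eq_zero {N i : ℕ} (h : N < i) (x : ℂ) : elem N i x = 0 := by
  refine Polynomial.coeff_eq_zero_of_natDegree_lt (lt_of_le_of_lt ?_ h)
  refine (Polynomial.natDegree_prod_le _ _).trans ?_
  have h1 : ∀ j ∈ Finset.range N,
      (Polynomial.X + Polynomial.C (x + ((j : ℕ) : ℂ))).natDegree ≤ 1 :=
    fun j _ => (Polynomial.natDegree_X_add_C _).le
  exact (Finset.sum_le_sum h1).trans (by simp)

/-- The reflection reverses the progression x, …, x + N - 1 and changes its sign, which amounts to s
↦ -s in the generating polynomial, up to (-1)ᴺ. -/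
theorem elem_reflect (N i : ℕ) (x : ℂ) :
    elem N i (1 - N - x) = (-1) ^ (N + i) * elem N i x := by
  have h1 : ∏ j ∈ Finset.range N, (Polynomial.X + Polynomial.C (1 - N - x + (j : ℂ))) =
      Polynomial.C ((-1) ^ N) * (∏ j ∈ Finset.range N,
        (Polynomial.X + Polynomial.C (x + (j : ℂ)))).comp (Polynomial.C (-1) * Polynomial.X) := by
    rw [Polynomial.prod_comp, ← Finset.prod_range_reflect, Polynomial.C_pow,
      ← Finset.card_range N, ← Finset.prod_const, Finset.card_range, ← Finset.prod_mul_distrib]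
    refine Finset.prod_congr rfl fun j hj => ?_
    have hj' : j + 1 ≤ N := Finset.mem_range.mp hj
    have : ((N - 1 - j : ℕ) : ℂ) = N - 1 - j := by
      rw [Nat.sub_sub, Nat.cast_sub (by omega)]; push_cast; ring
    rw [this]
    simp only [Polynomial.add_comp, Polynomial.X_comp, Polynomial.C_comp, Polynomial.C_neg,
      Polynomial.C_1, Polynomial.C_add, Polynomial.C_sub]
    ring
  rw [elem, h1, Polynomial.coeff_C_mul, Polynomial.comp_C_mul_X_coeff, elem, pow_add]
  ring

variable (B : Background)

theorem R_pow_grading (i l : ℕ) (a b : Fin 2) :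
    (mu B.d b - mu B.d a) * (B.R ^ i).coeff l a b = (l : ℂ) * (B.R ^ i).coeff l a b := by
  induction i generalizing l b with
  | zero =>
    rw [pow_zero, Polynomial.coeff_one]
    split_ifs with h
    · subst h
      by_cases hab : a = b
      · simp [hab]
      · simp [hab]
    · simp
  | succ i ih =>
    rw [pow_succ, Polynomial.coeff_mul, Matrix.sum_apply, Finset.mul_sum, Finset.mul_sum]
    refine Finset.sum_congr rfl fun p hp => ?_
    rw [Matrix.mul_apply, Finset.mul_sum, Finset.mul_sum]
    refine Finset.sum_congr rfl fun c _ => ?_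
    have h1 := ih p.1 c
    have h2 := B.R_grading p.2 c b
    have h3 : (l : ℂ) = p.1 + p.2 := by
      rw [← Finset.HasAntidiagonal.mem_antidiagonal.mp hp]; push_cast; rfl
    rw [h3]
    linear_combination (B.R.coeff p.2 c b) * h1 + (B.R ^ i).coeff p.1 a c * h2

theorem R_symm_sum (l : ℕ) (a b : Fin 2) :
    ∑ c, B.R.coeff l a c * eta c b = -(-1) ^ l * ∑ c, B.R.coeff l b c * eta c a := by
  linear_combination B.R_symm l a b

/-- As η is antidiagonal, lowering an index is the exchange a ↦ 1 - a. -/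
theorem R_coeff_flip (l : ℕ) (a b : Fin 2) :
    B.R.coeff l a b = -(-1) ^ l * B.R.coeff l (1 - b) (1 - a) := by
  have h := R_symm_sum B l a (1 - b)
  fin_cases a <;> fin_cases b <;> simpa [eta, Fin.sum_univ_two] using h

/-- The flip reverses products, so the extra factor is split off on opposite sides; each factor R[ℓ]
contributes the sign -(-1)^ℓ. -/
theorem R_pow_flip (i l : ℕ) (a b : Fin 2) :
    (B.R ^ i).coeff l a b = (-1) ^ (i + l) * (B.R ^ i).coeff l (1 - b) (1 - a) := by
  induction i generalizing l b with
  | zero =>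
    rw [pow_zero, Polynomial.coeff_one]
    split_ifs with h
    · subst h
      fin_cases a <;> fin_cases b <;> simp
    · simp
  | succ i ih =>
    conv_rhs => rw [pow_succ', Polynomial.coeff_mul, Matrix.sum_apply, Finset.mul_sum,
      ← Finset.Nat.sum_antidiagonal_swap]
    rw [pow_succ, Polynomial.coeff_mul, Matrix.sum_apply]
    refine Finset.sum_congr rfl fun p hp => ?_
    have hl := Finset.HasAntidiagonal.mem_antidiagonal.mp hp
    rw [Matrix.mul_apply, Matrix.mul_apply, Fin.sum_univ_two, Fin.sum_univ_two, ih, ih,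
      R_coeff_flip B p.2 0 b, R_coeff_flip B p.2 1 b, ← hl]
    simp only [Prod.fst_swap, Prod.snd_swap, sub_zero, sub_self]
    ring

theorem virCoeff_grading (N : ℕ) (k : ℤ) (l : ℕ) (a b : Fin 2) :
    (mu B.d b - mu B.d a) * virCoeff B N k l a b = (l : ℂ) * virCoeff B N k l a b := by
  rw [virCoeff, Finset.mul_sum, Finset.mul_sum]
  refine Finset.sum_congr rfl fun i _ => ?_
  linear_combination elem N i (mu B.d a + (k : ℂ) + 1 / 2) * R_pow_grading B i l a b

theorem virCoeff_eq_zero {N l : ℕ} (h : degBound B N < l) (k : ℤ) (a b : Fin 2) :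
    virCoeff B N k l a b = 0 := by
  refine Finset.sum_eq_zero fun i hi => ?_
  have hi' : i ≤ N := Nat.lt_succ_iff.mp (Finset.mem_range.mp hi)
  rw [Polynomial.coeff_eq_zero_of_natDegree_lt, Matrix.zero_apply, mul_zero]
  exact lt_of_le_of_lt (Polynomial.natDegree_pow_le.trans (Nat.mul_le_mul_right _ hi')) h

theorem mu_one_sub (d : ℂ) (a : Fin 2) : mu d (1 - a) = -mu d a := by
  fin_cases a <;> simp [mu] <;> ring

/-- The operators `L_n` are quantizations of infinitesimal symplectic transformations. -/
theorem virCoeff_flip (N : ℕ) (k : ℤ) (l : ℕ) (a b : Fin 2) :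
    virCoeff B N k l a b = (-1) ^ (N + l) * virCoeff B N (l - N - k) l (1 - b) (1 - a) := by
  rw [virCoeff, virCoeff, Finset.mul_sum]
  refine Finset.sum_congr rfl fun i _ => ?_
  -- Where the matrix entry is nonzero, the grading gives μ_b = μ_a + ℓ, and then the argument of
  -- `elem` on the right is the reflection 1 - N - x of the one on the left.
  by_cases h0 : (B.R ^ i).coeff l a b = 0
  · have := R_pow_flip B i l a b
    rw [h0] at this
    have h1 : (B.R ^ i).coeff l (1 - b) (1 - a) = 0 := by
      rcases mul_eq_zero.mp this.symm with h | h
      · exact absurd h (pow_ne_zero _ (by norm_num))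
      · exact h
    rw [h0, h1]; ring
  · have h1 : mu B.d b = mu B.d a + l := by
      have := R_pow_grading B i l a b
      rw [mul_left_inj' h0] at this
      linear_combination this
    have h2 : mu B.d (1 - b) + ((l - N - k : ℤ) : ℂ) + 1 / 2 =
        1 - N - (mu B.d a + (k : ℂ) + 1 / 2) := by
      rw [mu_one_sub, h1]; push_cast; ring
    rw [h2, elem_reflect, R_pow_flip B i l a b, pow_add, pow_add, pow_add]
    have hN : ((-1 : ℂ) ^ N) * (-1) ^ N = 1 := by rw [← mul_pow]; simp
    linear_combination (-elem N i (mu B.d a + (k : ℂ) + 1 / 2) * (-1) ^ i * (-1) ^ l *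
      (B.R ^ i).coeff l (1 - b) (1 - a)) * hN

theorem virCoeff_zero (k : ℤ) (l : ℕ) (a b : Fin 2) :
    virCoeff B 0 k l a b = if l = 0 ∧ a = b then 1 else 0 := by
  simp only [virCoeff, zero_add, Finset.range_one, Finset.sum_singleton, elem_zero, if_true,
    pow_zero, Polynomial.coeff_one, one_mul]
  split_ifs with h1 h2 h2 <;> simp_all [Matrix.one_apply]

/-- The coefficients are those of (s + x)⋯(s + x + N) with powers of s replaced by powers of R. The
last factor is split off: its scalar part multiplies, its part s becomes a convolution with R. -/
theorem virCoeff_succ (N : ℕ) (k : ℤ) (l : ℕ) (a c : Fin 2) :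
    virCoeff B (N + 1) k l a c = (mu B.d a + k + N + 1 / 2) * virCoeff B N k l a c +
      ∑ p ∈ Finset.HasAntidiagonal.antidiagonal l, ∑ b,
        virCoeff B N k p.1 a b * B.R.coeff p.2 b c := by
  set x := mu B.d a + (k : ℂ) + 1 / 2 with hx
  have h1 : ∑ p ∈ Finset.HasAntidiagonal.antidiagonal l, ∑ b,
    virCoeff B N k p.1 a b * B.R.coeff p.2 b c =
      ∑ i ∈ Finset.range (N + 1), elem N i x * (B.R ^ (i + 1)).coeff l a c := by
    simp only [virCoeff, ← hx, Finset.sum_mul]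
    rw [Finset.sum_congr rfl fun p _ => Finset.sum_comm, Finset.sum_comm]
    refine Finset.sum_congr rfl fun i _ => ?_
    rw [pow_succ, Polynomial.coeff_mul, Matrix.sum_apply, Finset.mul_sum]
    refine Finset.sum_congr rfl fun p _ => ?_
    rw [Matrix.mul_apply, Finset.mul_sum]
    exact Finset.sum_congr rfl fun b _ => by ring
  have h2 : virCoeff B N k l a c = ∑ i ∈ Finset.range (N + 2),
      elem N i x * (B.R ^ i).coeff l a c := by
    rw [Finset.sum_range_succ, elem_eq_zero (Nat.lt_succ_self N), zero_mul, add_zero]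
    rfl
  rw [h1, h2, virCoeff, ← hx, Finset.sum_range_succ', Finset.sum_range_succ' _ (N + 1),
    elem_succ_zero, mul_add, Finset.mul_sum]
  have e : mu B.d a + (k : ℂ) + N + 1 / 2 = x + N := by rw [hx]; ring
  have h3 : ∑ i ∈ Finset.range (N + 1), elem (N + 1) (i + 1) x * (B.R ^ (i + 1)).coeff l a c =
      ∑ i ∈ Finset.range (N + 1), (x + N) * (elem N (i + 1) x * (B.R ^ (i + 1)).coeff l a c) +
      ∑ i ∈ Finset.range (N + 1), elem N i x * (B.R ^ (i + 1)).coeff l a c := by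
    rw [← Finset.sum_add_distrib]
    refine Finset.sum_congr rfl fun i _ => ?_
    rw [elem_succ_succ]
    ring
  rw [e, h3]
  ring

/-! ### Two-sided sequences -/

/-- Two-sided sequences `g_a(k)`, with `k ∈ ℤ` and `a` a primary label. -/
abbrev Seq (R : Type*) : Type _ := Fin 2 → ℤ → R

section Seq

variable {R : Type*} [CommRing R]

/-- The shift of a sequence by `j` steps. -/
def sh (j : ℤ) : Seq R →ₗ[R] Seq R where
  toFun g a k := g a (k - j)
  map_add' _ _ := rfl
  map_smul' _ _ := rfl

@[simp] theorem sh_apply (j : ℤ) (g : Seq R) (a : Fin 2) (k : ℤ) :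
    sh j g a k = g a (k - j) := rfl

theorem sh_sh (i j : ℤ) (g : Seq R) : sh i (sh j g) = sh (i + j) g := by
  funext a k
  simp only [sh_apply]
  congr 1
  ring

@[simp] theorem sh_zero (g : Seq R) : sh 0 g = g := by
  funext a k; simp

variable [Algebra ℂ R]

/-- The linear transformation of sequences dual to the one underlying `L_{N-1}`. -/
def ls (N : ℕ) : Seq R →ₗ[R] Seq R where
  toFun g a k := ∑ l ∈ Finset.range (degBound B N + 1),
    ∑ b, virCoeff B N k l a b • g b (k + N - 1 - l)
  map_add' g h := by
    funext a k
    simp [smul_add, Finset.sum_add_distrib]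
  map_smul' c g := by
    funext a k
    simp [Finset.mul_sum, mul_add]

theorem ls_apply (N : ℕ) (g : Seq R) (a : Fin 2) (k : ℤ) :
    ls B N g a k = ∑ l ∈ Finset.range (degBound B N + 1),
      ∑ b, virCoeff B N k l a b • g b (k + N - 1 - l) := rfl

theorem ls_apply_of_le {N D : ℕ} (h : degBound B N ≤ D) (g : Seq R) (a : Fin 2) (k : ℤ) :
    ls B N g a k = ∑ l ∈ Finset.range (D + 1),
      ∑ b, virCoeff B N k l a b • g b (k + N - 1 - l) := by
  rw [ls_apply]
  refine Finset.sum_subset (Finset.range_subset_range.mpr (by omega)) fun l _ hl => ?_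
  refine Finset.sum_eq_zero fun b _ => ?_
  rw [virCoeff_eq_zero B (by simpa using hl), zero_smul]

/-- L₋₁ has no factors in its coefficients and corresponds to multiplication by z. -/
theorem ls_zero (g : Seq R) : ls B 0 g = sh 1 g := by
  funext a k
  have : degBound B 0 = 0 := by simp [degBound]
  rw [ls_apply, this, zero_add, Finset.sum_range_one]
  simp only [virCoeff_zero]
  simp

theorem degBound_succ (N : ℕ) : degBound B (N + 1) = degBound B N + B.R.natDegree := by
  simp [degBound, add_mul]

theorem ls_one_apply (g : Seq R) (a : Fin 2) (k : ℤ) :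
    ls B 1 g a k = (mu B.d a + k + 1 / 2) • g a k +
      ∑ l ∈ Finset.range (B.R.natDegree + 1), ∑ b, B.R.coeff l a b • g b (k - l) := by
  have h1 : ∀ (l : ℕ) (b : Fin 2), virCoeff B 1 k l a b =
      (if l = 0 ∧ a = b then (mu B.d a + k + 1 / 2) else 0) + B.R.coeff l a b := by
    intro l b
    rw [virCoeff, Finset.sum_range_succ, Finset.sum_range_one, pow_zero, pow_one,
      elem_succ_zero, elem_succ_succ, elem_zero, elem_zero, Polynomial.coeff_one]
    split_ifs <;> simp_all [Matrix.one_apply]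
  have h2 : degBound B 1 = B.R.natDegree := by simp [degBound]
  rw [ls_apply, h2]
  simp only [h1, add_smul, Finset.sum_add_distrib]
  congr 1
  · rw [Finset.sum_range_succ', Finset.sum_eq_zero, zero_add]
    · fin_cases a <;> simp [-one_div, add_smul]
    · simp
  · simp

theorem sum_antidiagonal_range {M : Type*} [AddCommMonoid M] (a b : ℕ) (F : ℕ → ℕ → M)
    (h1 : ∀ i j, a < i → F i j = 0) (h2 : ∀ i j, b < j → F i j = 0) :
    ∑ l ∈ Finset.range (a + b + 1), ∑ p ∈ Finset.HasAntidiagonal.antidiagonal l, F p.1 p.2 =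
      ∑ i ∈ Finset.range (a + 1), ∑ j ∈ Finset.range (b + 1), F i j := by
  rw [Finset.sum_sigma', Finset.sum_sigma']
  symm
  refine Finset.sum_of_injOn (fun x => ⟨x.1 + x.2, (x.1, x.2)⟩) ?_ ?_ ?_ ?_
  · rintro ⟨i, j⟩ _ ⟨i', j'⟩ _ h
    simp only [Sigma.mk.injEq] at h
    obtain ⟨h, h'⟩ := h
    have := (Prod.mk.injEq _ _ _ _).mp (eq_of_heq h')
    simp [this.1, this.2]
  · rintro ⟨i, j⟩ h
    simp at h ⊢
    omega
  · rintro ⟨l, i, j⟩ h h'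
    simp only [Finset.mem_sigma, Finset.mem_range,
      Finset.HasAntidiagonal.mem_antidiagonal] at h
    by_cases hi : a < i
    · exact h1 _ _ hi
    by_cases hj : b < j
    · exact h2 _ _ hj
    refine absurd ?_ h'
    refine ⟨⟨i, j⟩, ?_, ?_⟩
    · simp; omega
    · simp [h.2]
  · rintro ⟨i, j⟩ _
    rfl

/-- The structural identity behind all relations between the operators. In `virCoeff_succ` the
scalar factor is μ_a + k + N + 1/2, at the source index. Since (μ_b - μ_a) A = ℓ A, it may be
replaced by μ_b + (k + N - ℓ) + 1/2, the diagonal coefficient of `ls B 1` at the target index. -/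
theorem ls_succ (N : ℕ) (g : Seq R) : ls B (N + 1) g = ls B N (sh (-1) (ls B 1 g)) := by
  funext a k
  have hR : ∀ l : ℕ, B.R.natDegree < l → B.R.coeff l = 0 := fun l hl =>
    Polynomial.coeff_eq_zero_of_natDegree_lt hl
  rw [ls_apply, degBound_succ, ls_apply]
  simp only [sh_apply, ls_one_apply, smul_add, Finset.sum_add_distrib]
  conv_lhs =>
    simp only [virCoeff_succ, add_smul _ (Finset.sum _ _), Finset.sum_add_distrib]
  congr 1
  · rw [← Finset.sum_subset (Finset.range_subset_range.mpr
      (show degBound B N + 1 ≤ degBound B N + B.R.natDegree + 1 by omega))]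
    · refine Finset.sum_congr rfl fun l _ => Finset.sum_congr rfl fun b _ => ?_
      rw [smul_smul]
      congr 1
      · push_cast
        linear_combination -virCoeff_grading B N k l a b
      · congr 1; push_cast; ring
    · intro l _ hl
      refine Finset.sum_eq_zero fun b _ => ?_
      rw [virCoeff_eq_zero B (by simpa using hl), mul_zero, zero_smul]
  · have h3 := sum_antidiagonal_range (M := R) (degBound B N) B.R.natDegree
      (fun i j => ∑ b, ∑ c, (virCoeff B N k i a b * B.R.coeff j b c) •
        g c (k + N - i - j)) ?_ ?_
    · refine Eq.trans ?_ (h3.trans ?_)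
      · refine Finset.sum_congr rfl fun l _ => ?_
        simp only [Finset.sum_smul]
        rw [Finset.sum_comm]
        refine Finset.sum_congr rfl fun p hp => ?_
        rw [Finset.sum_comm]
        refine Finset.sum_congr rfl fun b _ => Finset.sum_congr rfl fun c _ => ?_
        congr 2
        rw [← Finset.HasAntidiagonal.mem_antidiagonal.mp hp]
        push_cast
        ring
      · refine Finset.sum_congr rfl fun i _ => ?_
        rw [Finset.sum_comm]
        refine Finset.sum_congr rfl fun b _ => ?_
        rw [Finset.smul_sum]
        refine Finset.sum_congr rfl fun j _ => ?_
        rw [Finset.smul_sum]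
        refine Finset.sum_congr rfl fun c _ => ?_
        rw [smul_smul]
        congr 2
        ring
    · intro i j hi
      simp [virCoeff_eq_zero B hi]
    · intro i j hj
      simp [hR j hj]

end Seq

end

/-! ### Gradients, the bilinear form of second order, and the pairing with the cone -/

section

variable (B : Background)

theorem pderiv_comm (i j : Fin 2 × ℕ) (H : LPS) :
    pderiv ℂ i (pderiv ℂ j H) = pderiv ℂ j (pderiv ℂ i H) := by
  classical
  rcases eq_or_ne i j with rfl | h
  · rfl
  · ext n
    simp only [coeff_pderiv, Finsupp.add_apply, Finsupp.single_apply, h, h.symm, if_false,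
      add_zero, add_right_comm n]
    ring

section Generic

variable {R : Type*} [CommRing R]

/-- The extension by zero of a sequence indexed by `k ≥ 0`. -/
def extend (G : Fin 2 × ℕ → R) : Seq R := fun a k => if 0 ≤ k then G (a, k.toNat) else 0

theorem extend_natCast (G : Fin 2 × ℕ → R) (a : Fin 2) (k : ℕ) : extend G a k = G (a, k) := by
  simp [extend]

theorem extend_of_neg (G : Fin 2 × ℕ → R) (a : Fin 2) {k : ℤ} (hk : k < 0) :
    extend G a k = 0 := if_neg (not_le.mpr hk)

theorem extend_add (G H : Fin 2 × ℕ → R) :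
    extend (fun i => G i + H i) = extend G + extend H := by
  funext a k
  by_cases h : 0 ≤ k <;> simp [extend, h]

theorem extend_mul (c : R) (G : Fin 2 × ℕ → R) :
    extend (fun i => c * G i) = c • extend G := by
  funext a k
  by_cases h : 0 ≤ k <;> simp [extend, h]

variable [Algebra ℂ R]

/-- The coordinates of negative degree of the point of the loop space determined by the values
`G i` of the derivatives. -/
def low (G : Fin 2 × ℕ → R) (j : ℕ) (c : Fin 2) : R := (-1 : ℂ) ^ (j + 1) • G (1 - c, j)

/-- The second order part of `L_{N-1}` as a bilinear form. -/
def bil (N : ℕ) (G H : Fin 2 × ℕ → R) : R :=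
  ∑ j ∈ Finset.range N, ∑ c, low G j c * ls B N (extend H) c (-1 - j)

/-- The bound ℓ ≤ k + n in L_n is automatic on a sequence extended by zero, because the other terms
have negative degree. -/
theorem ls_extend_natCast (N : ℕ) (H : Fin 2 × ℕ → R) (a : Fin 2) (k : ℕ) :
    ls B N (extend H) a k = ∑ l ∈ Finset.range (degBound B N + 1),
      if l + 1 ≤ k + N then ∑ b, virCoeff B N k l a b • H (b, k + N - (l + 1)) else 0 := by
  rw [ls_apply]
  refine Finset.sum_congr rfl fun l _ => ?_
  split_ifs with h
  · refine Finset.sum_congr rfl fun b _ => ?_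
    rw [← extend_natCast H, Nat.cast_sub h]
    congr 2
    push_cast
    ring
  · refine Finset.sum_eq_zero fun b _ => ?_
    rw [extend_of_neg _ _ (by omega), smul_zero]

theorem ls_extend_neg (N : ℕ) (H : Fin 2 × ℕ → R) (a : Fin 2) (j : ℕ) :
    ls B N (extend H) a (-1 - j) = ∑ l ∈ Finset.range (degBound B N + 1),
      if j + l + 2 ≤ N then ∑ b, virCoeff B N (-1 - j) l a b • H (b, N - 2 - j - l) else 0 := by
  rw [ls_apply]
  refine Finset.sum_congr rfl fun l _ => ?_
  split_ifs with h
  · refine Finset.sum_congr rfl fun b _ => ?_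
    rw [← extend_natCast H]
    congr 2
    omega
  · refine Finset.sum_eq_zero fun b _ => ?_
    rw [extend_of_neg _ _ (by omega), smul_zero]

theorem bil_eq (N : ℕ) (G H : Fin 2 × ℕ → R) :
    bil B N G H = ∑ l ∈ Finset.range (degBound B N + 1), ∑ j ∈ Finset.range N, if j + l + 2 ≤ N then
      ∑ c, ∑ b, ((-1) ^ (j + 1) * virCoeff B N (-1 - j) l (1 - c) b) •
        (G (c, j) * H (b, N - 2 - j - l)) else 0 := by
  rw [Finset.sum_comm, bil]
  refine Finset.sum_congr rfl fun j _ => ?_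
  simp only [ls_extend_neg, low, Finset.mul_sum]
  rw [Finset.sum_comm]
  refine Finset.sum_congr rfl fun l _ => ?_
  split_ifs with h
  · simp only [Fin.sum_univ_two, sub_zero, sub_self, mul_add, smul_mul_smul_comm]
    ring
  · simp

/-- The symplectic symmetry `virCoeff_flip` exchanges the two arguments under j ↦ N - 2 - j - ℓ. -/
theorem bil_comm (N : ℕ) (G H : Fin 2 × ℕ → R) : bil B N G H = bil B N H G := by
  rw [bil_eq, bil_eq]
  refine Finset.sum_congr rfl fun l _ => ?_
  rw [← Finset.sum_filter, ← Finset.sum_filter]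
  refine Finset.sum_bij' (fun j _ => N - 2 - j - l) (fun j _ => N - 2 - j - l) ?_ ?_ ?_ ?_ ?_
  · intro j hj; simp at hj ⊢; omega
  · intro j hj; simp at hj ⊢; omega
  · intro j hj; simp at hj; omega
  · intro j hj; simp at hj; omega
  · intro j hj
    simp at hj
    have e : N - 2 - (N - 2 - j - l) - l = j := by omega
    rw [Finset.sum_comm]
    refine Finset.sum_congr rfl fun b _ => Finset.sum_congr rfl fun c _ => ?_
    rw [e, mul_comm (G _), virCoeff_flip B N (-1 - j), sub_sub_cancel]
    congr 1
    have h1 : ((l : ℤ) - N - (-1 - j)) = -1 - ((N - 2 - j - l : ℕ) : ℤ) := by omega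
    rw [h1, ← mul_assoc]
    congr 1
    rw [← pow_add, neg_one_pow_eq_pow_mod_two, neg_one_pow_eq_pow_mod_two (n := _ + 1)]
    congr 1
    omega

end Generic

/-- The gradient of a formal function, extended by zero. -/
def grad (H : LPS) : Seq LPS := extend fun i => pderiv ℂ i H

theorem virVec_eq (N : ℕ) (H : LPS) :
    virVec B N H = sumT B fun i => ls B N (grad H) i.1 i.2 := by
  rw [virVec]
  congr 1
  funext i
  rw [grad, ls_extend_natCast]

theorem virPair_eq (N : ℕ) (K : Fin 2 × ℕ → Fin 2 × ℕ → LPS) :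
    virPair B N K = (1 / 2 : ℂ) • ∑ j ∈ Finset.range N, ∑ c,
      (-1 : ℂ) ^ (j + 1) • ls B N (extend (K (1 - c, j))) c (-1 - j) := by
  rw [virPair]
  congr 1
  refine Finset.sum_congr rfl fun j _ => ?_
  simp only [ls_extend_neg, Finset.smul_sum]
  rw [Finset.sum_comm]
  refine Finset.sum_congr rfl fun l _ => ?_
  split_ifs with h
  · simp [eta, Fin.sum_univ_two, smul_smul]
    abel
  · simp

theorem virPair_mul (N : ℕ) (G H : Fin 2 × ℕ → LPS) :
    virPair B N (fun i j => G i * H j) = (1 / 2 : ℂ) • bil B N G H := by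
  rw [virPair_eq, bil]
  congr 1
  refine Finset.sum_congr rfl fun j _ => Finset.sum_congr rfl fun c _ => ?_
  rw [extend_mul, map_smul, low, Pi.smul_apply, Pi.smul_apply, smul_eq_mul, smul_mul_assoc]

/-! ### The pairing with the point of the Lagrangian cone -/

/-- The pairing of a sequence with the point whose coordinates of degree `k ≥ 0` are `t̃_k` and whose
coordinates of degree `-1-j` are the derivatives of `F`; terms of degree below `-J` are dropped. -/
def pairing (F : LPS) (J : ℕ) : Seq LPS →ₗ[LPS] LPS where
  toFun g := sumT B (fun i => g i.1 i.2) +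
    ∑ j ∈ Finset.range J, ∑ c, low (fun i => pderiv ℂ i F) j c * g c (-1 - j)
  map_add' g h := by
    simp only [Pi.add_apply, sumT_add, mul_add, Finset.sum_add_distrib]
    abel
  map_smul' c g := by
    simp only [Pi.smul_apply, smul_eq_mul, sumT_mul, mul_add, Finset.mul_sum, RingHom.id_apply]
    congr 1
    exact Finset.sum_congr rfl fun j _ => Finset.sum_congr rfl fun b _ => by ring

variable (F : LPS)

theorem pairing_apply (J : ℕ) (g : Seq LPS) : pairing B F J g = sumT B (fun i => g i.1 i.2) +
    ∑ j ∈ Finset.range J, ∑ c, low (fun i => pderiv ℂ i F) j c * g c (-1 - j) := rfl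

theorem pairing_of_le {J J' : ℕ} (h : J ≤ J') (g : Seq LPS)
    (hg : ∀ c (m : ℤ), m < -J → g c m = 0) : pairing B F J' g = pairing B F J g := by
  rw [pairing_apply, pairing_apply, add_right_inj]
  symm
  refine Finset.sum_subset (Finset.range_subset_range.mpr h) fun j _ hj => ?_
  refine Finset.sum_eq_zero fun c _ => ?_
  have : J ≤ j := by simpa using hj
  rw [hg c _ (by omega), mul_zero]

/-- The transformation lowers degrees by at most N - 1; this makes finite cutoffs J sufficient. -/
theorem ls_eq_zero_of_lt {R : Type*} [CommRing R] [Algebra ℂ R] (N : ℕ) {g : Seq R} {s : ℤ}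
    (hg : ∀ c (m : ℤ), m < s → g c m = 0) (c : Fin 2) (m : ℤ) (hm : m < s - N + 1) :
    ls B N g c m = 0 := by
  rw [ls_apply]
  refine Finset.sum_eq_zero fun l _ => Finset.sum_eq_zero fun b _ => ?_
  rw [hg _ _ (by omega), smul_zero]

theorem grad_of_neg (H : LPS) (a : Fin 2) {k : ℤ} (hk : k < 0) : grad H a k = 0 :=
  extend_of_neg _ _ hk

theorem grad_natCast (H : LPS) (a : Fin 2) (k : ℕ) : grad H a k = pd a k H :=
  extend_natCast _ _ _

/-- The derivation along the vector field with components `θ` applied to the point of the cone. -/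
def flow (J : ℕ) (θ : Seq LPS →ₗ[LPS] Seq LPS) : Derivation ℂ LPS LPS :=
  Derivation.mk' ({
    toFun := fun H => pairing B F J (θ (grad H))
    map_add' := fun H K => by
      rw [← map_add, ← map_add]
      congr 2
      rw [grad, grad, grad, ← extend_add]
      simp only [map_add]
    map_smul' := fun c H => by
      have : grad (c • H) = (C c : LPS) • grad H := by
        rw [grad, grad, ← extend_mul]
        simp only [Derivation.map_smul, ← smul_eq_C_mul]
      rw [this, map_smul, map_smul, RingHom.id_apply, smul_eq_C_mul, smul_eq_mul] } :
    LPS →ₗ[ℂ] LPS) (fun H K => by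
      change pairing B F J (θ (grad (H * K))) = H • pairing B F J (θ (grad K)) +
        K • pairing B F J (θ (grad H))
      rw [← map_smul, ← map_smul, ← map_smul, ← map_smul, ← map_add, ← map_add]
      congr 2
      rw [grad, grad, grad, ← extend_mul, ← extend_mul, ← extend_add]
      simp only [Derivation.leibniz, smul_eq_mul])

theorem flow_apply (J : ℕ) (θ : Seq LPS →ₗ[LPS] Seq LPS) (H : LPS) :
    flow B F J θ H = pairing B F J (θ (grad H)) := rfl

/-- The vector field of `L_{N-1}` at genus `0`, that is `virVec + 2 virPair(dF, ·)`. -/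
def vir (N : ℕ) : Derivation ℂ LPS LPS := flow B F N (ls B N)

theorem vir_apply (N : ℕ) (H : LPS) :
    vir B F N H = virVec B N H + bil B N (fun i => pderiv ℂ i F) (fun i => pderiv ℂ i H) := by
  rw [vir, flow_apply, pairing_apply, virVec_eq]
  rfl

/-- The pure part of negative degree in `tangent`. -/
def eps (R : Type*) [CommRing R] (i : Fin 2 × ℕ) : Seq R := fun c m =>
  if m = -1 - i.2 ∧ c = 1 - i.1 then (-1) ^ i.2 else 0

/-- The sequences that annihilate the tangent space of the cone. -/
def sq (i : Fin 2 × ℕ) : Seq LPS := grad (pderiv ℂ i F) + eps LPS i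

theorem sq_eq_zero (i : Fin 2 × ℕ) (c : Fin 2) (m : ℤ) (hm : m < -1 - i.2) :
    sq F i c m = 0 := by
  rw [sq, Pi.add_apply, Pi.add_apply, grad_of_neg _ _ (by omega), eps, if_neg (by omega), add_zero]

theorem sumT_eq_sum (s : Finset (Fin 2 × ℕ)) (G : Fin 2 × ℕ → LPS) (h : ∀ i ∉ s, G i = 0) :
    sumT B G = ∑ i ∈ s, tt B i.1 i.2 * G i := by
  have : G = fun j => ∑ i ∈ s, if j = i then G i else 0 := by
    funext j
    rw [Finset.sum_ite_eq s j]
    split_ifs with hj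
    · rfl
    · exact h j hj
  conv_lhs => rw [this]
  rw [sumT_sum]
  exact Finset.sum_congr rfl fun i _ => sumT_single B i _

theorem ls_eps (N : ℕ) (i : Fin 2 × ℕ) (a : Fin 2) (m : ℤ) :
    ls B N (eps LPS i) a m = if 0 ≤ m + N + i.2 then
      C ((-1) ^ i.2 * virCoeff B N m (m + N + i.2).toNat a (1 - i.1)) else 0 := by
  have h0 : ∀ l b, eps LPS i b (m + N - 1 - l) =
      if l = m + N + i.2 ∧ b = 1 - i.1 then (-1) ^ i.2 else 0 := by
    intro l b
    rw [eps]
    congr 1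
    rw [eq_iff_iff]
    refine and_congr ?_ Iff.rfl
    omega
  split_ifs with h
  · rw [ls_apply_of_le B (le_max_left (degBound B N) (m + N + i.2).toNat),
      Finset.sum_eq_single_of_mem (m + N + i.2).toNat
        (Finset.mem_range.mpr (Nat.lt_succ_of_le (le_max_right _ _))),
      Finset.sum_eq_single_of_mem (1 - i.1) (Finset.mem_univ _)]
    · rw [h0, if_pos ⟨by omega, rfl⟩, smul_eq_C_mul, map_mul, map_pow, map_neg, map_one, mul_comm]
    · intro b _ hb
      rw [h0, if_neg (fun h => hb h.2), smul_zero]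
    · intro l _ hl
      refine Finset.sum_eq_zero fun b _ => ?_
      rw [h0, if_neg (fun h => hl (by omega)), smul_zero]
  · rw [ls_apply]
    refine Finset.sum_eq_zero fun l _ => Finset.sum_eq_zero fun b _ => ?_
    rw [h0, if_neg (fun h => by omega), smul_zero]

/-- Reindexing by m = ℓ - k - N. The square of ranges is larger than the original domain, but the
additional coefficients vanish by `virCoeff_eq_zero`. -/
theorem virQuad_eq (N : ℕ) : virQuad B N = (1 / 2 : ℂ) •
    ∑ k ∈ Finset.range (degBound B N + 1), ∑ m ∈ Finset.range (degBound B N + 1), ∑ a, ∑ c,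
      ((-1) ^ m * virCoeff B N k (k + N + m) a (1 - c)) • (tt B a k * tt B c m) := by
  rw [virQuad]
  congr 1
  refine Finset.sum_congr rfl fun k _ => ?_
  rw [← Finset.sum_filter]
  refine Finset.sum_of_injOn (fun l => l - k - N) ?_ ?_ ?_ ?_
  · intro l hl l' hl' h
    simp at hl hl' h
    omega
  · intro l hl
    simp at hl ⊢
    omega
  · intro m hm h
    refine Finset.sum_eq_zero fun a _ => Finset.sum_eq_zero fun c _ => ?_
    rw [virCoeff_eq_zero, mul_zero, zero_smul]
    by_contra hlt
    refine h ⟨k + N + m, ?_, ?_⟩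
    · simp; omega
    · simp; omega
  · intro l hl
    simp at hl
    have e : k + N + (l - k - N) = l := by omega
    rw [e]
    refine Finset.sum_congr rfl fun a _ => ?_
    rw [Finset.sum_comm]
    refine Finset.sum_congr rfl fun c _ => ?_
    fin_cases c <;> simp [eta, Fin.sum_univ_two, mul_comm]

/-- The matrix of the quadratic form is symmetric by `virCoeff_flip`, so the two Leibniz terms agree
and absorb the factor 1/2. -/
theorem pderiv_virQuad (N : ℕ) (i : Fin 2 × ℕ) :
    pderiv ℂ i (virQuad B N) = sumT B (fun j => ls B N (eps LPS i) j.1 j.2) := by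
  set D := degBound B N
  have h0 : ∀ (m : ℕ) (c : Fin 2), pderiv ℂ i (tt B c m) = if i = (c, m) then 1 else 0 :=
    fun m c => pderiv_tt B i c m
  have hR : sumT B (fun j => ls B N (eps LPS i) j.1 j.2) = ∑ k ∈ Finset.range (D + 1), ∑ a,
      ((-1) ^ i.2 * virCoeff B N k (k + N + i.2) a (1 - i.1)) • tt B a k := by
    rw [sumT_eq_sum B (Finset.univ ×ˢ Finset.range (D + 1)), Finset.sum_product, Finset.sum_comm]
    · refine Finset.sum_congr rfl fun k _ => Finset.sum_congr rfl fun a _ => ?_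
      have e : ((k : ℤ) + N + i.2).toNat = k + N + i.2 := by omega
      rw [ls_eps, if_pos (by positivity), e, smul_eq_C_mul, mul_comm]
    · rintro ⟨a, k⟩ hk
      have hk' : D + 1 ≤ k := by simpa using hk
      have e : ((k : ℤ) + N + i.2).toNat = k + N + i.2 := by omega
      rw [ls_eps, if_pos (by positivity), virCoeff_eq_zero B (by dsimp only; omega), mul_zero,
        map_zero]
  rw [hR, virQuad_eq, Derivation.map_smul, map_sum]
  simp only [map_sum, Derivation.map_smul, Derivation.leibniz, h0, smul_eq_mul, smul_add,
    Finset.sum_add_distrib]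
  have h1 : ∑ k ∈ Finset.range (D + 1), ∑ m ∈ Finset.range (D + 1), ∑ a, ∑ c,
      ((-1) ^ m * virCoeff B N k (k + N + m) a (1 - c)) •
        (tt B a k * if i = (c, m) then 1 else 0) =
      ∑ k ∈ Finset.range (D + 1), ∑ a,
      ((-1) ^ i.2 * virCoeff B N k (k + N + i.2) a (1 - i.1)) • tt B a k := by
    refine Finset.sum_congr rfl fun k _ => ?_
    rw [Finset.sum_comm]
    refine Finset.sum_congr rfl fun a _ => ?_
    by_cases hi : i.2 < D + 1
    · rw [Finset.sum_eq_single_of_mem i.2 (Finset.mem_range.mpr hi),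
        Finset.sum_eq_single_of_mem i.1 (Finset.mem_univ _), if_pos rfl, mul_one]
      · intro c _ hc
        rw [if_neg (fun h => hc (by rw [h])), mul_zero, smul_zero]
      · intro m _ hm
        refine Finset.sum_eq_zero fun c _ => ?_
        rw [if_neg (fun h => hm (by rw [h])), mul_zero, smul_zero]
    · rw [virCoeff_eq_zero B (show degBound B N < _ by omega), mul_zero, zero_smul]
      refine Finset.sum_eq_zero fun m hm => Finset.sum_eq_zero fun c _ => ?_
      rw [if_neg, mul_zero, smul_zero]
      rintro rfl
      exact hi (Finset.mem_range.mp hm)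
  have h2 : ∑ k ∈ Finset.range (D + 1), ∑ m ∈ Finset.range (D + 1), ∑ a, ∑ c,
      ((-1) ^ m * virCoeff B N k (k + N + m) a (1 - c)) •
        (tt B c m * if i = (a, k) then 1 else 0) =
      ∑ k ∈ Finset.range (D + 1), ∑ m ∈ Finset.range (D + 1), ∑ a, ∑ c,
      ((-1) ^ m * virCoeff B N k (k + N + m) a (1 - c)) •
        (tt B a k * if i = (c, m) then 1 else 0) := by
    rw [Finset.sum_comm]
    refine Finset.sum_congr rfl fun k _ => Finset.sum_congr rfl fun m _ => ?_
    rw [Finset.sum_comm]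
    refine Finset.sum_congr rfl fun a _ => Finset.sum_congr rfl fun c _ => ?_
    congr 1
    have h3 : (((m + N + k : ℕ) : ℤ) - N - m) = k := by push_cast; ring
    rw [virCoeff_flip, h3, sub_sub_cancel, ← mul_assoc, ← pow_add,
      show k + N + m = m + N + k by ring, show k + (N + (m + N + k)) = m + 2 * (N + k) by ring,
      pow_add (-1 : ℂ) m, pow_mul]
    simp
  rw [h2, h1, ← add_smul]
  norm_num

theorem pderiv_virVec (N : ℕ) (H : LPS) (i : Fin 2 × ℕ) :
    pderiv ℂ i (virVec B N H) = virVec B N (pderiv ℂ i H) + ls B N (grad H) i.1 i.2 := by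
  rw [virVec_eq, virVec_eq, pderiv_sumT, add_comm]
  congr 2
  funext j
  obtain ⟨a, k⟩ := j
  simp only [grad, ls_extend_natCast, map_sum]
  refine Finset.sum_congr rfl fun l _ => ?_
  split_ifs
  · simp only [map_sum, Derivation.map_smul]
    refine Finset.sum_congr rfl fun b _ => ?_
    rw [pderiv_comm]
  · simp

end

section

variable (B : Background) (F : LPS)

/-! ### Genus zero -/

/-- The genus `0` part of `L_{N-1} Z = 0`. -/
def genusZeroPart (N : ℕ) : LPS := virQuad B N + virVec B N F +
  (1 / 2 : ℂ) • bil B N (fun i => pderiv ℂ i F) (fun i => pderiv ℂ i F)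

theorem virasoroPart_genusZero (G : ℕ → LPS) (n : ℤ) :
    virasoroPart B G n 0 = genusZeroPart B (G 0) (n + 1).toNat := by
  simp only [virasoroPart, if_true, genusZeroPart, zero_add, Finset.range_one,
    Finset.sum_singleton, Nat.sub_zero, virPair_mul]
  simp

theorem derivation_bil {R : Type*} [CommRing R] [Algebra ℂ R] (D : Derivation ℂ R R) (N : ℕ)
    (G H : Fin 2 × ℕ → R) :
    D (bil B N G H) = bil B N (fun j => D (G j)) H + bil B N G (fun j => D (H j)) := by
  simp only [bil_eq, map_sum, ← Finset.sum_add_distrib]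
  refine Finset.sum_congr rfl fun l _ => Finset.sum_congr rfl fun j _ => ?_
  split_ifs
  · simp only [map_sum, ← Finset.sum_add_distrib]
    refine Finset.sum_congr rfl fun c _ => Finset.sum_congr rfl fun b _ => ?_
    rw [Derivation.map_smul, Derivation.leibniz, smul_eq_mul, smul_eq_mul, ← smul_add]
    congr 1
    ring
  · simp

/-- The transformation is moved across the symplectic pairing by `virCoeff_flip`. The sequence `ls B
N (eps LPS i)` starts in degree -N - i.2, hence the bound on J. -/
theorem sum_low_mul_ls_eps (N J : ℕ) (i : Fin 2 × ℕ) (hJ : N + i.2 ≤ J) :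
    ∑ j ∈ Finset.range J, ∑ c, low (fun i => pderiv ℂ i F) j c * ls B N (eps LPS i) c (-1 - j) =
      ls B N (grad F) i.1 i.2 := by
  rw [grad, ls_extend_natCast, ← Finset.sum_filter]
  symm
  refine Finset.sum_of_injOn (fun l => i.2 + N - (l + 1)) ?_ ?_ ?_ ?_
  · intro l hl l' hl' h
    simp at hl hl' h
    omega
  · intro l hl
    simp at hl ⊢
    omega
  · intro j hj h
    refine Finset.sum_eq_zero fun c _ => ?_
    rw [ls_eps]
    split_ifs with h0
    · rw [virCoeff_eq_zero, mul_zero, map_zero, mul_zero]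
      by_contra hlt
      refine h ⟨i.2 + N - (j + 1), ?_, ?_⟩
      · simp; omega
      · simp; omega
    · exact mul_zero _
  · intro l hl
    simp at hl
    have e : (-1 - ((i.2 + N - (l + 1) : ℕ) : ℤ) + N + i.2).toNat = l := by omega
    rw [← Equiv.sum_comp (Equiv.subLeft (1 : Fin 2))]
    refine Finset.sum_congr rfl fun c _ => ?_
    rw [ls_eps, if_pos (by omega), e, low, Equiv.subLeft_apply,
      virCoeff_flip B N i.2 l i.1, sub_sub_cancel, mul_comm _ (C _), ← smul_eq_C_mul, smul_smul]
    have e2 : (l : ℤ) - N - i.2 = -1 - ((i.2 + N - (l + 1) : ℕ) : ℤ) := by omega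
    rw [e2]
    congr 1
    rw [mul_right_comm, ← pow_add]
    congr 1
    rw [neg_one_pow_eq_pow_mod_two, neg_one_pow_eq_pow_mod_two (n := i.2 + _)]
    congr 1
    omega

/-- The quadratic part, the vector field and the bilinear form (whose two Leibniz terms cancel its
factor 1/2) together give the pairing of the full point of the cone. The constraint is thus reduced
to a condition linear in the sequences `sq F i`. -/
theorem pderiv_genusZeroPart (N J : ℕ) (i : Fin 2 × ℕ) (hJ : N + i.2 ≤ J) :
    pderiv ℂ i (genusZeroPart B F N) = pairing B F J (ls B N (sq F i)) := by
  rw [genusZeroPart, map_add, map_add, Derivation.map_smul, derivation_bil, bil_comm B N _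
    (fun i => pderiv ℂ i F), pderiv_virQuad, pderiv_virVec, sq, map_add, map_add,
    pairing_of_le B F (show N ≤ J by omega) (ls B N (grad _))
      (fun c m hm => ls_eq_zero_of_lt B N (s := 0) (fun c m hm => grad_of_neg _ _ hm) c m
        (by omega)), ← flow_apply, ← vir, vir_apply, pairing_apply,
    sum_low_mul_ls_eps B F N J i hJ]
  simp only [pderiv_comm i]
  rw [← two_smul ℂ (bil B N _ _), smul_smul]
  norm_num
  ring

/-! ### Vector fields and infinite sums -/

/-- A transformation of sequences, all of whose rows are finite. -/
def RowFinite (θ : Seq LPS →ₗ[LPS] Seq LPS) : Prop :=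
  ∀ G : Fin 2 × ℕ → Seq LPS, θ (fun a k => sumT B fun i => G i a k) =
    fun a k => sumT B fun i => θ (G i) a k

theorem rowFinite_ls (N : ℕ) : RowFinite B (ls B N) := by
  intro G
  funext a k
  simp only [ls_apply, smul_eq_C_mul, ← sumT_mul, ← sumT_sum]

theorem rowFinite_sh (j : ℤ) : RowFinite B (sh j) := fun _ => rfl

theorem RowFinite.comp {θ θ' : Seq LPS →ₗ[LPS] Seq LPS} (h : RowFinite B θ)
    (h' : RowFinite B θ') : RowFinite B (θ ∘ₗ θ') := by
  intro G
  rw [LinearMap.comp_apply, h', h]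
  rfl

/-- Product rule along a flow: the motion of the coordinates t̃ gives the pairing with θ of the
coefficient sequence. Row finiteness lets θ pass through the infinite sum. -/
theorem flow_sumT (J : ℕ) {θ : Seq LPS →ₗ[LPS] Seq LPS} (hθ : RowFinite B θ)
    (G : Fin 2 × ℕ → LPS) : flow B F J θ (sumT B G) =
      pairing B F J (θ (extend G)) + sumT B fun i => flow B F J θ (G i) := by
  have h1 : grad (sumT B G) = extend G + fun a k => sumT B fun i => grad (G i) a k := by
    funext a k
    by_cases hk : 0 ≤ k
    · simp [grad, extend, hk, pderiv_sumT]
    · simp [grad, extend, hk, sumT_zero]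
  rw [flow_apply, h1, map_add, map_add, hθ]
  congr 1
  simp only [flow_apply, pairing_apply, sumT_add, sumT_sum, sumT_mul]
  rw [sumT_comm]

/-- The vector field of `L_{N-1}` is tangent to the cone. -/
def Tangent (N : ℕ) : Prop :=
  ∀ (i : Fin 2 × ℕ) (J : ℕ), N + i.2 ≤ J → pairing B F J (ls B N (sq F i)) = 0

/-- `⟪τ_i τ_j⟫_0`. -/
def om (i j : Fin 2 × ℕ) : LPS := pderiv ℂ i (pderiv ℂ j F)

theorem om_comm (i j : Fin 2 × ℕ) : om F i j = om F j i := pderiv_comm _ _ _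

/-- The topological recursion relation in genus `0`, for three-point functions. -/
def TRR : Prop := ∀ (a : Fin 2) (k : ℕ) (i j : Fin 2 × ℕ),
  pderiv ℂ (a, k + 1) (om F i j) = ∑ e, om F (a, k) (e, 0) * pderiv ℂ (1 - e, 0) (om F i j)

/-- The topological recursion relation in genus `0`, for two-point functions. -/
def TRR₂ : Prop := ∀ (a b : Fin 2) (k l : ℕ),
  om F (a, k + 1) (b, l) + om F (a, k) (b, l + 1) =
    ∑ e, om F (a, k) (e, 0) * om F (1 - e, 0) (b, l)

theorem sq_natCast (i : Fin 2 × ℕ) (c : Fin 2) (m : ℕ) : sq F i c m = om F (c, m) i := by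
  rw [sq, Pi.add_apply, Pi.add_apply, grad_natCast, eps, if_neg (by omega), add_zero, om]

theorem sq_neg (i : Fin 2 × ℕ) (c : Fin 2) (m : ℕ) :
    sq F i c (-1 - m) = if m = i.2 ∧ c = 1 - i.1 then (-1) ^ i.2 else 0 := by
  rw [sq, Pi.add_apply, Pi.add_apply, grad_of_neg _ _ (by omega), eps, zero_add]
  congr 1
  rw [eq_iff_iff]
  refine and_congr ?_ Iff.rfl
  omega

theorem int_cases (m : ℤ) : (∃ k : ℕ, m = k) ∨ ∃ k : ℕ, m = -1 - k := by
  rcases le_or_gt 0 m with h | h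
  · exact Or.inl ⟨m.toNat, by omega⟩
  · exact Or.inr ⟨(-1 - m).toNat, by omega⟩

variable {F}

/-- The recursion for three-point functions in sequence form: gradients of two-point functions lie
in z times the span of the two sequences `sq F (e, 0)`. The entry created in degree -1 is supplied
by `eps`. -/
theorem sh_neg_one_grad_om (h : TRR F) (i j : Fin 2 × ℕ) :
    sh (-1) (grad (om F i j)) = ∑ e, pderiv ℂ (1 - e, 0) (om F i j) • sq F (e, 0) := by
  funext c m
  rw [sh_apply, sub_neg_eq_add, Finset.sum_apply, Finset.sum_apply]
  simp only [Pi.smul_apply, smul_eq_mul]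
  obtain ⟨m, rfl⟩ | ⟨m, rfl⟩ := int_cases m
  · have := grad_natCast (om F i j) c (m + 1)
    push_cast at this
    rw [this, pd, h]
    refine Finset.sum_congr rfl fun e _ => ?_
    rw [sq_natCast, mul_comm]
  · simp only [sq_neg]
    rcases m with _ | m
    · have := grad_natCast (om F i j) c 0
      rw [show (-1 : ℤ) - ((0 : ℕ) : ℤ) + 1 = ((0 : ℕ) : ℤ) by simp, this]
      fin_cases c <;> simp
    · rw [grad_of_neg _ _ (by push_cast; omega)]
      simp

/-- The recursion for two-point functions in sequence form: modulo the primary sequences, z⁻¹ raises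
the descendant level, with a sign. -/
theorem sh_neg_one_sq (h : TRR₂ F) (a : Fin 2) (k : ℕ) :
    sh (-1) (sq F (a, k)) = -sq F (a, k + 1) + ∑ e, om F (a, k) (1 - e, 0) • sq F (e, 0) := by
  funext c m
  rw [sh_apply, sub_neg_eq_add, Pi.add_apply, Pi.add_apply, Finset.sum_apply, Finset.sum_apply]
  simp only [Pi.smul_apply, Pi.neg_apply, smul_eq_mul]
  obtain ⟨m, rfl⟩ | ⟨m, rfl⟩ := int_cases m
  · have h1 := sq_natCast F (a, k) c (m + 1)
    push_cast at h1
    simp only [h1, sq_natCast]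
    have h2 := h c a m k
    rw [eq_neg_add_iff_add_eq, add_comm, h2]
    refine Finset.sum_congr rfl fun e _ => ?_
    rw [om_comm F (a, k), mul_comm]
  · rcases m with _ | m
    · have h1 := sq_natCast F (a, k) c 0
      rw [show (-1 : ℤ) - ((0 : ℕ) : ℤ) + 1 = ((0 : ℕ) : ℤ) by simp, h1]
      simp only [sq_neg]
      fin_cases c <;> simp [om_comm]
    · have h1 : (-1 : ℤ) - ((m + 1 : ℕ) : ℤ) + 1 = -1 - m := by push_cast; ring
      rw [h1]
      simp only [sq_neg, Nat.add_right_cancel_iff]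
      split_ifs <;> simp_all [pow_succ]

/-- Differentiate the tangency relation for N = 1, the vanishing of the pairing with g = `ls B 1 (sq
F i)`, along the flow of θ = `ls B N ∘ sh (-1)`. The entries of g do not move, since they are built
from constants and two-point functions. What remains is the motion of the point itself, which gives
the pairing with θ g, and θ g is `ls B (N+1) (sq F i)` by `ls_succ`. -/
theorem Tangent.succ {N : ℕ} (h : TRR F) (h₂ : TRR₂ F) (h1 : Tangent B F 1)
    (hN : Tangent B F N) : Tangent B F (N + 1) := by
  intro i J hJ
  set θ : Seq LPS →ₗ[LPS] Seq LPS := ls B N ∘ₗ sh (-1) with hθ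
  have hfin : RowFinite B θ := (rowFinite_ls B N).comp B (rowFinite_sh B (-1))
  -- The shifted gradient of a two-point function is a combination of the `sq F (e, 0)`, whose
  -- images under `ls B N` pair to zero by tangency for N.
  have hom : ∀ i j, flow B F J θ (om F i j) = 0 := by
    intro i j
    rw [flow_apply, hθ, LinearMap.comp_apply, sh_neg_one_grad_om h, map_sum, map_sum]
    refine Finset.sum_eq_zero fun e _ => ?_
    rw [map_smul, map_smul, hN (e, 0) J (by dsimp only; omega), smul_zero]
  have hsq : ∀ (j : Fin 2 × ℕ), N + 1 + j.2 ≤ J → pairing B F J (θ (sq F j)) = 0 := by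
    rintro ⟨a, k⟩ hj
    dsimp only at hj
    rw [hθ, LinearMap.comp_apply, sh_neg_one_sq h₂, map_add, map_add, map_neg, map_neg,
      hN _ J (by dsimp only; omega), map_sum, map_sum, neg_zero, zero_add]
    refine Finset.sum_eq_zero fun e _ => ?_
    rw [map_smul, map_smul, hN _ J (by dsimp only; omega), smul_zero]
  have hlow : ∀ (j : Fin 2 × ℕ), N + 1 + j.2 ≤ J →
      flow B F J θ (pderiv ℂ j F) = -pairing B F J (θ (eps LPS j)) := by
    intro j hj
    rw [flow_apply, eq_neg_iff_add_eq_zero, ← map_add, ← map_add]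
    exact hsq j hj
  set g := ls B 1 (sq F i) with hg
  have hgs : ∀ c (m : ℤ), m < -1 - i.2 → g c m = 0 :=
    fun c m hm => ls_eq_zero_of_lt B 1 (sq_eq_zero F i) c m (by push_cast; linarith)
  have hDsq : ∀ c m, flow B F J θ (sq F i c m) = 0 := by
    intro c m
    obtain ⟨m, rfl⟩ | ⟨m, rfl⟩ := int_cases m
    · rw [sq_natCast, hom]
    · rw [sq_neg]
      split_ifs
      · rw [show ((-1 : LPS) ^ i.2) = C ((-1) ^ i.2) by simp, ← mul_one (C _), ← smul_eq_C_mul,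
          Derivation.map_smul, Derivation.map_one_eq_zero, smul_zero]
      · exact map_zero _
  have hDg : ∀ c m, flow B F J θ (g c m) = 0 := by
    intro c m
    simp only [hg, ls_apply, map_sum, Derivation.map_smul, hDsq, smul_zero, Finset.sum_const_zero]
  have key := congrArg (flow B F J θ) (h1 i (1 + i.2) le_rfl)
  rw [map_zero, ← hg, pairing_apply, map_add, flow_sumT B F J hfin, map_sum] at key
  simp only [hDg, sumT_zero, add_zero] at key
  -- The finitely many negative entries of g are coefficients of pure sequences `eps`; by `hlow` the
  -- pairings of θ with these are minus the derivatives of ∂F along the flow, so the two kinds of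
  -- terms in `key` fit together.
  have hsplit : g = extend (fun i => g i.1 i.2) + ∑ j ∈ Finset.range (1 + i.2), ∑ c,
      ((-1) ^ j * g c (-1 - j)) • eps LPS (1 - c, j) := by
    funext c m
    rw [Pi.add_apply, Pi.add_apply, Finset.sum_apply, Finset.sum_apply]
    simp only [Finset.sum_apply, Pi.smul_apply, smul_eq_mul, eps, sub_sub_cancel]
    obtain ⟨m, rfl⟩ | ⟨m, rfl⟩ := int_cases m
    · rw [extend_natCast, Finset.sum_eq_zero, add_zero]
      intro j _
      refine Finset.sum_eq_zero fun c _ => ?_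
      rw [if_neg (by omega), mul_zero]
    · rw [extend_of_neg _ _ (by omega), zero_add]
      by_cases hm : m < 1 + i.2
      · rw [Finset.sum_eq_single_of_mem m (Finset.mem_range.mpr hm),
          Finset.sum_eq_single_of_mem c (Finset.mem_univ _), if_pos ⟨rfl, rfl⟩, mul_right_comm,
          ← mul_pow]
        · simp
        · intro b _ hb
          rw [if_neg (fun h => hb h.2.symm), mul_zero]
        · intro j _ hj
          refine Finset.sum_eq_zero fun c _ => ?_
          rw [if_neg (by omega), mul_zero]
      · rw [hgs c _ (by omega), Finset.sum_eq_zero]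
        intro j hj
        have := Finset.mem_range.mp hj
        refine Finset.sum_eq_zero fun c _ => ?_
        rw [if_neg (by omega), mul_zero]
  have hgoal : ls B (N + 1) (sq F i) = θ g := by
    rw [ls_succ]; rfl
  rw [hgoal, hsplit, map_add, map_add, ← key, add_right_inj, map_sum, map_sum]
  refine Finset.sum_congr rfl fun j hj => ?_
  have hj' := Finset.mem_range.mp hj
  rw [map_sum, map_sum, map_sum]
  refine Finset.sum_congr rfl fun c _ => ?_
  rw [Derivation.leibniz, hDg, smul_zero, zero_add, low, Derivation.map_smul,
    hlow _ (by dsimp only; omega), map_smul, map_smul]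
  simp only [smul_eq_mul, smul_eq_C_mul, map_pow, map_neg, map_one, map_mul, pow_succ]
  ring

theorem derivation_ls {R : Type*} [CommRing R] [Algebra ℂ R] (D : Derivation ℂ R R) (N : ℕ)
    (g : Seq R) : (fun a k => D (ls B N g a k)) = ls B N fun a k => D (g a k) := by
  funext a k
  simp only [ls_apply, map_sum, Derivation.map_smul]

variable (F) in
/-- The pairing of a sequence with a tangent vector of the cone. -/
def contact (J : ℕ) (j : Fin 2 × ℕ) (g : Seq LPS) : LPS := g j.1 j.2 +
  ∑ m ∈ Finset.range J, ∑ c, low (fun i => om F i j) m c * g c (-1 - m)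

theorem pderiv_pairing (J : ℕ) (j : Fin 2 × ℕ) (g : Seq LPS) : pderiv ℂ j (pairing B F J g) =
    contact F J j g + pairing B F J (fun a k => pderiv ℂ j (g a k)) := by
  simp only [pairing_apply, contact, map_add, pderiv_sumT, map_sum, Derivation.leibniz,
    smul_eq_mul, low, Derivation.map_smul, Finset.sum_add_distrib, om, pderiv_comm j]
  simp only [mul_comm (g _ _)]
  ring

theorem pderiv_sq (i j : Fin 2 × ℕ) :
    (fun a k => pderiv ℂ j (sq F i a k)) = grad (om F j i) := by
  funext c m
  obtain ⟨m, rfl⟩ | ⟨m, rfl⟩ := int_cases m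
  · rw [sq_natCast, grad_natCast, om, om, pderiv_comm j, pd]
  · rw [sq_neg, grad_of_neg _ _ (by omega)]
    split_ifs
    · rw [show ((-1 : LPS) ^ i.2) = C ((-1) ^ i.2) by simp, pderiv_C]
    · exact map_zero _

/-- Tangency differentiated in t_j: moving the point gives `contact`, moving the sequence gives the
vector field on the two-point function. -/
theorem Tangent.vir_om {N J : ℕ} (h : Tangent B F N) (i j : Fin 2 × ℕ) (hJ : N + i.2 ≤ J) :
    vir B F N (om F i j) = -contact F J j (ls B N (sq F i)) := by
  have h1 := congrArg (pderiv ℂ j) (h i J hJ)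
  rw [map_zero, pderiv_pairing, derivation_ls, pderiv_sq, om_comm F j,
    pairing_of_le B F (show N ≤ J by omega) _
      (fun c m hm => ls_eq_zero_of_lt B N (s := 0) (fun c m hm => grad_of_neg _ _ hm) c m
        (by omega))] at h1
  exact eq_neg_of_add_eq_zero_right h1

/-! ### The string equation -/

theorem tangent_of_genusZeroPart {N : ℕ} (h : genusZeroPart B F N = 0) : Tangent B F N := by
  intro i J hJ
  rw [← pderiv_genusZeroPart B F N J i hJ, h, map_zero]

/-- The string equation for two-point functions: each descendant index is lowered in turn; for two
primaries the constant η appears through `sq_neg`. -/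
theorem vir_zero_om (h : Tangent B F 0) (i j : Fin 2 × ℕ) :
    vir B F 0 (om F i j) = -(sq F i j.1 (j.2 - 1) +
      if i.2 = 0 then 0 else om F (i.1, i.2 - 1) j) := by
  rw [h.vir_om B i j (J := i.2) (by omega), contact, ls_zero, sh_apply]
  congr 2
  have h1 : ∀ (m : ℕ) (c : Fin 2), sh 1 (sq F i) c (-1 - m) =
      if m + 1 = i.2 ∧ c = 1 - i.1 then (-1) ^ i.2 else 0 := by
    intro m c
    rw [sh_apply, ← sq_neg]
    congr 1
    push_cast
    ring
  simp only [h1]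
  split_ifs with h0
  · rw [h0]; simp
  · rw [Finset.sum_eq_single_of_mem (i.2 - 1) (Finset.mem_range.mpr (by omega)),
      Finset.sum_eq_single_of_mem (1 - i.1) (Finset.mem_univ _), if_pos ⟨by omega, rfl⟩, low,
      sub_sub_cancel, Nat.sub_add_cancel (by omega), smul_eq_C_mul, mul_right_comm, map_pow,
      ← mul_pow]
    · simp
    · intro c _ hc
      rw [if_neg (fun h => hc h.2), mul_zero]
    · intro m hm hm'
      refine Finset.sum_eq_zero fun c _ => ?_
      rw [if_neg (by omega), mul_zero]

theorem vir_zero_om_zero_zero (h : Tangent B F 0) (a b : Fin 2) :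
    vir B F 0 (om F (a, 0) (b, 0)) = -if b = 1 - a then 1 else 0 := by
  have := sq_neg F (a, 0) b 0
  rw [vir_zero_om B h]
  simp at this ⊢
  rw [this]

theorem vir_zero_om_succ_zero (h : Tangent B F 0) (a b : Fin 2) (k : ℕ) :
    vir B F 0 (om F (a, k + 1) (b, 0)) = -om F (a, k) (b, 0) := by
  have := sq_neg F (a, k + 1) b 0
  rw [vir_zero_om B h]
  simp at this ⊢
  exact this

theorem vir_zero_om_zero_succ (h : Tangent B F 0) (a b : Fin 2) (k : ℕ) :
    vir B F 0 (om F (a, 0) (b, k + 1)) = -om F (a, 0) (b, k) := by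
  rw [om_comm, vir_zero_om_succ_zero B h, om_comm]

theorem vir_zero_om_succ_succ (h : Tangent B F 0) (a b : Fin 2) (k l : ℕ) :
    vir B F 0 (om F (a, k + 1) (b, l + 1)) =
      -(om F (a, k + 1) (b, l) + om F (a, k) (b, l + 1)) := by
  rw [vir_zero_om B h]
  simp [sq_natCast, om_comm F (b, l)]

theorem vir_eq_zero {H : LPS} (hH : ∀ i, pderiv ℂ i H = 0) (N : ℕ) : vir B F N H = 0 := by
  have : grad H = 0 := by
    funext a k
    by_cases hk : 0 ≤ k <;> simp [grad, extend, hH]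
  rw [vir, flow_apply, this, map_zero, map_zero]

/-- The defect W of the relation has zero derivatives by the three-point recursion, so the string
field annihilates it. On the other hand the string field maps W(k, l + 1) to -W(k, l) - W(k - 1, l +
1), the last term being absent for k = 0. Induction on k gives W = 0. -/
theorem TRR.trr₂ (h : TRR F) (h0 : Tangent B F 0) : TRR₂ F := by
  set W : Fin 2 → Fin 2 → ℕ → ℕ → LPS := fun a b k l =>
    om F (a, k + 1) (b, l) + om F (a, k) (b, l + 1) -
      ∑ e, om F (a, k) (e, 0) * om F (1 - e, 0) (b, l) with hW
  have hperm : ∀ i j k : Fin 2 × ℕ, pderiv ℂ i (om F j k) = pderiv ℂ j (om F i k) :=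
    fun i j k => pderiv_comm _ _ _
  have hperm' : ∀ i j k : Fin 2 × ℕ, pderiv ℂ i (om F j k) = pderiv ℂ k (om F i j) :=
    fun i j k => by rw [om_comm, hperm]
  have hdW : ∀ a b k l i, pderiv ℂ i (W a b k l) = 0 := by
    intro a b k l i
    have e1 : pderiv ℂ i (om F (a, k + 1) (b, l)) = _ := (hperm _ _ _).trans (h a k i (b, l))
    have e2 : pderiv ℂ i (om F (a, k) (b, l + 1)) = _ := (hperm' _ _ _).trans (h b l i (a, k))
    simp only [hW, map_sub, map_add, e1, e2, Derivation.leibniz, smul_eq_mul,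
      Fin.sum_univ_two, sub_zero, sub_self, hperm i (1, 0), hperm i (0, 0), hperm' i (a, k),
      om_comm F (b, l)]
    ring
  have hvW : ∀ a b k l, vir B F 0 (W a b k l) = 0 := fun a b k l => vir_eq_zero B (hdW a b k l) 0
  have hδ : ∀ (a : Fin 2) (f : Fin 2 → LPS),
      ∑ e, (if e = 1 - a then 1 else 0) * f e = f (1 - a) := by
    intro a f; simp
  have hW0 : ∀ k l, ∀ a b, W a b k l = 0 := by
    intro k
    induction k with
    | zero =>
      intro l a b
      have h1 := hvW a b 0 (l + 1)
      simp only [hW, map_sub, map_add, map_sum, Derivation.leibniz, smul_eq_mul,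
        vir_zero_om_succ_succ B h0, vir_zero_om_zero_succ B h0, vir_zero_om_zero_zero B h0,
        zero_add] at h1
      simp only [hW, zero_add]
      have h2 := hδ a (fun e => om F (1 - e, 0) (b, l + 1))
      simp only [sub_sub_cancel] at h2
      rw [← neg_eq_zero, ← h1, Finset.sum_add_distrib]
      simp only [mul_neg, neg_mul, Finset.sum_neg_distrib,
        mul_comm (om F (1 - _, 0) (b, l + 1)), h2]
      ring
    | succ k ih =>
      intro l a b
      have h1 := hvW a b (k + 1) (l + 1)
      have h2 := ih (l + 1) a b
      simp only [hW] at h2 ⊢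
      simp only [hW, map_sub, map_add, map_sum, Derivation.leibniz, smul_eq_mul,
        vir_zero_om_succ_succ B h0, vir_zero_om_zero_succ B h0, vir_zero_om_succ_zero B h0] at h1
      rw [Finset.sum_add_distrib] at h1
      simp only [mul_neg, Finset.sum_neg_distrib] at h1
      have h3 : ∑ e, om F (1 - e, 0) (b, l + 1) * om F (a, k) (e, 0) =
          ∑ e, om F (a, k) (e, 0) * om F (1 - e, 0) (b, l + 1) :=
        Finset.sum_congr rfl fun _ _ => mul_comm _ _
      linear_combination -h1 - h2 + h3
  intro a b k l
  exact sub_eq_zero.mp (hW0 k l a b)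

/-! ### The dilaton equation -/

variable (F) in
/-- The Euler vector field `∑ t̃ᵢ ∂ᵢ`. -/
def euler : Derivation ℂ LPS LPS := flow B F 0 LinearMap.id

theorem euler_apply (H : LPS) : euler B F H = sumT B fun i => pderiv ℂ i H := by
  rw [euler, flow_apply, pairing_apply]
  simp [grad_natCast]

theorem euler_sumT (G : Fin 2 × ℕ → LPS) :
    euler B F (sumT B G) = sumT B G + sumT B fun i => euler B F (G i) := by
  rw [euler, flow_sumT B F 0 (fun _ => rfl), pairing_apply]
  simp [extend_natCast]

theorem euler_tt (a : Fin 2) (k : ℕ) : euler B F (tt B a k) = tt B a k := by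
  simp only [euler_apply, pderiv_tt]
  rw [sumT_single B (a, k), mul_one]

theorem euler_virQuad (N : ℕ) : euler B F (virQuad B N) = 2 • virQuad B N := by
  simp only [virQuad_eq, Derivation.map_smul, map_sum, Derivation.leibniz, euler_tt, smul_eq_mul,
    Finset.smul_sum]
  refine Finset.sum_congr rfl fun _ _ => Finset.sum_congr rfl fun _ _ =>
    Finset.sum_congr rfl fun _ _ => Finset.sum_congr rfl fun _ _ => ?_
  rw [smul_comm (2 : ℕ), smul_comm (2 : ℕ), two_nsmul, mul_comm (tt _ _ _)]

theorem euler_pderiv (h : euler B F F = 2 • F) (i : Fin 2 × ℕ) :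
    euler B F (pderiv ℂ i F) = pderiv ℂ i F := by
  have h1 := congrArg (pderiv ℂ i) h
  rw [euler_apply, pderiv_sumT, two_nsmul, map_add, add_right_inj] at h1
  rw [euler_apply]
  refine Eq.trans ?_ h1
  simp only [pderiv_comm i]

theorem euler_genusZeroPart (h : euler B F F = 2 • F) (N : ℕ) :
    euler B F (genusZeroPart B F N) = 2 • genusZeroPart B F N := by
  have hg : (fun a k => euler B F (grad F a k)) = grad F := by
    funext a k
    by_cases hk : 0 ≤ k
    · simp [grad, extend, hk, euler_pderiv B h]
    · simp [grad, extend, hk]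
  have hl : ∀ a k, euler B F (ls B N (grad F) a k) = ls B N (grad F) a k := by
    intro a k
    have := derivation_ls B (euler B F) N (grad F)
    rw [hg] at this
    exact congrFun (congrFun this a) k
  rw [genusZeroPart, map_add, map_add, Derivation.map_smul, derivation_bil, euler_virQuad,
    virVec_eq, euler_sumT]
  simp only [euler_pderiv B h, hl]
  simp only [← two_nsmul]
  module

/-- Tangency kills the first derivatives, and a function of degree 2 for the Euler field ∑ t̃ᵢ∂ᵢ
without first derivatives satisfies 0 = 2f. -/
theorem genusZeroPart_eq_zero (h : euler B F F = 2 • F) {N : ℕ} (hN : Tangent B F N) :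
    genusZeroPart B F N = 0 := by
  have h1 : ∀ i, pderiv ℂ i (genusZeroPart B F N) = 0 := fun i => by
    rw [pderiv_genusZeroPart B F N (N + i.2) i le_rfl, hN i _ le_rfl]
  have h2 := euler_genusZeroPart B h N
  rw [euler_apply] at h2
  simp only [h1, sumT_zero] at h2
  rw [← Nat.cast_smul_eq_nsmul ℂ, eq_comm, smul_eq_zero] at h2
  simpa using h2

end

section

/-! ### Extension of derivations along formally étale algebras -/

section Etale

variable {S : Type*} [CommRing S] [Algebra ℂ S] (T : Type*) [CommRing T] [Algebra ℂ T]
  [Algebra S T] [IsScalarTower ℂ S T] [Algebra.FormallyEtale S T]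

/-- The unique extension of a derivation to a formally étale algebra. -/
def extendDerivation (D : Derivation ℂ S S) : Derivation ℂ T T :=
  ((LinearMap.liftBaseChange T (Algebra.linearMap S T ∘ₗ D.liftKaehlerDifferential)) ∘ₗ
    (KaehlerDifferential.tensorKaehlerEquivOfFormallyEtale ℂ S T).symm.toLinearMap).compDer
      (KaehlerDifferential.D ℂ T)

theorem extendDerivation_algebraMap (D : Derivation ℂ S S) (a : S) :
    extendDerivation T D (algebraMap S T a) = algebraMap S T (D a) := by
  change LinearMap.liftBaseChange T (Algebra.linearMap S T ∘ₗ D.liftKaehlerDifferential)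
    ((KaehlerDifferential.tensorKaehlerEquivOfFormallyEtale ℂ S T).symm
      (KaehlerDifferential.D ℂ T (algebraMap S T a))) = _
  rw [KaehlerDifferential.tensorKaehlerEquivOfFormallyEtale_symm_D_algebraMap]
  simp

variable {T}

/-- Since Ω_T = T ⊗_S Ω_S, the differentials from S generate Ω_T over T, and a derivation is
determined by its restriction to S. -/
theorem derivation_ext_of_formallyEtale (S : Type*) [CommRing S] [Algebra ℂ S]
    [Algebra S T] [IsScalarTower ℂ S T] [Algebra.FormallyEtale S T] {D D' : Derivation ℂ T T}
    (h : ∀ a : S, D (algebraMap S T a) = D' (algebraMap S T a)) : D = D' := by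
  set e := KaehlerDifferential.tensorKaehlerEquivOfFormallyEtale ℂ S T
  have key : D.liftKaehlerDifferential ∘ₗ e.toLinearMap =
      D'.liftKaehlerDifferential ∘ₗ e.toLinearMap := by
    apply TensorProduct.AlgebraTensorModule.ext
    intro t ω
    have hs : ω ∈ Submodule.span S (Set.range (KaehlerDifferential.D ℂ S)) := by
      rw [KaehlerDifferential.span_range_derivation]; trivial
    induction hs using Submodule.span_induction with
    | mem x hx =>
      obtain ⟨a, rfl⟩ := hx
      simp [e, h]
    | zero => simp
    | add x y _ _ hx hy => rw [TensorProduct.tmul_add, map_add, map_add, hx, hy]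
    | smul c x _ hx =>
      rw [TensorProduct.tmul_smul, LinearMap.map_smul_of_tower, LinearMap.map_smul_of_tower, hx]
  have key' : D.liftKaehlerDifferential = D'.liftKaehlerDifferential := by
    apply LinearMap.ext
    intro ω
    have := LinearMap.congr_fun key (e.symm ω)
    simpa using this
  ext t
  rw [← Derivation.liftKaehlerDifferential_comp D, key', Derivation.liftKaehlerDifferential_comp]

end Etale

instance : CharZero (FractionRing LPS) :=
  charZero_of_injective_algebraMap (algebraMap ℂ (FractionRing LPS)).injective

instance : Algebra.FormallyEtale LPS (FractionRing LPS) :=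
  Algebra.FormallyEtale.of_isLocalization (nonZeroDivisors LPS)

/-- An algebraic closure of the field of fractions of the ring of formal functions. -/
abbrev Closure : Type := AlgebraicClosure (FractionRing LPS)

/-- Separability is automatic in characteristic 0. Composed with the localization, this extends the
partial derivatives uniquely to a field in which φ'(u) has a square root. -/
instance : Algebra.FormallyEtale (FractionRing LPS) Closure :=
  Algebra.FormallyEtale.of_isSeparable _ _

instance : Algebra.FormallyEtale LPS Closure :=
  Algebra.FormallyEtale.comp _ (FractionRing LPS) _

end

section

variable {B : Background} {F : LPS}

/-! ### The tangent spaces of the cone of a potential -/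

variable (B F) in
/-- The consequences of the axioms for the genus `0` potential that do not involve `φ`. -/
structure IsCone : Prop where
  trr : TRR F
  trr₂ : TRR₂ F
  tangent : ∀ N, Tangent B F N
  euler : euler B F F = 2 • F

/-- The string equation and homogeneity are tangency for N = 0 and N = 1; `Tangent.succ` does the
rest. -/
theorem IsGenusZeroPotential.isCone {G : ℕ → LPS} (h : IsGenusZeroPotential B G) :
    IsCone B (G 0) := by
  have h1 : TRR (G 0) := by
    rintro a k ⟨b, l⟩ ⟨c, m⟩
    have := h.trr a b c k l m
    simp [eta, Fin.sum_univ_two] at this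
    simpa [om, add_comm] using this
  have t0 : Tangent B (G 0) 0 :=
    tangent_of_genusZeroPart B (by simpa [virasoroPart_genusZero] using h.string)
  have t1 : Tangent B (G 0) 1 :=
    tangent_of_genusZeroPart B (by simpa [virasoroPart_genusZero] using h.homogeneity)
  have h2 := h1.trr₂ B t0
  refine ⟨h1, h2, fun N => ?_, ?_⟩
  · induction N with
    | zero => exact t0
    | succ N ih => exact Tangent.succ B h1 h2 t1 ih
  · have := h.dilaton
    rw [euler_apply, two_nsmul]
    linear_combination -this

namespace IsCone

theorem grad_om (h : IsCone B F) (i j : Fin 2 × ℕ) :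
    grad (om F i j) = ∑ e, pderiv ℂ (1 - e, 0) (om F i j) • sh 1 (sq F (e, 0)) := by
  have h1 := congrArg (sh 1) (sh_neg_one_grad_om h.trr i j)
  simpa [sh_sh, map_sum, map_smul] using h1

end IsCone

theorem pderiv_om_rotate (F : LPS) (i j k : Fin 2 × ℕ) :
    pderiv ℂ i (om F j k) = pderiv ℂ j (om F k i) := by
  rw [om_comm F k i, om, om, pderiv_comm]

namespace IsCone

/-- The quantum differential equation: differentiating the frame `sq F (a, 0)` is z times
multiplication by a matrix of three-point functions. -/
theorem pderiv_sq_zero (h : IsCone B F) (a : Fin 2) (j : Fin 2 × ℕ) :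
    (fun c k => pderiv ℂ j (sq F (a, 0) c k)) =
      ∑ e, pderiv ℂ j (om F (a, 0) (1 - e, 0)) • sh 1 (sq F (e, 0)) := by
  rw [pderiv_sq, h.grad_om]
  simp only [pderiv_om_rotate F (1 - _, 0)]

end IsCone

variable (B F) in
/-- Multiplication by the Euler vector field in the frame `sq F (a, 0)`. -/
def eulerMul (a b : Fin 2) : LPS :=
  (1 + mu B.d a - mu B.d b) • om F (a, 0) (1 - b, 0) + C (B.R.coeff 1 a b)

/-- The sequence starts in degree -1, so only ℓ ≤ k + 1 contributes, and the last term meets the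
constant entry in degree -1. -/
theorem sum_R_sq (a c : Fin 2) (k : ℕ) :
    ∑ l ∈ Finset.range (B.R.natDegree + 1), ∑ b, B.R.coeff l c b • sq F (a, 0) b (k - l) =
      (∑ l ∈ Finset.range k, ∑ b, B.R.coeff (l + 1) c b • om F (b, k - 1 - l) (a, 0)) +
        C (B.R.coeff (k + 1) c (1 - a)) := by
  have h0 : ∀ l ∈ Finset.range (B.R.natDegree + k + 2), l ∉ Finset.range (B.R.natDegree + 1) →
      ∑ b, B.R.coeff l c b • sq F (a, 0) b (k - l) = 0 := by
    intro l _ hl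
    have : B.R.coeff l = 0 := Polynomial.coeff_eq_zero_of_natDegree_lt (by simpa using hl)
    simp [this]
  rw [Finset.sum_subset (Finset.range_subset_range.mpr (by omega)) h0,
    ← Finset.sum_subset (Finset.range_subset_range.mpr (show k + 2 ≤ _ by omega)),
    Finset.sum_range_succ, Finset.sum_range_succ', B.R_zero]
  · congr 1
    · simp only [Matrix.zero_apply, zero_smul, Finset.sum_const_zero, add_zero]
      refine Finset.sum_congr rfl fun l hl => Finset.sum_congr rfl fun b _ => ?_
      have := Finset.mem_range.mp hl
      rw [← sq_natCast]
      congr 2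
      omega
    · have h1 : ∀ b, sq F (a, 0) b ((k : ℤ) - ((k + 1 : ℕ) : ℤ)) = if b = 1 - a then 1 else 0 := by
        intro b
        have := sq_neg F (a, 0) b 0
        rw [show ((k : ℤ) - ((k + 1 : ℕ) : ℤ)) = -1 - ((0 : ℕ) : ℤ) by push_cast; ring, this]
        simp
      rw [Finset.sum_congr rfl fun b _ => by rw [h1 b]]
      simp [smul_eq_C_mul]
  · intro l _ hl
    refine Finset.sum_eq_zero fun b _ => ?_
    have : k + 2 ≤ l := by simpa using hl
    rw [sq_eq_zero F (a, 0) b _ (by dsimp only; omega), smul_zero]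

theorem ls_one_sq_natCast (a c : Fin 2) (k : ℕ) : ls B 1 (sq F (a, 0)) c k =
    (mu B.d c + k + 1 / 2) • om F (c, k) (a, 0) +
      ((∑ l ∈ Finset.range k, ∑ b, B.R.coeff (l + 1) c b • om F (b, k - 1 - l) (a, 0)) +
        C (B.R.coeff (k + 1) c (1 - a))) := by
  rw [ls_one_apply, sum_R_sq, sq_natCast]
  norm_cast

/-- In negative degrees every R[ℓ] with ℓ > 0 reaches below the first entry of the sequence, which
leaves the diagonal term. -/
theorem ls_one_sq_neg (a c : Fin 2) (m : ℕ) : ls B 1 (sq F (a, 0)) c (-1 - m) =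
    -(mu B.d a + 1 / 2) • sq F (a, 0) c (-1 - m) := by
  rw [ls_one_apply, Finset.sum_eq_zero, add_zero, sq_neg]
  · split_ifs with h1
    · rw [h1.2, h1.1, mu_one_sub]
      congr 1
      push_cast
      ring
    · simp
  · intro l _
    rcases l with _ | l
    · simp [B.R_zero]
    · refine Finset.sum_eq_zero fun b _ => ?_
      rw [sq_eq_zero F (a, 0) b _ (by dsimp only; omega), smul_zero]

namespace IsCone

theorem vir_one_om (h : IsCone B F) (a c : Fin 2) (k : ℕ) : vir B F 1 (om F (a, 0) (c, k)) =
    -(ls B 1 (sq F (a, 0)) c k + (mu B.d a + 1 / 2) • om F (c, k) (a, 0)) := by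
  rw [(h.tangent 1).vir_om B (a, 0) (c, k) (J := 1) (by simp), contact, Finset.sum_range_one]
  have h1 := fun e => ls_one_sq_neg (B := B) (F := F) a e 0
  have h2 := fun e => sq_neg F (a, 0) e 0
  simp only [h1, h2]
  congr 2
  rw [Finset.sum_eq_single_of_mem (1 - a) (Finset.mem_univ _)]
  · rw [om_comm F (c, k)]
    simp [low, sub_sub_cancel, neg_add_rev, ← sub_eq_add_neg]
    module
  · intro b _ hb
    simp [hb]

/-- By the recursion, the gradient of a two-point function with a descendant is a combination of
gradients with a primary in its place; so the action on the latter suffices. -/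
theorem vir_om_succ (h : IsCone B F) (N : ℕ) (i : Fin 2 × ℕ) (c : Fin 2) (k : ℕ) :
    vir B F N (om F i (c, k + 1)) =
      ∑ e, om F (c, k) (e, 0) * vir B F N (om F i (1 - e, 0)) := by
  have h1 : grad (om F i (c, k + 1)) = ∑ e, om F (c, k) (e, 0) • grad (om F i (1 - e, 0)) := by
    funext a m
    rw [Finset.sum_apply, Finset.sum_apply]
    simp only [Pi.smul_apply, smul_eq_mul]
    by_cases hm : 0 ≤ m
    · lift m to ℕ using hm
      simp only [grad_natCast, pd]
      rw [← pderiv_om_rotate F (c, k + 1), h.trr]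
      simp only [pderiv_om_rotate F (1 - _, 0)]
    · simp [grad_of_neg _ _ (not_le.mp hm)]
  rw [vir, flow_apply, h1, map_sum, map_sum]
  simp only [map_smul, smul_eq_mul, flow_apply]

theorem ls_one_sq_add (a c : Fin 2) :
    ls B 1 (sq F (a, 0)) c 0 + (mu B.d a + 1 / 2) • om F (c, 0) (a, 0) =
      eulerMul B F a (1 - c) := by
  have h1 := ls_one_sq_natCast (B := B) (F := F) a c 0
  have h2 := R_coeff_flip B 1 c (1 - a)
  rw [sub_sub_cancel] at h2
  rw [Nat.cast_zero] at h1
  rw [h1, eulerMul, mu_one_sub, sub_sub_cancel, om_comm F (c, 0), zero_add, h2]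
  simp
  module

theorem vir_one_om_zero (h : IsCone B F) (a b : Fin 2) :
    vir B F 1 (om F (a, 0) (b, 0)) = -eulerMul B F a (1 - b) := by
  rw [h.vir_one_om, ← ls_one_sq_add]
  rfl

/-- Multiplication by the Euler vector field on the tangent space. -/
theorem ls_one_sq (h : IsCone B F)
    (a : Fin 2) : ls B 1 (sq F (a, 0)) = -(mu B.d a + 1 / 2) • sq F (a, 0) +
    ∑ b, eulerMul B F a b • sh 1 (sq F (b, 0)) := by
  funext c m
  simp only [Pi.add_apply, Pi.smul_apply, Finset.sum_apply, sh_apply, smul_eq_mul]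
  obtain ⟨m, rfl⟩ | ⟨m, rfl⟩ := int_cases m
  · rcases m with _ | m
    · have h1 := ls_one_sq_add (B := B) (F := F) a c
      have h2 := fun b => sq_neg F (b, 0) c 0
      have h3 := sq_natCast F (a, 0) c 0
      simp only [Nat.cast_zero, sub_zero] at h2 h3
      simp only [Nat.cast_zero, zero_sub, h2, h3]
      rw [eq_sub_of_add_eq h1, Finset.sum_eq_single_of_mem (1 - c) (Finset.mem_univ _)]
      · simp; module
      · intro b _ hb
        rw [if_neg, mul_zero]
        rintro ⟨-, rfl⟩
        exact hb (by rw [sub_sub_cancel])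
    -- In positive degrees the entry is the homogeneity field on a descendant two-point function,
    -- and the recursion reduces that to primaries.
    · have h1 := h.vir_one_om a c (m + 1)
      have h2 := fun b => sq_natCast F (b, 0) c m
      rw [h.vir_om_succ] at h1
      simp only [h.vir_one_om_zero, sub_sub_cancel] at h1
      push_cast at h1 ⊢
      simp only [add_sub_cancel_right, h2]
      have h3 := sq_natCast F (a, 0) c (m + 1)
      push_cast at h3
      rw [h3]
      have h4 : ∑ e, om F (c, m) (e, 0) * -eulerMul B F a e =
          -∑ e, eulerMul B F a e * om F (c, m) (e, 0) := by
        simp [mul_comm]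
      rw [h4, neg_inj] at h1
      rw [h1]
      module
  · rw [ls_one_sq_neg, Finset.sum_eq_zero, add_zero]
    intro b _
    rw [sq_eq_zero F (b, 0) c _ (by dsimp only; omega), mul_zero]

end IsCone

end

section

variable {B : Background} {F : LPS}

/-! ### The structure functions -/

theorem constantCoeff_sumT (G : Fin 2 × ℕ → LPS) : constantCoeff (sumT B G) =
    ∑ a, B.base a * constantCoeff (G (a, 0)) - constantCoeff (G (0, 1)) := by
  have h1 : constantCoeff (sumX G) = 0 := by
    rw [← coeff_zero_eq_constantCoeff_apply]
    exact Finset.sum_empty (f := fun i => coeff (0 - Finsupp.single i 1) (G i))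
  rw [sumT, map_sub, map_add, h1, map_sum, zero_add]
  simp [smul_eq_C_mul]

namespace IsCone

/-- At the base point the only nonzero t̃ can be t̃^a_0 = p^a and t̃^0_1 = -1, so the differentiated
string equation reads ⟪O_0 O_a⟫ = p^{1-a}. In particular u takes the value p^1. -/
theorem constantCoeff_om (h : IsCone B F) (a : Fin 2) :
    constantCoeff (om F (0, 0) (a, 0)) = B.base (1 - a) := by
  have h1 := congrArg constantCoeff (h.tangent 0 (a, 0) 0 (by simp))
  rw [pairing_apply, Finset.range_zero, Finset.sum_empty, add_zero, ls_zero, constantCoeff_sumT,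
    map_zero] at h1
  have h2 := sq_natCast F (a, 0) 0 0
  have h3 := fun c => sq_neg F (a, 0) c 0
  simp at h1 h2 h3
  rw [h2, ← sub_eq_zero] at h1
  simp only [h3] at h1
  fin_cases a <;> simp at h1 ⊢ <;> linear_combination -h1

/-- The string equation for ⟪O_a O_b⟫ at the base point, where only the dilaton shift t̃^0_1 = -1
contributes. -/
theorem constantCoeff_pderiv_om (h : IsCone B F) (a b : Fin 2) :
    constantCoeff (pderiv ℂ (0, 0) (om F (a, 0) (b, 0))) = if b = 1 - a then 1 else 0 := by
  have h1 := congrArg constantCoeff (vir_zero_om_zero_zero B (h.tangent 0) a b)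
  rw [vir, flow_apply, pairing_apply, Finset.range_zero, Finset.sum_empty, add_zero, ls_zero,
    constantCoeff_sumT] at h1
  have h2 := grad_natCast (om F (a, 0) (b, 0)) 0 0
  simp at h2
  simp [grad_of_neg, h2, pd] at h1
  rw [h1]

end IsCone

theorem R_one_diag (a : Fin 2) : B.R.coeff 1 a a = 0 := by
  simpa [eq_comm] using B.R_grading 1 a a

theorem R_one_lower : B.R.coeff 1 1 0 = 0 := by
  have h := B.R_grading 1 1 0
  have h1 : (1 + B.d) * B.R.coeff 1 1 0 = 0 := by
    simp [mu] at h
    linear_combination -h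
  exact (mul_eq_zero.mp h1).resolve_left fun h2 => B.d_ne (by linear_combination h2)

theorem R_one_upper (hd : B.d ≠ 1) : B.R.coeff 1 0 1 = 0 := by
  have h := B.R_grading 1 0 1
  have h1 : (B.d - 1) * B.R.coeff 1 0 1 = 0 := by
    simp [mu] at h
    linear_combination h
  exact (mul_eq_zero.mp h1).resolve_left (sub_ne_zero.mpr hd)

variable (B F) in
/-- The off-diagonal entry of the multiplication by the Euler vector field. -/
def wFun : LPS := (1 - B.d) • uFun F + C (B.R.coeff 1 0 1)

theorem eulerMul_zero_zero : eulerMul B F 0 0 = vFun F := by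
  simp [eulerMul, R_one_diag]; rfl

theorem eulerMul_one_one : eulerMul B F 1 1 = vFun F := by
  simp [eulerMul, R_one_diag, om_comm F (1, 0)]; rfl

theorem eulerMul_zero_one : eulerMul B F 0 1 = wFun B F := by
  rw [eulerMul, wFun]
  congr 1
  simp [mu]
  rw [show (1 + -B.d / 2 - B.d / 2 : ℂ) = 1 - B.d by ring]
  rfl

theorem eulerMul_one_zero : eulerMul B F 1 0 = (1 + B.d) • om F (1, 0) (1, 0) := by
  simp [eulerMul, R_one_lower, mu]
  congr 1
  ring

/-- A cone for which `⟪O_1 O_1⟫_0 = φ(⟪O_0 O_0⟫_0)`. -/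
structure IsTwoPrimaryCone (B : Background) (F : LPS) : Prop extends IsCone B F where
  structure_function : om F (1, 0) (1, 0) = comp (phi B.d) (uFun F)

theorem phi_of_eq_one {d : ℂ} (hd : d = 1) : phi d = Complex.exp := by
  funext x; simp [phi, hd]

variable (B F) in
/-- The function `φ'(u)`. -/
def dphi : LPS := comp (deriv (phi B.d)) (uFun F)

namespace IsTwoPrimaryCone

theorem pderiv_phi (h : IsTwoPrimaryCone B F) (i : Fin 2 × ℕ) :
    pderiv ℂ i (om F (1, 0) (1, 0)) = dphi B F * pderiv ℂ i (uFun F) := by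
  rw [h.structure_function, pderiv_comp, dphi]

end IsTwoPrimaryCone

theorem vir_comp (N : ℕ) (f : ℂ → ℂ) (G : LPS) :
    vir B F N (comp f G) = comp (deriv f) G * vir B F N G := by
  have : grad (comp f G) = comp (deriv f) G • grad G := by
    rw [grad, grad, ← extend_mul]
    simp only [pderiv_comp]
  rw [vir, flow_apply, this, map_smul, map_smul, smul_eq_mul, flow_apply]

theorem constantCoeff_uFun (h : IsCone B F) : constantCoeff (uFun F) = B.base 1 :=
  h.constantCoeff_om 0

theorem pderiv_one_uFun : pderiv ℂ (1, 0) (uFun F) = pderiv ℂ (0, 0) (vFun F) := by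
  change pderiv ℂ (1, 0) (om F (0, 0) (0, 0)) = pderiv ℂ (0, 0) (om F (0, 0) (1, 0))
  rw [pderiv_om_rotate]

theorem IsCone.pderiv_vFun_ne_zero (h : IsCone B F) : pderiv ℂ (0, 0) (vFun F) ≠ 0 := by
  intro h0
  have := h.constantCoeff_pderiv_om 0 1
  change constantCoeff (pderiv ℂ (0, 0) (vFun F)) = _ at this
  simp [h0] at this

theorem IsCone.uFun_ne_zero (h : IsCone B F) : uFun F ≠ 0 := by
  intro h0
  apply h.pderiv_vFun_ne_zero
  rw [← pderiv_one_uFun, h0, map_zero]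

namespace IsTwoPrimaryCone

/-- Homogeneity of φ: the field of L₀ is applied to ⟪O_1 O_1⟫_0 = φ(u), once by the chain rule and
once by `vir_one_om_zero`. -/
theorem wFun_mul_dphi (h : IsTwoPrimaryCone B F) :
    wFun B F * dphi B F = (1 + B.d) • om F (1, 0) (1, 0) := by
  have h1 := h.vir_one_om_zero 1 1
  have h2 : vir B F 1 (uFun F) = _ := h.vir_one_om_zero 0 0
  rw [sub_zero, eulerMul_zero_one] at h2
  rw [h.structure_function, vir_comp, h2, sub_self, eulerMul_one_zero] at h1
  rw [dphi]
  linear_combination -h1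

theorem wFun_of_ne (hd : B.d ≠ 1) : wFun B F = (1 - B.d) • uFun F := by
  rw [wFun, R_one_upper hd, map_zero, add_zero]

theorem comp_exp_ne_zero : comp Complex.exp (uFun F) ≠ 0 := by
  intro h0
  have := constantCoeff_comp Complex.exp (uFun F)
  rw [h0, map_zero] at this
  exact Complex.exp_ne_zero _ this.symm

/-- For d = 1 the factor φ' = φ = exp cancels from the homogeneity relation, which therefore forces
R[1]_0^1 = 2. -/
theorem wFun_of_eq (h : IsTwoPrimaryCone B F) (hd : B.d = 1) : wFun B F = C 2 := by
  have h1 := h.wFun_mul_dphi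
  rw [h.structure_function, dphi, phi_of_eq_one hd, Complex.deriv_exp, hd, smul_eq_C_mul] at h1
  rw [mul_right_cancel₀ comp_exp_ne_zero h1]
  norm_num

theorem wFun_ne_zero (h : IsTwoPrimaryCone B F) : wFun B F ≠ 0 := by
  by_cases hd : B.d = 1
  · rw [h.wFun_of_eq hd]
    intro h0
    have := congrArg constantCoeff h0
    simp at this
  · rw [wFun_of_ne hd]
    exact smul_ne_zero (sub_ne_zero.mpr (Ne.symm hd)) h.uFun_ne_zero

/-- On the slit plane the constant term is nonzero. For d = 0 and d = 1/3 the base point may be 0,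
but then φ(u) is u or u², and u is a nonzero series. -/
theorem phi_ne_zero (h : IsTwoPrimaryCone B F) : om F (1, 0) (1, 0) ≠ 0 := by
  rw [h.structure_function]
  by_cases hd : B.d = 1
  · rw [phi_of_eq_one hd]
    exact comp_exp_ne_zero
  rcases B.base_mem with hb | hb | hb | hb
  · intro h0
    have := constantCoeff_comp (phi B.d) (uFun F)
    rw [h0, map_zero, constantCoeff_uFun h.toIsCone, phi, if_neg hd] at this
    exact Complex.slitPlane_ne_zero hb ((Complex.cpow_eq_zero_iff _ _).mp this.symm).1
  · have : phi B.d = fun x => x := by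
      funext x; simp [phi, hb]
    rw [this, comp_id]
    exact h.uFun_ne_zero
  · have : phi B.d = (fun x => x) * fun x => x := by
      funext x
      rw [phi, if_neg hd, hb]
      norm_num
      ring
    rw [this, comp_mul (f := fun x => x) (g := fun x => x) analyticAt_id analyticAt_id, comp_id]
    exact mul_ne_zero h.uFun_ne_zero h.uFun_ne_zero
  · exact absurd hb hd

theorem dphi_ne_zero (h : IsTwoPrimaryCone B F) : dphi B F ≠ 0 := by
  intro h0
  have h1 := h.wFun_mul_dphi
  rw [h0, mul_zero] at h1
  refine smul_ne_zero (fun h2 => B.d_ne ?_) h.phi_ne_zero h1.symm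
  linear_combination h2

/-- The relation w φ' = (1 + d) φ is differentiated in t^1_0, and ∂_{0,1} u = ∂v, which is nonzero,
is cancelled. -/
theorem wFun_mul_comp_deriv_deriv (h : IsTwoPrimaryCone B F) :
    wFun B F * comp (deriv (deriv (phi B.d))) (uFun F) = (2 * B.d) • dphi B F := by
  have h1 := congrArg (pderiv ℂ (1, 0)) h.wFun_mul_dphi
  have h2 := h.pderiv_vFun_ne_zero
  rw [← pderiv_one_uFun] at h2
  rw [Derivation.leibniz, Derivation.map_smul, h.pderiv_phi, dphi, pderiv_comp, ← dphi, wFun,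
    map_add, pderiv_C, Derivation.map_smul, add_zero, ← wFun] at h1
  refine mul_right_cancel₀ h2 ?_
  simp only [smul_eq_mul, smul_eq_C_mul] at h1 ⊢
  simp only [map_add, map_sub, map_one, map_mul, map_ofNat] at h1 ⊢
  linear_combination h1

end IsTwoPrimaryCone

/-! ### The functions `ψ` and `h_0` -/

namespace IsTwoPrimaryCone

/-- Written with w, both cases of ψ obey one equation. If d(3d - 1) = 0 the derivative vanishes and
no branch of the logarithm is needed; otherwise, for d ≠ 1, `base_mem` places the base point in the
slit plane. -/
theorem wFun_mul_comp_deriv_psi (h : IsTwoPrimaryCone B F) :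
    wFun B F * comp (deriv (fun x => 24 * psi B.d x)) (uFun F) = C (-(B.d * (3 * B.d - 1))) := by
  by_cases hd : B.d = 1
  · have : deriv (fun x => 24 * psi B.d x) = fun _ => -1 := by
      have h1 : (fun x => 24 * psi B.d x) = fun x => -x := by
        funext x; simp [psi, hd]; ring
      rw [h1]; funext x; simp
    rw [this, comp_const, h.wFun_of_eq hd, ← map_mul, hd]
    norm_num
  have hd' := sub_ne_zero.mpr hd
  have h1 : (fun x => 24 * psi B.d x) =
      fun x => (B.d * (3 * B.d - 1) / (B.d - 1)) * Complex.log x := by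
    funext x; simp only [psi, if_neg hd]; field_simp
  rw [h1]
  by_cases hc : B.d * (3 * B.d - 1) = 0
  · simp only [hc, zero_div, zero_mul, deriv_const', comp_const]
    simp
  have hb : B.base 1 ∈ Complex.slitPlane := by
    rcases B.base_mem with hb | hb | hb | hb
    · exact hb
    · simp [hb] at hc
    · norm_num [hb] at hc
    · exact absurd hb hd
  rw [wFun_of_ne hd]
  have h0 := constantCoeff_uFun h.toIsCone
  set c := B.d * (3 * B.d - 1) / (B.d - 1) with hcdef
  have h2 : deriv (fun x => c * Complex.log x) =ᶠ[nhds (constantCoeff (uFun F))]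
      fun x => c * x⁻¹ := by
    rw [h0]
    filter_upwards [Complex.isOpen_slitPlane.mem_nhds hb] with x hx
    rw [deriv_const_mul _ (Complex.differentiableAt_log hx), (Complex.hasDerivAt_log hx).deriv]
  have h3 : comp (fun x : ℂ => x) (uFun F) * comp (fun x => c * x⁻¹) (uFun F) = C c := by
    have hne : constantCoeff (uFun F) ≠ 0 := by rw [h0]; exact Complex.slitPlane_ne_zero hb
    rw [← comp_mul (f := fun x => x) (g := fun x => c * x⁻¹) analyticAt_id
        (analyticAt_const.mul (analyticAt_inv hne)),
      ← comp_const c (uFun F)]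
    refine comp_congr ?_
    filter_upwards [isOpen_ne.mem_nhds hne] with x hx
    simp only [Pi.mul_apply]
    field_simp
  rw [comp_id] at h3
  rw [comp_congr h2, smul_mul_assoc, h3, smul_eq_C_mul, ← map_mul, hcdef]
  congr 1
  field_simp
  ring

/-- For d ≠ 1 the exponents of h₀ and φ add up to -2, so h₀ φ u² is constant; φ and u are then
traded for φ' and w. If the coefficient of h₀ vanishes through d(3d - 1) = 0, no condition on the
base point is needed. -/
theorem comp_hZero_mul_dphi_mul (h : IsTwoPrimaryCone B F) :
    comp (hZero B.d) (uFun F) * dphi B F * wFun B F ^ 3 =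
      C (-(B.d * (3 * B.d - 1) * (3 * B.d - 5) * (B.d - 2) * (1 - B.d) ^ 2 / 5760)) := by
  by_cases hd : B.d = 1
  · have : hZero B.d = fun _ => 0 := by funext x; simp [hZero, hd]
    rw [this, comp_const, hd]
    simp
  by_cases hc : B.d * (3 * B.d - 1) = 0
  · have : hZero B.d = fun _ => 0 := by funext x; simp [hZero, hc]
    rw [this, comp_const, hc]
    simp
  have hb : B.base 1 ∈ Complex.slitPlane := by
    rcases B.base_mem with hb | hb | hb | hb
    · exact hb
    · simp [hb] at hc
    · norm_num [hb] at hc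
    · exact absurd hb hd
  have h0 := constantCoeff_uFun h.toIsCone
  have hd1 : (1 - B.d) ≠ 0 := sub_ne_zero.mpr (Ne.symm hd)
  have hd2 : B.d + 1 ≠ 0 := fun h1 => B.d_ne (by linear_combination h1)
  set c := -(B.d * (3 * B.d - 1) * (3 * B.d - 5) * (B.d - 2) / (5760 * (B.d + 1))) with hcdef
  have hf : hZero B.d = fun x => c * x ^ ((B.d - 3) / (1 - B.d)) := by
    funext x; simp only [hZero, if_neg hd, hcdef]
  have hg : phi B.d = fun x => x ^ ((1 + B.d) / (1 - B.d)) := by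
    funext x; simp only [phi, if_neg hd]
  have han : ∀ y : ℂ, AnalyticAt ℂ (fun x : ℂ => x ^ y) (constantCoeff (uFun F)) := fun y =>
    analyticAt_id.cpow analyticAt_const (by rwa [id, h0])
  have h3 : comp (hZero B.d) (uFun F) * comp (phi B.d) (uFun F) * (uFun F * uFun F) = C c := by
    have e1 := comp_mul (f := hZero B.d) (g := phi B.d) (G := uFun F)
      (by rw [hf]; exact analyticAt_const.mul (han _)) (by rw [hg]; exact han _)
    have e2 := comp_mul (f := fun x => x) (g := fun x => x) (G := uFun F)
      analyticAt_id analyticAt_id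
    have e3 := comp_mul (f := hZero B.d * phi B.d) (g := (fun x => x) * fun x => x) (G := uFun F)
      (by rw [hf, hg]; exact (analyticAt_const.mul (han _)).mul (han _))
      (analyticAt_id.mul analyticAt_id)
    rw [comp_id] at e2
    rw [← e1, ← e2, ← e3, ← comp_const c (uFun F)]
    refine comp_congr ?_
    have hne : constantCoeff (uFun F) ≠ 0 := by rw [h0]; exact Complex.slitPlane_ne_zero hb
    filter_upwards [isOpen_ne.mem_nhds hne] with x hx
    simp only [Pi.mul_apply, hf, hg]
    rw [mul_assoc c, ← Complex.cpow_add _ _ hx,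
      show (B.d - 3) / (1 - B.d) + (1 + B.d) / (1 - B.d) = ((-2 : ℤ) : ℂ) by
        push_cast; field_simp; ring, Complex.cpow_intCast]
    field_simp
  have h4 := h.wFun_mul_dphi
  rw [h.structure_function, smul_eq_C_mul] at h4
  have h5 := wFun_of_ne (F := F) hd
  rw [smul_eq_C_mul] at h5
  have h6 : comp (hZero B.d) (uFun F) * dphi B F * wFun B F ^ 3 =
      C (1 + B.d) * C (1 - B.d) ^ 2 * (comp (hZero B.d) (uFun F) * comp (phi B.d) (uFun F) *
        (uFun F * uFun F)) := by
    linear_combination (comp (hZero B.d) (uFun F) * wFun B F ^ 2) * h4 +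
      comp (hZero B.d) (uFun F) * C (1 + B.d) * comp (phi B.d) (uFun F) *
        (wFun B F + C (1 - B.d) * uFun F) * h5
  rw [h6, h3, ← map_pow, ← map_mul, ← map_mul, hcdef]
  congr 1
  have hd3 : 1 + B.d ≠ 0 := by rwa [add_comm]
  field_simp
  ring

end IsTwoPrimaryCone

end

section

variable {B : Background} {F : LPS}

/-! ### The residue pairing -/

section Res

variable {R : Type*} [CommRing R]

/-- The symplectic pairing `Res (g(-z), h(z))`, for sequences `g` and `h` that start in degrees
`≥ -1` and `≥ -3`. -/
def res (g : Seq R) : Seq R →ₗ[R] R where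
  toFun h := ∑ m ∈ Finset.range 4, ∑ a, (-1) ^ m * g a (m - 1) * h (1 - a) (-m)
  map_add' h k := by simp only [Pi.add_apply, mul_add, Finset.sum_add_distrib]
  map_smul' c h := by
    simp only [Pi.smul_apply, smul_eq_mul, RingHom.id_apply, Finset.mul_sum]
    exact Finset.sum_congr rfl fun _ _ => Finset.sum_congr rfl fun _ _ => by ring

theorem res_apply (g h : Seq R) : res g h =
    ∑ m ∈ Finset.range 4, ∑ a, (-1) ^ m * g a (m - 1) * h (1 - a) (-m) := rfl

theorem res_add (g g' h : Seq R) : res (g + g') h = res g h + res g' h := by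
  simp only [res_apply, Pi.add_apply, mul_add, add_mul, Finset.sum_add_distrib]

theorem res_smul (c : R) (g h : Seq R) : res (c • g) h = c * res g h := by
  simp only [res_apply, Pi.smul_apply, smul_eq_mul, Finset.mul_sum]
  exact Finset.sum_congr rfl fun _ _ => Finset.sum_congr rfl fun _ _ => by ring

/-- Moving z across Res(g(-z), h(z)) changes the sign; the degree bounds ensure that nothing leaves
the four terms of `res`. -/
theorem res_sh_one {g h : Seq R} (hg : ∀ a (m : ℤ), m < -1 → g a m = 0)
    (hh : ∀ a (m : ℤ), m < -3 → h a m = 0) : res (sh 1 g) h = -res g (sh 1 h) := by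
  have h1 := fun a => hg a (-1 - 1) (by norm_num)
  have h2 := fun a => hh a (-3 - 1) (by norm_num)
  simp only [res_apply, Finset.sum_range_succ, Finset.sum_range_zero, sh_apply, Fin.sum_univ_two]
  norm_num at h1 h2 ⊢
  simp only [h1, h2]
  ring

/-- For L₂ the bilinear form only uses degrees -1, -2, -3, and the signs in `low` are those of
g(-z). -/
theorem bil_three_eq_res [Algebra ℂ R] (G H : Fin 2 × ℕ → R) :
    bil B 3 G H = res (extend G) (ls B 3 (extend H)) := by
  have h1 := fun a => extend_natCast G a 0
  have h2 := fun a => extend_natCast G a 1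
  have h3 := fun a => extend_natCast G a 2
  have h4 := fun a => extend_of_neg G a (k := -1) (by norm_num)
  simp only [res_apply, bil, Finset.sum_range_succ, Finset.sum_range_zero, Fin.sum_univ_two, low]
  norm_num at h1 h2 h3 ⊢
  simp only [h1, h2, h3, h4]
  ring

end Res

/-- The values are instances of two-point relations: the recursion for r = -1, a combination of
recursions for r = -2, the symmetry of ⟪O_a O_b⟫ for r = 0. For r = 1 the entries in degree -1 leave
η, and for larger r nothing is left. -/
theorem IsCone.res_sq (h : IsCone B F) (a b : Fin 2) {r : ℤ} (hr : -2 ≤ r) :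
    res (sq F (a, 0)) (sh r (sq F (b, 0))) = if r = 1 ∧ b = 1 - a then 1 else 0 := by
  have ea : ∀ (c : Fin 2) (m : ℕ), sq F (a, 0) c m = om F (a, 0) (c, m) := fun c m => by
    rw [sq_natCast, om_comm]
  have eb : ∀ (c : Fin 2) (m : ℕ), sq F (b, 0) c m = om F (c, m) (b, 0) := fun c m =>
    sq_natCast F (b, 0) c m
  have ea0 := fun c => ea c 0
  have ea1 := fun c => ea c 1
  have ea2 := fun c => ea c 2
  have eb0 := fun c => eb c 0
  have eb1 := fun c => eb c 1
  have eb2 := fun c => eb c 2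
  have ea3 := fun c => sq_neg F (a, 0) c 0
  have eb3 := fun c => sq_neg F (b, 0) c 0
  have eb4 := fun c m => sq_eq_zero F (b, 0) c m
  have t0 := h.trr₂ a b 0 0
  have t1 := h.trr₂ a b 1 0
  have t2 := h.trr₂ a b 0 1
  simp only [zero_add, Fin.sum_univ_two, sub_zero, sub_self, one_add_one_eq_two] at t0 t1 t2
  simp only [Nat.cast_zero, Nat.cast_one, Nat.cast_ofNat, sub_zero, true_and,
    pow_zero] at ea0 ea1 ea2 eb0 eb1 eb2 ea3 eb3 eb4
  simp only [res_apply, Finset.sum_range_succ, Finset.sum_range_zero, sh_apply, Fin.sum_univ_two]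
  norm_num only [Nat.cast_zero, Nat.cast_one, Nat.cast_ofNat, pow_zero, pow_one, zero_add,
    sub_zero, sub_self, one_mul, zero_sub]
  rcases (show r = -2 ∨ r = -1 ∨ r = 0 ∨ r = 1 ∨ 2 ≤ r by omega) with rfl | rfl | rfl | rfl | h2
  · have t3 := fun e => h.trr₂ a e 0 0
    have t4 := fun e => h.trr₂ e b 0 0
    simp only [zero_add, Fin.sum_univ_two, sub_zero, sub_self] at t3 t4
    have k1 : sq F (a, 0) 0 (-1) * sq F (b, 0) 1 2 + sq F (a, 0) 1 (-1) * sq F (b, 0) 0 2 =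
        om F (a, 2) (b, 0) := by
      rw [ea3, ea3, eb2, eb2]
      fin_cases a <;> simp
    have k2 : sq F (a, 0) 0 2 * sq F (b, 0) 1 (-1) + sq F (a, 0) 1 2 * sq F (b, 0) 0 (-1) =
        om F (a, 0) (b, 2) := by
      rw [eb3, eb3, ea2, ea2]
      fin_cases b <;> simp
    norm_num only
    simp only [ea0, ea1, eb0, eb1]
    rw [if_neg (by norm_num)]
    linear_combination k1 - k2 + t1 - t2 + om F (1, 0) (b, 0) * t3 0 + om F (0, 0) (b, 0) * t3 1 -
      om F (a, 0) (0, 0) * t4 1 - om F (a, 0) (1, 0) * t4 0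
  · norm_num only [ea0, ea1, ea2, eb0, eb1, eb2, ea3, eb3]
    simp only [eb4 _ (-2) (by norm_num)]
    fin_cases a <;> fin_cases b <;> simp at t0 ⊢ <;> linear_combination t0
  · norm_num only [ea0, ea1, ea2, eb0, eb1, eb2, ea3, eb3]
    simp only [eb4 _ (-2) (by norm_num), eb4 _ (-3) (by norm_num)]
    fin_cases a <;> fin_cases b <;> simp
  · norm_num only [ea0, ea1, ea2, eb0, eb1, eb2, ea3, eb3]
    simp only [eb4 _ (-2) (by norm_num), eb4 _ (-3) (by norm_num), eb4 _ (-4) (by norm_num)]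
    fin_cases a <;> fin_cases b <;> simp
  · simp only [eb4 _ (-r) (by linarith), eb4 _ (-1 - r) (by linarith),
      eb4 _ (-2 - r) (by linarith), eb4 _ (-3 - r) (by linarith)]
    rw [if_neg (fun h => by omega)]
    simp

/-- The pairing with a tangent vector of the cone is a residue. -/
theorem contact_eq_res (c : Fin 2) (g : Seq LPS) :
    contact F 3 (c, 0) g = res (sq F (c, 0)) g := by
  have e0 := fun a => sq_natCast F (c, 0) a 0
  have e1 := fun a => sq_natCast F (c, 0) a 1
  have e2 := fun a => sq_natCast F (c, 0) a 2
  have e3 := fun a => sq_neg F (c, 0) a 0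
  norm_num at e0 e1 e2 e3
  simp only [res_apply, contact, Finset.sum_range_succ, Finset.sum_range_zero, Fin.sum_univ_two,
    low]
  norm_num
  simp only [e0, e1, e2, e3]
  fin_cases c <;> simp <;> ring

theorem contact_of_le {J J' : ℕ} (h : J ≤ J') (j : Fin 2 × ℕ) (g : Seq LPS)
    (hg : ∀ c (m : ℤ), m < -J → g c m = 0) : contact F J' j g = contact F J j g := by
  rw [contact, contact, add_right_inj]
  symm
  refine Finset.sum_subset (Finset.range_subset_range.mpr h) fun m _ hm => ?_
  refine Finset.sum_eq_zero fun c _ => ?_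
  have : J ≤ m := by simpa using hm
  rw [hg c _ (by omega), mul_zero]

/-- The commutator of ∂_{0,c} with the field comes from the dependence of the point of the cone on
t^c_0; for N ≤ 3 it is a residue. -/
theorem pderiv_vir {N : ℕ} (hN : N ≤ 3) (c : Fin 2) (H : LPS) :
    pderiv ℂ (c, 0) (vir B F N H) =
      vir B F N (pderiv ℂ (c, 0) H) + res (sq F (c, 0)) (ls B N (grad H)) := by
  have h1 : (fun a k => pderiv ℂ (c, 0) (grad H a k)) = grad (pderiv ℂ (c, 0) H) := by
    funext a k
    by_cases hk : 0 ≤ k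
    · simp [grad, extend, hk, pderiv_comm]
    · simp [grad, extend, hk]
  rw [vir, flow_apply, pderiv_pairing, derivation_ls, h1, add_comm, ← contact_eq_res,
    contact_of_le hN _ _ (fun a m hm => ls_eq_zero_of_lt B N (s := 0)
      (fun a m hm => grad_of_neg _ _ hm) a m (by omega))]
  rfl

end

section

variable {B : Background} {F : LPS}

/-! ### Formal functions in an extension field -/

section SeqMap

variable {R S : Type*} [CommRing R] [CommRing S] [Algebra ℂ R] [Algebra ℂ S] (f : R →ₐ[ℂ] S)

/-- The image of a sequence under a homomorphism. -/
def seqMap (g : Seq R) : Seq S := fun a k => f (g a k)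

theorem seqMap_apply (g : Seq R) (a : Fin 2) (k : ℤ) : seqMap f g a k = f (g a k) := rfl

theorem ls_seqMap (N : ℕ) (g : Seq R) : ls B N (seqMap f g) = seqMap f (ls B N g) := by
  funext a k
  simp only [ls_apply, seqMap, map_sum, map_smul]

theorem res_seqMap (g h : Seq R) : res (seqMap f g) (seqMap f h) = f (res g h) := by
  simp only [res_apply, seqMap, map_sum, map_mul, map_pow, map_neg, map_one]

theorem ls_one_sh (j : ℤ) (g : Seq R) :
    ls B 1 (sh j g) = sh j (ls B 1 g) + (j : ℂ) • sh j g := by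
  funext a k
  simp only [Pi.add_apply, Pi.smul_apply, sh_apply, ls_one_apply]
  have : ∀ l : ℤ, k - l - j = k - j - l := fun l => by ring
  simp only [this]
  push_cast
  module

theorem ls_three (g : Seq R) :
    ls B 3 g = ls B 1 (sh (-1) (ls B 1 (sh (-1) (ls B 1 g)))) := by
  rw [ls_succ, ls_succ]

/-- A derivation, applied to the entries of a sequence. -/
def seqDer (D : Derivation ℂ R R) : Seq R →+ Seq R where
  toFun g a k := D (g a k)
  map_zero' := by funext; simp
  map_add' g h := by funext; simp

theorem seqDer_apply (D : Derivation ℂ R R) (g : Seq R) (a : Fin 2) (k : ℤ) :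
    seqDer D g a k = D (g a k) := rfl

theorem seqDer_smul (D : Derivation ℂ R R) (c : R) (g : Seq R) :
    seqDer D (c • g) = D c • g + c • seqDer D g := by
  funext a k
  simp only [seqDer_apply, Pi.add_apply, Pi.smul_apply, smul_eq_mul, Derivation.leibniz]
  ring

theorem seqDer_sh (D : Derivation ℂ R R) (j : ℤ) (g : Seq R) :
    seqDer D (sh j g) = sh j (seqDer D g) := rfl

theorem ls_seqDer (D : Derivation ℂ R R) (N : ℕ) (g : Seq R) :
    seqDer D (ls B N g) = ls B N (seqDer D g) := derivation_ls B D N g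

end SeqMap

variable (K : Type*) [Field K] [Algebra ℂ K] [Algebra LPS K] [IsScalarTower ℂ LPS K]
  [Algebra.FormallyEtale LPS K]

/-- The inclusion of the ring of formal functions. -/
def emb : LPS →ₐ[ℂ] K := IsScalarTower.toAlgHom ℂ LPS K

variable {K}

/-- The partial derivatives on an extension field. -/
def delta (i : Fin 2 × ℕ) : Derivation ℂ K K := extendDerivation K (pderiv ℂ i)

theorem extendDerivation_emb (D : Derivation ℂ LPS LPS) (H : LPS) :
    extendDerivation K D (emb K H) = emb K (D H) := extendDerivation_algebraMap K D H

theorem delta_emb (i : Fin 2 × ℕ) (H : LPS) :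
    delta i (emb K H) = emb K (pderiv ℂ i H) := extendDerivation_emb _ _

theorem derivation_ext {D D' : Derivation ℂ K K} (h : ∀ H : LPS, D (emb K H) = D' (emb K H)) :
    D = D' := derivation_ext_of_formallyEtale LPS h

/-- The commutator is a derivation vanishing on formal functions, hence zero by uniqueness of
extensions. -/
theorem delta_comm (i j : Fin 2 × ℕ) (f : K) : delta i (delta j f) = delta j (delta i f) := by
  have h1 : ⁅delta (K := K) i, delta j⁆ = 0 := derivation_ext fun H => by
    rw [Derivation.commutator_apply, delta_emb, delta_emb, delta_emb, delta_emb, pderiv_comm,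
      sub_self, Derivation.coe_zero, Pi.zero_apply]
  have := congrArg (fun D => D f) h1
  simpa [Derivation.commutator_apply, sub_eq_zero] using this

/-- The gradient of an element of an extension field. -/
def gradK (f : K) : Seq K := extend fun i => delta i f

theorem gradK_emb (H : LPS) : gradK (emb K H) = seqMap (emb K) (grad H) := by
  funext a k
  by_cases hk : 0 ≤ k <;> simp [gradK, grad, seqMap, extend, hk, delta_emb]

theorem gradK_add (f g : K) : gradK (f + g) = gradK f + gradK g := by
  rw [gradK, gradK, gradK, ← extend_add]
  simp only [map_add]

theorem gradK_mul (f g : K) : gradK (f * g) = f • gradK g + g • gradK f := by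
  rw [gradK, gradK, gradK, ← extend_mul, ← extend_mul, ← extend_add]
  simp only [Derivation.leibniz, smul_eq_mul]

theorem gradK_algebraMap (c : ℂ) : gradK (algebraMap ℂ K c) = 0 := by
  funext a k
  by_cases hk : 0 ≤ k <;> simp [gradK, extend, hk]

theorem gradK_delta (j : Fin 2 × ℕ) (f : K) : gradK (delta j f) = seqDer (delta j) (gradK f) := by
  funext a k
  by_cases hk : 0 ≤ k <;> simp [gradK, extend, seqDer, hk, delta_comm j]

/-- The derivation obtained by applying a functional to the gradient. -/
def along (ℓ : Seq K →ₗ[K] K) : Derivation ℂ K K :=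
  Derivation.mk' ({
    toFun := fun f => ℓ (gradK f)
    map_add' := fun f g => by rw [gradK_add, map_add]
    map_smul' := fun c f => by
      rw [Algebra.smul_def, gradK_mul, gradK_algebraMap, smul_zero, add_zero, map_smul]
      simp [Algebra.smul_def] } : K →ₗ[ℂ] K)
    (fun f g => by
      change ℓ (gradK (f * g)) = f • ℓ (gradK g) + g • ℓ (gradK f)
      rw [gradK_mul, map_add, map_smul, map_smul])

variable (K B F) in
/-- The vector field of `L_{N-1}` on an extension field. -/
def virK (N : ℕ) : Derivation ℂ K K := extendDerivation K (vir B F N)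

theorem virK_emb (N : ℕ) (H : LPS) : virK B F K N (emb K H) = emb K (vir B F N H) :=
  extendDerivation_emb _ _

/-- Both the commutator and the residue of the gradient (`along`) are derivations, so `pderiv_vir`
extends from formal functions to the field. -/
theorem delta_virK {N : ℕ} (hN : N ≤ 3) (c : Fin 2) (f : K) :
    delta (c, 0) (virK B F K N f) = virK B F K N (delta (c, 0) f) +
      res (seqMap (emb K) (sq F (c, 0))) (ls B N (gradK f)) := by
  have h1 : ⁅delta (K := K) (c, 0), virK B F K N⁆ =
      along (res (seqMap (emb K) (sq F (c, 0))) ∘ₗ ls B N) := derivation_ext fun H => by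
    rw [Derivation.commutator_apply, virK_emb, delta_emb, delta_emb, virK_emb, pderiv_vir hN]
    change _ = res _ (ls B N (gradK _))
    rw [gradK_emb, ls_seqMap, res_seqMap, map_add, add_sub_cancel_left]
  have := congrArg (fun D => D f) h1
  rw [Derivation.commutator_apply, sub_eq_iff_eq_add'] at this
  exact this

/-! ### Canonical coordinates -/

variable (K B F) in
/-- The functions `w` and `v` and the frame of the tangent space, in an extension field. -/
def wK : K := emb K (wFun B F)

variable (K F) in
/-- The function `v` in an extension field. -/
def vK : K := emb K (vFun F)

variable (B F) in
/-- The square roots of `φ'(u)`. -/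
def IsRoot (κ : K) : Prop := κ ^ 2 = emb K (dphi B F)

theorem IsRoot.neg {κ : K} (h : IsRoot B F κ) : IsRoot B F (-κ) := by
  rw [IsRoot, neg_sq]; exact h

variable (B F) in
/-- Half the difference of the canonical coordinates. -/
def rho (κ : K) : K := κ * wK B F K

theorem rho_neg (κ : K) : rho B F (-κ) = -rho B F κ := neg_mul _ _

variable (B F) in
/-- The canonical coordinates. -/
def can (κ : K) : K := vK F K + rho B F κ

variable (F) in
/-- The eigenvectors of the multiplication by the Euler vector field. -/
def frame (κ : K) : Seq K := seqMap (emb K) (sq F (1, 0)) + κ • seqMap (emb K) (sq F (0, 0))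

variable [FaithfulSMul LPS K]

theorem emb_ne_zero {H : LPS} (hH : H ≠ 0) : emb K H ≠ 0 := by
  intro h0
  exact hH (FaithfulSMul.algebraMap_injective LPS K (h0.trans (map_zero (emb K)).symm))

namespace IsTwoPrimaryCone

theorem wK_ne_zero (h : IsTwoPrimaryCone B F) : wK B F K ≠ 0 := emb_ne_zero h.wFun_ne_zero

theorem root_ne_zero (h : IsTwoPrimaryCone B F) {κ : K} (hκ : IsRoot B F κ) : κ ≠ 0 := by
  rintro rfl
  apply emb_ne_zero (K := K) h.dphi_ne_zero
  rw [← hκ]; simp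

theorem rho_ne_zero (h : IsTwoPrimaryCone B F) {κ : K} (hκ : IsRoot B F κ) : rho B F κ ≠ 0 :=
  mul_ne_zero (h.root_ne_zero hκ) h.wK_ne_zero

/-- Implicit differentiation of κ² = φ'(u), combined with w φ'' = 2d φ'. -/
theorem extendDerivation_root (h : IsTwoPrimaryCone B F) {κ : K} (hκ : IsRoot B F κ)
    {D : Derivation ℂ LPS LPS} (hD : ∀ f G, D (comp f G) = comp (deriv f) G * D G) :
    wK B F K * extendDerivation K D κ = algebraMap ℂ K B.d * κ * emb K (D (uFun F)) := by
  have h1 := congrArg (extendDerivation K D) hκ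
  rw [extendDerivation_emb, dphi, hD, Derivation.leibniz_pow] at h1
  have h2 := congrArg (emb K) h.wFun_mul_comp_deriv_deriv
  rw [map_mul, map_smul, ← hκ, Algebra.smul_def, map_mul, map_ofNat] at h2
  rw [map_mul] at h1
  have h3 : (2 * κ) ≠ 0 := by
    have : CharZero K := charZero_of_injective_algebraMap (algebraMap ℂ K).injective
    exact mul_ne_zero two_ne_zero (h.root_ne_zero hκ)
  refine mul_left_cancel₀ h3 ?_
  rw [wK]
  simp only [smul_eq_mul, nsmul_eq_mul] at h1
  norm_num at h1
  linear_combination (emb K (wFun B F)) * h1 + emb K (D (uFun F)) * h2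

/-- The two terms of D(κw) are d κ Du and (1 - d) κ Du. -/
theorem extendDerivation_rho (h : IsTwoPrimaryCone B F) {κ : K} (hκ : IsRoot B F κ)
    {D : Derivation ℂ LPS LPS} (hD : ∀ f G, D (comp f G) = comp (deriv f) G * D G) :
    extendDerivation K D (rho B F κ) = κ * emb K (D (uFun F)) := by
  have h1 := h.extendDerivation_root hκ hD
  have h2 : D (wFun B F) = (1 - B.d) • D (uFun F) := by
    rw [wFun, map_add, Derivation.map_smul, MvPowerSeries.c_eq_algebraMap,
      Derivation.map_algebraMap, add_zero]
  rw [rho, Derivation.leibniz, smul_eq_mul, smul_eq_mul, h1, wK, extendDerivation_emb, h2,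
    map_smul, Algebra.smul_def, map_sub, map_one]
  ring

end IsTwoPrimaryCone

end

section

variable {B : Background} {F : LPS} {K : Type*} [Field K] [Algebra ℂ K] [Algebra LPS K]
  [IsScalarTower ℂ LPS K] [Algebra.FormallyEtale LPS K] [FaithfulSMul LPS K]

/-! ### The frame of canonical coordinates -/

theorem seqMap_add (g h : Seq LPS) : seqMap (emb K) (g + h) = seqMap (emb K) g +
    seqMap (emb K) h := by
  funext a k; simp [seqMap]

theorem seqMap_smul (c : LPS) (g : Seq LPS) :
    seqMap (emb K) (c • g) = emb K c • seqMap (emb K) g := by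
  funext a k; simp [seqMap]

theorem sh_seqMap (j : ℤ) (g : Seq LPS) : sh j (seqMap (emb K) g) = seqMap (emb K) (sh j g) := rfl

theorem seqDer_seqMap (i : Fin 2 × ℕ) (g : Seq LPS) :
    seqDer (delta i) (seqMap (emb K) g) = seqMap (emb K) (fun a k => pderiv ℂ i (g a k)) := by
  funext a k; simp [seqDer, seqMap, delta_emb]

theorem two_ne_zero_K : (2 : K) ≠ 0 := by
  have : CharZero K := charZero_of_injective_algebraMap (algebraMap ℂ K).injective
  exact two_ne_zero

namespace IsTwoPrimaryCone

theorem delta_rho (h : IsTwoPrimaryCone B F) {κ : K} (hκ : IsRoot B F κ) (i : Fin 2 × ℕ) :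
    delta i (rho B F κ) = κ * emb K (pderiv ℂ i (uFun F)) :=
  h.extendDerivation_rho hκ fun f G => pderiv_comp f G i

theorem rho_mul_delta (h : IsTwoPrimaryCone B F) {κ : K} (hκ : IsRoot B F κ) (i : Fin 2 × ℕ) :
    rho B F κ * delta i κ = algebraMap ℂ K B.d * κ * delta i (rho B F κ) := by
  rw [h.delta_rho hκ]
  have := h.extendDerivation_root hκ (D := pderiv ℂ i) fun f G => pderiv_comp f G i
  rw [rho, delta]
  linear_combination κ * this

theorem virK_rho (h : IsTwoPrimaryCone B F) {κ : K} (hκ : IsRoot B F κ) (N : ℕ) :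
    virK B F K N (rho B F κ) = κ * emb K (vir B F N (uFun F)) :=
  h.extendDerivation_rho hκ fun f G => vir_comp N f G

theorem rho_mul_virK (h : IsTwoPrimaryCone B F) {κ : K} (hκ : IsRoot B F κ) (N : ℕ) :
    rho B F κ * virK B F K N κ = algebraMap ℂ K B.d * κ * virK B F K N (rho B F κ) := by
  rw [h.virK_rho hκ]
  have := h.extendDerivation_root hκ (D := vir B F N) fun f G => vir_comp N f G
  rw [rho, virK]
  linear_combination κ * this

theorem delta_can (h : IsTwoPrimaryCone B F) {κ : K} (hκ : IsRoot B F κ) (i : Fin 2 × ℕ) :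
    delta i (can B F κ) = emb K (pderiv ℂ i (vFun F)) + κ * emb K (pderiv ℂ i (uFun F)) := by
  rw [can, map_add, vK, delta_emb, h.delta_rho hκ]

theorem pderiv_one_vFun (h : IsTwoPrimaryCone B F) :
    pderiv ℂ (1, 0) (vFun F) = dphi B F * pderiv ℂ (0, 0) (uFun F) := by
  rw [← h.pderiv_phi]
  change pderiv ℂ (1, 0) (om F (0, 0) (1, 0)) = _
  rw [pderiv_om_rotate]

/-- The canonical coordinates are Riemann invariants of the flow ∂_{0,1}, whose characteristic
speeds are the square roots of φ'(u). -/
theorem delta_one_can (h : IsTwoPrimaryCone B F) {κ : K} (hκ : IsRoot B F κ) :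
    delta (1, 0) (can B F κ) = κ * delta (0, 0) (can B F κ) := by
  rw [h.delta_can hκ, h.delta_can hκ, h.pderiv_one_vFun, pderiv_one_uFun, map_mul, ← hκ]
  ring

theorem grad_uFun (h : IsTwoPrimaryCone B F) : grad (uFun F) =
    pderiv ℂ (0, 0) (vFun F) • sh 1 (sq F (0, 0)) +
      pderiv ℂ (0, 0) (uFun F) • sh 1 (sq F (1, 0)) := by
  have := h.grad_om (0, 0) (0, 0)
  rw [Fin.sum_univ_two, sub_zero, sub_self] at this
  rw [← pderiv_one_uFun]
  exact this

theorem grad_vFun (h : IsTwoPrimaryCone B F) : grad (vFun F) =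
    (dphi B F * pderiv ℂ (0, 0) (uFun F)) • sh 1 (sq F (0, 0)) +
      pderiv ℂ (0, 0) (vFun F) • sh 1 (sq F (1, 0)) := by
  have := h.grad_om (0, 0) (1, 0)
  rw [Fin.sum_univ_two, sub_zero, sub_self] at this
  rw [← h.pderiv_one_vFun]
  exact this

theorem gradK_rho (h : IsTwoPrimaryCone B F) {κ : K} (hκ : IsRoot B F κ) :
    gradK (rho B F κ) = κ • seqMap (emb K) (grad (uFun F)) := by
  funext a k
  rw [Pi.smul_apply, Pi.smul_apply, seqMap, gradK, grad]
  by_cases hk : 0 ≤ k <;> simp [extend, hk, h.delta_rho hκ]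

theorem gradK_can (h : IsTwoPrimaryCone B F) {κ : K} (hκ : IsRoot B F κ) :
    gradK (can B F κ) = delta (0, 0) (can B F κ) • sh 1 (frame F κ) := by
  have hκ' : emb K (dphi B F) = κ ^ 2 := Eq.symm hκ
  rw [can, gradK_add, vK, gradK_emb, h.gradK_rho hκ, h.grad_uFun, h.grad_vFun, ← vK, ← can,
    h.delta_can hκ, frame]
  simp only [seqMap_add, seqMap_smul, sh_seqMap, map_add, map_smul, map_mul, hκ']
  module

/-- Multiplication by the Euler field has diagonal entries v and off-diagonal entries w and κ²w, so
(κ, 1) gives an eigenvector with eigenvalue v + κw. The grading μ exchanges the two eigenvectors up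
to the factor d/2. -/
theorem ls_one_frame (h : IsTwoPrimaryCone B F) {κ : K} (hκ : IsRoot B F κ) :
    ls B 1 (frame F κ) = (-1 / 2 : K) • frame F κ -
      (algebraMap ℂ K B.d / 2) • frame F (-κ) + can B F κ • sh 1 (frame F κ) := by
  have e1 := h.ls_one_sq 1
  have e0 := h.ls_one_sq 0
  rw [Fin.sum_univ_two, eulerMul_one_zero, eulerMul_one_one, ← h.wFun_mul_dphi] at e1
  rw [Fin.sum_univ_two, eulerMul_zero_zero, eulerMul_zero_one] at e0
  have hs : ∀ (c : ℂ) (g : Seq LPS),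
      seqMap (emb K) (c • g) = algebraMap ℂ K c • seqMap (emb K) g := by
    intro c g; funext a k; simp [seqMap, Algebra.smul_def]
  rw [frame, map_add, map_smul, ls_seqMap, ls_seqMap, e1, e0]
  have hκ' : emb K (dphi B F) = κ ^ 2 := Eq.symm hκ
  have e2 : algebraMap ℂ K 2 = 2 := map_ofNat _ 2
  have m0 : algebraMap ℂ K (-(mu B.d 0 + 1 / 2)) = (algebraMap ℂ K B.d - 1) / 2 := by
    simp [mu, e2]; ring
  have m1 : algebraMap ℂ K (-(mu B.d 1 + 1 / 2)) = (-algebraMap ℂ K B.d - 1) / 2 := by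
    simp [mu, e2]; ring
  simp only [seqMap_add, seqMap_smul, ← sh_seqMap, hs, m0, m1, frame, map_add, map_smul, map_mul,
    hκ', can, rho, vK, wK]
  match_scalars <;> field_simp [two_ne_zero_K] <;> ring

/-- The quantum differential equation is diagonal in the eigenbasis. The second term is the
derivative of the coefficient κ, because 2κ `sq F (0, 0)` is the difference of the two eigenvectors.
-/
theorem seqDer_frame (h : IsTwoPrimaryCone B F) {κ : K} (hκ : IsRoot B F κ) (i : Fin 2 × ℕ) :
    seqDer (delta i) (frame F κ) = delta i (can B F κ) • sh 1 (frame F κ) +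
      (delta i κ / (2 * κ)) • (frame F κ - frame F (-κ)) := by
  have hκ' : emb K (dphi B F) = κ ^ 2 := Eq.symm hκ
  have e1 := h.pderiv_sq_zero 1 i
  have e0 := h.pderiv_sq_zero 0 i
  rw [Fin.sum_univ_two, sub_zero, sub_self, h.pderiv_phi, om_comm] at e1
  rw [Fin.sum_univ_two, sub_zero, sub_self] at e0
  have h0 : delta i κ / (2 * κ) * (2 * κ) = delta i κ :=
    div_mul_cancel₀ _ (mul_ne_zero two_ne_zero_K (h.root_ne_zero hκ))
  have h1 : (delta i κ / (2 * κ)) • (frame F κ - frame F (-κ)) =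
      delta i κ • seqMap (emb K) (sq F (0, 0)) := by
    have : ∀ c : K, c • (frame F κ - frame F (-κ)) =
        (c * (2 * κ)) • seqMap (emb K) (sq F (0, 0)) := by
      intro c
      rw [frame, frame]
      module
    rw [this, h0]
  rw [h1, h.delta_can hκ]
  simp only [frame, map_add, seqDer_smul, seqDer_seqMap, e1, e0, seqMap_add, seqMap_smul,
    map_smul, map_mul, hκ', sh_seqMap]
  change _ • _ + emb K (pderiv ℂ i (vFun F)) • _ + (_ + κ • (emb K (pderiv ℂ i (vFun F)) • _ +
    emb K (pderiv ℂ i (uFun F)) • _)) = _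
  module

/-- The value κ + κ' shows that the eigenvectors for κ and -κ are orthogonal. -/
theorem res_frame (h : IsTwoPrimaryCone B F) (κ κ' : K) {r : ℤ} (hr : -2 ≤ r) :
    res (frame F κ) (sh r (frame F κ')) = if r = 1 then κ + κ' else 0 := by
  have e := fun a b => h.res_sq a b hr
  rw [frame, frame, res_add, res_smul, map_add, map_add, map_add, map_smul, map_smul, map_smul]
  have e00 := e 0 0
  have e01 := e 0 1
  have e10 := e 1 0
  have e11 := e 1 1
  simp only [sub_zero, sub_self, zero_ne_one, one_ne_zero, and_false, and_true,
    if_false] at e00 e01 e10 e11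
  simp only [sh_seqMap, res_seqMap, e00, e01, e10, e11, apply_ite (emb K), map_one, map_zero]
  split_ifs with h1
  · simp; ring
  · simp

theorem frame_eq_zero (κ : K) (a : Fin 2) (m : ℤ) (hm : m < -1) : frame F κ a m = 0 := by
  simp [frame, seqMap, sq_eq_zero F (0, 0) a m (by simpa using hm),
    sq_eq_zero F (1, 0) a m (by simpa using hm)]

theorem res_sh_frame (h : IsTwoPrimaryCone B F) (κ κ' : K) (i : ℕ) (hi : i ≤ 2) {r : ℤ}
    (hr : -2 ≤ r) : res (sh i (frame F κ)) (sh r (frame F κ')) =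
      if r + i = 1 then (-1) ^ i * (κ + κ') else 0 := by
  have h0 : ∀ a (m : ℤ), m < -3 → sh r (frame F κ') a m = 0 := fun a m hm =>
    frame_eq_zero _ _ _ (by linarith)
  have h1 : ∀ a (m : ℤ), m < -3 → sh 1 (sh r (frame F κ')) a m = 0 := fun a m hm =>
    frame_eq_zero _ _ _ (by linarith)
  have h2 : ∀ a (m : ℤ), m < -1 → sh 1 (frame F κ) a m = 0 := fun a m hm =>
    frame_eq_zero _ _ _ (by linarith)
  interval_cases i
  · simpa using h.res_frame κ κ' hr
  · rw [Nat.cast_one, res_sh_one (frame_eq_zero κ) h0, sh_sh, h.res_frame κ κ' (by linarith),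
      add_comm]
    split_ifs <;> simp
  · rw [Nat.cast_ofNat, show (2 : ℤ) = 1 + 1 by norm_num, ← sh_sh, res_sh_one h2 h0,
      res_sh_one (frame_eq_zero κ) h1, sh_sh, sh_sh, h.res_frame κ κ' (by linarith)]
    rw [show 1 + 1 + r = r + (1 + 1) by ring]
    split_ifs <;> simp

end IsTwoPrimaryCone

end

section

variable {B : Background} {F : LPS} {K : Type*} [Field K] [Algebra ℂ K] [Algebra LPS K]
  [IsScalarTower ℂ LPS K] [Algebra.FormallyEtale LPS K] [FaithfulSMul LPS K]

/-! ### The vector field of `L₂` in canonical coordinates -/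

variable (K) in
theorem charZero : CharZero K := charZero_of_injective_algebraMap (algebraMap ℂ K).injective

namespace IsTwoPrimaryCone

theorem ls_one_sh_frame (h : IsTwoPrimaryCone B F) {κ : K} (hκ : IsRoot B F κ) (j : ℤ) :
    ls B 1 (sh j (frame F κ)) = ((j : K) - 1 / 2) • sh j (frame F κ) -
      (algebraMap ℂ K B.d / 2) • sh j (frame F (-κ)) + can B F κ • sh (j + 1) (frame F κ) := by
  have e : ((j : ℂ) • sh j (frame F κ)) = (j : K) • sh j (frame F κ) := by
    funext a k
    simp [Algebra.smul_def]
  rw [ls_one_sh, e, h.ls_one_frame hκ, map_add, map_sub, map_smul, map_smul, map_smul, sh_sh]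
  module

theorem ls_one_sh_frame_neg (h : IsTwoPrimaryCone B F) {κ : K} (hκ : IsRoot B F κ) (j : ℤ) :
    ls B 1 (sh j (frame F (-κ))) = ((j : K) - 1 / 2) • sh j (frame F (-κ)) -
      (algebraMap ℂ K B.d / 2) • sh j (frame F κ) +
        can B F (-κ) • sh (j + 1) (frame F (-κ)) := by
  have := h.ls_one_sh_frame hκ.neg j
  rwa [neg_neg] at this

/-- The operator `ls B 3` on the shifted frame. -/
theorem ls_three_sh_frame (h : IsTwoPrimaryCone B F) {κ : K} (hκ : IsRoot B F κ) (j : ℤ) :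
    ls B 3 (sh j (frame F κ)) = can B F κ ^ 3 • sh (j + 1) (frame F κ) +
      ((3 * j - 3 / 2) * can B F κ ^ 2) • sh j (frame F κ) -
      (algebraMap ℂ K B.d / 2 * (can B F κ ^ 2 + can B F κ * can B F (-κ) + can B F (-κ) ^ 2)) •
        sh j (frame F (-κ)) +
      (((3 * j ^ 2 - 6 * j + 9 / 4 + algebraMap ℂ K B.d ^ 2 / 2) * can B F κ +
        algebraMap ℂ K B.d ^ 2 / 4 * can B F (-κ)) • sh (j - 1) (frame F κ)) -
      (algebraMap ℂ K B.d / 4 * ((6 * j - 5) * can B F κ + (6 * j - 7) * can B F (-κ))) •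
        sh (j - 1) (frame F (-κ)) +
      (((j - 1 / 2) * (j - 3 / 2) * (j - 5 / 2) +
        3 * algebraMap ℂ K B.d ^ 2 / 4 * (j - 3 / 2))) • sh (j - 2) (frame F κ) -
      (algebraMap ℂ K B.d / 2 * (3 * j ^ 2 - 9 * j + 23 / 4 + algebraMap ℂ K B.d ^ 2 / 4)) •
        sh (j - 2) (frame F (-κ)) := by
  have := charZero K
  simp only [ls_three, map_add, map_sub, map_smul, h.ls_one_sh_frame hκ, h.ls_one_sh_frame_neg hκ,
    sh_sh]
  have a1 : -1 + (j + 1) = j := by ring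
  have a2 : -1 + j = j - 1 := by ring
  have a3 : j - 1 + 1 = j := by ring
  have a4 : -1 + (j - 1) = j - 2 := by ring
  have a5 : j - 2 + 1 = j - 1 := by ring
  simp only [a1, a2, a3, a4, a5]
  push_cast
  match_scalars <;> ring

theorem res_zero_sh_frame (h : IsTwoPrimaryCone B F) (κ : K) {r : ℤ} (hr : -2 ≤ r) :
    res (seqMap (emb K) (sq F (0, 0))) (sh r (frame F κ)) = if r = 1 then 1 else 0 := by
  have e00 := h.res_sq 0 0 hr
  have e01 := h.res_sq 0 1 hr
  simp only [sub_zero, zero_ne_one, and_false, and_true, if_false] at e00 e01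
  rw [frame, map_add, map_add, map_smul, map_smul, sh_seqMap, sh_seqMap, res_seqMap, res_seqMap,
    e00, e01]
  split_ifs <;> simp

/-- Pairing with `sq F (0, 0)` retains exactly the terms shifted by 1 in `ls_three_sh_frame`, so for
j ≥ 0 only j = 0, 1, 2, 3 contribute. -/
theorem res_zero_ls_three (h : IsTwoPrimaryCone B F) {κ : K} (hκ : IsRoot B F κ) {j : ℤ}
    (hj : 0 ≤ j) : res (seqMap (emb K) (sq F (0, 0))) (ls B 3 (sh j (frame F κ))) =
      (if j = 0 then can B F κ ^ 3 else 0) + (if j = 1 then 3 / 2 * can B F κ ^ 2 -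
        algebraMap ℂ K B.d / 2 *
          (can B F κ ^ 2 + can B F κ * can B F (-κ) + can B F (-κ) ^ 2) else 0) +
      (if j = 2 then (9 - 7 * algebraMap ℂ K B.d + 2 * algebraMap ℂ K B.d ^ 2) / 4 * can B F κ -
        algebraMap ℂ K B.d * (5 - algebraMap ℂ K B.d) / 4 * can B F (-κ) else 0) +
      (if j = 3 then (1 - algebraMap ℂ K B.d) * (3 - algebraMap ℂ K B.d) *
        (5 - algebraMap ℂ K B.d) / 8 else 0) := by
  have := charZero K
  have e : ∀ (κ₂ : K) (r : ℤ), -2 ≤ r → _ := fun κ₂ r hr => h.res_zero_sh_frame κ₂ hr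
  rw [h.ls_three_sh_frame hκ]
  simp only [map_add, map_sub, map_smul, e _ (j + 1) (by linarith), e _ j (by linarith),
    e _ (j - 1) (by linarith), e _ (j - 2) (by linarith), smul_eq_mul]
  rcases lt_or_ge j 4 with h4 | h4
  · interval_cases j <;> norm_num <;> ring
  · simp only [show j + 1 ≠ 1 by omega, show j ≠ 0 by omega, show j ≠ 1 by omega,
      show j ≠ 2 by omega, show j ≠ 3 by omega, show j - 1 ≠ 1 by omega, show j - 2 ≠ 1 by omega,
      if_false]
    ring

/-- The vector fields on the canonical coordinates. -/
theorem virK_can (h : IsTwoPrimaryCone B F) {κ : K} (hκ : IsRoot B F κ) {N : ℕ} (hN : N ≤ 3) :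
    virK B F K N (can B F κ) =
      -res (frame F κ) (ls B N (seqMap (emb K) (sq F (0, 0)))) := by
  have e : ∀ c : Fin 2, vir B F N (om F (0, 0) (c, 0)) =
      -res (sq F (c, 0)) (ls B N (sq F (0, 0))) := fun c => by
    have t := Tangent.vir_om B (J := 3) (h.tangent N) (0, 0) (c, 0) (by simpa using hN)
    rw [contact_eq_res] at t
    exact t
  have e1 : vir B F N (vFun F) = _ := e 1
  have e0 : vir B F N (uFun F) = _ := e 0
  rw [can, map_add, vK, virK_emb, h.virK_rho hκ, e1, e0, ls_seqMap, frame, res_add, res_smul,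
    res_seqMap, res_seqMap, map_neg, map_neg]
  ring

/-- In `virK_can` the sequence `sq F (0, 0)` is the difference of the eigenvectors divided by 2κ. By
orthogonality only the leading term, the cube of the eigenvalue, survives. -/
theorem virK_three_can (h : IsTwoPrimaryCone B F) {κ : K} (hκ : IsRoot B F κ) :
    virK B F K 3 (can B F κ) = -can B F κ ^ 3 := by
  have := charZero K
  have hs : (2 * κ) • seqMap (emb K) (sq F (0, 0)) = frame F κ - frame F (-κ) := by
    rw [frame, frame]; module
  have e : ∀ (κ₂ : K) (r : ℤ), -2 ≤ r → _ := fun κ₂ r hr => h.res_frame κ κ₂ hr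
  have e0 : ∀ κ₂ : K, res (frame F κ) (frame F κ₂) = 0 := fun κ₂ => by
    rw [← sh_zero (frame F κ₂), e κ₂ 0 (by norm_num), if_neg (by norm_num)]
  have e1 := h.ls_three_sh_frame hκ 0
  have e2 := h.ls_three_sh_frame hκ.neg 0
  rw [neg_neg] at e2
  simp only [sh_zero] at e1 e2
  have h0 : (2 * κ) ≠ 0 := mul_ne_zero two_ne_zero (h.root_ne_zero hκ)
  refine mul_left_cancel₀ h0 ?_
  rw [h.virK_can hκ le_rfl, mul_neg, ← smul_eq_mul, ← map_smul, ← map_smul, hs, map_sub,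
    e1, e2]
  simp only [map_add, map_sub, map_smul, e _ (0 + 1) (by norm_num), e0,
    e _ (0 - 1) (by norm_num), e _ (0 - 2) (by norm_num), smul_eq_mul]
  norm_num
  ring

theorem virK_zero_can (h : IsTwoPrimaryCone B F) {κ : K} (hκ : IsRoot B F κ) :
    virK B F K 0 (can B F κ) = -1 := by
  have := charZero K
  have hs : (2 * κ) • seqMap (emb K) (sq F (0, 0)) = frame F κ - frame F (-κ) := by
    rw [frame, frame]; module
  have h0 : (2 * κ) ≠ 0 := mul_ne_zero two_ne_zero (h.root_ne_zero hκ)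
  refine mul_left_cancel₀ h0 ?_
  rw [h.virK_can hκ (by norm_num), mul_neg, ← smul_eq_mul, ← map_smul, ← map_smul, hs, map_sub,
    ls_zero, ls_zero, map_sub, h.res_frame _ _ (by norm_num), h.res_frame _ _ (by norm_num)]
  norm_num
  ring

/-- The coefficients are differentiated and the connection `seqDer_frame` is added: p and q raise
the shift by one, g rotates the frame. This is the recursion for gradients of jets. -/
theorem gradK_delta_of (h : IsTwoPrimaryCone B F) {κ : K} (hκ : IsRoot B F κ) {f : K}
    {a₁ b₁ a₂ b₂ a₃ b₃ : K}
    (hf : gradK f = a₁ • sh 1 (frame F κ) + b₁ • sh 1 (frame F (-κ)) + a₂ • sh 2 (frame F κ) +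
      b₂ • sh 2 (frame F (-κ)) + a₃ • sh 3 (frame F κ) + b₃ • sh 3 (frame F (-κ)))
    {g p q : K} (hg : delta (0, 0) κ / (2 * κ) = g) (hp : delta (0, 0) (can B F κ) = p)
    (hq : delta (0, 0) (can B F (-κ)) = q) :
    gradK (delta (0, 0) f) = (delta (0, 0) a₁ + g * (a₁ - b₁)) • sh 1 (frame F κ) +
      (delta (0, 0) b₁ + g * (b₁ - a₁)) • sh 1 (frame F (-κ)) +
      (delta (0, 0) a₂ + p * a₁ + g * (a₂ - b₂)) • sh 2 (frame F κ) +
      (delta (0, 0) b₂ + q * b₁ + g * (b₂ - a₂)) • sh 2 (frame F (-κ)) +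
      (delta (0, 0) a₃ + p * a₂ + g * (a₃ - b₃)) • sh 3 (frame F κ) +
      (delta (0, 0) b₃ + q * b₂ + g * (b₃ - a₃)) • sh 3 (frame F (-κ)) +
      (p * a₃) • sh 4 (frame F κ) + (q * b₃) • sh 4 (frame F (-κ)) := by
  have h1 := h.seqDer_frame hκ (0, 0)
  have h2 := h.seqDer_frame hκ.neg (0, 0)
  rw [neg_neg, map_neg, mul_neg, neg_div_neg_eq] at h2
  rw [hg, hp] at h1
  rw [hg, hq] at h2
  rw [gradK_delta, hf]
  simp only [map_add, seqDer_smul, seqDer_sh, h1, h2, map_smul, map_sub, sh_sh]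
  norm_num only
  module

/-- The commutator term of `delta_virK`, evaluated by `res_zero_ls_three`; shifts by 4 are beyond
its reach. -/
theorem virK_delta_of (h : IsTwoPrimaryCone B F) {κ : K} (hκ : IsRoot B F κ) {f : K}
    {a₁ b₁ a₂ b₂ a₃ b₃ a₄ b₄ : K}
    (hf : gradK f = a₁ • sh 1 (frame F κ) + b₁ • sh 1 (frame F (-κ)) + a₂ • sh 2 (frame F κ) +
      b₂ • sh 2 (frame F (-κ)) + a₃ • sh 3 (frame F κ) + b₃ • sh 3 (frame F (-κ)) +
      a₄ • sh 4 (frame F κ) + b₄ • sh 4 (frame F (-κ)))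
    {d x y : K} (hd : algebraMap ℂ K B.d = d) (hx : can B F κ = x) (hy : can B F (-κ) = y) :
    virK B F K 3 (delta (0, 0) f) = delta (0, 0) (virK B F K 3 f) -
      (a₁ * (3 / 2 * x ^ 2 - d / 2 * (x ^ 2 + x * y + y ^ 2)) +
       b₁ * (3 / 2 * y ^ 2 - d / 2 * (x ^ 2 + x * y + y ^ 2)) +
       a₂ * ((9 - 7 * d + 2 * d ^ 2) / 4 * x - d * (5 - d) / 4 * y) +
       b₂ * ((9 - 7 * d + 2 * d ^ 2) / 4 * y - d * (5 - d) / 4 * x) +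
       (a₃ + b₃) * ((1 - d) * (3 - d) * (5 - d) / 8)) := by
  have h1 : ∀ j : ℤ, 0 ≤ j → _ := fun j hj => h.res_zero_ls_three hκ hj
  have h2 : ∀ j : ℤ, 0 ≤ j → _ := fun j hj => h.res_zero_ls_three hκ.neg hj
  rw [neg_neg] at h2
  rw [delta_virK le_rfl, hf]
  simp only [map_add, map_smul, h1 1 (by norm_num), h1 2 (by norm_num), h1 3 (by norm_num),
    h1 4 (by norm_num), h2 1 (by norm_num), h2 2 (by norm_num), h2 3 (by norm_num),
    h2 4 (by norm_num), hd, hx, hy, smul_eq_mul]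
  norm_num only [if_true, if_false]
  ring

/-- For L₋₁ the transformation is one more shift, which moves the gradient out of reach of the
residue; the string field thus commutes with ∂ here. -/
theorem virK_zero_delta_of (h : IsTwoPrimaryCone B F) {κ : K} {f : K}
    {a₁ b₁ a₂ b₂ a₃ b₃ a₄ b₄ : K}
    (hf : gradK f = a₁ • sh 1 (frame F κ) + b₁ • sh 1 (frame F (-κ)) + a₂ • sh 2 (frame F κ) +
      b₂ • sh 2 (frame F (-κ)) + a₃ • sh 3 (frame F κ) + b₃ • sh 3 (frame F (-κ)) +
      a₄ • sh 4 (frame F κ) + b₄ • sh 4 (frame F (-κ))) :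
    virK B F K 0 (delta (0, 0) f) = delta (0, 0) (virK B F K 0 f) := by
  rw [delta_virK (by norm_num), hf, ls_zero]
  simp only [map_add, map_smul, sh_sh, h.res_zero_sh_frame _ (show (-2 : ℤ) ≤ 1 + 1 by norm_num),
    h.res_zero_sh_frame _ (show (-2 : ℤ) ≤ 1 + 2 by norm_num),
    h.res_zero_sh_frame _ (show (-2 : ℤ) ≤ 1 + 3 by norm_num),
    h.res_zero_sh_frame _ (show (-2 : ℤ) ≤ 1 + 4 by norm_num)]
  norm_num

variable (B) in
/-- The second order part of `L₂` as a bilinear form in the gradients. -/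
def _root_.TwoPrimary.bilK (f g : K) : K := res (gradK f) (ls B 3 (gradK g))

theorem bilK_of (h : IsTwoPrimaryCone B F) {κ : K} (hκ : IsRoot B F κ) {f f' : K}
    {a₁ b₁ a₂ b₂ a₁' b₁' a₂' b₂' : K}
    (hf : gradK f = a₁ • sh 1 (frame F κ) + b₁ • sh 1 (frame F (-κ)) + a₂ • sh 2 (frame F κ) +
      b₂ • sh 2 (frame F (-κ)))
    (hf' : gradK f' = a₁' • sh 1 (frame F κ) + b₁' • sh 1 (frame F (-κ)) +
      a₂' • sh 2 (frame F κ) + b₂' • sh 2 (frame F (-κ)))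
    {d x y : K} (hd : algebraMap ℂ K B.d = d) (hx : can B F κ = x) (hy : can B F (-κ) = y) :
    bilK B f f' = 2 * κ * (
      a₁ * a₁' * (x / 2 - (d ^ 2 - 1) / 4 * x - d ^ 2 / 4 * (x + y)) -
      b₁ * b₁' * (y / 2 - (d ^ 2 - 1) / 4 * y - d ^ 2 / 4 * (x + y)) -
      (a₁ * b₁' + b₁ * a₁') * (d / 4 * (x - y)) -
      3 / 8 * (d ^ 2 - 1) * (a₁ * a₂' + a₂ * a₁' - b₁ * b₂' - b₂ * b₁') +
      d / 8 * (d ^ 2 - 1) * (a₁ * b₂' + b₂ * a₁' - b₁ * a₂' - a₂ * b₁')) := by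
  have := charZero K
  have e : ∀ (κ₁ κ₂ : K) (r : ℤ), -2 ≤ r → _ := fun κ₁ κ₂ r hr =>
    h.res_sh_frame κ₁ κ₂ 1 (by norm_num) hr
  have e' : ∀ (κ₁ κ₂ : K) (r : ℤ), -2 ≤ r → _ := fun κ₁ κ₂ r hr =>
    h.res_sh_frame κ₁ κ₂ 2 (by norm_num) hr
  have e0 : ∀ κ₁ κ₂ : K, res (sh 1 (frame F κ₁)) (frame F κ₂) = -(κ₁ + κ₂) := fun κ₁ κ₂ => by
    have := e κ₁ κ₂ 0 (by norm_num)
    simpa using this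
  have e0' : ∀ κ₁ κ₂ : K, res (sh 2 (frame F κ₁)) (frame F κ₂) = 0 := fun κ₁ κ₂ => by
    have := e' κ₁ κ₂ 0 (by norm_num)
    simpa using this
  rw [bilK, hf, hf']
  have h1 : ∀ j : ℤ, _ := fun j => h.ls_three_sh_frame hκ j
  have h2 : ∀ j : ℤ, _ := fun j => h.ls_three_sh_frame hκ.neg j
  simp only [Nat.cast_one, Nat.cast_ofNat] at e e'
  simp only [neg_neg] at h2
  simp only [map_add, map_smul, h1, h2, hd, hx, hy]
  simp only [res_add, res_smul, map_add, map_sub, map_smul, smul_eq_mul]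
  norm_num [e, e', e0, e0']
  ring

end IsTwoPrimaryCone

end

section

/-! ### The second order part of the operators -/

section Quad

variable (B : Background) {R : Type*} [CommRing R] [Algebra ℂ R]

/-- The second order part of `L_{N-1}`, applied to a matrix of second derivatives. -/
def quad (N : ℕ) : (Fin 2 × ℕ → Fin 2 × ℕ → R) →ₗ[R] R where
  toFun G := (1 / 2 : ℂ) • ∑ j ∈ Finset.range N, ∑ c,
    (-1 : ℂ) ^ (j + 1) • ls B N (extend (G (1 - c, j))) c (-1 - j)
  map_add' G H := by
    rw [← smul_add, ← Finset.sum_add_distrib]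
    simp only [← Finset.sum_add_distrib, ← smul_add, ← Pi.add_apply, ← map_add, ← extend_add]
  map_smul' c G := by
    simp only [RingHom.id_apply, smul_comm c, Finset.smul_sum]
    refine Finset.sum_congr rfl fun j _ => Finset.sum_congr rfl fun e _ => ?_
    change _ • _ • ls B N (extend fun i => c * G (1 - e, j) i) e _ = _
    rw [extend_mul, map_smul, Pi.smul_apply, Pi.smul_apply, smul_comm _ c, smul_comm _ c]

theorem quad_apply (N : ℕ) (G : Fin 2 × ℕ → Fin 2 × ℕ → R) :
    quad B N G = (1 / 2 : ℂ) • ∑ j ∈ Finset.range N, ∑ c,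
      (-1 : ℂ) ^ (j + 1) • ls B N (extend (G (1 - c, j))) c (-1 - j) := rfl

theorem quad_mul (N : ℕ) (G H : Fin 2 × ℕ → R) :
    quad B N (fun i j => G i * H j) = (1 / 2 : ℂ) • bil B N G H := by
  rw [quad_apply, bil]
  congr 1
  refine Finset.sum_congr rfl fun j _ => Finset.sum_congr rfl fun c _ => ?_
  rw [extend_mul, map_smul, low, Pi.smul_apply, Pi.smul_apply, smul_eq_mul, smul_mul_assoc]

theorem virPair_eq_quad (N : ℕ) (G : Fin 2 × ℕ → Fin 2 × ℕ → LPS) :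
    virPair B N G = quad B N G := virPair_eq B N G

theorem seqMap_extend {S : Type*} [CommRing S] [Algebra ℂ S] (f : R →ₐ[ℂ] S)
    (G : Fin 2 × ℕ → R) : seqMap f (extend G) = extend fun i => f (G i) := by
  funext a k
  by_cases hk : 0 ≤ k <;> simp [seqMap, extend, hk]

theorem map_quad {S : Type*} [CommRing S] [Algebra ℂ S] (f : R →ₐ[ℂ] S) (N : ℕ)
    (G : Fin 2 × ℕ → Fin 2 × ℕ → R) : f (quad B N G) = quad B N fun i j => f (G i j) := by
  simp only [quad_apply, map_smul, map_sum, ← seqMap_extend, ls_seqMap, seqMap_apply]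

theorem derivation_quad (D : Derivation ℂ R R) (N : ℕ) (G : Fin 2 × ℕ → Fin 2 × ℕ → R) :
    D (quad B N G) = quad B N fun i j => D (G i j) := by
  have e : ∀ G : Fin 2 × ℕ → R, (extend fun i => D (G i)) = seqDer D (extend G) := fun G => by
    funext a k
    by_cases hk : 0 ≤ k <;> simp [seqDer, extend, hk]
  simp only [quad_apply, Derivation.map_smul, map_sum, e, ← ls_seqDer, seqDer_apply]

end Quad

/-! ### The second order part of `L₂` on the genus zero potential -/

section

variable {B : Background} {F : LPS}

theorem virCoeff_zero_right (N : ℕ) (k : ℤ) (a b : Fin 2) :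
    virCoeff B N k 0 a b = if a = b then elem N 0 (mu B.d a + k + 1 / 2) else 0 := by
  rw [virCoeff, Finset.sum_eq_single 0]
  · simp [Matrix.one_apply]
  · intro i _ hi
    obtain ⟨i, rfl⟩ := Nat.exists_eq_succ_of_ne_zero hi
    rw [pow_succ, Polynomial.mul_coeff_zero, B.R_zero]
    simp
  · simp

theorem virCoeff_one_right {N : ℕ} (hN : 1 ≤ N) (k : ℤ) (a b : Fin 2) :
    virCoeff B N k 1 a b = elem N 1 (mu B.d a + k + 1 / 2) * B.R.coeff 1 a b := by
  rw [virCoeff, Finset.sum_eq_single 1]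
  · simp
  · intro i _ hi
    rcases i with _ | _ | i
    · simp [Polynomial.coeff_one]
    · exact absurd rfl hi
    · rw [pow_succ, pow_succ, mul_assoc, Polynomial.mul_coeff_one, Polynomial.mul_coeff_zero,
        Polynomial.mul_coeff_one, B.R_zero]
      simp
  · intro h
    simp at h
    omega

/-- For n = 2 the indices satisfy j + m + ℓ = 1, so at most R[1] occurs, and only its entry R[1]_0^1
can be nonzero. -/
theorem virPair_three (G : Fin 2 × ℕ → Fin 2 × ℕ → LPS) :
    virPair B 3 G = (1 / 2 : ℂ) • (∑ c,
      (elem 3 0 (mu B.d c - 3 / 2) • G (1 - c, 1) (c, 0) -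
        elem 3 0 (mu B.d c - 1 / 2) • G (1 - c, 0) (c, 1)) -
      (elem 3 1 (mu B.d 0 - 1 / 2) * B.R.coeff 1 0 1) • G (1, 0) (1, 0)) := by
  have key : ∀ f : ℕ → LPS, (∀ l, degBound B 3 < l → f l = 0) → ∀ j, 
      ∑ l ∈ Finset.range (degBound B 3 + 1), (if j + l + 2 ≤ 3 then f l else 0) =
      (if j + 0 + 2 ≤ 3 then f 0 else 0) + (if j + 1 + 2 ≤ 3 then f 1 else 0) := by
    intro f hf j
    have e2 : ∀ g : ℕ → LPS, g 0 + g 1 = ∑ l ∈ Finset.range 2, g l := fun g => by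
      simp [Finset.sum_range_succ]
    rw [e2 fun l => if j + l + 2 ≤ 3 then f l else 0]
    rw [Finset.sum_subset (Finset.range_subset_range.mpr (show degBound B 3 + 1 ≤
      degBound B 3 + 2 by omega)), eq_comm, Finset.sum_subset (Finset.range_subset_range.mpr
      (show 2 ≤ degBound B 3 + 2 by omega))]
    · intro l _ hl
      exact if_neg (by simp at hl; omega)
    · intro l _ hl
      rw [hf l (by simpa using hl), ite_self]
  rw [virPair]
  congr 1
  have e3 : ∀ g : ℕ → LPS, ∑ l ∈ Finset.range 3, g l = g 0 + g 1 + g 2 := fun g => by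
    simp [Finset.sum_range_succ]
  rw [e3, key, key, key]
  · simp only [Fin.sum_univ_two, virCoeff_zero_right, virCoeff_one_right (show 1 ≤ 3 by norm_num),
      R_one_diag, R_one_lower, eta]
    norm_num
    have m1 : ∀ c, mu B.d c + -1 + 1 / 2 = mu B.d c - 1 / 2 := fun c => by ring
    have m2 : ∀ c, mu B.d c + (-1 - 1) + 1 / 2 = mu B.d c - 3 / 2 := fun c => by ring
    norm_num only at m1 m2 ⊢
    simp only [m1, m2]
    module
  all_goals
    intro l hl
    simp [virCoeff_eq_zero B hl]

theorem elem_three_zero (x : ℂ) : elem 3 0 x = x * (x + 1) * (x + 2) := by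
  simp only [elem_succ_zero, elem_zero]
  push_cast
  norm_num
  ring

theorem elem_three_one (x : ℂ) : elem 3 1 x = 3 * x ^ 2 + 6 * x + 2 := by
  simp only [elem_succ_succ, elem_succ_zero, elem_zero]
  push_cast
  norm_num
  ring

namespace IsTwoPrimaryCone

/-- The entry of degree 1 in `ls_one_sq`: the diagonal coefficients μ_c + 3/2 and μ_{1-c} + 1/2 add
up to 2, and R[2] has no diagonal entries by the grading. -/
theorem two_mul_om_zero_one (h : IsTwoPrimaryCone B F) (c : Fin 2) :
    2 * om F (c, 1) (1 - c, 0) = ∑ b, eulerMul B F (1 - c) b * om F (b, 0) (c, 0) -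
      ∑ b, B.R.coeff 1 c b • om F (b, 0) (1 - c, 0) := by
  have h1 := congrFun (congrFun (h.ls_one_sq (1 - c)) c) ((1 : ℕ) : ℤ)
  rw [ls_one_sq_natCast] at h1
  simp only [Pi.add_apply, Pi.smul_apply, Finset.sum_apply, sh_apply, smul_eq_mul, sq_natCast] at h1
  have e : (((1 : ℕ) : ℤ) - 1) = ((0 : ℕ) : ℤ) := by norm_num
  simp only [e, sq_natCast, sub_sub_cancel, om_comm F (c, 0)] at h1
  have h2 : C (σ := Fin 2 × ℕ) (B.R.coeff (1 + 1) c c) = 0 := by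
    have := B.R_grading 2 c c
    simp at this
    rw [this, map_zero]
  simp only [h2, Finset.range_one, Finset.sum_singleton, add_zero, zero_add, mu_one_sub] at h1
  simp only [Nat.sub_self] at h1
  rw [show (2 : LPS) = C (2 : ℂ) from (map_ofNat C 2).symm, ← smul_eq_C_mul]
  linear_combination (norm := skip) h1
  simp only [Fin.sum_univ_two]
  push_cast
  module

end IsTwoPrimaryCone

end

end

/-! ### The second order part on the extension field, and the jets -/

section

notation:max x:max "²" => x ^ (2 : ℕ)
notation:max x:max "³" => x ^ (3 : ℕ)
notation:max x:max "⁴" => x ^ (4 : ℕ)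
notation:max x:max "⁵" => x ^ (5 : ℕ)
notation:max x:max "⁶" => x ^ (6 : ℕ)

variable {B : Background} {F : LPS} {K : Type*} [Field K] [Algebra ℂ K] [Algebra LPS K]
  [IsScalarTower ℂ LPS K] [Algebra.FormallyEtale LPS K] [FaithfulSMul LPS K]

theorem emb_smul (c : ℂ) (H : LPS) : emb K (c • H) = algebraMap ℂ K c * emb K H := by
  rw [map_smul, Algebra.smul_def]

namespace IsTwoPrimaryCone

theorem emb_om_one_one (h : IsTwoPrimaryCone B F) {κ : K} (hκ : IsRoot B F κ) :
    (1 + algebraMap ℂ K B.d) * emb K (om F (1, 0) (1, 0)) = κ ^ 2 * wK B F K := by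
  have h1 := congrArg (emb K) h.wFun_mul_dphi
  have hκ' : emb K (dphi B F) = κ ^ 2 := Eq.symm hκ
  rw [map_mul, hκ', map_smul, Algebra.smul_def, map_add, map_one] at h1
  rw [wK, ← h1]
  ring

/-- The second order part of `L₂` on the potential of genus `0`. -/
theorem emb_virPair_three (h : IsTwoPrimaryCone B F) {κ : K} (hκ : IsRoot B F κ) :
    emb K (virPair B 3 fun i j => pderiv ℂ i (pderiv ℂ j F)) =
      -(3 / 8 * (algebraMap ℂ K B.d ^ 2 - 1) * vK F K ^ 2 +
        (algebraMap ℂ K B.d ^ 2 - 3) / 8 * rho B F κ ^ 2) := by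
  have := charZero K
  have y0 := congrArg (emb K) (h.two_mul_om_zero_one 0)
  have y1 := congrArg (emb K) (h.two_mul_om_zero_one 1)
  simp only [Fin.sum_univ_two, sub_zero, sub_self, eulerMul_zero_zero, eulerMul_zero_one,
    eulerMul_one_zero, eulerMul_one_one, R_one_diag, R_one_lower,
    map_add, map_sub, map_mul, map_ofNat, emb_smul, map_one, map_zero] at y0 y1
  have hw : wK B F K = (1 - algebraMap ℂ K B.d) * emb K (om F (0, 0) (0, 0)) +
      algebraMap ℂ K (B.R.coeff 1 0 1) := by
    rw [wK, wFun, map_add, map_smul, Algebra.smul_def, map_sub, map_one,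
      MvPowerSeries.c_eq_algebraMap, AlgHom.commutes]
    rfl
  have hv : vK F K = emb K (om F (1, 0) (0, 0)) := by rw [om_comm]; rfl
  have hv' : vK F K = emb K (vFun F) := rfl
  have hr : rho B F κ ^ 2 = (1 + algebraMap ℂ K B.d) * emb K (om F (1, 0) (1, 0)) * wK B F K := by
    rw [h.emb_om_one_one hκ, rho]; ring
  rw [← wK] at y1
  rw [← hv'] at y0 y1
  rw [← hv] at y0
  rw [om_comm F (0, 0) (1, 0), ← hv] at y1
  have hq : emb K (virPair B 3 fun i j => pderiv ℂ i (pderiv ℂ j F)) =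
      emb K (virPair B 3 fun i j => om F i j) := rfl
  have c1 : algebraMap ℂ K (1 / 2) = 1 / 2 := by rw [map_div₀, map_one, map_ofNat]
  have c3 : algebraMap ℂ K (3 / 2) = 3 / 2 := by rw [map_div₀, map_ofNat, map_ofNat]
  rw [hq, virPair_three]
  simp only [elem_three_zero, elem_three_one, Fin.sum_univ_two, sub_zero, sub_self, map_add,
    map_sub,
    map_mul, emb_smul, map_ofNat, map_one, map_pow, c1, c3,
    om_comm F (1, 0) (0, 1), om_comm F (0, 0) (1, 1)]
  have m0 : algebraMap ℂ K (mu B.d 0) = -algebraMap ℂ K B.d / 2 := by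
    rw [mu, if_pos rfl, map_div₀, map_neg, map_ofNat]
  have m1 : algebraMap ℂ K (mu B.d 1) = algebraMap ℂ K B.d / 2 := by
    rw [mu, if_neg (by norm_num), map_div₀, map_ofNat]
  rw [hr, m0, m1]
  -- For d ≠ 1 the grading removes R[1]_0^1; in both cases the formula becomes a polynomial
  -- identity.
  have hd : algebraMap ℂ K B.d = 1 ∨ algebraMap ℂ K (B.R.coeff 1 0 1) = 0 := by
    by_cases hd : B.d = 1
    · exact Or.inl (by rw [hd, map_one])
    · exact Or.inr (by rw [R_one_upper hd, map_zero])
  generalize algebraMap ℂ K B.d = d at *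
  generalize algebraMap ℂ K (B.R.coeff 1 0 1) = r at *
  generalize emb K (om F (0, 1) (1, 0)) = Y₀ at *
  generalize emb K (om F (1, 1) (0, 0)) = Y₁ at *
  generalize emb K (om F (1, 0) (1, 0)) = φ at *
  generalize emb K (om F (0, 0) (0, 0)) = u at *
  have e0 : Y₀ = ((1 + d) * φ * u + vK F K * vK F K - r * φ) / 2 := by
    linear_combination y0 / 2
  have e1 : Y₁ = (vK F K * vK F K + wK B F K * φ) / 2 := by
    linear_combination y1 / 2
  rw [e0, e1, hw]
  rcases hd with rfl | rfl
  · ring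
  · ring

end IsTwoPrimaryCone

variable (B) in
/-- The second order part of `L₂`. -/
def lap (f : K) : K := quad B 3 fun i j => delta i (delta j f)

theorem lap_emb (H : LPS) :
    lap B (emb K H) = emb K (virPair B 3 fun i j => pderiv ℂ i (pderiv ℂ j H)) := by
  rw [lap, virPair_eq_quad, map_quad]
  simp only [delta_emb]

/-- The second order part has constant coefficients. Its values on the jets can therefore be derived
from its value on F₀. -/
theorem lap_delta (k : Fin 2 × ℕ) (f : K) : lap B (delta k f) = delta k (lap B f) := by
  rw [lap, lap, derivation_quad]
  simp only [delta_comm _ k]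

theorem lap_add (f g : K) : lap B (f + g) = lap B f + lap B g := by
  rw [lap, lap, lap]
  simp only [map_add]
  exact map_add (quad B 3) _ _

theorem lap_sub (f g : K) : lap B (f - g) = lap B f - lap B g := by
  rw [lap, lap, lap]
  simp only [map_sub]
  exact map_sub (quad B 3) _ _

theorem quad_delta_mul (f g : K) :
    quad B 3 (fun i j => delta i f * delta j g) = 1 / 2 * bilK B f g := by
  rw [quad_mul, bil_three_eq_res, Algebra.smul_def, map_div₀, map_one, map_ofNat]
  rfl

/-- Logarithmic second derivatives. -/
theorem quad_log {f : K} (hf : f ≠ 0) : quad B 3 (fun i j => delta i (delta j f / f)) =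
    lap B f / f - 1 / 2 * bilK B f f / f ^ 2 := by
  have h1 : (fun i j => delta i (delta j f / f)) = f⁻¹ • (fun i j => delta i (delta j f)) -
      (f ^ 2)⁻¹ • (fun i j => delta i f * delta j f) := by
    funext i j
    simp only [Pi.sub_apply, Pi.smul_apply, smul_eq_mul, Derivation.leibniz_div]
    field_simp
  rw [h1, map_sub, map_smul, map_smul, quad_delta_mul, ← lap, smul_eq_mul, smul_eq_mul]
  ring

namespace IsTwoPrimaryCone

/-- Since ∂ρ = κ ∂u and ρ ∂κ = d κ ∂ρ, the Hessian of ρ is κ times that of u plus (d/ρ) ∂ρ ∂ρ. -/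
theorem lap_rho (h : IsTwoPrimaryCone B F) {κ : K} (hκ : IsRoot B F κ) :
    lap B (rho B F κ) = κ * lap B (emb K (uFun F)) +
      algebraMap ℂ K B.d / (2 * rho B F κ) * bilK B (rho B F κ) (rho B F κ) := by
  have hr := h.rho_ne_zero hκ
  have hk := h.root_ne_zero hκ
  have h1 : (fun i j => delta i (delta j (rho B F κ))) =
      κ • (fun i j => delta i (delta j (emb K (uFun F)))) + (algebraMap ℂ K B.d / rho B F κ) •
        (fun i j => delta i (rho B F κ) * delta j (rho B F κ)) := by
    funext i j
    have e1 := h.rho_mul_delta hκ i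
    simp only [Pi.add_apply, Pi.smul_apply, smul_eq_mul]
    rw [h.delta_rho hκ j, Derivation.leibniz, smul_eq_mul, smul_eq_mul, ← delta_emb,
      add_right_inj]
    field_simp
    linear_combination delta j (emb K (uFun F)) * e1
  rw [lap, h1, map_add, map_smul, map_smul, quad_delta_mul, ← lap, smul_eq_mul, smul_eq_mul]
  field_simp

/-- Both u and v are second derivatives of F₀, so `lap_delta` applies. -/
theorem lap_can (h : IsTwoPrimaryCone B F) {κ : K} (hκ : IsRoot B F κ) :
    lap B (can B F κ) = delta (0, 0) (delta (1, 0) (lap B (emb K F))) +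
      κ * delta (0, 0) (delta (0, 0) (lap B (emb K F))) +
      algebraMap ℂ K B.d / (2 * rho B F κ) * bilK B (rho B F κ) (rho B F κ) := by
  have eu : emb K (uFun F) = delta (0, 0) (delta (0, 0) (emb K F)) := by
    rw [delta_emb, delta_emb]; rfl
  have ev : vK F K = delta (0, 0) (delta (1, 0) (emb K F)) := by
    rw [delta_emb, delta_emb]; rfl
  rw [can, lap_add, h.lap_rho hκ, eu, ev]
  simp only [lap_delta]
  ring

end IsTwoPrimaryCone

/-! ### Jets of the canonical coordinates -/

variable (B F) in
/-- Names for the derivatives along `∂` of the canonical coordinates `v ± r`. -/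
structure Jets (κ d v r p q p₁ q₁ p₂ q₂ p₃ q₃ : K) : Prop where
  cone : IsTwoPrimaryCone B F
  root : IsRoot B F κ
  hd : algebraMap ℂ K B.d = d
  hv : vK F K = v
  hr : rho B F κ = r
  hp : delta (0, 0) (can B F κ) = p
  hq : delta (0, 0) (can B F (-κ)) = q
  hp₁ : delta (0, 0) p = p₁
  hq₁ : delta (0, 0) q = q₁
  hp₂ : delta (0, 0) p₁ = p₂
  hq₂ : delta (0, 0) q₁ = q₂
  hp₃ : delta (0, 0) p₂ = p₃
  hq₃ : delta (0, 0) q₂ = q₃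

namespace Jets

variable {κ d v r p q p₁ q₁ p₂ q₂ p₃ q₃ : K}

/-- The exchange of the two sheets κ ↦ -κ; every formula for q is the formula for p read through it.
-/
theorem neg (J : Jets B F κ d v r p q p₁ q₁ p₂ q₂ p₃ q₃) :
    Jets B F (-κ) d v (-r) q p q₁ p₁ q₂ p₂ q₃ p₃ :=
  ⟨J.cone, J.root.neg, J.hd, J.hv, by rw [rho_neg, J.hr], J.hq, by rw [neg_neg, J.hp], J.hq₁,
    J.hp₁, J.hq₂, J.hp₂, J.hq₃, J.hp₃⟩

theorem r_ne_zero (J : Jets B F κ d v r p q p₁ q₁ p₂ q₂ p₃ q₃) : r ≠ 0 :=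
  J.hr ▸ J.cone.rho_ne_zero J.root

theorem root_ne_zero (J : Jets B F κ d v r p q p₁ q₁ p₂ q₂ p₃ q₃) : κ ≠ 0 :=
  J.cone.root_ne_zero J.root

theorem can_eq (J : Jets B F κ d v r p q p₁ q₁ p₂ q₂ p₃ q₃) : can B F κ = v + r := by
  rw [can, J.hv, J.hr]

theorem can_neg_eq (J : Jets B F κ d v r p q p₁ q₁ p₂ q₂ p₃ q₃) : can B F (-κ) = v - r := by
  rw [J.neg.can_eq]; ring

theorem map_d (J : Jets B F κ d v r p q p₁ q₁ p₂ q₂ p₃ q₃) (D : Derivation ℂ K K) : D d = 0 := by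
  rw [← J.hd, Derivation.map_algebraMap]

theorem two_mul_v (J : Jets B F κ d v r p q p₁ q₁ p₂ q₂ p₃ q₃) :
    v = (1 / 2 : ℂ) • (can B F κ + can B F (-κ)) := by
  have := charZero K
  rw [J.can_eq, J.can_neg_eq, Algebra.smul_def, map_div₀, map_one, map_ofNat]
  ring

theorem two_mul_r (J : Jets B F κ d v r p q p₁ q₁ p₂ q₂ p₃ q₃) :
    r = (1 / 2 : ℂ) • (can B F κ - can B F (-κ)) := by
  have := charZero K
  rw [J.can_eq, J.can_neg_eq, Algebra.smul_def, map_div₀, map_one, map_ofNat]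
  ring

theorem half_smul (f : K) : (1 / 2 : ℂ) • f = f / 2 := by
  rw [Algebra.smul_def, map_div₀, map_one, map_ofNat]
  ring

theorem delta_v (J : Jets B F κ d v r p q p₁ q₁ p₂ q₂ p₃ q₃) : delta (0, 0) v = (p + q) / 2 := by
  conv_lhs => rw [J.two_mul_v]
  rw [Derivation.map_smul, map_add, J.hp, J.hq, half_smul]

theorem delta_r (J : Jets B F κ d v r p q p₁ q₁ p₂ q₂ p₃ q₃) : delta (0, 0) r = (p - q) / 2 := by
  conv_lhs => rw [J.two_mul_r]
  rw [Derivation.map_smul, map_sub, J.hp, J.hq, half_smul]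

theorem delta_one_v (J : Jets B F κ d v r p q p₁ q₁ p₂ q₂ p₃ q₃) :
    delta (1, 0) v = κ * (p - q) / 2 := by
  conv_lhs => rw [J.two_mul_v]
  rw [Derivation.map_smul, map_add, J.cone.delta_one_can J.root, J.cone.delta_one_can J.root.neg,
    J.hp, J.hq, half_smul]
  ring

theorem delta_one_r (J : Jets B F κ d v r p q p₁ q₁ p₂ q₂ p₃ q₃) :
    delta (1, 0) r = κ * (p + q) / 2 := by
  conv_lhs => rw [J.two_mul_r]
  rw [Derivation.map_smul, map_sub, J.cone.delta_one_can J.root, J.cone.delta_one_can J.root.neg,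
    J.hp, J.hq, half_smul]
  ring

theorem delta_κ (J : Jets B F κ d v r p q p₁ q₁ p₂ q₂ p₃ q₃) (i : Fin 2 × ℕ) :
    delta i κ = d * κ * delta i r / r := by
  have := J.cone.rho_mul_delta J.root i
  rw [J.hd, J.hr] at this
  rw [eq_div_iff J.r_ne_zero, ← this, mul_comm]

theorem virK_κ (J : Jets B F κ d v r p q p₁ q₁ p₂ q₂ p₃ q₃) (N : ℕ) :
    virK B F K N κ = d * κ * virK B F K N r / r := by
  have := J.cone.rho_mul_virK J.root N
  rw [J.hd, J.hr] at this
  rw [eq_div_iff J.r_ne_zero, ← this, mul_comm]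

theorem delta_κ_div (J : Jets B F κ d v r p q p₁ q₁ p₂ q₂ p₃ q₃) :
    delta (0, 0) κ / (2 * κ) = d * (p - q) / (4 * r) := by
  have := charZero K
  have h1 := J.r_ne_zero
  have h2 := J.root_ne_zero
  rw [J.delta_κ, J.delta_r]
  field_simp
  norm_num

theorem grad_can (J : Jets B F κ d v r p q p₁ q₁ p₂ q₂ p₃ q₃) : gradK (can B F κ) =
    p • sh 1 (frame F κ) + (0 : K) • sh 1 (frame F (-κ)) + (0 : K) • sh 2 (frame F κ) +
      (0 : K) • sh 2 (frame F (-κ)) + (0 : K) • sh 3 (frame F κ) +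
      (0 : K) • sh 3 (frame F (-κ)) := by
  rw [J.cone.gradK_can J.root, J.hp]
  module

theorem grad_p (J : Jets B F κ d v r p q p₁ q₁ p₂ q₂ p₃ q₃) {g : K}
    (hg : delta (0, 0) κ / (2 * κ) = g) : gradK p = 
    (p₁ + g * p) • sh 1 (frame F κ) + (-(g * p)) • sh 1 (frame F (-κ)) +
      p ^ 2 • sh 2 (frame F κ) + (0 : K) • sh 2 (frame F (-κ)) + (0 : K) • sh 3 (frame F κ) +
      (0 : K) • sh 3 (frame F (-κ)) := by
  conv_lhs => rw [← J.hp, J.cone.gradK_delta_of J.root J.grad_can hg J.hp J.hq, map_zero, J.hp₁]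
  module

theorem grad_p₁ (J : Jets B F κ d v r p q p₁ q₁ p₂ q₂ p₃ q₃) {g g₁ : K}
    (hg : delta (0, 0) κ / (2 * κ) = g) (hg₁ : delta (0, 0) g = g₁) : gradK p₁ = 
    (p₂ + g₁ * p + 2 * g * p₁ + 2 * g ^ 2 * p) • sh 1 (frame F κ) +
      (-(g₁ * p + 2 * g * p₁ + 2 * g ^ 2 * p)) • sh 1 (frame F (-κ)) +
      (3 * p * p₁ + 2 * g * p ^ 2) • sh 2 (frame F κ) +
      (-(g * p * (p + q))) • sh 2 (frame F (-κ)) +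
      p ^ 3 • sh 3 (frame F κ) + (0 : K) • sh 3 (frame F (-κ)) := by
  have h1 : delta (0, 0) (p ^ 2) = 2 * p * p₁ := by
    rw [pow_two, Derivation.leibniz, J.hp₁, smul_eq_mul]; ring
  conv_lhs => rw [← J.hp₁, J.cone.gradK_delta_of J.root (J.grad_p hg) hg J.hp J.hq, map_zero,
    map_add, map_neg, Derivation.leibniz, J.hp₁, J.hp₂, hg₁, h1]
  simp only [smul_eq_mul]
  module

theorem grad_p₂ (J : Jets B F κ d v r p q p₁ q₁ p₂ q₂ p₃ q₃) {g g₁ g₂ : K}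
    (hg : delta (0, 0) κ / (2 * κ) = g) (hg₁ : delta (0, 0) g = g₁) (hg₂ : delta (0, 0) g₁ = g₂) :
    gradK p₂ = 
    (p₃ + g₂ * p + 3 * g₁ * p₁ + 3 * g * p₂ + 6 * g * g₁ * p + 6 * g ^ 2 * p₁ + 4 * g ^ 3 * p) •
      sh 1 (frame F κ) +
      (-(g₂ * p + 3 * g₁ * p₁ + 3 * g * p₂ + 6 * g * g₁ * p + 6 * g ^ 2 * p₁ + 4 * g ^ 3 * p)) •
      sh 1 (frame F (-κ)) +
      (4 * p * p₂ + 3 * p₁ ^ 2 + 3 * g₁ * p ^ 2 + 9 * g * p * p₁ + 4 * g ^ 2 * p ^ 2 +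
        g ^ 2 * p * (p + q)) • sh 2 (frame F κ) + 
      (-(g₁ * p * (p + q) + g * p₁ * (p + q) + g * p * (p₁ + q₁) + g₁ * p * q + 2 * g * p₁ * q +
        2 * g ^ 2 * p * q + 3 * g * p * p₁ + 2 * g ^ 2 * p ^ 2 + g ^ 2 * p * (p + q))) •
        sh 2 (frame F (-κ)) +
      (6 * p ^ 2 * p₁ + 3 * g * p ^ 3) • sh 3 (frame F κ) +
      (-(g * p * q * (p + q) + g * p ^ 3)) • sh 3 (frame F (-κ)) +
      p ^ 4 • sh 4 (frame F κ) + (0 : K) • sh 4 (frame F (-κ)) := by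
  have h0 : ∀ D : Derivation ℂ K K, D 2 = 0 := fun D => by
    rw [← map_ofNat (algebraMap ℂ K), Derivation.map_algebraMap]
  have h0' : ∀ D : Derivation ℂ K K, D 3 = 0 := fun D => by
    rw [← map_ofNat (algebraMap ℂ K), Derivation.map_algebraMap]
  conv_lhs => rw [← J.hp₂, J.cone.gradK_delta_of J.root (J.grad_p₁ hg hg₁) hg J.hp J.hq]
  simp only [map_zero, map_add, map_neg, Derivation.leibniz, Derivation.leibniz_pow, J.hp₁, J.hp₂,
    J.hp₃, J.hq₁, hg₁, hg₂, h0, h0', smul_eq_mul, nsmul_eq_mul]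
  push_cast
  module

end Jets

end

/-! ### The vector field of L₂ on the jets -/

section

variable {B : Background} {F : LPS} {K : Type*} [Field K] [Algebra ℂ K] [Algebra LPS K]
  [IsScalarTower ℂ LPS K] [Algebra.FormallyEtale LPS K] [FaithfulSMul LPS K]

theorem derivation_ofNat (D : Derivation ℂ K K) (n : ℕ) [n.AtLeastTwo] :
    D (ofNat(n) : K) = 0 := by
  rw [← map_ofNat (algebraMap ℂ K), Derivation.map_algebraMap]

namespace Jets

variable {κ d v r p q p₁ q₁ p₂ q₂ p₃ q₃ : K}

theorem virK_r (J : Jets B F κ d v r p q p₁ q₁ p₂ q₂ p₃ q₃) :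
    virK B F K 3 r = -(r ^ 3 + 3 * v ^ 2 * r) := by
  have := charZero K
  conv_lhs => rw [J.two_mul_r]
  rw [Derivation.map_smul, map_sub, J.cone.virK_three_can J.root,
    J.cone.virK_three_can J.root.neg, J.can_eq, J.can_neg_eq, half_smul]
  ring

theorem virK_root (J : Jets B F κ d v r p q p₁ q₁ p₂ q₂ p₃ q₃) :
    virK B F K 3 κ = -(d * κ * (r ^ 2 + 3 * v ^ 2)) := by
  have := J.r_ne_zero
  rw [J.virK_κ, J.virK_r]
  field_simp

theorem virK_delta (J : Jets B F κ d v r p q p₁ q₁ p₂ q₂ p₃ q₃) {f a₁ b₁ a₂ b₂ a₃ b₃ : K}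
    (hf : gradK f = a₁ • sh 1 (frame F κ) + b₁ • sh 1 (frame F (-κ)) + a₂ • sh 2 (frame F κ) +
      b₂ • sh 2 (frame F (-κ)) + a₃ • sh 3 (frame F κ) + b₃ • sh 3 (frame F (-κ))) :
    virK B F K 3 (delta (0, 0) f) = delta (0, 0) (virK B F K 3 f) -
      (a₁ * (3 / 2 * (v + r) ^ 2 - d / 2 * ((v + r) ^ 2 + (v + r) * (v - r) + (v - r) ^ 2)) +
       b₁ * (3 / 2 * (v - r) ^ 2 - d / 2 * ((v + r) ^ 2 + (v + r) * (v - r) + (v - r) ^ 2)) +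
       a₂ * ((9 - 7 * d + 2 * d ^ 2) / 4 * (v + r) - d * (5 - d) / 4 * (v - r)) +
       b₂ * ((9 - 7 * d + 2 * d ^ 2) / 4 * (v - r) - d * (5 - d) / 4 * (v + r)) +
       (a₃ + b₃) * ((1 - d) * (3 - d) * (5 - d) / 8)) :=
  J.cone.virK_delta_of J.root (f := f) (a₁ := a₁) (b₁ := b₁) (a₂ := a₂) (b₂ := b₂) (a₃ := a₃)
    (b₃ := b₃) (a₄ := 0) (b₄ := 0) (by rw [hf]; module) J.hd J.can_eq J.can_neg_eq

/-- Start of a recursion: the value on a jet is ∂ of the value on the preceding one, corrected by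
the commutator term of `virK_delta`. -/
theorem virK_p (J : Jets B F κ d v r p q p₁ q₁ p₂ q₂ p₃ q₃) :
    virK B F K 3 p =
      3 * d * v ^ 2 * p / 2 + d * r ^ 2 * p / 2 - 9 * v ^ 2 * p / 2 - 9 * v * r * p -
      9 * r ^ 2 * p / 2 := by
  have := charZero K
  have hr := J.r_ne_zero
  have h1 := J.cone.virK_three_can J.root
  have h2 := J.virK_delta J.grad_can
  rw [J.hp, h1, J.can_eq] at h2
  rw [h2]
  simp only [map_add, map_sub, map_neg, map_zero, Derivation.leibniz, Derivation.leibniz_pow,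
    Derivation.leibniz_div, derivation_ofNat, J.map_d, J.delta_v, J.delta_r, J.hp₁, J.hp₂, J.hp₃,
    J.hq₁, J.hq₂, J.hq₃, smul_eq_mul, nsmul_eq_mul]
  push_cast
  ring

theorem virK_p₁ (J : Jets B F κ d v r p q p₁ q₁ p₂ q₂ p₃ q₃) :
    virK B F K 3 p₁ =
      - 3 * d ^ 2 * v * p ^ 2 / 4 - d ^ 2 * r * p ^ 2 / 4 + 3 * d * v ^ 2 * p₁ +
      3 * d * v * p ^ 2 + 3 * d * v * p * q + d * r ^ 2 * p₁ + d * r * p ^ 2 -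
      d * r * p * q / 2 - 6 * v ^ 2 * p₁ - 12 * v * r * p₁ - 45 * v * p ^ 2 / 4 -
      6 * r ^ 2 * p₁ - 45 * r * p ^ 2 / 4 := by
  have := charZero K
  have hr := J.r_ne_zero
  have hg := J.delta_κ_div
  have h2 := J.virK_delta (J.grad_p hg)
  rw [J.hp₁, J.virK_p] at h2
  rw [h2]
  simp only [map_add, map_sub, map_neg, map_zero, Derivation.leibniz, Derivation.leibniz_pow,
    Derivation.leibniz_div, derivation_ofNat, J.map_d, J.delta_v, J.delta_r, J.hp₁, J.hp₂, J.hp₃,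
    J.hq₁, J.hq₂, J.hq₃, smul_eq_mul, nsmul_eq_mul]
  push_cast
  field_simp
  ring

theorem virK_p₂ (J : Jets B F κ d v r p q p₁ q₁ p₂ q₂ p₃ q₃) :
    virK B F K 3 p₂ =
      - 3 * d³ * v * p³ / (16 * r) + 3 * d³ * v * p² * q / (8 * r) -
      3 * d³ * v * p * q² / (16 * r) - d³ * p³ / 16 + d³ * p² * q / 8 +
      d³ * p * q² / 16 - 15 * d² * v * p * p₁ / 4 - 5 * d² * r * p * p₁ / 4 -
      5 * d² * p³ / 4 - d² * p² * q / 2 - d² * p * q² / 8 +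
      9 * d * v² * p₂ / 2 + 27 * d * v * p * p₁ / 2 + 9 * d * v * p * q₁ / 2 +
      9 * d * v * p₁ * q + 3 * d * v * p³ / (16 * r) - 3 * d * v * p² * q / (8 * r) +
      3 * d * v * p * q² / (16 * r) + 3 * d * r² * p₂ / 2 + 9 * d * r * p * p₁ / 2 -
      d * r * p * q₁ / 2 - 3 * d * r * p₁ * q / 2 + 51 * d * p³ / 16 +
      27 * d * p² * q / 8 + 37 * d * p * q² / 16 - 15 * v² * p₂ / 2 - 15 * v * r * p₂ -
      165 * v * p * p₁ / 4 - 15 * r² * p₂ / 2 - 165 * r * p * p₁ / 4 - 105 * p³ / 8 := by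
  have := charZero K
  have hr := J.r_ne_zero
  have hg := J.delta_κ_div
  have hg₁ : delta (0, 0) (d * (p - q) / (4 * r)) =
      d * (p₁ - q₁) / (4 * r) - d * (p - q) ^ 2 / (8 * r²) := by
    simp only [map_add, map_sub, map_neg, map_zero, Derivation.leibniz, Derivation.leibniz_pow,
    Derivation.leibniz_div, derivation_ofNat, J.map_d, J.delta_v, J.delta_r, J.hp₁, J.hp₂, J.hp₃,
    J.hq₁, J.hq₂, J.hq₃, smul_eq_mul, nsmul_eq_mul]
    field_simp
    ring
  have h2 := J.virK_delta (J.grad_p₁ hg hg₁)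
  rw [J.hp₂, J.virK_p₁] at h2
  rw [h2]
  simp only [map_add, map_sub, map_neg, map_zero, Derivation.leibniz, Derivation.leibniz_pow,
    Derivation.leibniz_div, derivation_ofNat, J.map_d, J.delta_v, J.delta_r, J.hp₁, J.hp₂, J.hp₃,
    J.hq₁, J.hq₂, J.hq₃, smul_eq_mul, nsmul_eq_mul]
  push_cast
  field_simp
  ring

set_option maxHeartbeats 1000000 in
-- Last step of the recursion, F₂ containing no higher jets. The gradient of p₂ reaches the shift 4,
-- which `virK_delta_of` takes into account.
theorem virK_p₃ (J : Jets B F κ d v r p q p₁ q₁ p₂ q₂ p₃ q₃) :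
    virK B F K 3 p₃ =
      - 3 * d⁴ * v * p⁴ / (32 * r²) + 9 * d⁴ * v * p³ * q / (32 * r²) -
      9 * d⁴ * v * p² * q² / (32 * r²) + 3 * d⁴ * v * p * q³ / (32 * r²) -
      d⁴ * p⁴ / (16 * r) + 3 * d⁴ * p³ * q / (32 * r) -
      d⁴ * p * q³ / (32 * r) - 27 * d³ * v * p² * p₁ / (16 * r) +
      15 * d³ * v * p² * q₁ / (16 * r) + 39 * d³ * v * p * p₁ * q / (16 * r) -
      15 * d³ * v * p * q * q₁ / (16 * r) - 3 * d³ * v * p₁ * q² / (4 * r) +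
      9 * d³ * v * p⁴ / (32 * r²) - 27 * d³ * v * p³ * q / (32 * r²) +
      27 * d³ * v * p² * q² / (32 * r²) - 9 * d³ * v * p * q³ / (32 * r²) -
      9 * d³ * p² * p₁ / 16 + 5 * d³ * p² * q₁ / 16 + 13 * d³ * p * p₁ * q / 16 +
      5 * d³ * p * q * q₁ / 16 + d³ * p₁ * q² / 4 - 9 * d³ * p⁴ / (32 * r) +
      3 * d³ * p³ * q / (8 * r) + 3 * d³ * p² * q² / (32 * r) -
      3 * d³ * p * q³ / (16 * r) - 27 * d² * v * p * p₂ / 4 - 6 * d² * v * p₁² +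
      3 * d² * v * p⁴ / (32 * r²) - 9 * d² * v * p³ * q / (32 * r²) +
      9 * d² * v * p² * q² / (32 * r²) - 3 * d² * v * p * q³ / (32 * r²) -
      9 * d² * r * p * p₂ / 4 - 2 * d² * r * p₁² - 43 * d² * p² * p₁ / 4 -
      7 * d² * p² * q₁ / 8 - 27 * d² * p * p₁ * q / 8 - 5 * d² * p * q * q₁ / 8 -
      d² * p₁ * q² / 2 + d² * p⁴ / (16 * r) - 3 * d² * p³ * q / (32 * r) +
      d² * p * q³ / (32 * r) + 6 * d * v² * p₃ + 24 * d * v * p * p₂ +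
      6 * d * v * p * q₂ + 18 * d * v * p₁² + 18 * d * v * p₁ * q₁ + 18 * d * v * p₂ * q +
      27 * d * v * p² * p₁ / (16 * r) - 15 * d * v * p² * q₁ / (16 * r) -
      39 * d * v * p * p₁ * q / (16 * r) + 15 * d * v * p * q * q₁ / (16 * r) +
      3 * d * v * p₁ * q² / (4 * r) - 9 * d * v * p⁴ / (32 * r²) +
      27 * d * v * p³ * q / (32 * r²) - 27 * d * v * p² * q² / (32 * r²) +
      9 * d * v * p * q³ / (32 * r²) + 2 * d * r² * p₃ + 8 * d * r * p * p₂ -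
      d * r * p * q₂ / 2 + 6 * d * r * p₁² - 2 * d * r * p₁ * q₁ - 3 * d * r * p₂ * q +
      411 * d * p² * p₁ / 16 + 113 * d * p² * q₁ / 16 + 321 * d * p * p₁ * q / 16 +
      141 * d * p * q * q₁ / 16 + 37 * d * p₁ * q² / 4 + 9 * d * p⁴ / (32 * r) -
      3 * d * p³ * q / (8 * r) - 3 * d * p² * q² / (32 * r) +
      3 * d * p * q³ / (16 * r) - 9 * v² * p₃ - 18 * v * r * p₃ - 261 * v * p * p₂ / 4 -
      48 * v * p₁² - 9 * r² * p₃ - 261 * r * p * p₂ / 4 - 48 * r * p₁² -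
      735 * p² * p₁ / 8 := by
  have := charZero K
  have hr := J.r_ne_zero
  have hg := J.delta_κ_div
  have hg₁ : delta (0, 0) (d * (p - q) / (4 * r)) =
      d * (p₁ - q₁) / (4 * r) - d * (p - q) ^ 2 / (8 * r²) := by
    simp only [map_add, map_sub, map_neg, map_zero, Derivation.leibniz, Derivation.leibniz_pow,
    Derivation.leibniz_div, derivation_ofNat, J.map_d, J.delta_v, J.delta_r, J.hp₁, J.hp₂, J.hp₃,
    J.hq₁, J.hq₂, J.hq₃, smul_eq_mul, nsmul_eq_mul]
    field_simp
    ring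
  have hg₂ : delta (0, 0) (d * (p₁ - q₁) / (4 * r) - d * (p - q) ^ 2 / (8 * r²)) =
      d * (p₂ - q₂) / (4 * r) - 3 * d * (p - q) * (p₁ - q₁) / (8 * r²) +
        d * (p - q) ^ 3 / (8 * r³) := by
    simp only [map_add, map_sub, map_neg, map_zero, Derivation.leibniz, Derivation.leibniz_pow,
    Derivation.leibniz_div, derivation_ofNat, J.map_d, J.delta_v, J.delta_r, J.hp₁, J.hp₂, J.hp₃,
    J.hq₁, J.hq₂, J.hq₃, smul_eq_mul, nsmul_eq_mul]
    push_cast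
    field_simp
    ring
  have h2 := J.cone.virK_delta_of J.root (J.grad_p₂ hg hg₁ hg₂) J.hd J.can_eq J.can_neg_eq
  rw [J.hp₃, J.virK_p₂] at h2
  rw [h2]
  simp only [map_add, map_sub, map_neg, map_zero, Derivation.leibniz, Derivation.leibniz_pow,
    Derivation.leibniz_div, derivation_ofNat, J.map_d, J.delta_v, J.delta_r, J.hp₁, J.hp₂, J.hp₃,
    J.hq₁, J.hq₂, J.hq₃, smul_eq_mul, nsmul_eq_mul]
  push_cast
  field_simp
  ring


end Jets

end

/-! ### The second order part on the jets, F₁ in canonical coordinates, and its constraint -/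

section

variable {B : Background} {F : LPS} {K : Type*} [Field K] [Algebra ℂ K] [Algebra LPS K]
  [IsScalarTower ℂ LPS K] [Algebra.FormallyEtale LPS K] [FaithfulSMul LPS K]

theorem gradK_smul (c : ℂ) (f : K) : gradK (c • f) = algebraMap ℂ K c • gradK f := by
  rw [Algebra.smul_def, gradK_mul, gradK_algebraMap, smul_zero, add_zero]

theorem gradK_sub (f g : K) : gradK (f - g) = gradK f - gradK g := by
  have := gradK_add (f - g) g
  rw [sub_add_cancel] at this
  rw [this, add_sub_cancel_right]

theorem lap_smul (c : ℂ) (f : K) : lap B (c • f) = c • lap B f := by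
  have h1 : (fun i j => delta i (delta j (c • f))) =
      algebraMap ℂ K c • fun i j => delta i (delta j f) := by
    funext i j
    simp only [Derivation.map_smul, Pi.smul_apply, smul_eq_mul]
    rw [Algebra.smul_def]
  rw [lap, h1, map_smul, smul_eq_mul, ← Algebra.smul_def, lap]

theorem comp_const_mul (c : ℂ) (f : ℂ → ℂ) (G : LPS) :
    comp (fun x => c * f x) G = c • comp f G := by
  have : (PowerSeries.mk fun n => iteratedDeriv n (fun x => c * f x) (constantCoeff G) /
      (n.factorial : ℂ)) = c • PowerSeries.mk fun n =>
        iteratedDeriv n f (constantCoeff G) / (n.factorial : ℂ) := by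
    ext n
    rw [PowerSeries.coeff_mk, PowerSeries.coeff_smul, PowerSeries.coeff_mk,
      iteratedDeriv_const_mul_field, smul_eq_mul, mul_div_assoc]
  rw [comp, this, PowerSeries.subst_smul, comp]
  exact PowerSeries.HasSubst.of_constantCoeff_zero (by simp)

namespace Jets

variable {κ d v r p q p₁ q₁ p₂ q₂ p₃ q₃ : K}

theorem delta_neg_κ_div (J : Jets B F κ d v r p q p₁ q₁ p₂ q₂ p₃ q₃) :
    delta (0, 0) (-κ) / (2 * -κ) = d * (p - q) / (4 * r) := by
  rw [map_neg, mul_neg, neg_div_neg_eq, J.delta_κ_div]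

theorem grad_r (J : Jets B F κ d v r p q p₁ q₁ p₂ q₂ p₃ q₃) : gradK r =
    (p / 2) • sh 1 (frame F κ) + (-(q / 2)) • sh 1 (frame F (-κ)) + (0 : K) • sh 2 (frame F κ) +
      (0 : K) • sh 2 (frame F (-κ)) := by
  conv_lhs => rw [J.two_mul_r, gradK_smul, gradK_sub, J.grad_can, J.neg.grad_can, neg_neg,
    map_div₀, map_one, map_ofNat]
  module

theorem grad_p' (J : Jets B F κ d v r p q p₁ q₁ p₂ q₂ p₃ q₃) : gradK p =
    (p₁ + d * (p - q) / (4 * r) * p) • sh 1 (frame F κ) +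
      (-(d * (p - q) / (4 * r) * p)) • sh 1 (frame F (-κ)) +
      p ^ 2 • sh 2 (frame F κ) + (0 : K) • sh 2 (frame F (-κ)) := by
  rw [J.grad_p J.delta_κ_div]
  module

theorem grad_q' (J : Jets B F κ d v r p q p₁ q₁ p₂ q₂ p₃ q₃) : gradK q =
    (-(d * (p - q) / (4 * r) * q)) • sh 1 (frame F κ) +
      (q₁ + d * (p - q) / (4 * r) * q) • sh 1 (frame F (-κ)) +
      (0 : K) • sh 2 (frame F κ) + q ^ 2 • sh 2 (frame F (-κ)) := by
  rw [J.neg.grad_p J.delta_neg_κ_div, neg_neg]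
  module

theorem bilK_r (J : Jets B F κ d v r p q p₁ q₁ p₂ q₂ p₃ q₃) :
    bilK B r r =
      - 3 * d ^ 2 * v * κ * p ^ 2 / 8 + 3 * d ^ 2 * v * κ * q ^ 2 / 8 - d ^ 2 * κ * r * p ^ 2 / 8 -
      d ^ 2 * κ * r * q ^ 2 / 8 + d * κ * r * p * q / 2 + 3 * v * κ * p ^ 2 / 8 -
      3 * v * κ * q ^ 2 / 8 + 3 * κ * r * p ^ 2 / 8 + 3 * κ * r * q ^ 2 / 8 := by
  have := charZero K
  have hr := J.r_ne_zero
  rw [J.cone.bilK_of J.root J.grad_r J.grad_r J.hd J.can_eq J.can_neg_eq]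
  field_simp
  ring

theorem bilK_p (J : Jets B F κ d v r p q p₁ q₁ p₂ q₂ p₃ q₃) :
    bilK B p p =
      d⁴ * κ * p⁴ / (16 * r) - d⁴ * κ * p² * q² / (16 * r) -
      3 * d³ * v * κ * p² * p₁ / (4 * r) + 3 * d³ * v * κ * p * p₁ * q / (4 * r) -
      d³ * κ * p² * p₁ / 4 + d³ * κ * p * p₁ * q / 4 - d³ * κ * p⁴ / (4 * r) +
      d³ * κ * p³ * q / (8 * r) + d³ * κ * p² * q² / (8 * r) -
      3 * d² * v * κ * p₁² / 2 - d² * κ * r * p₁² / 2 - d² * κ * p² * p₁ -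
      d² * κ * p * p₁ * q / 2 + d² * κ * p⁴ / (16 * r) -
      d² * κ * p³ * q / (4 * r) + 3 * d² * κ * p² * q² / (16 * r) +
      3 * d * v * κ * p² * p₁ / (4 * r) - 3 * d * v * κ * p * p₁ * q / (4 * r) +
      3 * d * κ * p² * p₁ / 4 - 3 * d * κ * p * p₁ * q / 4 + 3 * d * κ * p⁴ / (8 * r) -
      3 * d * κ * p³ * q / (8 * r) + 3 * v * κ * p₁² / 2 + 3 * κ * r * p₁² / 2 +
      3 * κ * p² * p₁ / 2 := by
  have := charZero K
  have hr := J.r_ne_zero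
  rw [J.cone.bilK_of J.root J.grad_p' J.grad_p' J.hd J.can_eq J.can_neg_eq]
  field_simp
  ring

theorem delta_one_p (J : Jets B F κ d v r p q p₁ q₁ p₂ q₂ p₃ q₃) :
    delta (1, 0) p = d * κ * (p - q) / (2 * r) * p + κ * p₁ := by
  have := J.r_ne_zero
  conv_lhs => rw [← J.hp, delta_comm, J.cone.delta_one_can J.root, Derivation.leibniz, J.delta_κ,
    J.hp, J.hp₁, J.delta_r]
  simp only [smul_eq_mul]
  field_simp
  ring

/-- The second order part of `L₂` on the potential of genus `0`. -/
theorem lap_potential (J : Jets B F κ d v r p q p₁ q₁ p₂ q₂ p₃ q₃) :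
    lap B (emb K F) = -(3 / 8 * (d ^ 2 - 1) * v ^ 2 + (d ^ 2 - 3) / 8 * r ^ 2) := by
  rw [lap_emb, J.cone.emb_virPair_three J.root, J.hd, J.hv, J.hr]

theorem lap_can (J : Jets B F κ d v r p q p₁ q₁ p₂ q₂ p₃ q₃) :
    lap B (can B F κ) =
      - 3 * d ^ 3 * v * κ * p ^ 2 / (8 * r) + 3 * d ^ 3 * v * κ * p * q / (8 * r) -
      d ^ 3 * κ * p ^ 2 / 8 - 3 * d ^ 2 * v * κ * p₁ / 4 - d ^ 2 * κ * r * p₁ / 4 -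
      d ^ 2 * κ * p ^ 2 / 2 + 3 * d * v * κ * p ^ 2 / (8 * r) - 3 * d * v * κ * p * q / (8 * r) +
      3 * d * κ * p ^ 2 / 8 + 3 * v * κ * p₁ / 4 + 3 * κ * r * p₁ / 4 + 3 * κ * p ^ 2 / 4 := by
  have := charZero K
  have hr := J.r_ne_zero
  rw [J.cone.lap_can J.root, J.lap_potential, J.hr, J.hd, J.bilK_r]
  simp only [map_add, map_sub, map_neg, map_zero, Derivation.map_natCast,
    Derivation.map_one_eq_zero, Derivation.leibniz, Derivation.leibniz_pow,
    Derivation.leibniz_div, derivation_ofNat, J.map_d, J.delta_v, J.delta_r, J.delta_one_v,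
    J.delta_one_r, J.delta_κ, J.hp₁, J.hp₂, J.hp₃,
    J.hq₁, J.hq₂, J.hq₃, smul_eq_mul, nsmul_eq_mul]
  push_cast
  field_simp
  ring

theorem lap_p (J : Jets B F κ d v r p q p₁ q₁ p₂ q₂ p₃ q₃) :
    lap B p =
      - 3 * d⁴ * v * κ * p³ / (16 * r²) + 3 * d⁴ * v * κ * p² * q / (8 * r²) -
      3 * d⁴ * v * κ * p * q² / (16 * r²) - d⁴ * κ * p³ / (16 * r) +
      d⁴ * κ * p² * q / (16 * r) - 9 * d³ * v * κ * p * p₁ / (8 * r) +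
      3 * d³ * v * κ * p * q₁ / (8 * r) + 3 * d³ * v * κ * p₁ * q / (4 * r) +
      3 * d³ * v * κ * p³ / (16 * r²) - 3 * d³ * v * κ * p² * q / (8 * r²) +
      3 * d³ * v * κ * p * q² / (16 * r²) - 3 * d³ * κ * p * p₁ / 8 +
      d³ * κ * p₁ * q / 8 - 7 * d³ * κ * p³ / (16 * r) +
      d³ * κ * p² * q / (4 * r) + 3 * d³ * κ * p * q² / (16 * r) -
      3 * d² * v * κ * p₂ / 4 + 3 * d² * v * κ * p³ / (16 * r²) -
      3 * d² * v * κ * p² * q / (8 * r²) +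
      3 * d² * v * κ * p * q² / (16 * r²) - d² * κ * r * p₂ / 4 -
      3 * d² * κ * p * p₁ / 2 - d² * κ * p₁ * q / 4 + 3 * d² * κ * p³ / (16 * r) -
      3 * d² * κ * p² * q / (16 * r) + 9 * d * v * κ * p * p₁ / (8 * r) -
      3 * d * v * κ * p * q₁ / (8 * r) - 3 * d * v * κ * p₁ * q / (4 * r) -
      3 * d * v * κ * p³ / (16 * r²) + 3 * d * v * κ * p² * q / (8 * r²) -
      3 * d * v * κ * p * q² / (16 * r²) + 9 * d * κ * p * p₁ / 8 -
      3 * d * κ * p₁ * q / 8 + 9 * d * κ * p³ / (16 * r) - 3 * d * κ * p² * q / (8 * r) -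
      3 * d * κ * p * q² / (16 * r) + 3 * v * κ * p₂ / 4 + 3 * κ * r * p₂ / 4 +
      9 * κ * p * p₁ / 4 := by
  have := charZero K
  have hr := J.r_ne_zero
  conv_lhs => rw [← J.hp, lap_delta, J.lap_can]
  simp only [map_add, map_sub, map_neg, map_zero, Derivation.map_natCast,
    Derivation.map_one_eq_zero, Derivation.leibniz, Derivation.leibniz_pow,
    Derivation.leibniz_div, derivation_ofNat, J.map_d, J.delta_v, J.delta_r, J.delta_one_v,
    J.delta_one_r, J.delta_κ, J.hp₁, J.hp₂, J.hp₃,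
    J.hq₁, J.hq₂, J.hq₃, smul_eq_mul, nsmul_eq_mul]
  push_cast
  field_simp
  ring

theorem lap_r (J : Jets B F κ d v r p q p₁ q₁ p₂ q₂ p₃ q₃) :
    lap B r =
      - 3 * d³ * v * κ * p² / (16 * r) + 3 * d³ * v * κ * q² / (16 * r) -
      d³ * κ * p² / 16 - d³ * κ * q² / 16 - 3 * d² * v * κ * p₁ / 8 -
      3 * d² * v * κ * q₁ / 8 - d² * κ * r * p₁ / 8 + d² * κ * r * q₁ / 8 -
      d² * κ * p² / 4 - d² * κ * q² / 4 + 3 * d * v * κ * p² / (16 * r) -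
      3 * d * v * κ * q² / (16 * r) + 3 * d * κ * p² / 16 + 3 * d * κ * q² / 16 +
      3 * v * κ * p₁ / 8 + 3 * v * κ * q₁ / 8 + 3 * κ * r * p₁ / 8 - 3 * κ * r * q₁ / 8 +
      3 * κ * p² / 8 + 3 * κ * q² / 8 := by
  have := charZero K
  have hr := J.r_ne_zero
  conv_lhs => rw [J.two_mul_r, lap_smul, lap_sub, half_smul, J.lap_can, J.neg.lap_can]
  field_simp
  ring

/-- The determinant of the matrix `∂𝒰`. -/
theorem emb_Delta (J : Jets B F κ d v r p q p₁ q₁ p₂ q₂ p₃ q₃) : emb K (Delta F) = p * q := by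
  have h1 := J.cone.delta_can J.root (0, 0)
  have h2 := J.cone.delta_can J.root.neg (0, 0)
  have h3 := J.cone.pderiv_phi (0, 0)
  have hκ' : emb K (dphi B F) = κ ^ 2 := Eq.symm J.root
  have e : Delta F = pderiv ℂ (0, 0) (vFun F) ^ 2 -
      pderiv ℂ (0, 0) (uFun F) * pderiv ℂ (0, 0) (om F (1, 0) (1, 0)) := by
    rw [Delta, Matrix.det_fin_two]
    have h4 : prim F [0, 1, 0] = prim F [0, 0, 1] := congrArg (pderiv ℂ (0, 0)) (pderiv_comm _ _ _)
    simp only [dU, Matrix.of_apply, Fin.sum_univ_two, eta]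
    simp [h4]
    change pderiv ℂ (0, 0) (vFun F) * pderiv ℂ (0, 0) (vFun F) - pderiv ℂ (0, 0) (uFun F) *
      pderiv ℂ (0, 0) (om F (1, 0) (1, 0)) = _
    ring
  rw [e, h3, ← J.hp, ← J.hq, h1, h2, map_sub, map_pow, map_mul, map_mul, hκ']
  ring

theorem constantCoeff_Delta (h : IsCone B F) : constantCoeff (Delta F) = 1 := by
  have h4 : prim F [0, 1, 0] = prim F [0, 0, 1] := congrArg (pderiv ℂ (0, 0)) (pderiv_comm _ _ _)
  have e0 := h.constantCoeff_pderiv_om 0 0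
  have e1 := h.constantCoeff_pderiv_om 0 1
  change constantCoeff (prim F [0, 0, 0]) = _ at e0
  change constantCoeff (prim F [0, 0, 1]) = _ at e1
  rw [Delta, Matrix.det_fin_two]
  simp only [dU, Matrix.of_apply, Fin.sum_univ_two, eta]
  simp [h4, e0, e1]

theorem mul_ne_zero (J : Jets B F κ d v r p q p₁ q₁ p₂ q₂ p₃ q₃) : p * q ≠ 0 := by
  rw [← J.emb_Delta]
  refine emb_ne_zero fun h0 => ?_
  have := constantCoeff_Delta J.cone.toIsCone
  simp [h0] at this

theorem p_ne_zero (J : Jets B F κ d v r p q p₁ q₁ p₂ q₂ p₃ q₃) : p ≠ 0 := left_ne_zero_of_mul J.mul_ne_zero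

theorem q_ne_zero (J : Jets B F κ d v r p q p₁ q₁ p₂ q₂ p₃ q₃) : q ≠ 0 := right_ne_zero_of_mul J.mul_ne_zero

/-- F₁ behaves like (log p + log q - d(3d - 1) log r)/24. Only logarithmic derivatives are formed,
so no logarithm is needed in the field. -/
theorem extendDerivation_genusOne (J : Jets B F κ d v r p q p₁ q₁ p₂ q₂ p₃ q₃)
    {D : Derivation ℂ LPS LPS} (hD : ∀ f G, D (comp f G) = comp (deriv f) G * D G)
    (hD' : Delta F * D ((PowerSeries.log ℂ).subst (Delta F - 1)) = D (Delta F)) :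
    extendDerivation K D (emb K (genusOne B F)) = (extendDerivation K D p / p +
      extendDerivation K D q / q - d * (3 * d - 1) * (extendDerivation K D r / r)) / 24 := by
  have := charZero K
  have hr := J.r_ne_zero
  have hk := J.root_ne_zero
  have hp := J.p_ne_zero
  have hq := J.q_ne_zero
  have h1 := congrArg (emb K) hD'
  have h2 := congrArg (emb K) J.cone.wFun_mul_comp_deriv_psi
  have h3 := J.cone.extendDerivation_rho J.root hD
  have h4 := congrArg (emb K) (hD (fun x => 24 * psi B.d x) (uFun F))
  rw [comp_const_mul, Derivation.map_smul, emb_smul, map_ofNat, map_mul] at h4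
  rw [map_mul, ← extendDerivation_emb (D := D) (H := Delta F), J.emb_Delta,
    Derivation.leibniz, smul_eq_mul, smul_eq_mul] at h1
  rw [map_mul, ← wK, MvPowerSeries.c_eq_algebraMap, AlgHom.commutes] at h2
  simp only [map_neg, map_mul, map_sub, map_ofNat, map_one, J.hd] at h2
  have hw : r = κ * wK B F K := J.hr.symm
  rw [J.hr] at h3
  rw [genusOne, extendDerivation_emb, map_add, map_add, Derivation.map_smul, emb_smul, map_div₀,
    map_one, map_ofNat]
  have e1 : emb K (D ((PowerSeries.log ℂ).subst (Delta F - 1))) =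
      extendDerivation K D p / p + extendDerivation K D q / q := by
    field_simp
    linear_combination h1
  have e2 : emb K (D (comp (psi B.d) (uFun F))) =
      -(d * (3 * d - 1) * (extendDerivation K D r / r)) / 24 := by
    rw [h3, eq_div_iff (by norm_num), eq_neg_iff_add_eq_zero]
    field_simp
    rw [hw]
    linear_combination κ * wK B F K * h4 + κ * emb K (D (uFun F)) * h2
  rw [e1, e2]
  ring

theorem delta_genusOne (J : Jets B F κ d v r p q p₁ q₁ p₂ q₂ p₃ q₃) (i : Fin 2 × ℕ) :
    delta i (emb K (genusOne B F)) =
      (delta i p / p + delta i q / q - d * (3 * d - 1) * (delta i r / r)) / 24 :=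
  J.extendDerivation_genusOne (fun f G => pderiv_comp f G i)
    (mul_pderiv_log (constantCoeff_Delta J.cone.toIsCone) i)

theorem virK_genusOne (J : Jets B F κ d v r p q p₁ q₁ p₂ q₂ p₃ q₃) (N : ℕ) :
    virK B F K N (emb K (genusOne B F)) = (virK B F K N p / p + virK B F K N q / q -
      d * (3 * d - 1) * (virK B F K N r / r)) / 24 := by
  refine J.extendDerivation_genusOne (fun f G => vir_comp N f G) ?_
  have h1 : Delta F • grad ((PowerSeries.log ℂ).subst (Delta F - 1)) = grad (Delta F) := by
    rw [grad, grad, ← extend_mul]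
    simp only [mul_pderiv_log (constantCoeff_Delta J.cone.toIsCone)]
  rw [vir, flow_apply, flow_apply, ← h1, map_smul, map_smul, smul_eq_mul]

theorem gradK_genusOne (J : Jets B F κ d v r p q p₁ q₁ p₂ q₂ p₃ q₃) : gradK (emb K (genusOne B F)) =
    ((p₁ / p - d * (3 * d - 1) * p / (2 * r)) / 24) • sh 1 (frame F κ) +
      ((q₁ / q + d * (3 * d - 1) * q / (2 * r)) / 24) • sh 1 (frame F (-κ)) +
      (p / 24) • sh 2 (frame F κ) + (q / 24) • sh 2 (frame F (-κ)) := by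
  have := charZero K
  have hr := J.r_ne_zero
  have hp := J.p_ne_zero
  have hq := J.q_ne_zero
  have h1 : gradK (emb K (genusOne B F)) = (1 / (24 * p)) • gradK p + (1 / (24 * q)) • gradK q -
      (d * (3 * d - 1) / (24 * r)) • gradK r := by
    funext a k
    simp only [gradK, extend, Pi.add_apply, Pi.sub_apply, Pi.smul_apply, smul_eq_mul]
    split_ifs
    · rw [J.delta_genusOne]
      field_simp
    · simp
  rw [h1, J.grad_p', J.grad_q', J.grad_r]
  match_scalars <;> field_simp <;> ring

theorem lap_genusOne (J : Jets B F κ d v r p q p₁ q₁ p₂ q₂ p₃ q₃) : lap B (emb K (genusOne B F)) =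
    ((lap B p / p - 1 / 2 * bilK B p p / p ^ 2) + (lap B q / q - 1 / 2 * bilK B q q / q ^ 2) -
      d * (3 * d - 1) * (lap B r / r - 1 / 2 * bilK B r r / r ^ 2)) / 24 := by
  have := charZero K
  rw [← quad_log J.p_ne_zero, ← quad_log J.q_ne_zero, ← quad_log J.r_ne_zero, lap,
    ← smul_eq_mul (d * (3 * d - 1)), ← map_smul, ← map_add, ← map_sub, div_eq_inv_mul,
    ← smul_eq_mul, ← map_smul]
  congr 1
  funext i j
  simp only [J.delta_genusOne, Pi.smul_apply, Pi.sub_apply, Pi.add_apply, smul_eq_mul]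
  rw [Derivation.leibniz_div, map_sub, map_add, derivation_ofNat, Derivation.leibniz,
    Derivation.leibniz (delta i) d, map_sub, Derivation.leibniz (delta i) 3, J.map_d,
    derivation_ofNat, Derivation.map_one_eq_zero]
  simp only [smul_eq_mul]
  field_simp
  ring

/-- The genus one part of `L₂ Z = 0`. -/
theorem genus_one (J : Jets B F κ d v r p q p₁ q₁ p₂ q₂ p₃ q₃) :
    virK B F K 3 (emb K (genusOne B F)) + lap B (emb K F) = 0 := by
  have := charZero K
  have hr := J.r_ne_zero
  have hp := J.p_ne_zero
  have hq := J.q_ne_zero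
  rw [J.virK_genusOne, J.lap_potential, J.virK_p, J.neg.virK_p, J.virK_r]
  field_simp
  ring

end Jets

end

/-! ### The vector field of L₂ on rescaled jets -/

section

variable {B : Background} {F : LPS} {K : Type*} [Field K] [Algebra ℂ K] [Algebra LPS K]
  [IsScalarTower ℂ LPS K] [Algebra.FormallyEtale LPS K] [FaithfulSMul LPS K]

namespace Jets

variable {κ d v r p q p₁ q₁ p₂ q₂ p₃ q₃ : K}

set_option maxHeartbeats 1000000 in
-- The rescaled jets bₙ = rⁿpₙ/p and cₙ = rⁿqₙ/q make the action of the field polynomial. The value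
-- follows by applying the field to the defining relation and cancelling p.
theorem virK_b₁ (J : Jets B F κ d v r p q p₁ q₁ p₂ q₂ p₃ q₃)
    {b₁ c₁ : K} (hb₁ : r * p₁ = b₁ * p)
    (hc₁ : r * q₁ = c₁ * q) :
    virK B F K 3 b₁ =
      - 3 * d ^ 2 * v * r * p / 4 - d ^ 2 * r ^ 2 * p / 4 + 3 * d * v ^ 2 * b₁ / 2 +
      3 * d * v * r * p + 3 * d * v * r * q + d * r ^ 2 * p + d * r ^ 2 * b₁ / 2 -
      d * r ^ 2 * q / 2 - 9 * v ^ 2 * b₁ / 2 - 45 * v * r * p / 4 - 3 * v * r * b₁ -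
      45 * r ^ 2 * p / 4 - 5 * r ^ 2 * b₁ / 2 := by
  have := charZero K
  have hr := J.r_ne_zero
  have hp := J.p_ne_zero
  have hq := J.q_ne_zero
  have hp₁ : p₁ = b₁ * p / r := by rw [← hb₁]; field_simp
  have hq₁ : q₁ = c₁ * q / r := by rw [← hc₁]; field_simp
  have hb := congrArg (virK B F K 3) hb₁
  simp only [Derivation.leibniz, Derivation.leibniz_pow, J.virK_p₁, J.virK_p, J.virK_r,
    smul_eq_mul, nsmul_eq_mul] at hb
  refine mul_right_cancel₀ hp ?_
  rw [hp₁] at hb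
  rw [← sub_eq_iff_eq_add'] at hb
  linear_combination (norm := skip) -hb
  field_simp
  ring

set_option maxHeartbeats 1000000 in
theorem virK_b₂ (J : Jets B F κ d v r p q p₁ q₁ p₂ q₂ p₃ q₃)
    {b₁ b₂ c₁ c₂ : K} (hb₁ : r * p₁ = b₁ * p) (hb₂ : r² * p₂ = b₂ * p)
    (hc₁ : r * q₁ = c₁ * q) (hc₂ : r² * q₂ = c₂ * q) :
    virK B F K 3 b₂ =
      - 3 * d³ * v * r * p² / 16 + 3 * d³ * v * r * p * q / 8 -
      3 * d³ * v * r * q² / 16 - d³ * r² * p² / 16 + d³ * r² * p * q / 8 +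
      d³ * r² * q² / 16 - 15 * d² * v * r * p * b₁ / 4 -
      5 * d² * r² * p² / 4 - 5 * d² * r² * p * b₁ / 4 -
      d² * r² * p * q / 2 - d² * r² * q² / 8 + 3 * d * v² * b₂ +
      3 * d * v * r * p² / 16 + 27 * d * v * r * p * b₁ / 2 - 3 * d * v * r * p * q / 8 +
      9 * d * v * r * b₁ * q + 3 * d * v * r * q² / 16 + 9 * d * v * r * q * c₁ / 2 +
      51 * d * r² * p² / 16 + 9 * d * r² * p * b₁ / 2 + 27 * d * r² * p * q / 8 -
      3 * d * r² * b₁ * q / 2 + d * r² * b₂ + 37 * d * r² * q² / 16 -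
      d * r² * q * c₁ / 2 - 9 * v² * b₂ - 165 * v * r * p * b₁ / 4 - 6 * v * r * b₂ -
      105 * r² * p² / 8 - 165 * r² * p * b₁ / 4 - 5 * r² * b₂ := by
  have := charZero K
  have hr := J.r_ne_zero
  have hp := J.p_ne_zero
  have hq := J.q_ne_zero
  have hp₁ : p₁ = b₁ * p / r := by rw [← hb₁]; field_simp
  have hp₂ : p₂ = b₂ * p / r² := by rw [← hb₂]; field_simp
  have hq₁ : q₁ = c₁ * q / r := by rw [← hc₁]; field_simp
  have hq₂ : q₂ = c₂ * q / r² := by rw [← hc₂]; field_simp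
  have hb := congrArg (virK B F K 3) hb₂
  simp only [Derivation.leibniz, Derivation.leibniz_pow, J.virK_p₂, J.virK_p, J.virK_r,
    smul_eq_mul, nsmul_eq_mul] at hb
  push_cast at hb
  refine mul_right_cancel₀ hp ?_
  rw [hp₁, hp₂, hq₁] at hb
  rw [← sub_eq_iff_eq_add'] at hb
  linear_combination (norm := skip) -hb
  field_simp
  ring

set_option maxHeartbeats 1000000 in
theorem virK_b₃ (J : Jets B F κ d v r p q p₁ q₁ p₂ q₂ p₃ q₃)
    {b₁ b₂ b₃ c₁ c₂ c₃ : K} (hb₁ : r * p₁ = b₁ * p) (hb₂ : r² * p₂ = b₂ * p) (hb₃ : r³ * p₃ =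
      b₃ * p)
    (hc₁ : r * q₁ = c₁ * q) (hc₂ : r² * q₂ = c₂ * q) (hc₃ : r³ * q₃ = c₃ * q) :
    virK B F K 3 b₃ =
      - 3 * d⁴ * v * r * p³ / 32 + 9 * d⁴ * v * r * p² * q / 32 -
      9 * d⁴ * v * r * p * q² / 32 + 3 * d⁴ * v * r * q³ / 32 -
      d⁴ * r² * p³ / 16 + 3 * d⁴ * r² * p² * q / 32 -
      d⁴ * r² * q³ / 32 + 9 * d³ * v * r * p³ / 32 -
      27 * d³ * v * r * p² * b₁ / 16 - 27 * d³ * v * r * p² * q / 32 +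
      39 * d³ * v * r * p * b₁ * q / 16 + 27 * d³ * v * r * p * q² / 32 +
      15 * d³ * v * r * p * q * c₁ / 16 - 3 * d³ * v * r * b₁ * q² / 4 -
      9 * d³ * v * r * q³ / 32 - 15 * d³ * v * r * q² * c₁ / 16 -
      9 * d³ * r² * p³ / 32 - 9 * d³ * r² * p² * b₁ / 16 +
      3 * d³ * r² * p² * q / 8 + 13 * d³ * r² * p * b₁ * q / 16 +
      3 * d³ * r² * p * q² / 32 + 5 * d³ * r² * p * q * c₁ / 16 +
      d³ * r² * b₁ * q² / 4 - 3 * d³ * r² * q³ / 16 +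
      5 * d³ * r² * q² * c₁ / 16 + 3 * d² * v * r * p³ / 32 -
      9 * d² * v * r * p² * q / 32 - 6 * d² * v * r * p * b₁² -
      27 * d² * v * r * p * b₂ / 4 + 9 * d² * v * r * p * q² / 32 -
      3 * d² * v * r * q³ / 32 + d² * r² * p³ / 16 -
      43 * d² * r² * p² * b₁ / 4 - 3 * d² * r² * p² * q / 32 -
      2 * d² * r² * p * b₁² - 27 * d² * r² * p * b₁ * q / 8 -
      9 * d² * r² * p * b₂ / 4 - 7 * d² * r² * p * q * c₁ / 8 -
      d² * r² * b₁ * q² / 2 + d² * r² * q³ / 32 -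
      5 * d² * r² * q² * c₁ / 8 + 9 * d * v² * b₃ / 2 - 9 * d * v * r * p³ / 32 +
      27 * d * v * r * p² * b₁ / 16 + 27 * d * v * r * p² * q / 32 +
      18 * d * v * r * p * b₁² - 39 * d * v * r * p * b₁ * q / 16 + 24 * d * v * r * p * b₂ -
      27 * d * v * r * p * q² / 32 - 15 * d * v * r * p * q * c₁ / 16 +
      3 * d * v * r * b₁ * q² / 4 + 18 * d * v * r * b₁ * q * c₁ + 18 * d * v * r * b₂ * q +
      9 * d * v * r * q³ / 32 + 15 * d * v * r * q² * c₁ / 16 + 6 * d * v * r * q * c₂ +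
      9 * d * r² * p³ / 32 + 411 * d * r² * p² * b₁ / 16 -
      3 * d * r² * p² * q / 8 + 6 * d * r² * p * b₁² +
      321 * d * r² * p * b₁ * q / 16 + 8 * d * r² * p * b₂ -
      3 * d * r² * p * q² / 32 + 113 * d * r² * p * q * c₁ / 16 +
      37 * d * r² * b₁ * q² / 4 - 2 * d * r² * b₁ * q * c₁ - 3 * d * r² * b₂ * q +
      3 * d * r² * b₃ / 2 + 3 * d * r² * q³ / 16 + 141 * d * r² * q² * c₁ / 16 -
      d * r² * q * c₂ / 2 - 27 * v² * b₃ / 2 - 48 * v * r * p * b₁² -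
      261 * v * r * p * b₂ / 4 - 9 * v * r * b₃ - 735 * r² * p² * b₁ / 8 -
      48 * r² * p * b₁² - 261 * r² * p * b₂ / 4 - 15 * r² * b₃ / 2 := by
  have := charZero K
  have hr := J.r_ne_zero
  have hp := J.p_ne_zero
  have hq := J.q_ne_zero
  have hp₁ : p₁ = b₁ * p / r := by rw [← hb₁]; field_simp
  have hp₂ : p₂ = b₂ * p / r² := by rw [← hb₂]; field_simp
  have hp₃ : p₃ = b₃ * p / r³ := by rw [← hb₃]; field_simp
  have hq₁ : q₁ = c₁ * q / r := by rw [← hc₁]; field_simp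
  have hq₂ : q₂ = c₂ * q / r² := by rw [← hc₂]; field_simp
  have hq₃ : q₃ = c₃ * q / r³ := by rw [← hc₃]; field_simp
  have hb := congrArg (virK B F K 3) hb₃
  simp only [Derivation.leibniz, Derivation.leibniz_pow, J.virK_p₃, J.virK_p, J.virK_r,
    smul_eq_mul, nsmul_eq_mul] at hb
  push_cast at hb
  refine mul_right_cancel₀ hp ?_
  rw [hp₁, hp₂, hp₃, hq₁, hq₂] at hb
  rw [← sub_eq_iff_eq_add'] at hb
  linear_combination (norm := skip) -hb
  field_simp
  ring

end Jets

end

/-! ### The genus two constraint for L₂ as a polynomial identity -/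

section

variable {B : Background} {F : LPS} {K : Type*} [Field K] [Algebra ℂ K] [Algebra LPS K]
  [IsScalarTower ℂ LPS K] [Algebra.FormallyEtale LPS K] [FaithfulSMul LPS K]

namespace Jets

variable {κ d v r p q p₁ q₁ p₂ q₂ p₃ q₃ : K}

set_option maxHeartbeats 1000000 in
-- This is the inhomogeneous term of the genus two constraint; the factor 46080 r³pq is chosen
-- because it also clears the denominators of F₂.
theorem second_order_genusOne (J : Jets B F κ d v r p q p₁ q₁ p₂ q₂ p₃ q₃)
    {b₁ b₂ c₁ c₂ : K} (hb₁ : r * p₁ = b₁ * p) (hb₂ : r² * p₂ = b₂ * p)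
    (hc₁ : r * q₁ = c₁ * q) (hc₂ : r² * q₂ = c₂ * q) :
    (1 / 2 * bilK B (emb K (genusOne B F)) (emb K (genusOne B F)) + lap B (emb K (genusOne B F))) *
        (46080 * r³ * p * q) = κ * (
      - 135 * d⁶ * v * r * p³ * q + 135 * d⁶ * v * r * p * q³ -
      45 * d⁶ * r² * p³ * q - 45 * d⁶ * r² * p * q³ +
      1170 * d⁵ * v * r * p³ * q - 1170 * d⁵ * v * r * p * q³ +
      390 * d⁵ * r² * p³ * q + 120 * d⁵ * r² * p² * q² +
      390 * d⁵ * r² * p * q³ - 1320 * d⁴ * v * r * p³ * q +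
      2340 * d⁴ * v * r * p² * b₁ * q + 1320 * d⁴ * v * r * p * q³ +
      2340 * d⁴ * v * r * p * q² * c₁ + 1060 * d⁴ * r² * p³ * q +
      780 * d⁴ * r² * p² * b₁ * q + 140 * d⁴ * r² * p² * q² +
      1060 * d⁴ * r² * p * q³ - 780 * d⁴ * r² * p * q² * c₁ -
      810 * d³ * v * r * p³ * q - 1500 * d³ * v * r * p² * b₁ * q +
      720 * d³ * v * r * p² * q * c₁ + 720 * d³ * v * r * p * b₁ * q² +
      810 * d³ * v * r * p * q³ - 1500 * d³ * v * r * p * q² * c₁ -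
      1920 * d³ * r² * p³ * q - 740 * d³ * r² * p² * b₁ * q +
      2240 * d³ * r² * p² * q² + 100 * d³ * r² * p² * q * c₁ -
      100 * d³ * r² * p * b₁ * q² - 1920 * d³ * r² * p * q³ +
      740 * d³ * r² * p * q² * c₁ + 1455 * d² * v * r * p³ * q -
      2340 * d² * v * r * p² * b₁ * q + 1380 * d² * v * r * p * b₁² * q -
      1440 * d² * v * r * p * b₂ * q - 1455 * d² * v * r * p * q³ -
      2340 * d² * v * r * p * q² * c₁ - 1380 * d² * v * r * p * q * c₁² +
      1440 * d² * v * r * p * q * c₂ - 675 * d² * r² * p³ * q -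
      4320 * d² * r² * p² * b₁ * q - 740 * d² * r² * p² * q² -
      40 * d² * r² * p² * q * c₁ + 460 * d² * r² * p * b₁² * q +
      40 * d² * r² * p * b₁ * q² - 480 * d² * r² * p * b₂ * q -
      675 * d² * r² * p * q³ + 4320 * d² * r² * p * q² * c₁ +
      460 * d² * r² * p * q * c₁² - 480 * d² * r² * p * q * c₂ -
      360 * d * v * r * p³ * q + 1500 * d * v * r * p² * b₁ * q -
      720 * d * v * r * p² * q * c₁ - 720 * d * v * r * p * b₁ * q² +
      360 * d * v * r * p * q³ + 1500 * d * v * r * p * q² * c₁ +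
      750 * d * r² * p³ * q + 2220 * d * r² * p² * b₁ * q -
      720 * d * r² * p² * q² + 20 * d * r² * p² * q * c₁ -
      20 * d * r² * p * b₁ * q² - 80 * d * r² * p * b₁ * q * c₁ +
      750 * d * r² * p * q³ - 2220 * d * r² * p * q² * c₁ -
      1380 * v * r * p * b₁² * q + 1440 * v * r * p * b₂ * q + 1380 * v * r * p * q * c₁² -
      1440 * v * r * p * q * c₂ + 2940 * r² * p² * b₁ * q - 1380 * r² * p * b₁² * q +
      1440 * r² * p * b₂ * q - 2940 * r² * p * q² * c₁ - 1380 * r² * p * q * c₁² +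
      1440 * r² * p * q * c₂) := by
  have := charZero K
  have hr := J.r_ne_zero
  have hp := J.p_ne_zero
  have hq := J.q_ne_zero
  have hp₁ : p₁ = b₁ * p / r := by rw [← hb₁]; field_simp
  have hp₂ : p₂ = b₂ * p / r² := by rw [← hb₂]; field_simp
  have hq₁ : q₁ = c₁ * q / r := by rw [← hc₁]; field_simp
  have hq₂ : q₂ = c₂ * q / r² := by rw [← hc₂]; field_simp
  rw [J.cone.bilK_of J.root J.gradK_genusOne J.gradK_genusOne J.hd J.can_eq J.can_neg_eq,
    J.lap_genusOne, J.lap_p, J.neg.lap_p, J.lap_r, J.bilK_p, J.neg.bilK_p, J.bilK_r, hp₁, hp₂, hq₁,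
    hq₂]
  field_simp
  ring

set_option maxHeartbeats 4000000 in
/-- The genus two part of `L₂ Z = 0`. -/
theorem genus_two (J : Jets B F κ d v r p q p₁ q₁ p₂ q₂ p₃ q₃)
    {b₁ b₂ b₃ c₁ c₂ c₃ : K} (hb₁ : r * p₁ = b₁ * p) (hb₂ : r² * p₂ = b₂ * p) (hb₃ : r³ * p₃ =
      b₃ * p)
    (hc₁ : r * q₁ = c₁ * q) (hc₂ : r² * q₂ = c₂ * q) (hc₃ : r³ * q₃ = c₃ * q) {f : K}
    (hf : f * (46080 * r³ * p * q) = κ * (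
      - 18 * d⁶ * p³ * q - 18 * d⁶ * p * q³ + 126 * d⁵ * p³ * q -
      36 * d⁵ * p² * q² + 126 * d⁵ * p * q³ - 328 * d⁴ * p³ * q +
      252 * d⁴ * p² * b₁ * q + 168 * d⁴ * p² * q² - 328 * d⁴ * p * q³ -
      252 * d⁴ * p * q² * c₁ - d³ * p⁴ + 322 * d³ * p³ * q -
      456 * d³ * p² * b₁ * q - 130 * d³ * p² * q² - 24 * d³ * p² * q * c₁ +
      24 * d³ * p * b₁ * q² + 322 * d³ * p * q³ + 456 * d³ * p * q² * c₁ -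
      d³ * q⁴ + 7 * d² * p⁴ - 14 * d² * p³ * b₁ - 222 * d² * p³ * q +
      2 * d² * p³ * c₁ + 438 * d² * p² * b₁ * q + 186 * d² * p² * q² +
      42 * d² * p² * q * c₁ + 264 * d² * p * b₁² * q - 42 * d² * p * b₁ * q² -
      288 * d² * p * b₂ * q - 222 * d² * p * q³ - 438 * d² * p * q² * c₁ +
      264 * d² * p * q * c₁² - 288 * d² * p * q * c₂ - 2 * d² * b₁ * q³ +
      7 * d² * q⁴ + 14 * d² * q³ * c₁ - 10 * d * p⁴ + 30 * d * p³ * b₁ +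
      80 * d * p³ * q - 2 * d * p³ * c₁ - 154 * d * p² * b₁ * q +
      4 * d * p² * b₁ * c₁ - 20 * d * p² * b₂ - 100 * d * p² * q² -
      34 * d * p² * q * c₁ + 60 * d * p² * c₁² - 36 * d * p² * c₂ -
      132 * d * p * b₁² * q + 34 * d * p * b₁ * q² - 40 * d * p * b₁ * q * c₁ +
      152 * d * p * b₂ * q + 80 * d * p * q³ + 154 * d * p * q² * c₁ -
      132 * d * p * q * c₁² + 152 * d * p * q * c₂ + 60 * d * b₁² * q² +
      2 * d * b₁ * q³ + 4 * d * b₁ * q² * c₁ - 36 * d * b₂ * q² - 10 * d * q⁴ -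
      30 * d * q³ * c₁ - 20 * d * q² * c₂ - 256 * p * c₁³ + 336 * p * c₁ * c₂ -
      80 * p * c₃ + 256 * b₁³ * q - 336 * b₁ * b₂ * q + 80 * b₃ * q)) :
    virK B F K 3 f + (1 / 2 * bilK B (emb K (genusOne B F)) (emb K (genusOne B F)) +
      lap B (emb K (genusOne B F))) = 0 := by
  have := charZero K
  have hr := J.r_ne_zero
  have hp := J.p_ne_zero
  have hq := J.q_ne_zero
  have hT := J.second_order_genusOne hb₁ hb₂ hc₁ hc₂
  have e₁ := J.virK_b₁ hb₁ hc₁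
  have e₂ := J.virK_b₂ hb₁ hb₂ hc₁ hc₂
  have e₃ := J.virK_b₃ hb₁ hb₂ hb₃ hc₁ hc₂ hc₃
  -- On the other sheet r changes sign, so the rescaled jets of odd order change sign as well.
  have n₁ : -r * q₁ = -c₁ * q := by linear_combination -hc₁
  have n₂ : (-r) ^ 2 * q₂ = c₂ * q := by linear_combination hc₂
  have n₃ : (-r) ^ 3 * q₃ = -c₃ * q := by linear_combination -hc₃
  have m₁ : -r * p₁ = -b₁ * p := by linear_combination -hb₁
  have m₂ : (-r) ^ 2 * p₂ = b₂ * p := by linear_combination hb₂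
  have m₃ : (-r) ^ 3 * p₃ = -b₃ * p := by linear_combination -hb₃
  have f₁ := J.neg.virK_b₁ n₁ m₁
  have f₂ := J.neg.virK_b₂ n₁ n₂ m₁ m₂
  have f₃ := J.neg.virK_b₃ n₁ n₂ n₃ m₁ m₂ m₃
  have gp := J.virK_p
  have gq := J.neg.virK_p
  rw [map_neg, neg_eq_iff_eq_neg] at f₁ f₃
  have hV := congrArg (virK B F K 3) hf
  simp only [map_add, map_sub, map_neg, Derivation.leibniz, Derivation.leibniz_pow,
    derivation_ofNat, J.map_d, J.virK_r, J.virK_root, smul_eq_mul, nsmul_eq_mul] at hV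
  push_cast at hV
  rw [e₁, e₂, e₃, f₁, f₂, f₃, gp, gq] at hV
  have h0 : 46080 * r³ * p * q ≠ 0 :=
    _root_.mul_ne_zero (_root_.mul_ne_zero (_root_.mul_ne_zero (by norm_num) (pow_ne_zero 3 hr)) hp) hq
  refine mul_right_cancel₀ h0 ?_
  -- The coefficient of `hf` is the logarithmic derivative of r³pq along the vector field.
  linear_combination hV + hT - (-3 * (r² + 3 * v²) +
    (3 * d * v² / 2 + d * r² / 2 - 9 * v² / 2 - 9 * v * r - 9 * r² / 2) +
    (3 * d * v² / 2 + d * r² / 2 - 9 * v² / 2 + 9 * v * r - 9 * r² / 2)) * hf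

end Jets

end

section

variable {B : Background} {F : LPS} {K : Type*} [Field K] [Algebra ℂ K] [Algebra LPS K]
  [IsScalarTower ℂ LPS K] [Algebra.FormallyEtale LPS K] [FaithfulSMul LPS K]

/-! ### Correlators of primary fields in canonical coordinates -/

/-- The derivatives `∂₀^m ∂₁^n`. -/
def cr (f : K) (m n : ℕ) : K := (delta (K := K) (0, 0))^[m] ((delta (K := K) (1, 0))^[n] f)

theorem cr_succ_left (f : K) (m n : ℕ) : cr f (m + 1) n = delta (0, 0) (cr f m n) := by
  rw [cr, Function.iterate_succ_apply', cr]

theorem cr_succ_right (f : K) (m n : ℕ) : cr f m (n + 1) = delta (1, 0) (cr f m n) := by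
  induction m with
  | zero => rw [cr, cr, Function.iterate_succ_apply']; rfl
  | succ m ih => rw [cr_succ_left, ih, cr_succ_left, delta_comm]

/-- Primary derivatives commute, so only the multiplicity of each label matters. -/
theorem emb_prim_count (H : LPS) (l : List (Fin 2)) :
    emb K (prim H l) = cr (emb K H) (l.count 0) (l.count 1) := by
  induction l with
  | nil => rfl
  | cons a l ih =>
    change emb K (pderiv ℂ (a, 0) (prim H l)) = _
    rw [← delta_emb, ih]
    fin_cases a
    · simp [cr_succ_left]
    · simp [cr_succ_right]

theorem emb_prim_one (H : LPS) (a : Fin 2) :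
    emb K (prim H [a]) = cr (emb K H) (1 - a) a := by
  rw [emb_prim_count]; fin_cases a <;> rfl

theorem emb_prim_two (H : LPS) (a b : Fin 2) :
    emb K (prim H [a, b]) = cr (emb K H) (2 - (a + b)) (a + b : ℕ) := by
  rw [emb_prim_count]; fin_cases a <;> fin_cases b <;> rfl

theorem emb_prim_zero_one (H : LPS) (a : Fin 2) :
    emb K (prim H [0, a]) = cr (emb K H) (2 - a) a := by
  rw [emb_prim_count]; fin_cases a <;> rfl

theorem emb_prim_zero_two (H : LPS) (a b : Fin 2) :
    emb K (prim H [0, a, b]) = cr (emb K H) (3 - (a + b)) (a + b : ℕ) := by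
  rw [emb_prim_count]; fin_cases a <;> fin_cases b <;> rfl

theorem emb_prim_zero_three (H : LPS) (a b c : Fin 2) :
    emb K (prim H [0, a, b, c]) = cr (emb K H) (4 - (a + b + c)) (a + b + c : ℕ) := by
  rw [emb_prim_count]; fin_cases a <;> fin_cases b <;> fin_cases c <;> rfl

theorem emb_prim_zero_four (H : LPS) (a b c e : Fin 2) :
    emb K (prim H [0, a, b, c, e]) = cr (emb K H) (5 - (a + b + c + e)) (a + b + c + e : ℕ) := by
  rw [emb_prim_count]
  fin_cases a <;> fin_cases b <;> fin_cases c <;> fin_cases e <;> rfl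

theorem emb_prim_zero_zero_two (H : LPS) (a b : Fin 2) :
    emb K (prim H [0, 0, a, b]) = cr (emb K H) (4 - (a + b)) (a + b : ℕ) := by
  rw [emb_prim_count]; fin_cases a <;> fin_cases b <;> rfl

theorem emb_prim_zero_zero_three (H : LPS) (a b c : Fin 2) :
    emb K (prim H [0, 0, a, b, c]) = cr (emb K H) (5 - (a + b + c)) (a + b + c : ℕ) := by
  rw [emb_prim_count]; fin_cases a <;> fin_cases b <;> fin_cases c <;> rfl

theorem emb_prim_zero_zero_four (H : LPS) (a b c e : Fin 2) :
    emb K (prim H [0, 0, a, b, c, e]) =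
      cr (emb K H) (6 - (a + b + c + e)) (a + b + c + e : ℕ) := by
  rw [emb_prim_count]
  fin_cases a <;> fin_cases b <;> fin_cases c <;> fin_cases e <;> rfl

namespace Jets

variable {κ d v r p q p₁ q₁ p₂ q₂ p₃ q₃ : K}

theorem emb_delta_uFun (J : Jets B F κ d v r p q p₁ q₁ p₂ q₂ p₃ q₃) :
    emb K (pderiv ℂ (0, 0) (uFun F)) = (p - q) / (2 * κ) := by
  have := charZero K
  have hk := J.root_ne_zero
  have h1 := J.cone.delta_rho J.root (0, 0)
  rw [J.hr, J.delta_r] at h1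
  rw [eq_div_iff (by simpa using hk)]
  linear_combination -2 * h1

theorem emb_delta_vFun (J : Jets B F κ d v r p q p₁ q₁ p₂ q₂ p₃ q₃) :
    emb K (pderiv ℂ (0, 0) (vFun F)) = (p + q) / 2 := by
  rw [← delta_emb, ← J.delta_v, ← J.hv, vK]

theorem cr_three_zero (J : Jets B F κ d v r p q p₁ q₁ p₂ q₂ p₃ q₃) :
    cr (emb K F) 3 0 = (p - q) / (2 * κ) := by
  rw [← J.emb_delta_uFun]
  exact (emb_prim_count F [0, 0, 0]).symm

theorem cr_two_one (J : Jets B F κ d v r p q p₁ q₁ p₂ q₂ p₃ q₃) :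
    cr (emb K F) 2 1 = (p + q) / 2 := by
  rw [← J.emb_delta_vFun]
  exact (emb_prim_count F [0, 0, 1]).symm

theorem cr_one_two (J : Jets B F κ d v r p q p₁ q₁ p₂ q₂ p₃ q₃) :
    cr (emb K F) 1 2 = κ * (p - q) / 2 := by
  have := charZero K
  have hk := J.root_ne_zero
  have hκ' : emb K (dphi B F) = κ ^ 2 := Eq.symm J.root
  have h1 : emb K (pderiv ℂ (0, 0) (om F (1, 0) (1, 0))) = cr (emb K F) 1 2 :=
    emb_prim_count F [0, 1, 1]
  rw [← h1, J.cone.pderiv_phi, map_mul, hκ', J.emb_delta_uFun]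
  field_simp

/-- The matrix `𝒞`, in the frame of canonical coordinates. -/
theorem emb_CC (J : Jets B F κ d v r p q p₁ q₁ p₂ q₂ p₃ q₃) (a b : Fin 2) :
    emb K (CC F a b) = (if a = 0 then κ else 1) * (if b = 0 then κ else 1) / (2 * κ * p) -
      (if a = 0 then -κ else 1) * (if b = 0 then -κ else 1) / (2 * κ * q) := by
  have := charZero K
  have hk := J.root_ne_zero
  have hp := J.p_ne_zero
  have hq := J.q_ne_zero
  set M : Matrix (Fin 2) (Fin 2) LPS := Matrix.of fun a b => prim F [0, a, b] with hM
  have h4 : prim F [0, 1, 0] = prim F [0, 0, 1] := congrArg (pderiv ℂ (0, 0)) (pderiv_comm _ _ _)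
  have hdet : M.det = -Delta F := by
    rw [Delta, Matrix.det_fin_two, Matrix.det_fin_two]
    simp only [dU, hM, Matrix.of_apply, Fin.sum_univ_two, eta]
    simp [h4]
  have hu : IsUnit M.det := by
    rw [MvPowerSeries.isUnit_iff_constantCoeff, hdet, map_neg,
      constantCoeff_Delta J.cone.toIsCone]
    exact isUnit_one.neg
  have h1 : M * CC F = 1 := Matrix.mul_nonsing_inv M hu
  have h2 : M.map (emb K) * (CC F).map (emb K) = 1 := by
    rw [← Matrix.map_mul, h1]
    simp
  have hMe : M.map (emb K) = !![(p - q) / (2 * κ), (p + q) / 2; (p + q) / 2, κ * (p - q) / 2] := by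
    ext a b
    simp only [Matrix.map_apply, hM, Matrix.of_apply, emb_prim_zero_two]
    fin_cases a <;> fin_cases b
    · exact J.cr_three_zero
    · exact J.cr_two_one
    · exact J.cr_two_one
    · exact J.cr_one_two
  -- The candidate is a combination of the rank one matrices of (κ, 1) and (-κ, 1). Being a left
  -- inverse of the image of the matrix, it equals the image of the inverse.
  set X : Matrix (Fin 2) (Fin 2) K := Matrix.of fun a b =>
    (if a = 0 then κ else 1) * (if b = 0 then κ else 1) / (2 * κ * p) -
      (if a = 0 then -κ else 1) * (if b = 0 then -κ else 1) / (2 * κ * q) with hX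
  have h3 : X * M.map (emb K) = 1 := by
    rw [hMe]
    ext a b
    fin_cases a <;> fin_cases b <;> simp [hX, Matrix.mul_apply, Fin.sum_univ_two] <;> field_simp <;>
      ring
  have h5 : (CC F).map (emb K) = X := by
    rw [← Matrix.one_mul ((CC F).map (emb K)), ← h3, Matrix.mul_assoc, h2, Matrix.mul_one]
  have := congrFun (congrFun h5 a) b
  simpa [hX] using this

end Jets

end

section

/-! ### Contractions of symmetric tensors in a frame of two vectors -/

section Contractions

variable {K : Type*} [Field K] {κ m n : K} {C : ℕ → K}

/-- The matrix with entries C(a + b) is m e⊗e + n e'⊗e' with e = (κ, 1) and e' = (-κ, 1). A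
contraction of symmetric tensors is thus a sum over their components along e and e'; the other
contractions work in the same way. -/
theorem contraction_four (hC₀ : C 0 = κ ^ 2 * (m + n)) (hC₁ : C 1 = κ * (m - n))
    (hC₂ : C 2 = m + n) (x : ℕ → K) :
    ∑ a : Fin 2, ∑ b : Fin 2, ∑ c : Fin 2, ∑ e : Fin 2, x (a + b + c + e) * C (a + b) * C (c + e) =
      m ^ 2 * (κ ^ 4 * x 0 + 4 * κ ^ 3 * x 1 + 6 * κ ^ 2 * x 2 + 4 * κ * x 3 + x 4) +
      2 * m * n * (κ ^ 4 * x 0 - 2 * κ ^ 2 * x 2 + x 4) +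
      n ^ 2 * (κ ^ 4 * x 0 - 4 * κ ^ 3 * x 1 + 6 * κ ^ 2 * x 2 - 4 * κ * x 3 + x 4) := by
  simp only [Fin.sum_univ_two, Fin.val_zero, Fin.val_one, Nat.reduceAdd, hC₀, hC₁, hC₂]
  ring

theorem contraction_two_four (hC₀ : C 0 = κ² * (m + n)) (hC₁ : C 1 = κ * (m - n))
    (hC₂ : C 2 = m + n) (y z : ℕ → K) :
    ∑ a : Fin 2, ∑ b : Fin 2, ∑ c : Fin 2, ∑ e : Fin 2, ∑ f : Fin 2, ∑ g : Fin 2,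
      y (a + b) * z (c + e + f + g) * C (a + c) * C (b + e) * C (f + g) =
      m² * (κ² * y 0 + 2 * κ * y 1 + y 2) *
        (m * (κ⁴ * z 0 + 4 * κ³ * z 1 + 6 * κ² * z 2 + 4 * κ * z 3 + z 4) +
          n * (κ⁴ * z 0 - 2 * κ² * z 2 + z 4)) +
      2 * m * n * (y 2 - κ² * y 0) *
        (m * (-κ⁴ * z 0 - 2 * κ³ * z 1 + 2 * κ * z 3 + z 4) +
          n * (-κ⁴ * z 0 + 2 * κ³ * z 1 - 2 * κ * z 3 + z 4)) +
      n² * (κ² * y 0 - 2 * κ * y 1 + y 2) *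
        (m * (κ⁴ * z 0 - 2 * κ² * z 2 + z 4) +
          n * (κ⁴ * z 0 - 4 * κ³ * z 1 + 6 * κ² * z 2 - 4 * κ * z 3 + z 4)) := by
  simp only [Fin.sum_univ_two, Fin.val_zero, Fin.val_one, Nat.reduceAdd, hC₀, hC₁, hC₂]
  ring

theorem contraction_three_three (hC₀ : C 0 = κ² * (m + n)) (hC₁ : C 1 = κ * (m - n))
    (hC₂ : C 2 = m + n) (y z : ℕ → K) :
    ∑ a : Fin 2, ∑ b : Fin 2, ∑ c : Fin 2, ∑ e : Fin 2, ∑ f : Fin 2, ∑ g : Fin 2,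
      y (a + b + c) * z (e + f + g) * C (a + e) * C (b + f) * C (c + g) =
      m³ * (κ³ * y 0 + 3 * κ² * y 1 + 3 * κ * y 2 + y 3) *
        (κ³ * z 0 + 3 * κ² * z 1 + 3 * κ * z 2 + z 3) +
      3 * m² * n * (-κ³ * y 0 - κ² * y 1 + κ * y 2 + y 3) *
        (-κ³ * z 0 - κ² * z 1 + κ * z 2 + z 3) +
      3 * m * n² * (κ³ * y 0 - κ² * y 1 - κ * y 2 + y 3) *
        (κ³ * z 0 - κ² * z 1 - κ * z 2 + z 3) +
      n³ * (-κ³ * y 0 + 3 * κ² * y 1 - 3 * κ * y 2 + y 3) *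
        (-κ³ * z 0 + 3 * κ² * z 1 - 3 * κ * z 2 + z 3) := by
  simp only [Fin.sum_univ_two, Fin.val_zero, Fin.val_one, Nat.reduceAdd, hC₀, hC₁, hC₂]
  ring

set_option maxHeartbeats 2000000 in
theorem contraction_two_three_three (hC₀ : C 0 = κ² * (m + n)) (hC₁ : C 1 = κ * (m - n))
    (hC₂ : C 2 = m + n) (y z : ℕ → K) :
    ∑ a : Fin 2, ∑ b : Fin 2, ∑ c : Fin 2, ∑ e : Fin 2, ∑ f : Fin 2, ∑ g : Fin 2,
      ∑ h : Fin 2, ∑ k : Fin 2,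
      y (a + b) * z (c + e + f) * z (g + h + k) * C (a + c) * C (b + g) * C (e + h) * C (f + k) =
      m² * (κ² * y 0 + 2 * κ * y 1 + y 2) *
        (m² * (κ³ * z 0 + 3 * κ² * z 1 + 3 * κ * z 2 + z 3) ^ 2 +
          2 * m * n * (-κ³ * z 0 - κ² * z 1 + κ * z 2 + z 3) ^ 2 +
          n² * (κ³ * z 0 - κ² * z 1 - κ * z 2 + z 3) ^ 2) +
      2 * m * n * (y 2 - κ² * y 0) *
        (m² * (κ³ * z 0 + 3 * κ² * z 1 + 3 * κ * z 2 + z 3) *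
            (-κ³ * z 0 - κ² * z 1 + κ * z 2 + z 3) +
          2 * m * n * (-κ³ * z 0 - κ² * z 1 + κ * z 2 + z 3) *
            (κ³ * z 0 - κ² * z 1 - κ * z 2 + z 3) +
          n² * (κ³ * z 0 - κ² * z 1 - κ * z 2 + z 3) *
            (-κ³ * z 0 + 3 * κ² * z 1 - 3 * κ * z 2 + z 3)) +
      n² * (κ² * y 0 - 2 * κ * y 1 + y 2) *
        (m² * (-κ³ * z 0 - κ² * z 1 + κ * z 2 + z 3) ^ 2 +
          2 * m * n * (κ³ * z 0 - κ² * z 1 - κ * z 2 + z 3) ^ 2 +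
          n² * (-κ³ * z 0 + 3 * κ² * z 1 - 3 * κ * z 2 + z 3) ^ 2) := by
  simp only [Fin.sum_univ_two, Fin.val_zero, Fin.val_one, Nat.reduceAdd, hC₀, hC₁, hC₂]
  ring

theorem contraction_two (hC₀ : C 0 = κ ^ 2 * (m + n)) (hC₁ : C 1 = κ * (m - n))
    (hC₂ : C 2 = m + n) (w y s : ℕ → K) :
    ∑ a : Fin 2, ∑ b : Fin 2, (1 / 2 * w (a + b) + 4 / 5 * (y a * s b)) * C (a + b) =
      m * (1 / 2 * (κ ^ 2 * w 0 + 2 * κ * w 1 + w 2) + 4 / 5 * (κ * y 0 + y 1) * (κ * s 0 + s 1)) +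
      n * (1 / 2 * (κ ^ 2 * w 0 - 2 * κ * w 1 + w 2) +
        4 / 5 * (y 1 - κ * y 0) * (s 1 - κ * s 0)) := by
  simp only [Fin.sum_univ_two, Fin.val_zero, Fin.val_one, Nat.reduceAdd, hC₀, hC₁, hC₂]
  ring

theorem contraction_two_two (hC₀ : C 0 = κ ^ 2 * (m + n)) (hC₁ : C 1 = κ * (m - n))
    (hC₂ : C 2 = m + n) (y z s : ℕ → K) :
    ∑ a : Fin 2, ∑ b : Fin 2, ∑ c : Fin 2, ∑ e : Fin 2,
      y (a + b) * (6 / 5 * z (c + e) - 1 / 10 * (s c * s e)) * C (a + c) * C (b + e) =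
      m ^ 2 * (κ ^ 2 * y 0 + 2 * κ * y 1 + y 2) *
        (6 / 5 * (κ ^ 2 * z 0 + 2 * κ * z 1 + z 2) - 1 / 10 * (κ * s 0 + s 1) ^ 2) +
      2 * m * n * (y 2 - κ ^ 2 * y 0) *
        (6 / 5 * (z 2 - κ ^ 2 * z 0) - 1 / 10 * (κ * s 0 + s 1) * (s 1 - κ * s 0)) +
      n ^ 2 * (κ ^ 2 * y 0 - 2 * κ * y 1 + y 2) *
        (6 / 5 * (κ ^ 2 * z 0 - 2 * κ * z 1 + z 2) - 1 / 10 * (s 1 - κ * s 0) ^ 2) := by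
  simp only [Fin.sum_univ_two, Fin.val_zero, Fin.val_one, Nat.reduceAdd, hC₀, hC₁, hC₂]
  ring

theorem contraction_three_one (hC₀ : C 0 = κ ^ 2 * (m + n)) (hC₁ : C 1 = κ * (m - n))
    (hC₂ : C 2 = m + n) (y z w s : ℕ → K) :
    ∑ a : Fin 2, ∑ b : Fin 2, ∑ c : Fin 2, ∑ e : Fin 2,
      (7 / 10 * (y (a + b + c) * s e) - 3 / 10 * (z (a + b + c) * w e)) * C (a + b) * C (c + e) =
      m ^ 2 * (7 / 10 * (κ ^ 3 * y 0 + 3 * κ ^ 2 * y 1 + 3 * κ * y 2 + y 3) * (κ * s 0 + s 1) -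
        3 / 10 * (κ ^ 3 * z 0 + 3 * κ ^ 2 * z 1 + 3 * κ * z 2 + z 3) * (κ * w 0 + w 1)) +
      m * n * (7 / 10 * ((-κ ^ 3 * y 0 - κ ^ 2 * y 1 + κ * y 2 + y 3) * (s 1 - κ * s 0) +
          (κ ^ 3 * y 0 - κ ^ 2 * y 1 - κ * y 2 + y 3) * (κ * s 0 + s 1)) -
        3 / 10 * ((-κ ^ 3 * z 0 - κ ^ 2 * z 1 + κ * z 2 + z 3) * (w 1 - κ * w 0) +
          (κ ^ 3 * z 0 - κ ^ 2 * z 1 - κ * z 2 + z 3) * (κ * w 0 + w 1))) +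
      n ^ 2 * (7 / 10 * (-κ ^ 3 * y 0 + 3 * κ ^ 2 * y 1 - 3 * κ * y 2 + y 3) * (s 1 - κ * s 0) -
        3 / 10 * (-κ ^ 3 * z 0 + 3 * κ ^ 2 * z 1 - 3 * κ * z 2 + z 3) * (w 1 - κ * w 0)) := by
  simp only [Fin.sum_univ_two, Fin.val_zero, Fin.val_one, Nat.reduceAdd, hC₀, hC₁, hC₂]
  ring

set_option maxHeartbeats 1000000 in
theorem contraction_two_three_one (hC₀ : C 0 = κ² * (m + n)) (hC₁ : C 1 = κ * (m - n))
    (hC₂ : C 2 = m + n) (y z s : ℕ → K) :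
    ∑ a : Fin 2, ∑ b : Fin 2, ∑ c : Fin 2, ∑ e : Fin 2, ∑ f : Fin 2, ∑ g : Fin 2,
      y (a + b) * z (c + e + f) * s g * (3 / 10 * (C (a + g) * C (b + c) * C (e + f)) -
        23 / 10 * (C (a + c) * C (b + e) * C (f + g))) =
      3 / 10 * (
        (m * (κ * s 0 + s 1) * (m * (κ² * y 0 + 2 * κ * y 1 + y 2)) +
          n * (s 1 - κ * s 0) * (m * (y 2 - κ² * y 0))) *
            (m * (κ³ * z 0 + 3 * κ² * z 1 + 3 * κ * z 2 + z 3) +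
              n * (κ³ * z 0 - κ² * z 1 - κ * z 2 + z 3)) +
        (m * (κ * s 0 + s 1) * (n * (y 2 - κ² * y 0)) +
          n * (s 1 - κ * s 0) * (n * (κ² * y 0 - 2 * κ * y 1 + y 2))) *
            (m * (-κ³ * z 0 - κ² * z 1 + κ * z 2 + z 3) +
              n * (-κ³ * z 0 + 3 * κ² * z 1 - 3 * κ * z 2 + z 3))) -
      23 / 10 * (
        m² * (κ² * y 0 + 2 * κ * y 1 + y 2) *
          (m * (κ³ * z 0 + 3 * κ² * z 1 + 3 * κ * z 2 + z 3) * (κ * s 0 + s 1) +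
            n * (-κ³ * z 0 - κ² * z 1 + κ * z 2 + z 3) * (s 1 - κ * s 0)) +
        2 * m * n * (y 2 - κ² * y 0) *
          (m * (-κ³ * z 0 - κ² * z 1 + κ * z 2 + z 3) * (κ * s 0 + s 1) +
            n * (κ³ * z 0 - κ² * z 1 - κ * z 2 + z 3) * (s 1 - κ * s 0)) +
        n² * (κ² * y 0 - 2 * κ * y 1 + y 2) *
          (m * (κ³ * z 0 - κ² * z 1 - κ * z 2 + z 3) * (κ * s 0 + s 1) +
            n * (-κ³ * z 0 + 3 * κ² * z 1 - 3 * κ * z 2 + z 3) * (s 1 - κ * s 0))) := by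
  simp only [Fin.sum_univ_two, Fin.val_zero, Fin.val_one, Nat.reduceAdd, hC₀, hC₁, hC₂]
  ring

end Contractions

end

/-! ### Primary correlators of genus 0 in terms of the jets -/

section

variable {B : Background} {F : LPS} {K : Type*} [Field K] [Algebra ℂ K] [Algebra LPS K]
  [IsScalarTower ℂ LPS K] [Algebra.FormallyEtale LPS K] [FaithfulSMul LPS K]

namespace Jets

variable {κ d v r p q p₁ q₁ p₂ q₂ p₃ q₃ : K}

theorem delta_one_q (J : Jets B F κ d v r p q p₁ q₁ p₂ q₂ p₃ q₃) :
    delta (1, 0) q = -(d * κ * (p - q) / (2 * r) * q) - κ * q₁ := by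
  have := J.r_ne_zero
  rw [J.neg.delta_one_p]
  field_simp
  ring

/-- The derivative ∂_{0,1} is commuted past ∂, after which `delta_one_p` applies. -/
theorem delta_one_p₁ (J : Jets B F κ d v r p q p₁ q₁ p₂ q₂ p₃ q₃) : delta (1, 0) p₁ =
    κ * (d ^ 2 * p ^ 3 - 2 * d ^ 2 * p ^ 2 * q + d ^ 2 * p * q ^ 2 + 6 * d * r * p * p₁ -
      2 * d * r * p * q₁ - 4 * d * r * p₁ * q - d * p ^ 3 + 2 * d * p ^ 2 * q - d * p * q ^ 2 +
      4 * r ^ 2 * p₂) / (4 * r ^ 2) := by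
  have := charZero K
  have hr := J.r_ne_zero
  have hk := J.root_ne_zero
  rw [← J.hp₁, delta_comm, J.delta_one_p]
  simp only [Derivation.leibniz_div, Derivation.leibniz, Derivation.leibniz_pow, map_add, map_sub,
    map_neg, derivation_ofNat, Derivation.map_natCast, Derivation.map_one_eq_zero,
    J.delta_κ, J.delta_r, J.delta_one_r, J.map_d, J.hp, J.hq, J.hp₁, J.hq₁, J.hp₂, J.hq₂, J.hp₃,
    J.hq₃, J.delta_one_p, J.delta_one_q,
    smul_eq_mul, nsmul_eq_mul]
  field_simp
  ring

theorem delta_one_q₁ (J : Jets B F κ d v r p q p₁ q₁ p₂ q₂ p₃ q₃) : delta (1, 0) q₁ =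
    κ * (- d ^ 2 * p ^ 2 * q + 2 * d ^ 2 * p * q ^ 2 - d ^ 2 * q ^ 3 - 4 * d * r * p * q₁ -
      2 * d * r * p₁ * q + 6 * d * r * q * q₁ + d * p ^ 2 * q - 2 * d * p * q ^ 2 + d * q ^ 3 -
      4 * r ^ 2 * q₂) / (4 * r ^ 2) := by
  have := J.r_ne_zero
  rw [J.neg.delta_one_p₁]
  field_simp
  ring

/-- This correlator and the ones below are derivatives of the three-point functions, with ∂_{0,1}
expressed on jets. -/
theorem cr_four_zero (J : Jets B F κ d v r p q p₁ q₁ p₂ q₂ p₃ q₃) : cr (emb K F) 4 0 =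
    (- d * p ^ 2 + 2 * d * p * q - d * q ^ 2 + 2 * r * p₁ - 2 * r * q₁) / (4 * κ * r) := by
  have := charZero K
  have hr := J.r_ne_zero
  have hk := J.root_ne_zero
  rw [cr_succ_left, J.cr_three_zero]
  simp only [Derivation.leibniz_div, Derivation.leibniz, Derivation.leibniz_pow, map_add, map_sub,
    map_neg, derivation_ofNat, Derivation.map_natCast, Derivation.map_one_eq_zero,
    J.delta_κ, J.delta_r, J.delta_one_r, J.map_d, J.hp, J.hq, J.hp₁, J.hq₁, J.hp₂, J.hq₂, J.hp₃,
    J.hq₃, J.delta_one_p, J.delta_one_q, J.delta_one_p₁, J.delta_one_q₁,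
    smul_eq_mul, nsmul_eq_mul]
  field_simp
  ring

theorem cr_three_one (J : Jets B F κ d v r p q p₁ q₁ p₂ q₂ p₃ q₃) : cr (emb K F) 3 1 =
    (p₁ + q₁) / 2 := by
  have := charZero K
  have hr := J.r_ne_zero
  have hk := J.root_ne_zero
  rw [cr_succ_left, J.cr_two_one]
  simp only [Derivation.leibniz_div, Derivation.leibniz, Derivation.leibniz_pow, map_add, map_sub,
    map_neg, derivation_ofNat, Derivation.map_natCast, Derivation.map_one_eq_zero,
    J.delta_κ, J.delta_r, J.delta_one_r, J.map_d, J.hp, J.hq, J.hp₁, J.hq₁, J.hp₂, J.hq₂, J.hp₃,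
    J.hq₃, J.delta_one_p, J.delta_one_q, J.delta_one_p₁, J.delta_one_q₁,
    smul_eq_mul, nsmul_eq_mul]
  field_simp
  ring

theorem cr_two_two (J : Jets B F κ d v r p q p₁ q₁ p₂ q₂ p₃ q₃) : cr (emb K F) 2 2 =
    κ * (d * p ^ 2 - 2 * d * p * q + d * q ^ 2 + 2 * r * p₁ - 2 * r * q₁) / (4 * r) := by
  have := charZero K
  have hr := J.r_ne_zero
  have hk := J.root_ne_zero
  rw [cr_succ_left, J.cr_one_two]
  simp only [Derivation.leibniz_div, Derivation.leibniz, Derivation.leibniz_pow, map_add, map_sub,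
    map_neg, derivation_ofNat, Derivation.map_natCast, Derivation.map_one_eq_zero,
    J.delta_κ, J.delta_r, J.delta_one_r, J.map_d, J.hp, J.hq, J.hp₁, J.hq₁, J.hp₂, J.hq₂, J.hp₃,
    J.hq₃, J.delta_one_p, J.delta_one_q, J.delta_one_p₁, J.delta_one_q₁,
    smul_eq_mul, nsmul_eq_mul]
  field_simp
  ring

theorem cr_one_three (J : Jets B F κ d v r p q p₁ q₁ p₂ q₂ p₃ q₃) : cr (emb K F) 1 3 =
    κ ^ 2 * (d * p ^ 2 - d * q ^ 2 + r * p₁ + r * q₁) / (2 * r) := by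
  have := charZero K
  have hr := J.r_ne_zero
  have hk := J.root_ne_zero
  rw [cr_succ_right, J.cr_one_two]
  simp only [Derivation.leibniz_div, Derivation.leibniz, Derivation.leibniz_pow, map_add, map_sub,
    map_neg, derivation_ofNat, Derivation.map_natCast, Derivation.map_one_eq_zero,
    J.delta_κ, J.delta_r, J.delta_one_r, J.map_d, J.hp, J.hq, J.hp₁, J.hq₁, J.hp₂, J.hq₂, J.hp₃,
    J.hq₃, J.delta_one_p, J.delta_one_q, J.delta_one_p₁, J.delta_one_q₁,
    smul_eq_mul, nsmul_eq_mul]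
  field_simp
  ring

theorem cr_five_zero (J : Jets B F κ d v r p q p₁ q₁ p₂ q₂ p₃ q₃) : cr (emb K F) 5 0 =
    (d ^ 2 * p ^ 3 - 3 * d ^ 2 * p ^ 2 * q + 3 * d ^ 2 * p * q ^ 2 - d ^ 2 * q ^ 3 -
      6 * d * r * p * p₁ + 6 * d * r * p * q₁ + 6 * d * r * p₁ * q - 6 * d * r * q * q₁ +
      d * p ^ 3 - 3 * d * p ^ 2 * q + 3 * d * p * q ^ 2 - d * q ^ 3 + 4 * r ^ 2 * p₂ -
      4 * r ^ 2 * q₂) / (8 * κ * r ^ 2) := by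
  have := charZero K
  have hr := J.r_ne_zero
  have hk := J.root_ne_zero
  rw [cr_succ_left, J.cr_four_zero]
  simp only [Derivation.leibniz_div, Derivation.leibniz, Derivation.leibniz_pow, map_add, map_sub,
    map_neg, derivation_ofNat, Derivation.map_natCast, Derivation.map_one_eq_zero,
    J.delta_κ, J.delta_r, J.delta_one_r, J.map_d, J.hp, J.hq, J.hp₁, J.hq₁, J.hp₂, J.hq₂, J.hp₃,
    J.hq₃, J.delta_one_p, J.delta_one_q, J.delta_one_p₁, J.delta_one_q₁,
    smul_eq_mul, nsmul_eq_mul]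
  field_simp
  ring

theorem cr_four_one (J : Jets B F κ d v r p q p₁ q₁ p₂ q₂ p₃ q₃) : cr (emb K F) 4 1 =
    (p₂ + q₂) / 2 := by
  have := charZero K
  have hr := J.r_ne_zero
  have hk := J.root_ne_zero
  rw [cr_succ_left, J.cr_three_one]
  simp only [Derivation.leibniz_div, Derivation.leibniz, Derivation.leibniz_pow, map_add, map_sub,
    map_neg, derivation_ofNat, Derivation.map_natCast, Derivation.map_one_eq_zero,
    J.delta_κ, J.delta_r, J.delta_one_r, J.map_d, J.hp, J.hq, J.hp₁, J.hq₁, J.hp₂, J.hq₂, J.hp₃,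
    J.hq₃, J.delta_one_p, J.delta_one_q, J.delta_one_p₁, J.delta_one_q₁,
    smul_eq_mul, nsmul_eq_mul]
  field_simp
  ring

theorem cr_three_two (J : Jets B F κ d v r p q p₁ q₁ p₂ q₂ p₃ q₃) : cr (emb K F) 3 2 =
    κ * (d ^ 2 * p ^ 3 - 3 * d ^ 2 * p ^ 2 * q + 3 * d ^ 2 * p * q ^ 2 - d ^ 2 * q ^ 3 +
      6 * d * r * p * p₁ - 6 * d * r * p * q₁ - 6 * d * r * p₁ * q + 6 * d * r * q * q₁ -
      d * p ^ 3 + 3 * d * p ^ 2 * q - 3 * d * p * q ^ 2 + d * q ^ 3 + 4 * r ^ 2 * p₂ -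
      4 * r ^ 2 * q₂) / (8 * r ^ 2) := by
  have := charZero K
  have hr := J.r_ne_zero
  have hk := J.root_ne_zero
  rw [cr_succ_left, J.cr_two_two]
  simp only [Derivation.leibniz_div, Derivation.leibniz, Derivation.leibniz_pow, map_add, map_sub,
    map_neg, derivation_ofNat, Derivation.map_natCast, Derivation.map_one_eq_zero,
    J.delta_κ, J.delta_r, J.delta_one_r, J.map_d, J.hp, J.hq, J.hp₁, J.hq₁, J.hp₂, J.hq₂, J.hp₃,
    J.hq₃, J.delta_one_p, J.delta_one_q, J.delta_one_p₁, J.delta_one_q₁,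
    smul_eq_mul, nsmul_eq_mul]
  field_simp
  ring

theorem cr_two_three (J : Jets B F κ d v r p q p₁ q₁ p₂ q₂ p₃ q₃) : cr (emb K F) 2 3 =
    κ ^ 2 * (2 * d ^ 2 * p ^ 3 - 2 * d ^ 2 * p ^ 2 * q - 2 * d ^ 2 * p * q ^ 2 + 2 * d ^ 2 * q ^ 3 +
      6 * d * r * p * p₁ + 2 * d * r * p * q₁ - 2 * d * r * p₁ * q - 6 * d * r * q * q₁ -
      d * p ^ 3 + d * p ^ 2 * q + d * p * q ^ 2 - d * q ^ 3 + 2 * r ^ 2 * p₂ +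
      2 * r ^ 2 * q₂) / (4 * r ^ 2) := by
  have := charZero K
  have hr := J.r_ne_zero
  have hk := J.root_ne_zero
  rw [cr_succ_left, J.cr_one_three]
  simp only [Derivation.leibniz_div, Derivation.leibniz, Derivation.leibniz_pow, map_add, map_sub,
    map_neg, derivation_ofNat, Derivation.map_natCast, Derivation.map_one_eq_zero,
    J.delta_κ, J.delta_r, J.delta_one_r, J.map_d, J.hp, J.hq, J.hp₁, J.hq₁, J.hp₂, J.hq₂, J.hp₃,
    J.hq₃, J.delta_one_p, J.delta_one_q, J.delta_one_p₁, J.delta_one_q₁,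
    smul_eq_mul, nsmul_eq_mul]
  field_simp
  ring

theorem cr_one_four (J : Jets B F κ d v r p q p₁ q₁ p₂ q₂ p₃ q₃) : cr (emb K F) 1 4 =
    κ ^ 3 * (9 * d ^ 2 * p ^ 3 - 3 * d ^ 2 * p ^ 2 * q + 3 * d ^ 2 * p * q ^ 2 - 9 * d ^ 2 * q ^ 3 +
      18 * d * r * p * p₁ - 2 * d * r * p * q₁ - 2 * d * r * p₁ * q + 18 * d * r * q * q₁ -
      3 * d * p ^ 3 + d * p ^ 2 * q - d * p * q ^ 2 + 3 * d * q ^ 3 + 4 * r ^ 2 * p₂ -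
      4 * r ^ 2 * q₂) / (8 * r ^ 2) := by
  have := charZero K
  have hr := J.r_ne_zero
  have hk := J.root_ne_zero
  rw [cr_succ_right, J.cr_one_three]
  simp only [Derivation.leibniz_div, Derivation.leibniz, Derivation.leibniz_pow, map_add, map_sub,
    map_neg, derivation_ofNat, Derivation.map_natCast, Derivation.map_one_eq_zero,
    J.delta_κ, J.delta_r, J.delta_one_r, J.map_d, J.hp, J.hq, J.hp₁, J.hq₁, J.hp₂, J.hq₂, J.hp₃,
    J.hq₃, J.delta_one_p, J.delta_one_q, J.delta_one_p₁, J.delta_one_q₁,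
    smul_eq_mul, nsmul_eq_mul]
  field_simp
  ring

set_option maxHeartbeats 1000000 in
theorem cr_six_zero (J : Jets B F κ d v r p q p₁ q₁ p₂ q₂ p₃ q₃) : cr (emb K F) 6 0 =
    (- d³ * p⁴ + 4 * d³ * p³ * q - 6 * d³ * p² * q² + 4 * d³ * p * q³ -
      d³ * q⁴ + 12 * d² * r * p² * p₁ - 12 * d² * r * p² * q₁ -
      24 * d² * r * p * p₁ * q + 24 * d² * r * p * q * q₁ + 12 * d² * r * p₁ * q² -
      12 * d² * r * q² * q₁ - 3 * d² * p⁴ + 12 * d² * p³ * q -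
      18 * d² * p² * q² + 12 * d² * p * q³ - 3 * d² * q⁴ -
      16 * d * r² * p * p₂ + 16 * d * r² * p * q₂ - 12 * d * r² * p₁² +
      24 * d * r² * p₁ * q₁ + 16 * d * r² * p₂ * q - 16 * d * r² * q * q₂ -
      12 * d * r² * q₁² + 12 * d * r * p² * p₁ - 12 * d * r * p² * q₁ -
      24 * d * r * p * p₁ * q + 24 * d * r * p * q * q₁ + 12 * d * r * p₁ * q² -
      12 * d * r * q² * q₁ - 2 * d * p⁴ + 8 * d * p³ * q - 12 * d * p² * q² +
      8 * d * p * q³ - 2 * d * q⁴ + 8 * r³ * p₃ - 8 * r³ * q₃) / (16 * κ * r³) := by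
  have := charZero K
  have hr := J.r_ne_zero
  have hk := J.root_ne_zero
  rw [cr_succ_left, J.cr_five_zero]
  simp only [Derivation.leibniz_div, Derivation.leibniz, Derivation.leibniz_pow, map_add, map_sub,
    map_neg, derivation_ofNat, Derivation.map_natCast, Derivation.map_one_eq_zero,
    J.delta_κ, J.delta_r, J.delta_one_r, J.map_d, J.hp, J.hq, J.hp₁, J.hq₁, J.hp₂, J.hq₂, J.hp₃,
    J.hq₃, J.delta_one_p, J.delta_one_q, J.delta_one_p₁, J.delta_one_q₁,
    smul_eq_mul, nsmul_eq_mul]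
  field_simp
  ring

set_option maxHeartbeats 1000000 in
theorem cr_five_one (J : Jets B F κ d v r p q p₁ q₁ p₂ q₂ p₃ q₃) : cr (emb K F) 5 1 =
    (p₃ + q₃) / 2 := by
  have := charZero K
  have hr := J.r_ne_zero
  have hk := J.root_ne_zero
  rw [cr_succ_left, J.cr_four_one]
  simp only [Derivation.leibniz_div, Derivation.leibniz, Derivation.leibniz_pow, map_add, map_sub,
    map_neg, derivation_ofNat, Derivation.map_natCast, Derivation.map_one_eq_zero,
    J.delta_κ, J.delta_r, J.delta_one_r, J.map_d, J.hp, J.hq, J.hp₁, J.hq₁, J.hp₂, J.hq₂, J.hp₃,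
    J.hq₃, J.delta_one_p, J.delta_one_q, J.delta_one_p₁, J.delta_one_q₁,
    smul_eq_mul, nsmul_eq_mul]
  field_simp
  ring

set_option maxHeartbeats 1000000 in
theorem cr_four_two (J : Jets B F κ d v r p q p₁ q₁ p₂ q₂ p₃ q₃) : cr (emb K F) 4 2 =
    κ * (d³ * p⁴ - 4 * d³ * p³ * q + 6 * d³ * p² * q² - 4 * d³ * p * q³ +
      d³ * q⁴ + 12 * d² * r * p² * p₁ - 12 * d² * r * p² * q₁ -
      24 * d² * r * p * p₁ * q + 24 * d² * r * p * q * q₁ + 12 * d² * r * p₁ * q² -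
      12 * d² * r * q² * q₁ - 3 * d² * p⁴ + 12 * d² * p³ * q -
      18 * d² * p² * q² + 12 * d² * p * q³ - 3 * d² * q⁴ +
      16 * d * r² * p * p₂ - 16 * d * r² * p * q₂ + 12 * d * r² * p₁² -
      24 * d * r² * p₁ * q₁ - 16 * d * r² * p₂ * q + 16 * d * r² * q * q₂ +
      12 * d * r² * q₁² - 12 * d * r * p² * p₁ + 12 * d * r * p² * q₁ +
      24 * d * r * p * p₁ * q - 24 * d * r * p * q * q₁ - 12 * d * r * p₁ * q² +
      12 * d * r * q² * q₁ + 2 * d * p⁴ - 8 * d * p³ * q + 12 * d * p² * q² -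
      8 * d * p * q³ + 2 * d * q⁴ + 8 * r³ * p₃ - 8 * r³ * q₃) / (16 * r³) := by
  have := charZero K
  have hr := J.r_ne_zero
  have hk := J.root_ne_zero
  rw [cr_succ_left, J.cr_three_two]
  simp only [Derivation.leibniz_div, Derivation.leibniz, Derivation.leibniz_pow, map_add, map_sub,
    map_neg, derivation_ofNat, Derivation.map_natCast, Derivation.map_one_eq_zero,
    J.delta_κ, J.delta_r, J.delta_one_r, J.map_d, J.hp, J.hq, J.hp₁, J.hq₁, J.hp₂, J.hq₂, J.hp₃,
    J.hq₃, J.delta_one_p, J.delta_one_q, J.delta_one_p₁, J.delta_one_q₁,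
    smul_eq_mul, nsmul_eq_mul]
  field_simp
  ring

set_option maxHeartbeats 1000000 in
theorem cr_three_three (J : Jets B F κ d v r p q p₁ q₁ p₂ q₂ p₃ q₃) : cr (emb K F) 3 3 =
    κ² * (2 * d³ * p⁴ - 4 * d³ * p³ * q + 4 * d³ * p * q³ - 2 * d³ * q⁴ +
      12 * d² * r * p² * p₁ - 12 * d² * r * p * p₁ * q - 12 * d² * r * p * q * q₁ +
      12 * d² * r * q² * q₁ - 3 * d² * p⁴ + 6 * d² * p³ * q -
      6 * d² * p * q³ + 3 * d² * q⁴ + 8 * d * r² * p * p₂ +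
      4 * d * r² * p * q₂ + 6 * d * r² * p₁² - 4 * d * r² * p₂ * q -
      8 * d * r² * q * q₂ - 6 * d * r² * q₁² - 6 * d * r * p² * p₁ +
      6 * d * r * p * p₁ * q + 6 * d * r * p * q * q₁ - 6 * d * r * q² * q₁ + d * p⁴ -
      2 * d * p³ * q + 2 * d * p * q³ - d * q⁴ + 2 * r³ * p₃ + 2 * r³ * q₃) / (4 * r³) := by
  have := charZero K
  have hr := J.r_ne_zero
  have hk := J.root_ne_zero
  rw [cr_succ_left, J.cr_two_three]
  simp only [Derivation.leibniz_div, Derivation.leibniz, Derivation.leibniz_pow, map_add, map_sub,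
    map_neg, derivation_ofNat, Derivation.map_natCast, Derivation.map_one_eq_zero,
    J.delta_κ, J.delta_r, J.delta_one_r, J.map_d, J.hp, J.hq, J.hp₁, J.hq₁, J.hp₂, J.hq₂, J.hp₃,
    J.hq₃, J.delta_one_p, J.delta_one_q, J.delta_one_p₁, J.delta_one_q₁,
    smul_eq_mul, nsmul_eq_mul]
  field_simp
  ring

set_option maxHeartbeats 1000000 in
theorem cr_two_four (J : Jets B F κ d v r p q p₁ q₁ p₂ q₂ p₃ q₃) : cr (emb K F) 2 4 =
    κ³ * (27 * d³ * p⁴ - 36 * d³ * p³ * q + 18 * d³ * p² * q² -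
      36 * d³ * p * q³ + 27 * d³ * q⁴ + 108 * d² * r * p² * p₁ -
      12 * d² * r * p² * q₁ - 72 * d² * r * p * p₁ * q + 72 * d² * r * p * q * q₁ +
      12 * d² * r * p₁ * q² - 108 * d² * r * q² * q₁ - 27 * d² * p⁴ +
      36 * d² * p³ * q - 18 * d² * p² * q² + 36 * d² * p * q³ -
      27 * d² * q⁴ + 48 * d * r² * p * p₂ - 16 * d * r² * p * q₂ +
      36 * d * r² * p₁² - 8 * d * r² * p₁ * q₁ - 16 * d * r² * p₂ * q +
      48 * d * r² * q * q₂ + 36 * d * r² * q₁² - 36 * d * r * p² * p₁ +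
      4 * d * r * p² * q₁ + 24 * d * r * p * p₁ * q - 24 * d * r * p * q * q₁ -
      4 * d * r * p₁ * q² + 36 * d * r * q² * q₁ + 6 * d * p⁴ - 8 * d * p³ * q +
      4 * d * p² * q² - 8 * d * p * q³ + 6 * d * q⁴ + 8 * r³ * p₃ -
      8 * r³ * q₃) / (16 * r³) := by
  have := charZero K
  have hr := J.r_ne_zero
  have hk := J.root_ne_zero
  rw [cr_succ_left, J.cr_one_four]
  simp only [Derivation.leibniz_div, Derivation.leibniz, Derivation.leibniz_pow, map_add, map_sub,
    map_neg, derivation_ofNat, Derivation.map_natCast, Derivation.map_one_eq_zero,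
    J.delta_κ, J.delta_r, J.delta_one_r, J.map_d, J.hp, J.hq, J.hp₁, J.hq₁, J.hp₂, J.hq₂, J.hp₃,
    J.hq₃, J.delta_one_p, J.delta_one_q, J.delta_one_p₁, J.delta_one_q₁,
    smul_eq_mul, nsmul_eq_mul]
  field_simp
  ring

end Jets

end

/-! ### The functions s = 24ψ, φ'' and h₀ in canonical coordinates -/

section

variable {B : Background} {F : LPS} {K : Type*} [Field K] [Algebra ℂ K] [Algebra LPS K]
  [IsScalarTower ℂ LPS K] [Algebra.FormallyEtale LPS K] [FaithfulSMul LPS K]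

namespace Jets

variable {κ d v r p q p₁ q₁ p₂ q₂ p₃ q₃ : K}

/-- From w s'(u) = -d(3d - 1), ∂r = κ ∂u and r = κw. So s behaves like -d(3d - 1) log r. -/
theorem delta_log (J : Jets B F κ d v r p q p₁ q₁ p₂ q₂ p₃ q₃) (i : Fin 2 × ℕ) :
    delta i (emb K (comp (fun x => 24 * psi B.d x) (uFun F))) =
      -(d * (3 * d - 1)) * (delta i r / r) := by
  have := charZero K
  have hr := J.r_ne_zero
  have hk := J.root_ne_zero
  have h2 := congrArg (emb K) J.cone.wFun_mul_comp_deriv_psi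
  rw [map_mul, ← wK, MvPowerSeries.c_eq_algebraMap, AlgHom.commutes] at h2
  simp only [map_neg, map_mul, map_sub, map_ofNat, map_one, J.hd] at h2
  have h3 := J.cone.delta_rho J.root i
  have hw : r = κ * wK B F K := J.hr.symm
  rw [J.hr] at h3
  rw [delta_emb, pderiv_comp, map_mul, h3, ← h2]
  field_simp
  rw [hw]
  ring

theorem emb_comp_deriv_deriv_phi (J : Jets B F κ d v r p q p₁ q₁ p₂ q₂ p₃ q₃) :
    emb K (comp (iteratedDeriv 2 (phi B.d)) (uFun F)) = 2 * d * κ ^ 3 / r := by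
  have hr := J.r_ne_zero
  have hκ' : emb K (dphi B F) = κ ^ 2 := Eq.symm J.root
  have hw : r = κ * wK B F K := J.hr.symm
  have h2 := congrArg (emb K) J.cone.wFun_mul_comp_deriv_deriv
  rw [map_mul, ← wK, emb_smul, map_mul, map_ofNat, J.hd, hκ'] at h2
  rw [iteratedDeriv_succ, iteratedDeriv_one, eq_div_iff hr, hw]
  linear_combination κ * h2

/-- The equation for s' is differentiated in t^1_0 and ∂_{0,1} u is cancelled, which gives w s'' =
-(1 - d) s'. -/
theorem emb_comp_deriv_deriv_psi (J : Jets B F κ d v r p q p₁ q₁ p₂ q₂ p₃ q₃) :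
    emb K (comp (iteratedDeriv 2 fun x => 24 * psi B.d x) (uFun F)) =
      d * (3 * d - 1) * (1 - d) * κ ^ 2 / r ^ 2 := by
  have hr := J.r_ne_zero
  have hk := J.root_ne_zero
  have hw : r = κ * wK B F K := J.hr.symm
  set s : ℂ → ℂ := fun x => 24 * psi B.d x
  have h0 := congrArg (emb K) J.cone.wFun_mul_comp_deriv_psi
  rw [map_mul, ← wK, MvPowerSeries.c_eq_algebraMap, AlgHom.commutes] at h0
  simp only [map_neg, map_mul, map_sub, map_ofNat, map_one, J.hd] at h0
  have h1 := congrArg (pderiv ℂ (1, 0)) J.cone.wFun_mul_comp_deriv_psi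
  have h2 := J.cone.pderiv_vFun_ne_zero
  rw [← pderiv_one_uFun] at h2
  rw [Derivation.leibniz, pderiv_comp, wFun, map_add, pderiv_C, Derivation.map_smul, add_zero,
    pderiv_C, ← wFun] at h1
  have h3 := congrArg (emb K) h1
  simp only [smul_eq_mul, map_add, map_mul, map_zero, emb_smul, map_sub, map_one, J.hd] at h3
  have h4 : wK B F K * emb K (comp (deriv (deriv s)) (uFun F)) +
      (1 - d) * emb K (comp (deriv s) (uFun F)) = 0 := by
    refine mul_right_cancel₀ (emb_ne_zero (K := K) h2) ?_
    rw [wK]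
    linear_combination h3
  rw [iteratedDeriv_succ, iteratedDeriv_one, eq_div_iff (pow_ne_zero 2 hr), hw]
  linear_combination κ ^ 2 * wK B F K * h4 - κ ^ 2 * (1 - d) * h0

/-- By `comp_hZero_mul_dphi_mul` the function h₀(u) is a constant times κ/r³, while (∂v)² +
φ'(u)(∂u)² is (p² + q²)/2. -/
theorem emb_genusTwoTwo (J : Jets B F κ d v r p q p₁ q₁ p₂ q₂ p₃ q₃) : emb K (genusTwoTwo B F) =
    -(d * (3 * d - 1) * (3 * d - 5) * (d - 2) * (1 - d) ^ 2) * κ * (p ^ 2 + q ^ 2) /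
      (23040 * r ^ 3) := by
  have := charZero K
  have hr := J.r_ne_zero
  have hk := J.root_ne_zero
  have hκ' : emb K (dphi B F) = κ ^ 2 := Eq.symm J.root
  have hw : r = κ * wK B F K := J.hr.symm
  have h0 := congrArg (emb K) J.cone.comp_hZero_mul_dphi_mul
  rw [map_mul, map_mul, map_pow, ← wK, MvPowerSeries.c_eq_algebraMap, AlgHom.commutes, hκ'] at h0
  simp only [map_neg, map_mul, map_sub, map_pow, map_div₀, map_ofNat, map_one, J.hd] at h0
  have h1 : emb K (comp (hZero B.d) (uFun F)) =
      -(d * (3 * d - 1) * (3 * d - 5) * (d - 2) * (1 - d) ^ 2) * κ / (5760 * r ^ 3) := by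
    rw [eq_div_iff (by simp [hr])]
    rw [hw]
    linear_combination 5760 * κ * h0
  rw [genusTwoTwo, emb_smul, map_mul, map_add, map_mul, map_pow, map_pow, ← dphi, hκ',
    J.emb_delta_uFun, J.emb_delta_vFun, h1]
  simp only [map_div₀, map_one, map_ofNat]
  field_simp
  ring

theorem cr_log_one_zero (J : Jets B F κ d v r p q p₁ q₁ p₂ q₂ p₃ q₃) :
    cr (emb K (comp (fun x => 24 * psi B.d x) (uFun F))) 1 0 =
    (- 3 * d ^ 2 * p + 3 * d ^ 2 * q + d * p - d * q) / (2 * r) := by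
  have := charZero K
  have hr := J.r_ne_zero
  have hk := J.root_ne_zero
  refine (J.delta_log (0, 0)).trans ?_
  rw [J.delta_r]
  field_simp
  ring

theorem cr_log_zero_one (J : Jets B F κ d v r p q p₁ q₁ p₂ q₂ p₃ q₃) :
    cr (emb K (comp (fun x => 24 * psi B.d x) (uFun F))) 0 1 =
    κ * (- 3 * d ^ 2 * p - 3 * d ^ 2 * q + d * p + d * q) / (2 * r) := by
  have := charZero K
  have hr := J.r_ne_zero
  have hk := J.root_ne_zero
  refine (J.delta_log (1, 0)).trans ?_
  rw [J.delta_one_r]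
  field_simp
  ring

theorem cr_log_two_zero (J : Jets B F κ d v r p q p₁ q₁ p₂ q₂ p₃ q₃) :
    cr (emb K (comp (fun x => 24 * psi B.d x) (uFun F))) 2 0 =
    (- 6 * d ^ 2 * r * p₁ + 6 * d ^ 2 * r * q₁ + 3 * d ^ 2 * p ^ 2 - 6 * d ^ 2 * p * q +
      3 * d ^ 2 * q ^ 2 + 2 * d * r * p₁ - 2 * d * r * q₁ - d * p ^ 2 + 2 * d * p * q -
      d * q ^ 2) / (4 * r ^ 2) := by
  have := charZero K
  have hr := J.r_ne_zero
  have hk := J.root_ne_zero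
  rw [cr_succ_left, J.cr_log_one_zero]
  simp only [Derivation.leibniz_div, Derivation.leibniz, Derivation.leibniz_pow, map_add, map_sub,
    map_neg, derivation_ofNat, Derivation.map_natCast, Derivation.map_one_eq_zero,
    J.delta_κ, J.delta_r, J.delta_one_r, J.map_d, J.hp, J.hq, J.hp₁, J.hq₁, J.hp₂, J.hq₂, J.hp₃,
    J.hq₃, J.delta_one_p, J.delta_one_q, J.delta_one_p₁, J.delta_one_q₁,
    smul_eq_mul, nsmul_eq_mul]
  field_simp
  ring

theorem cr_log_one_one (J : Jets B F κ d v r p q p₁ q₁ p₂ q₂ p₃ q₃) :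
    cr (emb K (comp (fun x => 24 * psi B.d x) (uFun F))) 1 1 =
    κ * (- 3 * d ^ 3 * p ^ 2 + 3 * d ^ 3 * q ^ 2 - 6 * d ^ 2 * r * p₁ - 6 * d ^ 2 * r * q₁ +
      4 * d ^ 2 * p ^ 2 - 4 * d ^ 2 * q ^ 2 + 2 * d * r * p₁ + 2 * d * r * q₁ - d * p ^ 2 +
      d * q ^ 2) / (4 * r ^ 2) := by
  have := charZero K
  have hr := J.r_ne_zero
  have hk := J.root_ne_zero
  rw [cr_succ_left, J.cr_log_zero_one]
  simp only [Derivation.leibniz_div, Derivation.leibniz, Derivation.leibniz_pow, map_add, map_sub,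
    map_neg, derivation_ofNat, Derivation.map_natCast, Derivation.map_one_eq_zero,
    J.delta_κ, J.delta_r, J.delta_one_r, J.map_d, J.hp, J.hq, J.hp₁, J.hq₁, J.hp₂, J.hq₂, J.hp₃,
    J.hq₃, J.delta_one_p, J.delta_one_q, J.delta_one_p₁, J.delta_one_q₁,
    smul_eq_mul, nsmul_eq_mul]
  field_simp
  ring

theorem cr_log_zero_two (J : Jets B F κ d v r p q p₁ q₁ p₂ q₂ p₃ q₃) :
    cr (emb K (comp (fun x => 24 * psi B.d x) (uFun F))) 0 2 =
    κ ^ 2 * (- 6 * d ^ 3 * p ^ 2 - 6 * d ^ 3 * q ^ 2 - 6 * d ^ 2 * r * p₁ + 6 * d ^ 2 * r * q₁ +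
      5 * d ^ 2 * p ^ 2 + 6 * d ^ 2 * p * q + 5 * d ^ 2 * q ^ 2 + 2 * d * r * p₁ -
      2 * d * r * q₁ - d * p ^ 2 - 2 * d * p * q - d * q ^ 2) / (4 * r ^ 2) := by
  have := charZero K
  have hr := J.r_ne_zero
  have hk := J.root_ne_zero
  rw [cr_succ_right, J.cr_log_zero_one]
  simp only [Derivation.leibniz_div, Derivation.leibniz, Derivation.leibniz_pow, map_add, map_sub,
    map_neg, derivation_ofNat, Derivation.map_natCast, Derivation.map_one_eq_zero,
    J.delta_κ, J.delta_r, J.delta_one_r, J.map_d, J.hp, J.hq, J.hp₁, J.hq₁, J.hp₂, J.hq₂, J.hp₃,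
    J.hq₃, J.delta_one_p, J.delta_one_q, J.delta_one_p₁, J.delta_one_q₁,
    smul_eq_mul, nsmul_eq_mul]
  field_simp
  ring

theorem cr_log_three_zero (J : Jets B F κ d v r p q p₁ q₁ p₂ q₂ p₃ q₃) :
    cr (emb K (comp (fun x => 24 * psi B.d x) (uFun F))) 3 0 =
    (- 6 * d² * r² * p₂ + 6 * d² * r² * q₂ + 9 * d² * r * p * p₁ -
      9 * d² * r * p * q₁ - 9 * d² * r * p₁ * q + 9 * d² * r * q * q₁ -
      3 * d² * p³ + 9 * d² * p² * q - 9 * d² * p * q² + 3 * d² * q³ +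
      2 * d * r² * p₂ - 2 * d * r² * q₂ - 3 * d * r * p * p₁ + 3 * d * r * p * q₁ +
      3 * d * r * p₁ * q - 3 * d * r * q * q₁ + d * p³ - 3 * d * p² * q +
      3 * d * p * q² - d * q³) / (4 * r³) := by
  have := charZero K
  have hr := J.r_ne_zero
  have hk := J.root_ne_zero
  rw [cr_succ_left, J.cr_log_two_zero]
  simp only [Derivation.leibniz_div, Derivation.leibniz, Derivation.leibniz_pow, map_add, map_sub,
    map_neg, derivation_ofNat, Derivation.map_natCast, Derivation.map_one_eq_zero,
    J.delta_κ, J.delta_r, J.delta_one_r, J.map_d, J.hp, J.hq, J.hp₁, J.hq₁, J.hp₂, J.hq₂, J.hp₃,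
    J.hq₃, J.delta_one_p, J.delta_one_q, J.delta_one_p₁, J.delta_one_q₁,
    smul_eq_mul, nsmul_eq_mul]
  field_simp
  ring

theorem cr_log_two_one (J : Jets B F κ d v r p q p₁ q₁ p₂ q₂ p₃ q₃) :
    cr (emb K (comp (fun x => 24 * psi B.d x) (uFun F))) 2 1 =
    κ * (- 3 * d⁴ * p³ + 3 * d⁴ * p² * q + 3 * d⁴ * p * q² - 3 * d⁴ * q³ -
      18 * d³ * r * p * p₁ - 6 * d³ * r * p * q₁ + 6 * d³ * r * p₁ * q +
      18 * d³ * r * q * q₁ + 10 * d³ * p³ - 10 * d³ * p² * q -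
      10 * d³ * p * q² + 10 * d³ * q³ - 12 * d² * r² * p₂ -
      12 * d² * r² * q₂ + 24 * d² * r * p * p₁ + 8 * d² * r * p * q₁ -
      8 * d² * r * p₁ * q - 24 * d² * r * q * q₁ - 9 * d² * p³ +
      9 * d² * p² * q + 9 * d² * p * q² - 9 * d² * q³ + 4 * d * r² * p₂ +
      4 * d * r² * q₂ - 6 * d * r * p * p₁ - 2 * d * r * p * q₁ + 2 * d * r * p₁ * q +
      6 * d * r * q * q₁ + 2 * d * p³ - 2 * d * p² * q - 2 * d * p * q² +
      2 * d * q³) / (8 * r³) := by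
  have := charZero K
  have hr := J.r_ne_zero
  have hk := J.root_ne_zero
  rw [cr_succ_left, J.cr_log_one_one]
  simp only [Derivation.leibniz_div, Derivation.leibniz, Derivation.leibniz_pow, map_add, map_sub,
    map_neg, derivation_ofNat, Derivation.map_natCast, Derivation.map_one_eq_zero,
    J.delta_κ, J.delta_r, J.delta_one_r, J.map_d, J.hp, J.hq, J.hp₁, J.hq₁, J.hp₂, J.hq₂, J.hp₃,
    J.hq₃, J.delta_one_p, J.delta_one_q, J.delta_one_p₁, J.delta_one_q₁,
    smul_eq_mul, nsmul_eq_mul]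
  field_simp
  ring

theorem cr_log_one_two (J : Jets B F κ d v r p q p₁ q₁ p₂ q₂ p₃ q₃) :
    cr (emb K (comp (fun x => 24 * psi B.d x) (uFun F))) 1 2 =
    κ² * (- 6 * d⁴ * p³ + 6 * d⁴ * p² * q - 6 * d⁴ * p * q² + 6 * d⁴ * q³ -
      18 * d³ * r * p * p₁ + 6 * d³ * r * p * q₁ + 6 * d³ * r * p₁ * q -
      18 * d³ * r * q * q₁ + 11 * d³ * p³ - 5 * d³ * p² * q +
      5 * d³ * p * q² - 11 * d³ * q³ - 6 * d² * r² * p₂ +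
      6 * d² * r² * q₂ + 15 * d² * r * p * p₁ + d² * r * p * q₁ +
      d² * r * p₁ * q + 15 * d² * r * q * q₁ - 6 * d² * p³ - 2 * d² * p² * q +
      2 * d² * p * q² + 6 * d² * q³ + 2 * d * r² * p₂ - 2 * d * r² * q₂ -
      3 * d * r * p * p₁ - d * r * p * q₁ - d * r * p₁ * q - 3 * d * r * q * q₁ + d * p³ +
      d * p² * q - d * p * q² - d * q³) / (4 * r³) := by
  have := charZero K
  have hr := J.r_ne_zero
  have hk := J.root_ne_zero
  rw [cr_succ_left, J.cr_log_zero_two]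
  simp only [Derivation.leibniz_div, Derivation.leibniz, Derivation.leibniz_pow, map_add, map_sub,
    map_neg, derivation_ofNat, Derivation.map_natCast, Derivation.map_one_eq_zero,
    J.delta_κ, J.delta_r, J.delta_one_r, J.map_d, J.hp, J.hq, J.hp₁, J.hq₁, J.hp₂, J.hq₂, J.hp₃,
    J.hq₃, J.delta_one_p, J.delta_one_q, J.delta_one_p₁, J.delta_one_q₁,
    smul_eq_mul, nsmul_eq_mul]
  field_simp
  ring

end Jets

end

/-! ### Components of the correlators along the two eigenvectors -/

section

variable {B : Background} {F : LPS} {K : Type*} [Field K] [Algebra ℂ K] [Algebra LPS K]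
  [IsScalarTower ℂ LPS K] [Algebra.FormallyEtale LPS K] [FaithfulSMul LPS K]

namespace Jets

variable {κ d v r p q p₁ q₁ p₂ q₂ p₃ q₃ : K}

/-- The letters p and m at the end of a name stand for contractions with (κ, 1) and (-κ, 1). All
mixed components are divisible by d. -/
theorem frame_zero_three_ppp (J : Jets B F κ d v r p q p₁ q₁ p₂ q₂ p₃ q₃) :
      κ ^ 3 * cr (emb K F) 4 0 + 3 * κ ^ 2 * cr (emb K F) 3 1 + 3 * κ * cr (emb K F) 2 2 +
      cr (emb K F) 1 3 =
      κ ^ 2 * (d * p ^ 2 - d * p * q + 4 * r * p₁) / r := by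
  have := charZero K
  have hr := J.r_ne_zero
  have hk := J.root_ne_zero
  rw [J.cr_four_zero, J.cr_three_one, J.cr_two_two, J.cr_one_three]
  field_simp
  ring

theorem frame_zero_three_ppm (J : Jets B F κ d v r p q p₁ q₁ p₂ q₂ p₃ q₃) :
      -κ ^ 3 * cr (emb K F) 4 0 - κ ^ 2 * cr (emb K F) 3 1 + κ * cr (emb K F) 2 2 +
      cr (emb K F) 1 3 =
      κ ^ 2 * (d * p ^ 2 - d * p * q) / r := by
  have := charZero K
  have hr := J.r_ne_zero
  have hk := J.root_ne_zero
  rw [J.cr_four_zero, J.cr_three_one, J.cr_two_two, J.cr_one_three]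
  field_simp
  ring

theorem frame_zero_three_pmm (J : Jets B F κ d v r p q p₁ q₁ p₂ q₂ p₃ q₃) :
      κ ^ 3 * cr (emb K F) 4 0 - κ ^ 2 * cr (emb K F) 3 1 - κ * cr (emb K F) 2 2 +
      cr (emb K F) 1 3 =
      κ ^ 2 * (d * p * q - d * q ^ 2) / r := by
  have := charZero K
  have hr := J.r_ne_zero
  have hk := J.root_ne_zero
  rw [J.cr_four_zero, J.cr_three_one, J.cr_two_two, J.cr_one_three]
  field_simp
  ring

theorem frame_zero_three_mmm (J : Jets B F κ d v r p q p₁ q₁ p₂ q₂ p₃ q₃) :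
      -κ ^ 3 * cr (emb K F) 4 0 + 3 * κ ^ 2 * cr (emb K F) 3 1 - 3 * κ * cr (emb K F) 2 2 +
      cr (emb K F) 1 3 =
      κ ^ 2 * (d * p * q - d * q ^ 2 + 4 * r * q₁) / r := by
  have := charZero K
  have hr := J.r_ne_zero
  have hk := J.root_ne_zero
  rw [J.cr_four_zero, J.cr_three_one, J.cr_two_two, J.cr_one_three]
  field_simp
  ring

theorem frame_zero_zero_two_pp (J : Jets B F κ d v r p q p₁ q₁ p₂ q₂ p₃ q₃) :
      κ ^ 2 * cr (emb K F) 4 0 + 2 * κ * cr (emb K F) 3 1 + cr (emb K F) 2 2 =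
      κ * (2 * p₁) := by
  have := charZero K
  have hr := J.r_ne_zero
  have hk := J.root_ne_zero
  rw [J.cr_four_zero, J.cr_three_one, J.cr_two_two]
  field_simp
  ring

theorem frame_zero_zero_two_pm (J : Jets B F κ d v r p q p₁ q₁ p₂ q₂ p₃ q₃) :
      cr (emb K F) 2 2 - κ ^ 2 * cr (emb K F) 4 0 =
      κ * (d * p ^ 2 - 2 * d * p * q + d * q ^ 2) / (2 * r) := by
  have := charZero K
  have hr := J.r_ne_zero
  have hk := J.root_ne_zero
  rw [J.cr_four_zero, J.cr_two_two]
  field_simp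
  ring

theorem frame_zero_zero_two_mm (J : Jets B F κ d v r p q p₁ q₁ p₂ q₂ p₃ q₃) :
      κ ^ 2 * cr (emb K F) 4 0 - 2 * κ * cr (emb K F) 3 1 + cr (emb K F) 2 2 =
      κ * (- 2 * q₁) := by
  have := charZero K
  have hr := J.r_ne_zero
  have hk := J.root_ne_zero
  rw [J.cr_four_zero, J.cr_three_one, J.cr_two_two]
  field_simp
  ring

theorem frame_zero_zero_three_ppp (J : Jets B F κ d v r p q p₁ q₁ p₂ q₂ p₃ q₃) :
      κ ^ 3 * cr (emb K F) 5 0 + 3 * κ ^ 2 * cr (emb K F) 4 1 + 3 * κ * cr (emb K F) 3 2 +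
      cr (emb K F) 2 3 =
      κ ^ 2 * (2 * d ^ 2 * p ^ 3 - 4 * d ^ 2 * p ^ 2 * q + 2 * d ^ 2 * p * q ^ 2 + 6 * d * r * p *
        p₁ -
      2 * d * r * p * q₁ - 4 * d * r * p₁ * q - d * p ^ 3 + 2 * d * p ^ 2 * q - d * p * q ^ 2 +
      8 * r ^ 2 * p₂) / (2 * r ^ 2) := by
  have := charZero K
  have hr := J.r_ne_zero
  have hk := J.root_ne_zero
  rw [J.cr_five_zero, J.cr_four_one, J.cr_three_two, J.cr_two_three]
  field_simp
  ring

theorem frame_zero_zero_three_ppm (J : Jets B F κ d v r p q p₁ q₁ p₂ q₂ p₃ q₃) :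
      -κ ^ 3 * cr (emb K F) 5 0 - κ ^ 2 * cr (emb K F) 4 1 + κ * cr (emb K F) 3 2 +
      cr (emb K F) 2 3 =
      κ ^ 2 * (d ^ 2 * p ^ 3 - d ^ 2 * p ^ 2 * q - d ^ 2 * p * q ^ 2 + d ^ 2 * q ^ 3 + 6 * d * r *
        p * p₁ -
      2 * d * r * p * q₁ - 4 * d * r * p₁ * q - d * p ^ 3 + 2 * d * p ^ 2 * q -
      d * p * q ^ 2) / (2 * r ^ 2) := by
  have := charZero K
  have hr := J.r_ne_zero
  have hk := J.root_ne_zero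
  rw [J.cr_five_zero, J.cr_four_one, J.cr_three_two, J.cr_two_three]
  field_simp
  ring

theorem frame_zero_zero_three_pmm (J : Jets B F κ d v r p q p₁ q₁ p₂ q₂ p₃ q₃) :
      κ ^ 3 * cr (emb K F) 5 0 - κ ^ 2 * cr (emb K F) 4 1 - κ * cr (emb K F) 3 2 +
      cr (emb K F) 2 3 =
      κ ^ 2 * (d ^ 2 * p ^ 3 - d ^ 2 * p ^ 2 * q - d ^ 2 * p * q ^ 2 + d ^ 2 * q ^ 3 + 4 * d * r *
        p * q₁ +
      2 * d * r * p₁ * q - 6 * d * r * q * q₁ - d * p ^ 2 * q + 2 * d * p * q ^ 2 -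
      d * q ^ 3) / (2 * r ^ 2) := by
  have := charZero K
  have hr := J.r_ne_zero
  have hk := J.root_ne_zero
  rw [J.cr_five_zero, J.cr_four_one, J.cr_three_two, J.cr_two_three]
  field_simp
  ring

theorem frame_zero_zero_three_mmm (J : Jets B F κ d v r p q p₁ q₁ p₂ q₂ p₃ q₃) :
      -κ ^ 3 * cr (emb K F) 5 0 + 3 * κ ^ 2 * cr (emb K F) 4 1 - 3 * κ * cr (emb K F) 3 2 +
      cr (emb K F) 2 3 =
      κ ^ 2 * (2 * d ^ 2 * p ^ 2 * q - 4 * d ^ 2 * p * q ^ 2 + 2 * d ^ 2 * q ^ 3 + 4 * d * r * p *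
        q₁ +
      2 * d * r * p₁ * q - 6 * d * r * q * q₁ - d * p ^ 2 * q + 2 * d * p * q ^ 2 - d * q ^ 3 +
      8 * r ^ 2 * q₂) / (2 * r ^ 2) := by
  have := charZero K
  have hr := J.r_ne_zero
  have hk := J.root_ne_zero
  rw [J.cr_five_zero, J.cr_four_one, J.cr_three_two, J.cr_two_three]
  field_simp
  ring

theorem frame_zero_four_pppp (J : Jets B F κ d v r p q p₁ q₁ p₂ q₂ p₃ q₃) :
      κ ^ 4 * cr (emb K F) 5 0 + 4 * κ ^ 3 * cr (emb K F) 4 1 + 6 * κ ^ 2 * cr (emb K F) 3 2 +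
      4 * κ * cr (emb K F) 2 3 + cr (emb K F) 1 4 =
      κ ^ 3 * (4 * d ^ 2 * p ^ 3 - 5 * d ^ 2 * p ^ 2 * q + d ^ 2 * p * q ^ 2 + 12 * d * r * p * p₁ -
      2 * d * r * p * q₁ - 6 * d * r * p₁ * q - 2 * d * p ^ 3 + 3 * d * p ^ 2 * q -
      d * p * q ^ 2 + 8 * r ^ 2 * p₂) / r ^ 2 := by
  have := charZero K
  have hr := J.r_ne_zero
  have hk := J.root_ne_zero
  rw [J.cr_five_zero, J.cr_four_one, J.cr_three_two, J.cr_two_three, J.cr_one_four]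
  field_simp
  ring

theorem frame_zero_four_pppm (J : Jets B F κ d v r p q p₁ q₁ p₂ q₂ p₃ q₃) :
      -κ ^ 4 * cr (emb K F) 5 0 - 2 * κ ^ 3 * cr (emb K F) 4 1 + 2 * κ * cr (emb K F) 2 3 +
      cr (emb K F) 1 4 =
      κ ^ 3 * (2 * d ^ 2 * p ^ 3 - d ^ 2 * p ^ 2 * q - d ^ 2 * p * q ^ 2 + 6 * d * r * p * p₁ -
      2 * d * r * p₁ * q - d * p ^ 3 + d * p ^ 2 * q) / r ^ 2 := by
  have := charZero K
  have hr := J.r_ne_zero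
  have hk := J.root_ne_zero
  rw [J.cr_five_zero, J.cr_four_one, J.cr_two_three, J.cr_one_four]
  field_simp
  ring

theorem frame_zero_four_ppmm (J : Jets B F κ d v r p q p₁ q₁ p₂ q₂ p₃ q₃) :
      κ ^ 4 * cr (emb K F) 5 0 - 2 * κ ^ 2 * cr (emb K F) 3 2 + cr (emb K F) 1 4 =
      κ ^ 3 * (d ^ 2 * p ^ 3 - d ^ 2 * q ^ 3 + 2 * d * r * p * q₁ + 2 * d * r * p₁ * q - d * p ^ 2 *
        q +
      d * p * q ^ 2) / r ^ 2 := by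
  have := charZero K
  have hr := J.r_ne_zero
  have hk := J.root_ne_zero
  rw [J.cr_five_zero, J.cr_three_two, J.cr_one_four]
  field_simp
  ring

theorem frame_zero_four_pmmm (J : Jets B F κ d v r p q p₁ q₁ p₂ q₂ p₃ q₃) :
      -κ ^ 4 * cr (emb K F) 5 0 + 2 * κ ^ 3 * cr (emb K F) 4 1 - 2 * κ * cr (emb K F) 2 3 +
      cr (emb K F) 1 4 =
      κ ^ 3 * (d ^ 2 * p ^ 2 * q + d ^ 2 * p * q ^ 2 - 2 * d ^ 2 * q ^ 3 - 2 * d * r * p * q₁ +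
      6 * d * r * q * q₁ - d * p * q ^ 2 + d * q ^ 3) / r ^ 2 := by
  have := charZero K
  have hr := J.r_ne_zero
  have hk := J.root_ne_zero
  rw [J.cr_five_zero, J.cr_four_one, J.cr_two_three, J.cr_one_four]
  field_simp
  ring

theorem frame_zero_four_mmmm (J : Jets B F κ d v r p q p₁ q₁ p₂ q₂ p₃ q₃) :
      κ ^ 4 * cr (emb K F) 5 0 - 4 * κ ^ 3 * cr (emb K F) 4 1 + 6 * κ ^ 2 * cr (emb K F) 3 2 -
      4 * κ * cr (emb K F) 2 3 + cr (emb K F) 1 4 =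
      κ ^ 3 * (- d ^ 2 * p ^ 2 * q + 5 * d ^ 2 * p * q ^ 2 - 4 * d ^ 2 * q ^ 3 - 6 * d * r * p *
        q₁ -
      2 * d * r * p₁ * q + 12 * d * r * q * q₁ + d * p ^ 2 * q - 3 * d * p * q ^ 2 +
      2 * d * q ^ 3 - 8 * r ^ 2 * q₂) / r ^ 2 := by
  have := charZero K
  have hr := J.r_ne_zero
  have hk := J.root_ne_zero
  rw [J.cr_five_zero, J.cr_four_one, J.cr_three_two, J.cr_two_three, J.cr_one_four]
  field_simp
  ring

/-- This tensor is contracted with two copies of 𝒞, which is diagonal in the frame; so only the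
components in which the labels agree in pairs are needed. -/
theorem frame_zero_zero_four_pppp (J : Jets B F κ d v r p q p₁ q₁ p₂ q₂ p₃ q₃) :
      κ⁴ * cr (emb K F) 6 0 + 4 * κ³ * cr (emb K F) 5 1 + 6 * κ² * cr (emb K F) 4 2 +
      4 * κ * cr (emb K F) 3 3 + cr (emb K F) 2 4 =
      κ³ * (8 * d³ * p⁴ - 15 * d³ * p³ * q + 6 * d³ * p² * q² + d³ * p * q³ +
      48 * d² * r * p² * p₁ - 12 * d² * r * p² * q₁ - 54 * d² * r * p * p₁ * q +
      6 * d² * r * p * q * q₁ + 12 * d² * r * p₁ * q² - 12 * d² * p⁴ +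
      27 * d² * p³ * q - 18 * d² * p² * q² + 3 * d² * p * q³ +
      32 * d * r² * p * p₂ - 4 * d * r² * p * q₂ + 24 * d * r² * p₁² -
      16 * d * r² * p₁ * q₁ - 20 * d * r² * p₂ * q - 24 * d * r * p² * p₁ +
      8 * d * r * p² * q₁ + 30 * d * r * p * p₁ * q - 6 * d * r * p * q * q₁ -
      8 * d * r * p₁ * q² + 4 * d * p⁴ - 10 * d * p³ * q + 8 * d * p² * q² -
      2 * d * p * q³ + 16 * r³ * p₃) / (2 * r³) := by
  have := charZero K
  have hr := J.r_ne_zero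
  have hk := J.root_ne_zero
  rw [J.cr_six_zero, J.cr_five_one, J.cr_four_two, J.cr_three_three, J.cr_two_four]
  field_simp
  ring

theorem frame_zero_zero_four_ppmm (J : Jets B F κ d v r p q p₁ q₁ p₂ q₂ p₃ q₃) :
      κ⁴ * cr (emb K F) 6 0 - 2 * κ² * cr (emb K F) 4 2 + cr (emb K F) 2 4 =
      κ³ * (3 * d³ * p⁴ - 3 * d³ * p³ * q - 3 * d³ * p * q³ + 3 * d³ * q⁴ +
      12 * d² * r * p² * p₁ - 6 * d² * r * p * p₁ * q + 6 * d² * r * p * q * q₁ -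
      12 * d² * r * q² * q₁ - 3 * d² * p⁴ + 3 * d² * p³ * q +
      3 * d² * p * q³ - 3 * d² * q⁴ + 4 * d * r² * p * q₂ +
      8 * d * r² * p₁ * q₁ + 4 * d * r² * p₂ * q - 4 * d * r * p² * q₁ -
      6 * d * r * p * p₁ * q + 6 * d * r * p * q * q₁ + 4 * d * r * p₁ * q² +
      2 * d * p³ * q - 4 * d * p² * q² + 2 * d * p * q³) / (2 * r³) := by
  have := charZero K
  have hr := J.r_ne_zero
  have hk := J.root_ne_zero
  rw [J.cr_six_zero, J.cr_four_two, J.cr_two_four]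
  field_simp
  ring

theorem frame_zero_zero_four_mmmm (J : Jets B F κ d v r p q p₁ q₁ p₂ q₂ p₃ q₃) :
      κ⁴ * cr (emb K F) 6 0 - 4 * κ³ * cr (emb K F) 5 1 + 6 * κ² * cr (emb K F) 4 2 -
      4 * κ * cr (emb K F) 3 3 + cr (emb K F) 2 4 =
      κ³ * (d³ * p³ * q + 6 * d³ * p² * q² - 15 * d³ * p * q³ + 8 * d³ * q⁴ -
      12 * d² * r * p² * q₁ - 6 * d² * r * p * p₁ * q + 54 * d² * r * p * q * q₁ +
      12 * d² * r * p₁ * q² - 48 * d² * r * q² * q₁ + 3 * d² * p³ * q -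
      18 * d² * p² * q² + 27 * d² * p * q³ - 12 * d² * q⁴ -
      20 * d * r² * p * q₂ - 16 * d * r² * p₁ * q₁ - 4 * d * r² * p₂ * q +
      32 * d * r² * q * q₂ + 24 * d * r² * q₁² + 8 * d * r * p² * q₁ +
      6 * d * r * p * p₁ * q - 30 * d * r * p * q * q₁ - 8 * d * r * p₁ * q² +
      24 * d * r * q² * q₁ - 2 * d * p³ * q + 8 * d * p² * q² - 10 * d * p * q³ +
      4 * d * q⁴ - 16 * r³ * q₃) / (2 * r³) := by
  have := charZero K
  have hr := J.r_ne_zero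
  have hk := J.root_ne_zero
  rw [J.cr_six_zero, J.cr_five_one, J.cr_four_two, J.cr_three_three, J.cr_two_four]
  field_simp
  ring

theorem frame_log_one_p (J : Jets B F κ d v r p q p₁ q₁ p₂ q₂ p₃ q₃) :
      κ * cr (emb K (comp (fun x => 24 * psi B.d x) (uFun F))) 1 0 +
      cr (emb K (comp (fun x => 24 * psi B.d x) (uFun F))) 0 1 =
      κ * (- 3 * d ^ 2 * p + d * p) / r := by
  have := charZero K
  have hr := J.r_ne_zero
  have hk := J.root_ne_zero
  rw [J.cr_log_one_zero, J.cr_log_zero_one]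
  field_simp
  ring

theorem frame_log_one_m (J : Jets B F κ d v r p q p₁ q₁ p₂ q₂ p₃ q₃) :
      cr (emb K (comp (fun x => 24 * psi B.d x) (uFun F))) 0 1 -
      κ * cr (emb K (comp (fun x => 24 * psi B.d x) (uFun F))) 1 0 =
      κ * (- 3 * d ^ 2 * q + d * q) / r := by
  have := charZero K
  have hr := J.r_ne_zero
  have hk := J.root_ne_zero
  rw [J.cr_log_one_zero, J.cr_log_zero_one]
  field_simp
  ring

theorem frame_log_zero_one_p (J : Jets B F κ d v r p q p₁ q₁ p₂ q₂ p₃ q₃) :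
      κ * cr (emb K (comp (fun x => 24 * psi B.d x) (uFun F))) 2 0 +
      cr (emb K (comp (fun x => 24 * psi B.d x) (uFun F))) 1 1 =
      κ * (- 3 * d ^ 3 * p ^ 2 + 3 * d ^ 3 * q ^ 2 - 12 * d ^ 2 * r * p₁ + 7 * d ^ 2 * p ^ 2 -
      6 * d ^ 2 * p * q - d ^ 2 * q ^ 2 + 4 * d * r * p₁ - 2 * d * p ^ 2 +
      2 * d * p * q) / (4 * r ^ 2) := by
  have := charZero K
  have hr := J.r_ne_zero
  have hk := J.root_ne_zero
  rw [J.cr_log_two_zero, J.cr_log_one_one]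
  field_simp
  ring

theorem frame_log_zero_one_m (J : Jets B F κ d v r p q p₁ q₁ p₂ q₂ p₃ q₃) :
      cr (emb K (comp (fun x => 24 * psi B.d x) (uFun F))) 1 1 -
      κ * cr (emb K (comp (fun x => 24 * psi B.d x) (uFun F))) 2 0 =
      κ * (- 3 * d ^ 3 * p ^ 2 + 3 * d ^ 3 * q ^ 2 - 12 * d ^ 2 * r * q₁ + d ^ 2 * p ^ 2 +
      6 * d ^ 2 * p * q - 7 * d ^ 2 * q ^ 2 + 4 * d * r * q₁ - 2 * d * p * q +
      2 * d * q ^ 2) / (4 * r ^ 2) := by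
  have := charZero K
  have hr := J.r_ne_zero
  have hk := J.root_ne_zero
  rw [J.cr_log_two_zero, J.cr_log_one_one]
  field_simp
  ring

theorem frame_log_two_pp (J : Jets B F κ d v r p q p₁ q₁ p₂ q₂ p₃ q₃) :
      κ ^ 2 * cr (emb K (comp (fun x => 24 * psi B.d x) (uFun F))) 2 0 +
      2 * κ * cr (emb K (comp (fun x => 24 * psi B.d x) (uFun F))) 1 1 +
      cr (emb K (comp (fun x => 24 * psi B.d x) (uFun F))) 0 2 =
      κ ^ 2 * (- 3 * d ^ 3 * p ^ 2 - 6 * d ^ 2 * r * p₁ + 4 * d ^ 2 * p ^ 2 + 2 * d * r * p₁ - d *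
        p ^ 2) / r ^ 2 := by
  have := charZero K
  have hr := J.r_ne_zero
  have hk := J.root_ne_zero
  rw [J.cr_log_two_zero, J.cr_log_one_one, J.cr_log_zero_two]
  field_simp
  ring

theorem frame_log_two_pm (J : Jets B F κ d v r p q p₁ q₁ p₂ q₂ p₃ q₃) :
      cr (emb K (comp (fun x => 24 * psi B.d x) (uFun F))) 0 2 -
      κ ^ 2 * cr (emb K (comp (fun x => 24 * psi B.d x) (uFun F))) 2 0 =
      κ ^ 2 * (- 3 * d ^ 3 * p ^ 2 - 3 * d ^ 3 * q ^ 2 + d ^ 2 * p ^ 2 + 6 * d ^ 2 * p * q + d ^ 2 *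
        q ^ 2 -
      2 * d * p * q) / (2 * r ^ 2) := by
  have := charZero K
  have hr := J.r_ne_zero
  have hk := J.root_ne_zero
  rw [J.cr_log_two_zero, J.cr_log_zero_two]
  field_simp
  ring

theorem frame_log_two_mm (J : Jets B F κ d v r p q p₁ q₁ p₂ q₂ p₃ q₃) :
      κ ^ 2 * cr (emb K (comp (fun x => 24 * psi B.d x) (uFun F))) 2 0 -
      2 * κ * cr (emb K (comp (fun x => 24 * psi B.d x) (uFun F))) 1 1 +
      cr (emb K (comp (fun x => 24 * psi B.d x) (uFun F))) 0 2 =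
      κ ^ 2 * (- 3 * d ^ 3 * q ^ 2 + 6 * d ^ 2 * r * q₁ + 4 * d ^ 2 * q ^ 2 - 2 * d * r * q₁ - d *
        q ^ 2) / r ^ 2 := by
  have := charZero K
  have hr := J.r_ne_zero
  have hk := J.root_ne_zero
  rw [J.cr_log_two_zero, J.cr_log_one_one, J.cr_log_zero_two]
  field_simp
  ring

theorem frame_log_zero_two_pp (J : Jets B F κ d v r p q p₁ q₁ p₂ q₂ p₃ q₃) :
      κ² * cr (emb K (comp (fun x => 24 * psi B.d x) (uFun F))) 3 0 +
      2 * κ * cr (emb K (comp (fun x => 24 * psi B.d x) (uFun F))) 2 1 +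
      cr (emb K (comp (fun x => 24 * psi B.d x) (uFun F))) 1 2 =
      κ² * (- 9 * d⁴ * p³ + 9 * d⁴ * p² * q - 3 * d⁴ * p * q² + 3 * d⁴ * q³ -
      36 * d³ * r * p * p₁ + 12 * d³ * r * p₁ * q + 21 * d³ * p³ -
      15 * d³ * p² * q - 5 * d³ * p * q² - d³ * q³ - 24 * d² * r² * p₂ +
      48 * d² * r * p * p₁ - 16 * d² * r * p₁ * q - 18 * d² * p³ +
      16 * d² * p² * q + 2 * d² * p * q² + 8 * d * r² * p₂ - 12 * d * r * p * p₁ +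
      4 * d * r * p₁ * q + 4 * d * p³ - 4 * d * p² * q) / (4 * r³) := by
  have := charZero K
  have hr := J.r_ne_zero
  have hk := J.root_ne_zero
  rw [J.cr_log_three_zero, J.cr_log_two_one, J.cr_log_one_two]
  field_simp
  ring

theorem frame_log_zero_two_mm (J : Jets B F κ d v r p q p₁ q₁ p₂ q₂ p₃ q₃) :
      κ² * cr (emb K (comp (fun x => 24 * psi B.d x) (uFun F))) 3 0 -
      2 * κ * cr (emb K (comp (fun x => 24 * psi B.d x) (uFun F))) 2 1 +
      cr (emb K (comp (fun x => 24 * psi B.d x) (uFun F))) 1 2 =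
      κ² * (- 3 * d⁴ * p³ + 3 * d⁴ * p² * q - 9 * d⁴ * p * q² + 9 * d⁴ * q³ +
      12 * d³ * r * p * q₁ - 36 * d³ * r * q * q₁ + d³ * p³ + 5 * d³ * p² * q +
      15 * d³ * p * q² - 21 * d³ * q³ + 24 * d² * r² * q₂ -
      16 * d² * r * p * q₁ + 48 * d² * r * q * q₁ - 2 * d² * p² * q -
      16 * d² * p * q² + 18 * d² * q³ - 8 * d * r² * q₂ + 4 * d * r * p * q₁ -
      12 * d * r * q * q₁ + 4 * d * p * q² - 4 * d * q³) / (4 * r³) := by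
  have := charZero K
  have hr := J.r_ne_zero
  have hk := J.root_ne_zero
  rw [J.cr_log_three_zero, J.cr_log_two_one, J.cr_log_one_two]
  field_simp
  ring

end Jets

end

/-! ### The contractions occurring in F₂ -/

section

variable {B : Background} {F : LPS} {K : Type*} [Field K] [Algebra ℂ K] [Algebra LPS K]
  [IsScalarTower ℂ LPS K] [Algebra.FormallyEtale LPS K] [FaithfulSMul LPS K]

namespace Jets

variable {κ d v r p q p₁ q₁ p₂ q₂ p₃ q₃ : K}

/-- The entries of the matrix `𝒞`, as a function of the sum of their labels. -/
def frameInv (κ p q : K) (j : ℕ) : K := κ ^ (2 - j) *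
    (1 / (2 * κ * p) + (-1) ^ j * -(1 / (2 * κ * q)))

theorem emb_CC' (J : Jets B F κ d v r p q p₁ q₁ p₂ q₂ p₃ q₃) (a b : Fin 2) :
    emb K (CC F a b) = frameInv κ p q (a + b) := by
  rw [J.emb_CC, frameInv]
  fin_cases a <;> fin_cases b <;> simp <;> ring

theorem frameInv_zero : frameInv κ p q 0 = κ ^ 2 * (1 / (2 * κ * p) + -(1 / (2 * κ * q))) := by
  simp [frameInv]

theorem frameInv_one : frameInv κ p q 1 = κ * (1 / (2 * κ * p) - -(1 / (2 * κ * q))) := by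
  simp [frameInv]

theorem frameInv_two : frameInv κ p q 2 = 1 / (2 * κ * p) + -(1 / (2 * κ * q)) := by
  simp [frameInv]

set_option maxHeartbeats 1000000 in
-- The contraction formula with m = 1/(2κp) and n = -1/(2κq), the weights of 𝒞 on the two
-- eigenvectors. The other contractions use the same weights.
theorem emb_contraction_four (J : Jets B F κ d v r p q p₁ q₁ p₂ q₂ p₃ q₃) :
    emb K (∑ a, ∑ b, ∑ c, ∑ e, prim F [0, 0, a, b, c, e] * CC F a b * CC F c e) =
      κ * (- 5 * d³ * p⁵ * q + 20 * d³ * p⁴ * q² - 30 * d³ * p³ * q³ +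
      20 * d³ * p² * q⁴ - 5 * d³ * p * q⁵ - 12 * d² * r * p⁴ * q₁ -
      30 * d² * r * p³ * p₁ * q + 54 * d² * r * p³ * q * q₁ +
      72 * d² * r * p² * p₁ * q² - 72 * d² * r * p² * q² * q₁ -
      54 * d² * r * p * p₁ * q³ + 30 * d² * r * p * q³ * q₁ +
      12 * d² * r * p₁ * q⁴ + 9 * d² * p⁵ * q - 36 * d² * p⁴ * q² +
      54 * d² * p³ * q³ - 36 * d² * p² * q⁴ + 9 * d² * p * q⁵ -
      20 * d * r² * p³ * q₂ - 16 * d * r² * p² * p₁ * q₁ -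
      4 * d * r² * p² * p₂ * q + 24 * d * r² * p² * q * q₂ +
      24 * d * r² * p² * q₁² - 16 * d * r² * p * p₁ * q * q₁ +
      24 * d * r² * p * p₂ * q² - 4 * d * r² * p * q² * q₂ +
      24 * d * r² * p₁² * q² - 16 * d * r² * p₁ * q² * q₁ -
      20 * d * r² * p₂ * q³ + 8 * d * r * p⁴ * q₁ + 6 * d * r * p³ * p₁ * q -
      22 * d * r * p³ * q * q₁ - 20 * d * r * p² * p₁ * q² +
      20 * d * r * p² * q² * q₁ + 22 * d * r * p * p₁ * q³ -
      6 * d * r * p * q³ * q₁ - 8 * d * r * p₁ * q⁴ - 2 * d * p⁵ * q +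
      8 * d * p⁴ * q² - 12 * d * p³ * q³ + 8 * d * p² * q⁴ -
      2 * d * p * q⁵ - 16 * r³ * p² * q₃ + 16 * r³ * p₃ * q²) / (8 * r³ * p² * q²) := by
  have := charZero K
  have hr := J.r_ne_zero
  have hk := J.root_ne_zero
  have hp := J.p_ne_zero
  have hq := J.q_ne_zero
  have h := contraction_four (frameInv_zero (κ := κ) (p := p) (q := q)) frameInv_one frameInv_two
    (fun j => cr (emb K F) (6 - j) j)
  beta_reduce at h
  simp only [map_sum, map_add, map_sub, map_mul, emb_smul, map_div₀, map_one, map_ofNat,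
    J.emb_CC', emb_prim_zero_zero_four]
  rw [h]
  clear h
  simp only [Nat.sub_zero, Nat.reduceSub]
  rw [J.frame_zero_zero_four_pppp, J.frame_zero_zero_four_ppmm, J.frame_zero_zero_four_mmmm]
  field_simp
  ring

set_option maxHeartbeats 1000000 in
theorem emb_contraction_two_four (J : Jets B F κ d v r p q p₁ q₁ p₂ q₂ p₃ q₃) :
    emb K (∑ a, ∑ b, ∑ c, ∑ e, ∑ f, ∑ g,
      prim F [0, 0, a, b] * prim F [0, c, e, f, g] * CC F a c * CC F b e * CC F f g) =
      κ * (- d³ * p⁶ * q² + 4 * d³ * p⁵ * q³ - 6 * d³ * p⁴ * q⁴ +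
      4 * d³ * p³ * q⁵ - d³ * p² * q⁶ - 6 * d² * r * p⁵ * q * q₁ -
      8 * d² * r * p⁴ * p₁ * q² + 20 * d² * r * p⁴ * q² * q₁ +
      22 * d² * r * p³ * p₁ * q³ - 22 * d² * r * p³ * q³ * q₁ -
      20 * d² * r * p² * p₁ * q⁴ + 8 * d² * r * p² * q⁴ * q₁ +
      6 * d² * r * p * p₁ * q⁵ + d² * p⁶ * q² - 4 * d² * p⁵ * q³ +
      6 * d² * p⁴ * q⁴ - 4 * d² * p³ * q⁵ + d² * p² * q⁶ -
      12 * d * r² * p⁴ * q₁² - 4 * d * r² * p³ * p₁ * q * q₁ +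
      20 * d * r² * p³ * q * q₁² - 8 * d * r² * p² * p₁ * q² * q₁ +
      20 * d * r² * p * p₁² * q³ - 4 * d * r² * p * p₁ * q³ * q₁ -
      12 * d * r² * p₁² * q⁴ + 2 * d * r * p⁵ * q * q₁ -
      4 * d * r * p⁴ * q² * q₁ - 2 * d * r * p³ * p₁ * q³ +
      2 * d * r * p³ * q³ * q₁ + 4 * d * r * p² * p₁ * q⁴ -
      2 * d * r * p * p₁ * q⁵ - 16 * r³ * p³ * q₁ * q₂ +
      16 * r³ * p₁ * p₂ * q³) / (8 * r³ * p³ * q³) := by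
  have := charZero K
  have hr := J.r_ne_zero
  have hk := J.root_ne_zero
  have hp := J.p_ne_zero
  have hq := J.q_ne_zero
  have h := contraction_two_four (frameInv_zero (κ := κ) (p := p) (q := q)) frameInv_one frameInv_two
    (fun j => cr (emb K F) (4 - j) j)
    (fun j => cr (emb K F) (5 - j) j)
  beta_reduce at h
  simp only [map_sum, map_add, map_sub, map_mul, emb_smul, map_div₀, map_one, map_ofNat,
    J.emb_CC', emb_prim_zero_zero_two]
  simp only [emb_prim_zero_four]
  rw [h]
  clear h
  simp only [Nat.sub_zero, Nat.reduceSub]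
  rw [J.frame_zero_zero_two_pp, J.frame_zero_zero_two_pm, J.frame_zero_zero_two_mm,
    J.frame_zero_four_pppp, J.frame_zero_four_pppm, J.frame_zero_four_ppmm, J.frame_zero_four_pmmm,
    J.frame_zero_four_mmmm]
  field_simp
  ring

set_option maxHeartbeats 1000000 in
theorem emb_contraction_three_three (J : Jets B F κ d v r p q p₁ q₁ p₂ q₂ p₃ q₃) :
    emb K (∑ a, ∑ b, ∑ c, ∑ e, ∑ f, ∑ g,
      prim F [0, 0, a, b, c] * prim F [0, e, f, g] * CC F a e * CC F b f * CC F c g) =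
      κ * (- d³ * p⁶ * q² + 4 * d³ * p⁵ * q³ - 6 * d³ * p⁴ * q⁴ +
      4 * d³ * p³ * q⁵ - d³ * p² * q⁶ - 6 * d² * r * p⁵ * q * q₁ -
      10 * d² * r * p⁴ * p₁ * q² + 22 * d² * r * p⁴ * q² * q₁ +
      26 * d² * r * p³ * p₁ * q³ - 26 * d² * r * p³ * q³ * q₁ -
      22 * d² * r * p² * p₁ * q⁴ + 10 * d² * r * p² * q⁴ * q₁ +
      6 * d² * r * p * p₁ * q⁵ + 2 * d² * p⁶ * q² - 8 * d² * p⁵ * q³ +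
      12 * d² * p⁴ * q⁴ - 8 * d² * p³ * q⁵ + 2 * d² * p² * q⁶ -
      4 * d * r² * p⁴ * q * q₂ - 8 * d * r² * p⁴ * q₁² -
      4 * d * r² * p³ * p₁ * q * q₁ + 4 * d * r² * p³ * q² * q₂ +
      12 * d * r² * p³ * q * q₁² + 4 * d * r² * p² * p₂ * q³ +
      12 * d * r² * p * p₁² * q³ - 4 * d * r² * p * p₁ * q³ * q₁ -
      4 * d * r² * p * p₂ * q⁴ - 8 * d * r² * p₁² * q⁴ +
      2 * d * r * p⁵ * q * q₁ - 4 * d * r * p⁴ * q² * q₁ -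
      2 * d * r * p³ * p₁ * q³ + 2 * d * r * p³ * q³ * q₁ +
      4 * d * r * p² * p₁ * q⁴ - 2 * d * r * p * p₁ * q⁵ -
      16 * r³ * p³ * q₁ * q₂ + 16 * r³ * p₁ * p₂ * q³) / (8 * r³ * p³ * q³) := by
  have := charZero K
  have hr := J.r_ne_zero
  have hk := J.root_ne_zero
  have hp := J.p_ne_zero
  have hq := J.q_ne_zero
  have h := contraction_three_three (frameInv_zero (κ := κ) (p := p) (q := q)) frameInv_one frameInv_two
    (fun j => cr (emb K F) (5 - j) j)
    (fun j => cr (emb K F) (4 - j) j)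
  beta_reduce at h
  simp only [map_sum, map_add, map_sub, map_mul, emb_smul, map_div₀, map_one, map_ofNat,
    J.emb_CC', emb_prim_zero_zero_three]
  simp only [emb_prim_zero_three]
  rw [h]
  clear h
  simp only [Nat.sub_zero, Nat.reduceSub]
  rw [J.frame_zero_zero_three_ppp, J.frame_zero_zero_three_ppm, J.frame_zero_zero_three_pmm,
    J.frame_zero_zero_three_mmm, J.frame_zero_three_ppp, J.frame_zero_three_ppm,
    J.frame_zero_three_pmm, J.frame_zero_three_mmm]
  field_simp
  ring

set_option maxHeartbeats 1000000 in
theorem emb_contraction_two_three_three (J : Jets B F κ d v r p q p₁ q₁ p₂ q₂ p₃ q₃) :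
    emb K (∑ a, ∑ b, ∑ c, ∑ e, ∑ f, ∑ g, ∑ h, ∑ k,
      prim F [0, 0, a, b] * prim F [0, c, e, f] * prim F [0, g, h, k] *
        CC F a c * CC F b g * CC F e h * CC F f k) =
      κ * (- d² * p⁶ * q² * q₁ - d² * p⁵ * p₁ * q³ + 3 * d² * p⁵ * q³ * q₁ +
      3 * d² * p⁴ * p₁ * q⁴ - 3 * d² * p⁴ * q⁴ * q₁ -
      3 * d² * p³ * p₁ * q⁵ + d² * p³ * q⁵ * q₁ + d² * p² * p₁ * q⁶ -
      2 * d * r * p⁵ * q * q₁² + 2 * d * r * p⁴ * q² * q₁² +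
      2 * d * r * p² * p₁² * q⁴ - 2 * d * r * p * p₁² * q⁵ -
      4 * r² * p⁴ * q₁³ + 4 * r² * p₁³ * q⁴) / (2 * r² * p⁴ * q⁴) := by
  have := charZero K
  have hr := J.r_ne_zero
  have hk := J.root_ne_zero
  have hp := J.p_ne_zero
  have hq := J.q_ne_zero
  have h := contraction_two_three_three (frameInv_zero (κ := κ) (p := p) (q := q)) frameInv_one frameInv_two
    (fun j => cr (emb K F) (4 - j) j)
    (fun j => cr (emb K F) (4 - j) j)
  beta_reduce at h
  simp only [map_sum, map_add, map_sub, map_mul, emb_smul, map_div₀, map_one, map_ofNat,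
    J.emb_CC', emb_prim_zero_zero_two]
  simp only [emb_prim_zero_three]
  rw [h]
  clear h
  simp only [Nat.sub_zero, Nat.reduceSub]
  rw [J.frame_zero_zero_two_pp, J.frame_zero_zero_two_pm, J.frame_zero_zero_two_mm,
    J.frame_zero_three_ppp, J.frame_zero_three_ppm, J.frame_zero_three_pmm, J.frame_zero_three_mmm]
  field_simp
  ring

set_option maxHeartbeats 1000000 in
theorem emb_contraction_log_two (J : Jets B F κ d v r p q p₁ q₁ p₂ q₂ p₃ q₃) :
    emb K (∑ a, ∑ b, ((1 / 2 : ℂ) • prim (comp (fun x => 24 * psi B.d x) (uFun F)) [0, a,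
      b] + (4 / 5 : ℂ) •
      (prim (comp (fun x => 24 * psi B.d x) (uFun F)) [0, a] *
        prim (comp (fun x => 24 * psi B.d x) (uFun F)) [b])) * CC F a b) =
      κ * (288 * d⁴ * r * p * p₁ * q - 288 * d⁴ * r * p * q * q₁ + 15 * d⁴ * p⁴ -
      204 * d⁴ * p³ * q + 378 * d⁴ * p² * q² - 204 * d⁴ * p * q³ +
      15 * d⁴ * q⁴ - 60 * d³ * r * p² * q₁ - 372 * d³ * r * p * p₁ * q +
      372 * d³ * r * p * q * q₁ + 60 * d³ * r * p₁ * q² - 5 * d³ * p⁴ +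
      176 * d³ * p³ * q - 342 * d³ * p² * q² + 176 * d³ * p * q³ -
      5 * d³ * q⁴ - 120 * d² * r² * p * q₂ - 120 * d² * r² * p₂ * q +
      80 * d² * r * p² * q₁ + 272 * d² * r * p * p₁ * q - 272 * d² * r * p * q * q₁ -
      80 * d² * r * p₁ * q² - 96 * d² * p³ * q + 192 * d² * p² * q² -
      96 * d² * p * q³ + 40 * d * r² * p * q₂ + 40 * d * r² * p₂ * q -
      20 * d * r * p² * q₁ - 60 * d * r * p * p₁ * q + 60 * d * r * p * q * q₁ +
      20 * d * r * p₁ * q² + 20 * d * p³ * q - 40 * d * p² * q² +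
      20 * d * p * q³) / (80 * r³ * p * q) := by
  have := charZero K
  have hr := J.r_ne_zero
  have hk := J.root_ne_zero
  have hp := J.p_ne_zero
  have hq := J.q_ne_zero
  have h := contraction_two (frameInv_zero (κ := κ) (p := p) (q := q)) frameInv_one frameInv_two
    (fun j => cr (emb K (comp (fun x => 24 * psi B.d x) (uFun F))) (3 - j) j)
    (fun j => cr (emb K (comp (fun x => 24 * psi B.d x) (uFun F))) (2 - j) j)
    (fun j => cr (emb K (comp (fun x => 24 * psi B.d x) (uFun F))) (1 - j) j)
  beta_reduce at h
  simp only [map_sum, map_add, map_sub, map_mul, emb_smul, map_div₀, map_one, map_ofNat,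
    J.emb_CC', emb_prim_zero_two]
  simp only [emb_prim_zero_one, emb_prim_one]
  rw [h]
  clear h
  simp only [Nat.sub_zero, Nat.reduceSub]
  rw [J.frame_log_zero_two_pp, J.frame_log_zero_two_mm, J.frame_log_zero_one_p,
    J.frame_log_zero_one_m, J.frame_log_one_p, J.frame_log_one_m]
  field_simp
  ring

set_option maxHeartbeats 1000000 in
theorem emb_contraction_log_two_two (J : Jets B F κ d v r p q p₁ q₁ p₂ q₂ p₃ q₃) :
    emb K (∑ a, ∑ b, ∑ c, ∑ e, prim F [0, 0, a, b] *
      ((6 / 5 : ℂ) • prim (comp (fun x => 24 * psi B.d x) (uFun F)) [c, e] - (1 / 10 : ℂ) •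
        (prim (comp (fun x => 24 * psi B.d x) (uFun F)) [c] *
          prim (comp (fun x => 24 * psi B.d x) (uFun F)) [e])) * CC F a c * CC F b e) =
      κ * (9 * d⁵ * p⁴ * q² - 18 * d⁵ * p³ * q³ + 9 * d⁵ * p² * q⁴ -
      18 * d⁴ * r * p² * p₁ * q² + 18 * d⁴ * r * p² * q² * q₁ +
      18 * d⁴ * p⁵ * q - 42 * d⁴ * p⁴ * q² + 48 * d⁴ * p³ * q³ -
      42 * d⁴ * p² * q⁴ + 18 * d⁴ * p * q⁵ - 60 * d³ * r * p² * p₁ * q² +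
      60 * d³ * r * p² * q² * q₁ - 6 * d³ * p⁵ * q - 23 * d³ * p⁴ * q² +
      58 * d³ * p³ * q³ - 23 * d³ * p² * q⁴ - 6 * d³ * p * q⁵ -
      144 * d² * r² * p² * q₁² - 144 * d² * r² * p₁² * q² +
      94 * d² * r * p² * p₁ * q² - 94 * d² * r * p² * q² * q₁ +
      12 * d² * p⁴ * q² - 24 * d² * p³ * q³ + 12 * d² * p² * q⁴ +
      48 * d * r² * p² * q₁² + 48 * d * r² * p₁² * q² -
      24 * d * r * p² * p₁ * q² + 24 * d * r * p² * q² * q₁) / (40 * r³ * p² * q²) := by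
  have := charZero K
  have hr := J.r_ne_zero
  have hk := J.root_ne_zero
  have hp := J.p_ne_zero
  have hq := J.q_ne_zero
  have h := contraction_two_two (frameInv_zero (κ := κ) (p := p) (q := q)) frameInv_one frameInv_two
    (fun j => cr (emb K F) (4 - j) j)
    (fun j => cr (emb K (comp (fun x => 24 * psi B.d x) (uFun F))) (2 - j) j)
    (fun j => cr (emb K (comp (fun x => 24 * psi B.d x) (uFun F))) (1 - j) j)
  beta_reduce at h
  simp only [map_sum, map_add, map_sub, map_mul, emb_smul, map_div₀, map_one, map_ofNat,
    J.emb_CC', emb_prim_zero_zero_two]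
  simp only [emb_prim_two, emb_prim_one]
  rw [h]
  clear h
  simp only [Nat.sub_zero, Nat.reduceSub]
  rw [J.frame_zero_zero_two_pp, J.frame_zero_zero_two_pm, J.frame_zero_zero_two_mm,
    J.frame_log_two_pp, J.frame_log_two_pm, J.frame_log_two_mm, J.frame_log_one_p,
    J.frame_log_one_m]
  field_simp
  ring

set_option maxHeartbeats 1000000 in
theorem emb_contraction_log_three_one (J : Jets B F κ d v r p q p₁ q₁ p₂ q₂ p₃ q₃) :
    emb K (∑ a, ∑ b, ∑ c, ∑ e, ((7 / 10 : ℂ) • (prim F [0, 0, a, b, c] *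
      prim (comp (fun x => 24 * psi B.d x) (uFun F)) [e]) -
      (3 / 10 : ℂ) • (prim F [0, a, b, c] *
        prim (comp (fun x => 24 * psi B.d x) (uFun F)) [0, e])) * CC F a b * CC F c e) =
      κ * (21 * d⁴ * p⁵ * q - 84 * d⁴ * p⁴ * q² + 126 * d⁴ * p³ * q³ -
      84 * d⁴ * p² * q⁴ + 21 * d⁴ * p * q⁵ + 18 * d³ * r * p⁴ * q₁ +
      18 * d³ * r * p² * p₁ * q² - 18 * d³ * r * p² * q² * q₁ -
      18 * d³ * r * p₁ * q⁴ - 7 * d³ * p⁵ * q + 28 * d³ * p⁴ * q² -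
      42 * d³ * p³ * q³ + 28 * d³ * p² * q⁴ - 7 * d³ * p * q⁵ -
      168 * d² * r² * p² * q * q₂ + 72 * d² * r² * p² * q₁² -
      168 * d² * r² * p * p₂ * q² + 72 * d² * r² * p₁² * q² -
      6 * d² * r * p⁴ * q₁ - 36 * d² * r * p³ * q * q₁ -
      42 * d² * r * p² * p₁ * q² + 42 * d² * r * p² * q² * q₁ +
      36 * d² * r * p * p₁ * q³ + 6 * d² * r * p₁ * q⁴ +
      56 * d * r² * p² * q * q₂ - 24 * d * r² * p² * q₁² +
      56 * d * r² * p * p₂ * q² - 24 * d * r² * p₁² * q² +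
      12 * d * r * p³ * q * q₁ + 12 * d * r * p² * p₁ * q² -
      12 * d * r * p² * q² * q₁ - 12 * d * r * p * p₁ * q³) / (80 * r³ * p² * q²) := by
  have := charZero K
  have hr := J.r_ne_zero
  have hk := J.root_ne_zero
  have hp := J.p_ne_zero
  have hq := J.q_ne_zero
  have h := contraction_three_one (frameInv_zero (κ := κ) (p := p) (q := q)) frameInv_one frameInv_two
    (fun j => cr (emb K F) (5 - j) j)
    (fun j => cr (emb K F) (4 - j) j)
    (fun j => cr (emb K (comp (fun x => 24 * psi B.d x) (uFun F))) (2 - j) j)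
    (fun j => cr (emb K (comp (fun x => 24 * psi B.d x) (uFun F))) (1 - j) j)
  beta_reduce at h
  simp only [map_sum, map_add, map_sub, map_mul, emb_smul, map_div₀, map_one, map_ofNat,
    J.emb_CC', emb_prim_zero_zero_three]
  simp only [emb_prim_zero_three, emb_prim_zero_one, emb_prim_one]
  rw [h]
  clear h
  simp only [Nat.sub_zero, Nat.reduceSub]
  rw [J.frame_zero_zero_three_ppp, J.frame_zero_zero_three_ppm, J.frame_zero_zero_three_pmm,
    J.frame_zero_zero_three_mmm, J.frame_zero_three_ppp, J.frame_zero_three_ppm,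
    J.frame_zero_three_pmm, J.frame_zero_three_mmm, J.frame_log_zero_one_p, J.frame_log_zero_one_m,
    J.frame_log_one_p, J.frame_log_one_m]
  field_simp
  ring

set_option maxHeartbeats 1000000 in
theorem emb_contraction_log_two_three_one (J : Jets B F κ d v r p q p₁ q₁ p₂ q₂ p₃ q₃) :
    emb K (∑ a, ∑ b, ∑ c, ∑ e, ∑ f, ∑ g, prim F [0, 0, a, b] * prim F [0, c, e, f] *
      prim (comp (fun x => 24 * psi B.d x) (uFun F)) [g] *
      ((3 / 10 : ℂ) • (CC F a g * CC F b c * CC F e f) -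
        (23 / 10 : ℂ) • (CC F a c * CC F b e * CC F f g))) =
      κ * (- 69 * d⁴ * p⁵ * q + 276 * d⁴ * p⁴ * q² - 414 * d⁴ * p³ * q³ +
      276 * d⁴ * p² * q⁴ - 69 * d⁴ * p * q⁵ - 18 * d³ * r * p⁴ * q₁ +
      36 * d³ * r * p³ * q * q₁ + 18 * d³ * r * p² * p₁ * q² -
      18 * d³ * r * p² * q² * q₁ - 36 * d³ * r * p * p₁ * q³ +
      18 * d³ * r * p₁ * q⁴ + 23 * d³ * p⁵ * q - 92 * d³ * p⁴ * q² +
      138 * d³ * p³ * q³ - 92 * d³ * p² * q⁴ + 23 * d³ * p * q⁵ +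
      480 * d² * r² * p² * q₁² + 480 * d² * r² * p₁² * q² +
      6 * d² * r * p⁴ * q₁ - 12 * d² * r * p³ * q * q₁ -
      6 * d² * r * p² * p₁ * q² + 6 * d² * r * p² * q² * q₁ +
      12 * d² * r * p * p₁ * q³ - 6 * d² * r * p₁ * q⁴ -
      160 * d * r² * p² * q₁² - 160 * d * r² * p₁² * q²) / (80 * r³ * p² * q²) := by
  have := charZero K
  have hr := J.r_ne_zero
  have hk := J.root_ne_zero
  have hp := J.p_ne_zero
  have hq := J.q_ne_zero
  have h := contraction_two_three_one (frameInv_zero (κ := κ) (p := p) (q := q)) frameInv_one frameInv_two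
    (fun j => cr (emb K F) (4 - j) j)
    (fun j => cr (emb K F) (4 - j) j)
    (fun j => cr (emb K (comp (fun x => 24 * psi B.d x) (uFun F))) (1 - j) j)
  beta_reduce at h
  simp only [map_sum, map_add, map_sub, map_mul, emb_smul, map_div₀, map_one, map_ofNat,
    J.emb_CC', emb_prim_zero_zero_two]
  simp only [emb_prim_zero_three, emb_prim_one]
  rw [h]
  clear h
  simp only [Nat.sub_zero, Nat.reduceSub]
  rw [J.frame_zero_zero_two_pp, J.frame_zero_zero_two_pm, J.frame_zero_zero_two_mm,
    J.frame_zero_three_ppp, J.frame_zero_three_ppm, J.frame_zero_three_pmm, J.frame_zero_three_mmm,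
    J.frame_log_one_p, J.frame_log_one_m]
  field_simp
  ring

end Jets

end

/-! ### F₂ in canonical coordinates -/

section

variable {B : Background} {F : LPS} {K : Type*} [Field K] [Algebra ℂ K] [Algebra LPS K]
  [IsScalarTower ℂ LPS K] [Algebra.FormallyEtale LPS K] [FaithfulSMul LPS K]

namespace Jets

variable {κ d v r p q p₁ q₁ p₂ q₂ p₃ q₃ : K}

set_option maxHeartbeats 1000000 in
-- The contractions are collected over the common denominator 46080 = 576·80. Their higher powers of
-- p and q in the denominator are absorbed by the rescaled jets. The result is the hypothesis on f
-- in `genus_two`.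
theorem emb_genusTwo (J : Jets B F κ d v r p q p₁ q₁ p₂ q₂ p₃ q₃)
    {b₁ b₂ b₃ c₁ c₂ c₃ : K} (hb₁ : r * p₁ = b₁ * p) (hb₂ : r² * p₂ = b₂ * p)
    (hb₃ : r³ * p₃ = b₃ * p) (hc₁ : r * q₁ = c₁ * q) (hc₂ : r² * q₂ = c₂ * q)
    (hc₃ : r³ * q₃ = c₃ * q) :
    emb K (genusTwo B F) * (46080 * r³ * p * q) = κ * (
      - 18 * d⁶ * p³ * q - 18 * d⁶ * p * q³ + 126 * d⁵ * p³ * q -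
      36 * d⁵ * p² * q² + 126 * d⁵ * p * q³ - 328 * d⁴ * p³ * q +
      252 * d⁴ * p² * b₁ * q + 168 * d⁴ * p² * q² - 328 * d⁴ * p * q³ -
      252 * d⁴ * p * q² * c₁ - d³ * p⁴ + 322 * d³ * p³ * q -
      456 * d³ * p² * b₁ * q - 130 * d³ * p² * q² - 24 * d³ * p² * q * c₁ +
      24 * d³ * p * b₁ * q² + 322 * d³ * p * q³ + 456 * d³ * p * q² * c₁ -
      d³ * q⁴ + 7 * d² * p⁴ - 14 * d² * p³ * b₁ - 222 * d² * p³ * q +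
      2 * d² * p³ * c₁ + 438 * d² * p² * b₁ * q + 186 * d² * p² * q² +
      42 * d² * p² * q * c₁ + 264 * d² * p * b₁² * q - 42 * d² * p * b₁ * q² -
      288 * d² * p * b₂ * q - 222 * d² * p * q³ - 438 * d² * p * q² * c₁ +
      264 * d² * p * q * c₁² - 288 * d² * p * q * c₂ - 2 * d² * b₁ * q³ +
      7 * d² * q⁴ + 14 * d² * q³ * c₁ - 10 * d * p⁴ + 30 * d * p³ * b₁ +
      80 * d * p³ * q - 2 * d * p³ * c₁ - 154 * d * p² * b₁ * q +
      4 * d * p² * b₁ * c₁ - 20 * d * p² * b₂ - 100 * d * p² * q² -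
      34 * d * p² * q * c₁ + 60 * d * p² * c₁² - 36 * d * p² * c₂ -
      132 * d * p * b₁² * q + 34 * d * p * b₁ * q² - 40 * d * p * b₁ * q * c₁ +
      152 * d * p * b₂ * q + 80 * d * p * q³ + 154 * d * p * q² * c₁ -
      132 * d * p * q * c₁² + 152 * d * p * q * c₂ + 60 * d * b₁² * q² +
      2 * d * b₁ * q³ + 4 * d * b₁ * q² * c₁ - 36 * d * b₂ * q² - 10 * d * q⁴ -
      30 * d * q³ * c₁ - 20 * d * q² * c₂ - 256 * p * c₁³ + 336 * p * c₁ * c₂ -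
      80 * p * c₃ + 256 * b₁³ * q - 336 * b₁ * b₂ * q + 80 * b₃ * q) := by
  have := charZero K
  have hr := J.r_ne_zero
  have hk := J.root_ne_zero
  have hp := J.p_ne_zero
  have hq := J.q_ne_zero
  have hΔ : emb K (Delta F)⁻¹ = (p * q)⁻¹ := by
    refine eq_inv_of_mul_eq_one_left ?_
    rw [← J.emb_Delta, ← map_mul, MvPowerSeries.inv_mul_cancel _ (by
      rw [constantCoeff_Delta J.cone.toIsCone]; exact one_ne_zero), map_one]
  have hp₁ : p₁ = b₁ * p / r := by rw [← hb₁]; field_simp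
  have hp₂ : p₂ = b₂ * p / r² := by rw [← hb₂]; field_simp
  have hp₃ : p₃ = b₃ * p / r³ := by rw [← hb₃]; field_simp
  have hq₁ : q₁ = c₁ * q / r := by rw [← hc₁]; field_simp
  have hq₂ : q₂ = c₂ * q / r² := by rw [← hc₂]; field_simp
  have hq₃ : q₃ = c₃ * q / r³ := by rw [← hc₃]; field_simp
  rw [genusTwo, map_add, map_add, J.emb_genusTwoTwo, genusTwoZero, genusTwoOne]
  rw [map_add, map_sub, map_sub, emb_smul, emb_smul, emb_smul, emb_smul, J.emb_contraction_four,
    J.emb_contraction_two_four, J.emb_contraction_three_three, J.emb_contraction_two_three_three]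
  rw [emb_smul, map_add, map_add, map_add, map_add, J.emb_contraction_log_two,
    J.emb_contraction_log_two_two, J.emb_contraction_log_three_one,
    J.emb_contraction_log_two_three_one, emb_smul, map_mul, map_mul, map_mul, map_pow,
    J.emb_delta_uFun, J.emb_comp_deriv_deriv_phi, J.emb_comp_deriv_deriv_psi, hΔ]
  simp only [map_div₀, map_one, map_ofNat]
  rw [hp₁, hp₂, hp₃, hq₁, hq₂, hq₃]
  field_simp
  ring

end Jets

end

/-! ### The constraints for L₋₁ and L₂ in genus 1 and 2 -/

section

variable {B : Background} {F : LPS} {K : Type*} [Field K] [Algebra ℂ K] [Algebra LPS K]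
  [IsScalarTower ℂ LPS K] [Algebra.FormallyEtale LPS K] [FaithfulSMul LPS K]

theorem eq_add_zero_smul {V : Type*} [AddCommGroup V] [Module K V] (x a b : V) :
    x = x + (0 : K) • a + (0 : K) • b := by simp

namespace Jets

variable {κ d v r p q p₁ q₁ p₂ q₂ p₃ q₃ : K}

/-- The rescaled jets are taken to be rⁿpₙ/p and rⁿqₙ/q, which exist because p and q are nonzero. -/
theorem virK_three_genusTwo (J : Jets B F κ d v r p q p₁ q₁ p₂ q₂ p₃ q₃) :
    virK B F K 3 (emb K (genusTwo B F)) + (1 / 2 * bilK B (emb K (genusOne B F))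
      (emb K (genusOne B F)) + lap B (emb K (genusOne B F))) = 0 := by
  have hp := J.p_ne_zero
  have hq := J.q_ne_zero
  have h (n : ℕ) (x : K) : r ^ n * x = r ^ n * x / p * p := by field_simp
  have h' (n : ℕ) (x : K) : r ^ n * x = r ^ n * x / q * q := by field_simp
  have e₁ := h 1 p₁
  have e₁' := h' 1 q₁
  rw [pow_one] at e₁ e₁'
  exact J.genus_two e₁ (h 2 p₂) (h 3 p₃) e₁' (h' 2 q₂) (h' 3 q₃)
    (J.emb_genusTwo e₁ (h 2 p₂) (h 3 p₃) e₁' (h' 2 q₂) (h' 3 q₃))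

/-- The string field maps both canonical coordinates to -1 and commutes with ∂, so it annihilates
all their jets. This gives the constraints for L₋₁, because v itself does not occur in F₁ and F₂. -/
theorem virK_zero_p (J : Jets B F κ d v r p q p₁ q₁ p₂ q₂ p₃ q₃) : virK B F K 0 p = 0 := by
  conv_lhs => rw [← J.hp]
  rw [J.cone.virK_zero_delta_of (f := can B F κ) (κ := κ)
    ((J.grad_can).trans (eq_add_zero_smul _ _ _)),
    J.cone.virK_zero_can J.root, map_neg, Derivation.map_one_eq_zero, neg_zero]

theorem virK_zero_p₁ (J : Jets B F κ d v r p q p₁ q₁ p₂ q₂ p₃ q₃) : virK B F K 0 p₁ = 0 := by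
  conv_lhs => rw [← J.hp₁]
  rw [J.cone.virK_zero_delta_of (f := p) (κ := κ)
    ((J.grad_p rfl).trans (eq_add_zero_smul _ _ _)), J.virK_zero_p, map_zero]

theorem virK_zero_p₂ (J : Jets B F κ d v r p q p₁ q₁ p₂ q₂ p₃ q₃) : virK B F K 0 p₂ = 0 := by
  conv_lhs => rw [← J.hp₂]
  rw [J.cone.virK_zero_delta_of (f := p₁) (κ := κ)
    ((J.grad_p₁ rfl rfl).trans (eq_add_zero_smul _ _ _)), J.virK_zero_p₁,
    map_zero]

theorem virK_zero_p₃ (J : Jets B F κ d v r p q p₁ q₁ p₂ q₂ p₃ q₃) : virK B F K 0 p₃ = 0 := by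
  conv_lhs => rw [← J.hp₃]
  rw [J.cone.virK_zero_delta_of (f := p₂) (κ := κ) (J.grad_p₂ rfl rfl rfl), J.virK_zero_p₂,
    map_zero]

theorem virK_zero_r (J : Jets B F κ d v r p q p₁ q₁ p₂ q₂ p₃ q₃) : virK B F K 0 r = 0 := by
  conv_lhs => rw [J.two_mul_r]
  rw [Derivation.map_smul, map_sub, J.cone.virK_zero_can J.root, J.cone.virK_zero_can J.root.neg,
    sub_self, smul_zero]

theorem virK_zero_κ (J : Jets B F κ d v r p q p₁ q₁ p₂ q₂ p₃ q₃) : virK B F K 0 κ = 0 := by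
  rw [J.virK_κ, J.virK_zero_r, mul_zero, zero_div]

theorem virK_zero_genusOne (J : Jets B F κ d v r p q p₁ q₁ p₂ q₂ p₃ q₃) :
    virK B F K 0 (emb K (genusOne B F)) = 0 := by
  rw [J.virK_genusOne, J.virK_zero_p, J.neg.virK_zero_p, J.virK_zero_r]
  simp

theorem virK_zero_genusTwo (J : Jets B F κ d v r p q p₁ q₁ p₂ q₂ p₃ q₃) :
    virK B F K 0 (emb K (genusTwo B F)) = 0 := by
  have := charZero K
  have hr := J.r_ne_zero
  have hp := J.p_ne_zero
  have hq := J.q_ne_zero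
  have h (n : ℕ) (x : K) : r ^ n * x = r ^ n * x / p * p := by field_simp
  have h' (n : ℕ) (x : K) : r ^ n * x = r ^ n * x / q * q := by field_simp
  have e₁ := h 1 p₁
  have e₁' := h' 1 q₁
  rw [pow_one] at e₁ e₁'
  have h0 : virK B F K 0 (46080 * r ^ 3 * p * q) = 0 := by
    simp only [Derivation.leibniz, Derivation.leibniz_pow, derivation_ofNat, J.virK_zero_r,
      J.virK_zero_p, J.neg.virK_zero_p, smul_zero, add_zero]
  have h1 : 46080 * r ^ 3 * p * q ≠ 0 :=
    _root_.mul_ne_zero (_root_.mul_ne_zero (_root_.mul_ne_zero (by norm_num)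
      (pow_ne_zero 3 hr)) hp) hq
  have h2 := congrArg (virK B F K 0)
    (J.emb_genusTwo e₁ (h 2 p₂) (h 3 p₃) e₁' (h' 2 q₂) (h' 3 q₃))
  rw [Derivation.leibniz, h0, smul_zero, zero_add] at h2
  simp only [map_add, map_sub, map_neg, Derivation.leibniz, Derivation.leibniz_pow,
    Derivation.leibniz_div, derivation_ofNat, J.map_d, J.virK_zero_r, J.virK_zero_κ, J.virK_zero_p,
    J.virK_zero_p₁, J.virK_zero_p₂, J.virK_zero_p₃, J.neg.virK_zero_p, J.neg.virK_zero_p₁,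
    J.neg.virK_zero_p₂, J.neg.virK_zero_p₃, smul_zero, add_zero, neg_zero, sub_zero] at h2
  exact (smul_eq_zero.mp h2).resolve_left h1

end Jets

/-! ### The constraints for `L₋₁` and `L₂` -/

theorem emb_injective : Function.Injective (emb K) := FaithfulSMul.algebraMap_injective LPS K

instance : FaithfulSMul LPS Closure :=
  (faithfulSMul_iff_algebraMap_injective LPS Closure).mpr (by
    rw [IsScalarTower.algebraMap_eq LPS (FractionRing LPS) Closure]
    exact (algebraMap (FractionRing LPS) Closure).injective.comp
      (IsFractionRing.injective LPS (FractionRing LPS)))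

namespace IsTwoPrimaryCone

/-- An algebraically closed field contains a root κ; all the other data are merely names. -/
theorem exists_jets (h : IsTwoPrimaryCone B F) :
    ∃ κ d v r p q p₁ q₁ p₂ q₂ p₃ q₃ : Closure, Jets B F κ d v r p q p₁ q₁ p₂ q₂ p₃ q₃ := by
  obtain ⟨κ, hκ⟩ := IsAlgClosed.exists_pow_nat_eq (emb Closure (dphi B F)) (n := 2) (by norm_num)
  exact ⟨κ, _, _, _, _, _, _, _, _, _, _, _, h, hκ, rfl, rfl, rfl, rfl, rfl, rfl, rfl, rfl, rfl,
    rfl, rfl⟩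

theorem vir_three_genusOne (h : IsTwoPrimaryCone B F) : vir B F 3 (genusOne B F) +
    virPair B 3 (fun i j => pderiv ℂ i (pderiv ℂ j F)) = 0 := by
  obtain ⟨κ, d, v, r, p, q, p₁, q₁, p₂, q₂, p₃, q₃, J⟩ := h.exists_jets
  apply emb_injective (K := Closure)
  rw [map_add, ← virK_emb, ← lap_emb, J.genus_one, map_zero]

theorem vir_three_genusTwo (h : IsTwoPrimaryCone B F) : vir B F 3 (genusTwo B F) +
    (virPair B 3 (fun i j => pderiv ℂ i (genusOne B F) * pderiv ℂ j (genusOne B F)) +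
    virPair B 3 (fun i j => pderiv ℂ i (pderiv ℂ j (genusOne B F)))) = 0 := by
  obtain ⟨κ, d, v, r, p, q, p₁, q₁, p₂, q₂, p₃, q₃, J⟩ := h.exists_jets
  apply emb_injective (K := Closure)
  rw [map_add, map_add, ← virK_emb, ← lap_emb, virPair_eq_quad, map_quad, map_zero,
    ← J.virK_three_genusTwo, ← quad_delta_mul]
  simp only [map_mul, delta_emb]

theorem vir_zero_genusOne (h : IsTwoPrimaryCone B F) : vir B F 0 (genusOne B F) = 0 := by
  obtain ⟨κ, d, v, r, p, q, p₁, q₁, p₂, q₂, p₃, q₃, J⟩ := h.exists_jets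
  apply emb_injective (K := Closure)
  rw [← virK_emb, J.virK_zero_genusOne, map_zero]

theorem vir_zero_genusTwo (h : IsTwoPrimaryCone B F) : vir B F 0 (genusTwo B F) = 0 := by
  obtain ⟨κ, d, v, r, p, q, p₁, q₁, p₂, q₂, p₃, q₃, J⟩ := h.exists_jets
  apply emb_injective (K := Closure)
  rw [← virK_emb, J.virK_zero_genusTwo, map_zero]

end IsTwoPrimaryCone

end

section

/-! ### The commutation relations of the transformations of sequences -/

section Weyl

variable (B : Background) {R : Type*} [CommRing R] [Algebra ℂ R]

/-- The transformation `E` with `E ∘ sh 1 = sh 1 ∘ E + 1`. -/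
def lower (g : Seq R) : Seq R := sh (-1) (ls B 1 g)

theorem lower_sh_one (g : Seq R) : lower B (sh 1 g) = sh 1 (lower B g) + g := by
  rw [lower, ls_one_sh, map_add, lower, sh_sh, sh_sh]
  simp [sh_sh]

/-- Iteration of `ls_succ`: in the Weyl algebra of z = `sh 1` and ∂ = `lower`, the transformation is
z∂ᴺ. -/
theorem ls_eq_iterate (N : ℕ) (g : Seq R) : ls B N g = sh 1 ((lower B)^[N] g) := by
  induction N generalizing g with
  | zero => rw [ls_zero]; rfl
  | succ N ih => rw [ls_succ, ih, Function.iterate_succ_apply]; rfl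

theorem lower_add (g h : Seq R) : lower B (g + h) = lower B g + lower B h := by
  rw [lower, map_add, map_add]; rfl

theorem lower_smul (c : ℂ) (g : Seq R) : lower B (c • g) = c • lower B g := by
  rw [lower, ← algebraMap_smul R c g, map_smul, map_smul, algebraMap_smul]; rfl

theorem iterate_lower_sh_one (N : ℕ) (g : Seq R) :
    (lower B)^[N + 1] (sh 1 g) = sh 1 ((lower B)^[N + 1] g) + ((N : ℂ) + 1) • (lower B)^[N] g := by
  induction N with
  | zero => simp [lower_sh_one]
  | succ N ih =>
    rw [Function.iterate_succ_apply', ih, lower_add, lower_sh_one, lower_smul,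
      ← Function.iterate_succ_apply' (lower B), ← Function.iterate_succ_apply' (lower B)]
    push_cast
    module

/-- Moving z across ∂ᴹ turns z∂ᴹ·z∂ᴺ into z²∂^{M+N} + M z∂^{M+N-1}; the first term is symmetric in M
and N. -/
theorem ls_ls {M P : ℕ} {N : ℕ} (h : M + N = P + 1) (g : Seq R) :
    ls B M (ls B N g) - ls B N (ls B M g) = ((M : ℂ) - N) • ls B P g := by
  have key : ∀ M N : ℕ, M + N = P + 1 → ls B M (ls B N g) =
      sh 2 ((lower B)^[P + 1] g) + (M : ℂ) • ls B P g := by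
    intro M N h
    rw [ls_eq_iterate B M, ls_eq_iterate B N, ls_eq_iterate B P]
    rcases M with _ | M
    · have : N = P + 1 := by omega
      subst this
      simp [sh_sh]
    · have h' : M + N = P := by omega
      rw [iterate_lower_sh_one, ← Function.iterate_add_apply, ← Function.iterate_add_apply, map_add,
        sh_sh, h', show M + 1 + N = P + 1 by omega, ← algebraMap_smul R ((M : ℂ) + 1), map_smul,
        algebraMap_smul]
      push_cast
      norm_num
  rw [key M N h, key N M (by omega)]
  module

end Weyl

end

section

variable (B : Background)

/-! ### The action of the operators on the coordinates and the derivatives -/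

/-- The coordinates, as a sequence of negative degree. -/
def ttSeq : Seq LPS := fun a m =>
  if m < 0 then (-1 : ℂ) ^ (-1 - m).toNat • tt B (1 - a) (-1 - m).toNat else 0

theorem ttSeq_neg (a : Fin 2) (j : ℕ) : ttSeq B a (-1 - j) = (-1 : ℂ) ^ j • tt B (1 - a) j := by
  have : (-1 - (-1 - (j : ℤ))).toNat = j := by omega
  rw [ttSeq, if_pos (by omega), this]

theorem ttSeq_of_nonneg (a : Fin 2) {m : ℤ} (hm : 0 ≤ m) : ttSeq B a m = 0 := if_neg (by omega)

/-- The sequence with a single nonzero entry. -/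
def point (b : Fin 2) (m : ℤ) : Seq LPS := fun a k => if a = b ∧ k = m then 1 else 0

/-- By `virCoeff_flip` the transformation is its own transpose for the symplectic pairing, up to
sign; column m becomes row -1 - m, applied to the sequence of coordinates. -/
theorem sumT_ls_point (N : ℕ) (b : Fin 2) (m : ℤ) :
    sumT B (fun i => ls B N (point b m) i.1 i.2) =
      (-1 : ℂ) ^ (m.natAbs + 1) • ls B N (ttSeq B) (1 - b) (-1 - m) := by
  simp only [ls_apply]
  rw [sumT_sum, Finset.smul_sum]
  refine Finset.sum_congr rfl fun l _ => ?_
  by_cases hk : 0 ≤ m - N + 1 + l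
  · obtain ⟨k, hk⟩ := Int.eq_ofNat_of_zero_le hk
    rw [sumT_eq_sum B (Finset.univ ×ˢ {k}), Finset.sum_product, Finset.smul_sum]
    · have e1 : -1 - m + N - 1 - l = -1 - (k : ℤ) := by omega
      have e2 : (k : ℤ) + N - 1 - l = m := by omega
      rw [e1]
      refine Finset.sum_nbij (fun a => 1 - a) (by simp) ?_ ?_ ?_
      · intro a _ a' _ h
        fin_cases a <;> fin_cases a' <;> simp_all
      · intro a _
        exact ⟨1 - a, by simp, by simp⟩
      · intro a _
        rw [Finset.sum_singleton, ttSeq_neg, e2, sub_sub_cancel,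
          Finset.sum_eq_single_of_mem b (Finset.mem_univ _), point, if_pos ⟨rfl, rfl⟩,
          virCoeff_flip B N k l a b, show (l : ℤ) - N - k = -1 - m by omega, smul_smul, smul_smul,
          mul_smul_comm, mul_one]
        · congr 1
          have : (-1 : ℂ) ^ (N + l) = (-1) ^ (m.natAbs + 1) * (-1) ^ k := by
            rw [← pow_add, neg_one_pow_eq_pow_mod_two, neg_one_pow_eq_pow_mod_two (n := _ + k)]
            congr 1
            omega
          rw [this]
          ring
        · intro c _ hc
          rw [point, if_neg (fun h => hc h.1), smul_zero]
    · rintro ⟨a, k'⟩ hk'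
      have hk'' : ¬k = k' := by simpa using hk'
      refine Finset.sum_eq_zero fun c _ => ?_
      rw [point, if_neg (by rintro ⟨-, h⟩; dsimp only at h; omega), smul_zero]
  · rw [sumT_eq_sum B ∅, Finset.sum_empty]
    · symm
      refine smul_eq_zero_of_right _ (Finset.sum_eq_zero fun c _ => ?_)
      rw [ttSeq_of_nonneg _ _ (by omega), smul_zero]
    · rintro ⟨a, k'⟩ _
      refine Finset.sum_eq_zero fun c _ => ?_
      rw [point, if_neg (by rintro ⟨-, h⟩; dsimp only at h; omega), smul_zero]

theorem pderiv_virQuad_eq (N : ℕ) (i : Fin 2 × ℕ) :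
    pderiv ℂ i (virQuad B N) = ls B N (ttSeq B) i.1 i.2 := by
  have h : eps LPS i = ((-1 : LPS) ^ i.2) • point (1 - i.1) (-1 - i.2) := by
    funext c m
    simp only [eps, point, Pi.smul_apply, smul_eq_mul, mul_ite, mul_one, mul_zero, and_comm]
  have h1 : (-1 - (i.2 : ℤ)).natAbs = i.2 + 1 := by omega
  have h2 : -1 - (-1 - (i.2 : ℤ)) = i.2 := by ring
  rw [pderiv_virQuad, h]
  simp only [map_smul, Pi.smul_apply, smul_eq_mul]
  rw [sumT_mul, sumT_ls_point, h1, h2, sub_sub_cancel, mul_smul_comm]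
  rw [show (-1 : LPS) ^ i.2 = algebraMap ℂ LPS ((-1) ^ i.2) by simp, ← Algebra.smul_def, smul_smul,
    ← pow_add, show i.2 + 1 + 1 + i.2 = 2 * (i.2 + 1) by ring, pow_mul]
  simp

theorem grad_tt (c : Fin 2) (j : ℕ) : grad (tt B c j) = point c j := by
  funext a k
  by_cases hk : 0 ≤ k
  · obtain ⟨k, rfl⟩ := Int.eq_ofNat_of_zero_le hk
    rw [grad_natCast, pd, pderiv_tt, point]
    congr 1
    simp
  · rw [grad_of_neg _ _ (by omega), point, if_neg (by omega)]

theorem virVec_tt (N : ℕ) (c : Fin 2) (j : ℕ) :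
    virVec B N (tt B c j) = (-1 : ℂ) ^ (j + 1) • ls B N (ttSeq B) (1 - c) (-1 - j) := by
  rw [virVec_eq, grad_tt, sumT_ls_point]
  rfl

theorem bil_tt (N : ℕ) (c : Fin 2) (j : ℕ) (f : LPS) :
    bil B N (fun i => pderiv ℂ i (tt B c j)) (fun i => pderiv ℂ i f) =
      (-1 : ℂ) ^ (j + 1) • ls B N (grad f) (1 - c) (-1 - j) := by
  simp only [bil, low, pderiv_tt]
  by_cases hj : j < N
  · rw [Finset.sum_eq_single_of_mem j (Finset.mem_range.mpr hj),
      Finset.sum_eq_single_of_mem (1 - c) (Finset.mem_univ _)]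
    · simp [grad]
    · intro b _ hb
      rw [if_neg, smul_zero, zero_mul]
      simp only [Prod.mk.injEq, and_true]
      rintro rfl
      exact hb (sub_sub_cancel _ _).symm
    · intro k _ hk
      refine Finset.sum_eq_zero fun b _ => ?_
      rw [if_neg, smul_zero, zero_mul]
      simp only [Prod.mk.injEq, not_and]
      exact fun _ => hk
  · rw [ls_eq_zero_of_lt B N (s := 0) (fun c m hm => grad_of_neg f c hm) _ _ (by omega), smul_zero]
    refine Finset.sum_eq_zero fun k hk => Finset.sum_eq_zero fun b _ => ?_
    rw [if_neg, smul_zero, zero_mul]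
    simp only [Prod.mk.injEq, not_and]
    have := Finset.mem_range.mp hk
    intro _
    omega

/-- For the potential 0 the derivation `vir` reduces to `virVec`. -/
theorem virVec_mul (N : ℕ) (f g : LPS) :
    virVec B N (f * g) = f * virVec B N g + g * virVec B N f := by
  have h : ∀ H, virVec B N H = vir B 0 N H := fun H => by
    rw [vir_apply]
    simp [bil, low]
  simp only [h, Derivation.leibniz, smul_eq_mul]

theorem virBiLin_apply (N : ℕ) (f : LPS) :
    virBiLin B N f = quad B N fun i j => pderiv ℂ i (pderiv ℂ j f) :=
  (show virBiLin B N f = virPair B N fun i j => pderiv ℂ i (pderiv ℂ j f) from rfl).trans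
    (virPair_eq_quad B N fun i j => pderiv ℂ i (pderiv ℂ j f))

theorem virBiLin_mul (N : ℕ) (f g : LPS) : virBiLin B N (f * g) = f * virBiLin B N g +
    g * virBiLin B N f + bil B N (fun i => pderiv ℂ i f) (fun i => pderiv ℂ i g) := by
  have h : (fun i j => pderiv ℂ i (pderiv ℂ j (f * g))) =
      f • (fun i j => pderiv ℂ i (pderiv ℂ j g)) + g • (fun i j => pderiv ℂ i (pderiv ℂ j f)) +
        ((fun i j => pderiv ℂ i f * pderiv ℂ j g) + fun i j => pderiv ℂ i g * pderiv ℂ j f) := by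
    funext i j
    simp only [Pi.add_apply, Pi.smul_apply, smul_eq_mul, Derivation.leibniz, map_add]
    ring
  rw [virBiLin_apply, virBiLin_apply, virBiLin_apply, h, map_add, map_add, map_add, map_smul,
    map_smul, quad_mul, quad_mul, bil_comm B N (fun i => pderiv ℂ i g), smul_eq_mul, smul_eq_mul]
  rw [← add_smul]
  norm_num

theorem virBiLin_tt (N : ℕ) (c : Fin 2) (j : ℕ) : virBiLin B N (tt B c j) = 0 := by
  have : (fun i i' => pderiv ℂ i (pderiv ℂ i' (tt B c j))) = 0 := by
    funext i i'
    rw [pderiv_tt]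
    split_ifs <;> simp
  rw [virBiLin_apply, this, map_zero]

theorem pderiv_virBiLin (N : ℕ) (f : LPS) (i : Fin 2 × ℕ) :
    pderiv ℂ i (virBiLin B N f) = virBiLin B N (pderiv ℂ i f) := by
  rw [virBiLin_apply, virBiLin_apply, derivation_quad]
  congr 1
  funext j k
  rw [pderiv_comm i, pderiv_comm i k]

/-- The operator `L_{N-1}`. -/
def virOp (hbar : ℂ) (N : ℕ) : Module.End ℂ LPS :=
  hbar⁻¹ • LinearMap.mulLeft ℂ (virQuad B N) + virVecLin B N + hbar • virBiLin B N +
    virConst B N • LinearMap.id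

theorem virOp_apply (hbar : ℂ) (N : ℕ) (f : LPS) : virOp B hbar N f =
    hbar⁻¹ • (virQuad B N * f) + virVec B N f + hbar • virBiLin B N f + virConst B N • f := rfl

/-- The derivatives of `f` and its products with the coordinates. -/
def modes (hbar : ℂ) (f : LPS) : Seq LPS := grad f + (hbar⁻¹ • f) • ttSeq B

theorem modes_natCast (hbar : ℂ) (f : LPS) (a : Fin 2) (k : ℕ) :
    modes B hbar f a k = pderiv ℂ (a, k) f := by
  rw [modes, Pi.add_apply, Pi.add_apply, Pi.smul_apply, Pi.smul_apply,
    ttSeq_of_nonneg _ _ (Int.natCast_nonneg k), smul_zero, add_zero, grad_natCast]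

theorem modes_neg (hbar : ℂ) (f : LPS) (a : Fin 2) (j : ℕ) :
    modes B hbar f a (-1 - j) = (hbar⁻¹ * (-1) ^ j) • (tt B (1 - a) j * f) := by
  rw [modes, Pi.add_apply, Pi.add_apply, Pi.smul_apply, Pi.smul_apply, ttSeq_neg,
    grad_of_neg _ _ (by omega), zero_add, smul_eq_mul, smul_mul_smul_comm, mul_comm f]

/-- The commutators of `L_{N-1}` with the derivatives and the coordinates. -/
theorem virOp_modes {hbar : ℂ} (h0 : hbar ≠ 0) (N : ℕ) (f : LPS) (a : Fin 2) (k : ℤ) :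
    virOp B hbar N (modes B hbar f a k) =
      modes B hbar (virOp B hbar N f) a k - ls B N (modes B hbar f) a k := by
  have hls : ∀ k, ls B N (modes B hbar f) a k =
      ls B N (grad f) a k + hbar⁻¹ • (f * ls B N (ttSeq B) a k) := fun k => by
    rw [modes, map_add, map_smul, Pi.add_apply, Pi.add_apply, Pi.smul_apply, Pi.smul_apply,
      smul_eq_mul, smul_mul_assoc]
  obtain ⟨k, rfl⟩ | ⟨j, rfl⟩ := int_cases k
  · rw [hls, modes_natCast, modes_natCast, virOp_apply, virOp_apply, map_add, map_add, map_add,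
      Derivation.map_smul, Derivation.map_smul, Derivation.map_smul, Derivation.leibniz,
      pderiv_virVec, pderiv_virBiLin, pderiv_virQuad_eq, smul_eq_mul, smul_eq_mul]
    module
  -- In negative degrees the mode is multiplication by a coordinate. The vector field sends it to
  -- other coordinates, and the cross term `bil_tt` of the second order part supplies the
  -- derivatives.
  · obtain ⟨c, rfl⟩ : ∃ c, a = 1 - c := ⟨1 - a, (sub_sub_cancel _ _).symm⟩
    rw [hls, modes_neg, modes_neg, map_smul, virOp_apply, virOp_apply]
    simp only [sub_sub_cancel]
    rw [virVec_mul, virBiLin_mul, virVec_tt, bil_tt, virBiLin_tt, pow_succ]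
    have hs : ((-1 : ℂ) ^ j) * (-1) ^ j = 1 := by rw [← mul_pow]; simp
    rcases neg_one_pow_eq_or ℂ j with e | e <;> rw [e] <;>
      · simp only [smul_add, mul_add, add_mul, mul_smul_comm, smul_smul, mul_zero, add_zero,
          mul_left_comm (tt B c j)]
        match_scalars <;> field_simp

end

section

variable (B : Background)

/-! ### Continuous operators on formal power series -/

/-- An operator is row finite if every coefficient of the result depends on finitely many
coefficients of the argument. -/
def IsRowFinite (A : LPS → LPS) : Prop := ∀ n, ∃ s : Finset ((Fin 2 × ℕ) →₀ ℕ), ∀ f : LPS,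
  (∀ m ∈ s, coeff m f = 0) → coeff n (A f) = 0

namespace IsRowFinite

variable {A A' : LPS → LPS}

theorem comp (h : IsRowFinite A) (h' : IsRowFinite A') : IsRowFinite fun f => A (A' f) := by
  classical
  intro n
  obtain ⟨s, hs⟩ := h n
  choose t ht using h'
  refine ⟨s.biUnion t, fun f hf => hs _ fun m hm => ht m f fun k hk => hf k ?_⟩
  exact Finset.mem_biUnion.mpr ⟨m, hm, hk⟩

theorem add (h : IsRowFinite A) (h' : IsRowFinite A') : IsRowFinite fun f => A f + A' f := by
  classical
  intro n
  obtain ⟨s, hs⟩ := h n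
  obtain ⟨s', hs'⟩ := h' n
  refine ⟨s ∪ s', fun f hf => ?_⟩
  rw [map_add, hs f fun m hm => hf m (Finset.mem_union_left _ hm),
    hs' f fun m hm => hf m (Finset.mem_union_right _ hm), add_zero]

theorem smul (c : ℂ) (h : IsRowFinite A) : IsRowFinite fun f => c • A f := by
  intro n
  obtain ⟨s, hs⟩ := h n
  exact ⟨s, fun f hf => by rw [map_smul, hs f hf, smul_zero]⟩

theorem sub (h : IsRowFinite A) (h' : IsRowFinite A') : IsRowFinite fun f => A f - A' f := by
  simpa [sub_eq_add_neg] using h.add (h'.smul (-1))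

theorem zero : IsRowFinite fun _ => 0 := fun _ => ⟨∅, fun _ _ => map_zero _⟩

theorem id : IsRowFinite fun f => f := fun n => ⟨{n}, fun _ hf => hf n (by simp)⟩

theorem sum {ι : Type*} (s : Finset ι) {A : ι → LPS → LPS} (h : ∀ i ∈ s, IsRowFinite (A i)) :
    IsRowFinite fun f => ∑ i ∈ s, A i f := by
  classical
  induction s using Finset.induction_on with
  | empty => simpa using zero
  | insert a s ha ih =>
    simp only [Finset.sum_insert ha]
    exact (h a (by simp)).add (ih fun i hi => h i (by simp [hi]))

theorem pderiv (i : Fin 2 × ℕ) : IsRowFinite fun f => MvPowerSeries.pderiv ℂ i f := fun n =>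
  ⟨{n + Finsupp.single i 1}, fun f hf => by rw [coeff_pderiv, hf _ (by simp), zero_mul]⟩

theorem mul (G : LPS) : IsRowFinite fun f => G * f := by
  classical
  intro n
  refine ⟨(Finset.HasAntidiagonal.antidiagonal n).image Prod.snd, fun f hf => ?_⟩
  rw [coeff_mul]
  refine Finset.sum_eq_zero fun p hp => ?_
  rw [hf _ (Finset.mem_image_of_mem _ hp), mul_zero]

theorem sumX {A : Fin 2 × ℕ → LPS → LPS} (h : ∀ i, IsRowFinite (A i)) :
    IsRowFinite fun f => TwoPrimary.sumX fun i => A i f := by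
  classical
  intro n
  choose s hs using fun i => h i
  refine ⟨n.support.biUnion fun i => s i (n - Finsupp.single i 1), fun f hf => ?_⟩
  change ∑ i ∈ n.support, coeff (n - Finsupp.single i 1) (A i f) = 0
  exact Finset.sum_eq_zero fun i hi => hs i _ f fun m hm =>
    hf m (Finset.mem_biUnion.mpr ⟨i, hi, hm⟩)

theorem sumT {A : Fin 2 × ℕ → LPS → LPS} (h : ∀ i, IsRowFinite (A i)) :
    IsRowFinite fun f => TwoPrimary.sumT B fun i => A i f :=
  ((sumX h).add (sum _ fun a _ => (h (a, 0)).smul _)).sub (h (0, 1))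

theorem grad (a : Fin 2) (k : ℤ) : IsRowFinite fun f => TwoPrimary.grad f a k := by
  by_cases hk : 0 ≤ k
  · simpa only [TwoPrimary.grad, extend, hk, if_true] using pderiv (a, k.toNat)
  · simpa only [TwoPrimary.grad, extend, hk, if_false] using zero

end IsRowFinite

/-- This continuity is what allows conclusions about polynomials to be carried over to power series.
-/
theorem isRowFinite_virOp (hbar : ℂ) (N : ℕ) : IsRowFinite (virOp B hbar N) := by
  have h1 : IsRowFinite fun f => virVec B N f := by
    simp only [virVec_eq, ls_apply]
    exact .sumT B fun i => .sum _ fun l _ => .sum _ fun b _ => (IsRowFinite.grad b _).smul _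
  have h2 : IsRowFinite fun f => virBiLin B N f := by
    have : ∀ f, virBiLin B N f = (1 / 2 : ℂ) • ∑ j ∈ Finset.range N, ∑ c,
        (-1 : ℂ) ^ (j + 1) • ∑ l ∈ Finset.range (degBound B N + 1), ∑ b,
          virCoeff B N (-1 - j) l c b •
            (if 0 ≤ (-1 - (j : ℤ) + N - 1 - l) then pderiv ℂ (1 - c, j)
              (pderiv ℂ (b, (-1 - (j : ℤ) + N - 1 - l).toNat) f) else 0) := fun f => by
      rw [virBiLin_apply, quad_apply]
      simp only [ls_apply, extend]
    simp only [this]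
    refine (IsRowFinite.sum _ fun j _ => .sum _ fun c _ => (IsRowFinite.sum _ fun l _ =>
      .sum _ fun b _ => IsRowFinite.smul _ ?_).smul _).smul _
    split_ifs
    · exact (IsRowFinite.pderiv _).comp (IsRowFinite.pderiv _)
    · exact .zero
  exact ((((IsRowFinite.mul _).smul _).add h1).add (h2.smul _)).add (IsRowFinite.id.smul _)

/-- A row finite operator that commutes with the coordinates and the derivatives is a scalar. -/
theorem eq_smul_of_commute {T : LPS →ₗ[ℂ] LPS} (hT : IsRowFinite T)
    (hX : ∀ i f, T (X i * f) = X i * T f) (hD : ∀ i f, T (pderiv ℂ i f) = pderiv ℂ i (T f))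
    (f : LPS) : T f = constantCoeff (T 1) • f := by
  classical
  set c := constantCoeff (T 1) with hc
  have h0 : ∀ f : LPS, coeff 0 (T f) = c * coeff 0 f := by
    intro f
    -- The constant term of T f depends on finitely many coefficients of f. Hence f may be replaced
    -- by its constant term plus finitely many monomials of positive degree, each of which contains
    -- a coordinate that T lets through, so it contributes nothing.
    obtain ⟨s, hs⟩ := hT 0
    set g := f - C (coeff 0 f) with hg
    set p : LPS := ∑ m ∈ s, monomial m (coeff m g) with hp
    have h1 : coeff 0 (T (g - p)) = 0 := hs _ fun m hm => by
      rw [map_sub, hp, map_sum, Finset.sum_eq_single_of_mem m hm, coeff_monomial_same, sub_self]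
      intro k _ hk
      rw [coeff_monomial, if_neg hk.symm]
    have h2 : ∀ m, coeff 0 (T (monomial m (coeff m g))) = 0 := by
      intro m
      by_cases hm : m = 0
      · subst hm
        have : coeff 0 g = 0 := by simp [hg]
        rw [this]
        simp
      · obtain ⟨i, hi⟩ := Finsupp.ne_iff.mp hm
        have h3 : Finsupp.single i 1 + (m - Finsupp.single i 1) = m := by
          rw [add_tsub_cancel_of_le]
          rw [Finsupp.single_le_iff]
          exact Nat.one_le_iff_ne_zero.mpr hi
        have h4 : monomial m (coeff m g) =
            X i * monomial (m - Finsupp.single i 1) (coeff m g) := by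
          rw [X_def, monomial_mul_monomial, h3, one_mul]
        rw [h4, hX, coeff_zero_eq_constantCoeff, map_mul, constantCoeff_X, zero_mul]
    have h5 : coeff 0 (T p) = 0 := by
      rw [hp, map_sum, map_sum]
      exact Finset.sum_eq_zero fun m _ => h2 m
    have h6 : f = (coeff 0 f) • (1 : LPS) + p + (g - p) := by
      rw [add_assoc, add_sub_cancel, hg, smul_eq_C_mul, mul_one, add_sub_cancel]
    conv_lhs => rw [h6, map_add, map_add, map_add, map_add, h1, h5, add_zero, add_zero,
      map_smul, map_smul, coeff_zero_eq_constantCoeff, ← hc]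
    rw [smul_eq_mul, mul_comm, coeff_zero_eq_constantCoeff]
  -- Higher coefficients are reached by differentiation, with which T commutes, up to a nonzero
  -- integer factor.
  have key : ∀ (k : ℕ) (n : (Fin 2 × ℕ) →₀ ℕ), n.degree = k → ∀ f,
      coeff n (T f) = c * coeff n f := by
    intro k
    induction k with
    | zero =>
      intro n hn f
      rw [Finsupp.degree_eq_zero_iff] at hn
      rw [hn, h0]
    | succ k ih =>
      intro n hn f
      have hn0 : n ≠ 0 := by
        rintro rfl
        simp at hn
      obtain ⟨i, hi⟩ := Finsupp.ne_iff.mp hn0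
      have h3 : (n - Finsupp.single i 1) + Finsupp.single i 1 = n := by
        rw [tsub_add_cancel_of_le]
        rw [Finsupp.single_le_iff]
        exact Nat.one_le_iff_ne_zero.mpr hi
      have h4 : (n - Finsupp.single i 1).degree = k := by
        rw [← h3, map_add, Finsupp.degree_single] at hn
        omega
      have h5 := ih _ h4 (pderiv ℂ i f)
      rw [hD, coeff_pderiv, coeff_pderiv, h3, ← mul_assoc] at h5
      refine mul_right_cancel₀ ?_ h5
      exact Nat.cast_add_one_ne_zero _
  ext n
  rw [key _ n rfl, map_smul, smul_eq_mul]

/-! ### The Virasoro relations -/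

theorem map_ls {N : ℕ} (A : LPS →ₗ[ℂ] LPS) (g : Seq LPS) (a : Fin 2) (k : ℤ) :
    A (ls B N g a k) = ls B N (fun a k => A (g a k)) a k := by
  simp only [ls_apply, map_sum, map_smul]

/-- The defect of a commutation relation. -/
def defect (hbar : ℂ) (M N P : ℕ) : LPS →ₗ[ℂ] LPS :=
  virOp B hbar M ∘ₗ virOp B hbar N - virOp B hbar N ∘ₗ virOp B hbar M -
    ((M : ℂ) - N) • virOp B hbar P

theorem defect_apply (hbar : ℂ) (M N P : ℕ) (f : LPS) : defect B hbar M N P f =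
    virOp B hbar M (virOp B hbar N f) - virOp B hbar N (virOp B hbar M f) -
      ((M : ℂ) - N) • virOp B hbar P f := rfl

/-- By `virOp_modes`, bracketing with an operator acts on the modes through its transformation of
sequences. These transformations satisfy the bracket relation of `ls_ls`, so the contributions to
the defect cancel. -/
theorem defect_modes {hbar : ℂ} (h0 : hbar ≠ 0) {M N P : ℕ} (h : M + N = P + 1) (f : LPS)
    (a : Fin 2) (k : ℤ) : defect B hbar M N P (modes B hbar f a k) =
      modes B hbar (defect B hbar M N P f) a k := by
  have hm : ∀ f g, modes B hbar (f - g) = modes B hbar f - modes B hbar g := fun f g => by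
    funext a k
    obtain ⟨k, rfl⟩ | ⟨j, rfl⟩ := int_cases k
    · simp [modes_natCast]
    · simp [modes_neg, mul_sub, smul_sub]
  have hms : ∀ (c : ℂ) f, modes B hbar (c • f) = c • modes B hbar f := fun c f => by
    funext a k
    obtain ⟨k, rfl⟩ | ⟨j, rfl⟩ := int_cases k
    · simp [modes_natCast]
    · simp [modes_neg, smul_smul, mul_comm]
  have key : ∀ M N : ℕ, virOp B hbar M (virOp B hbar N (modes B hbar f a k)) =
      modes B hbar (virOp B hbar M (virOp B hbar N f)) a k -
        ls B M (modes B hbar (virOp B hbar N f)) a k -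
        ls B N (modes B hbar (virOp B hbar M f)) a k + ls B N (ls B M (modes B hbar f)) a k := by
    intro M N
    have e : (fun a k => virOp B hbar M (modes B hbar f a k)) =
        modes B hbar (virOp B hbar M f) - ls B M (modes B hbar f) := by
      funext a k
      exact virOp_modes B h0 M f a k
    rw [virOp_modes B h0, map_sub, virOp_modes B h0, map_ls, e, map_sub]
    simp only [Pi.sub_apply]
    abel
  have h3 := congrFun (congrFun (ls_ls B h (modes B hbar f)) a) k
  simp only [Pi.sub_apply, Pi.smul_apply] at h3
  rw [defect_apply, key M N, key N M, virOp_modes B h0, defect_apply, hm, hm, hms]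
  simp only [Pi.sub_apply, Pi.smul_apply, smul_sub]
  rw [← h3]
  abel

/-- The modes consist of all derivatives and, up to nonzero factors, all coordinates, so the defect
can only be a central term. -/
theorem defect_eq_smul {hbar : ℂ} (h0 : hbar ≠ 0) {M N P : ℕ} (h : M + N = P + 1) (f : LPS) :
    defect B hbar M N P f = constantCoeff (defect B hbar M N P 1) • f := by
  refine eq_smul_of_commute ?_ ?_ ?_ f
  · have hM := isRowFinite_virOp B hbar M
    have hN := isRowFinite_virOp B hbar N
    exact ((hM.comp hN).sub (hN.comp hM)).sub ((isRowFinite_virOp B hbar P).smul _)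
  · rintro ⟨a, j⟩ f
    have h1 := defect_modes B h0 h f (1 - a) (-1 - j)
    rw [modes_neg, modes_neg, sub_sub_cancel, map_smul] at h1
    have h2 := smul_right_injective LPS (r := hbar⁻¹ * (-1) ^ j)
      (mul_ne_zero (inv_ne_zero h0) (pow_ne_zero _ (by norm_num))) h1
    rw [tt, add_mul, add_mul, map_add, ← smul_eq_C_mul, map_smul, smul_eq_C_mul,
      add_left_inj] at h2
    exact h2
  · rintro ⟨a, k⟩ f
    have h1 := defect_modes B h0 h f a k
    rwa [modes_natCast, modes_natCast] at h1

end

/-! ### Vanishing of the central terms, and generation by L₋₁ and L₂ -/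

section

variable (B : Background)

theorem virQuad_zero : virQuad B 0 = tt B 0 0 * tt B 1 0 := by
  have h : degBound B 0 = 0 := by simp [degBound]
  rw [virQuad_eq, h]
  simp [virCoeff_zero, Fin.sum_univ_two]
  rw [mul_comm (tt B 1 0), ← two_smul ℂ, smul_smul]
  norm_num

theorem virVec_one (N : ℕ) : virVec B N 1 = 0 := by
  have := virVec_mul B N 1 1
  simpa using this

theorem virBiLin_one (N : ℕ) : virBiLin B N 1 = 0 := by
  have : (fun i j => pderiv ℂ i (pderiv ℂ j (1 : LPS))) = 0 := by
    funext i j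
    simp
  rw [virBiLin_apply, this, map_zero]

theorem virOp_one (hbar : ℂ) (N : ℕ) :
    virOp B hbar N 1 = hbar⁻¹ • virQuad B N + virConst B N • 1 := by
  rw [virOp_apply, virVec_one, virBiLin_one, mul_one, smul_zero, add_zero, add_zero]

theorem virBiLin_zero (f : LPS) : virBiLin B 0 f = 0 := by
  rw [virBiLin_apply, quad_apply]
  simp

/-- Only the second order part of L₁ can act nontrivially on t̃^0_0 t̃^1_0, by a constant. The value
determines the constant in L₀ through [L₁, L₋₁] = 2L₀. -/
theorem virBiLin_virQuad_zero (P : ℕ) : virBiLin B (P + 1) (virQuad B 0) =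
    (((P : ℂ) + 1) * virConst B P) • 1 := by
  rw [virQuad_zero, virBiLin_mul, virBiLin_tt, virBiLin_tt, mul_zero, mul_zero, zero_add, zero_add,
    bil_tt, grad_tt, ls_apply]
  have h1 : ∀ l : ℕ, ∑ b, virCoeff B (P + 1) (-1 - ((0 : ℕ) : ℤ)) l (1 - 0) b •
      point 1 ((0 : ℕ) : ℤ) b (-1 - ((0 : ℕ) : ℤ) + ((P + 1 : ℕ) : ℤ) - 1 - l) =
      if l + 1 = P then virCoeff B (P + 1) (-1) l 1 1 • (1 : LPS) else 0 := by
    intro l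
    rw [Fin.sum_univ_two, point, point, if_neg (by simp), smul_zero, zero_add]
    split_ifs with h2 h3 h3
    · simp
    · omega
    · omega
    · rw [smul_zero]
  simp only [h1]
  have h2 : ∀ l, l ≠ 0 → virCoeff B (P + 1) (-1) l 1 1 = 0 := fun l hl => by
    have := virCoeff_grading B (P + 1) (-1) l 1 1
    rw [sub_self, zero_mul, eq_comm] at this
    exact (mul_eq_zero.mp this).resolve_left (by exact_mod_cast hl)
  rw [Finset.sum_eq_single_of_mem 0 (by simp)]
  · rw [virConst]
    by_cases hP : P = 1
    · subst hP
      rw [if_pos rfl, if_pos rfl, virCoeff_zero_right, if_pos rfl, smul_smul]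
      congr 1
      simp [elem_succ_zero, elem_zero, Fin.sum_univ_two, mu]
      ring
    · rw [if_neg (by omega), if_neg hP, smul_zero, mul_zero, zero_smul]
  · intro l _ hl
    rw [h2 l hl, zero_smul, ite_self]

theorem euler_virVec (N : ℕ) {H : LPS} (h : euler B H H = 2 • H) :
    euler B H (virVec B N H) = 2 • virVec B N H := by
  have hg : (fun a k => euler B H (grad H a k)) = grad H := by
    funext a k
    by_cases hk : 0 ≤ k
    · simp [grad, extend, hk, euler_pderiv B h]
    · simp [grad, extend, hk]
  have hl : ∀ a k, euler B H (ls B N (grad H) a k) = ls B N (grad H) a k := by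
    intro a k
    have := derivation_ls B (euler B H) N (grad H)
    rw [hg] at this
    exact congrFun (congrFun this a) k
  rw [virVec_eq, euler_sumT]
  simp only [hl, two_nsmul]

theorem euler_congr (F G H : LPS) : euler B F H = euler B G H := by
  rw [euler_apply, euler_apply]

/-- The commutators with `L₋₁`. -/
theorem defect_zero_right {hbar : ℂ} (h0 : hbar ≠ 0) (P : ℕ) (f : LPS) :
    defect B hbar (P + 1) 0 P f = 0 := by
  set W := virVec B (P + 1) (virQuad B 0) - virVec B 0 (virQuad B (P + 1)) -
    ((P : ℂ) + 1) • virQuad B P with hW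
  have h1 : defect B hbar (P + 1) 0 P 1 = hbar⁻¹ • W := by
    have hc : virConst B 0 = 0 := by simp [virConst]
    have e : ∀ N (c : ℂ), virOp B hbar N (c • 1) = c • virOp B hbar N 1 := fun N c => map_smul _ _ _
    have e' : ∀ N (f : LPS), virOp B hbar N (hbar⁻¹ • f) = hbar⁻¹ • virOp B hbar N f :=
      fun N c => map_smul _ _ _
    rw [defect_apply, virOp_one, virOp_one, virOp_one, map_add, map_add, e, e, e', e', virOp_one,
      virOp_one, virOp_apply, virOp_apply, virBiLin_zero, virBiLin_virQuad_zero, hc, hW,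
      mul_comm (virQuad B 0)]
    push_cast
    match_scalars <;> field_simp <;> ring
  -- The scalar is read off on the series 1, where the defect is ħ⁻¹W with W quadratic in t̃. A
  -- constant that is homogeneous of degree 2 for the Euler field vanishes.
  have h2 : euler B 0 W = 2 • W := by
    have e : ∀ M N, euler B 0 (virVec B M (virQuad B N)) = 2 • virVec B M (virQuad B N) :=
      fun M N => by
        rw [euler_congr B 0 (virQuad B N), euler_virVec]
        rw [euler_virQuad]
    rw [hW, map_sub, map_sub, Derivation.map_smul, e, e, euler_virQuad]
    module
  have h3 : ∀ i, pderiv ℂ i W = 0 := fun i => by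
    have h4 := defect_eq_smul B h0 (show P + 1 + 0 = P + 1 from rfl) 1
    rw [h1] at h4
    have h5 := congrArg (pderiv ℂ i) h4
    rw [Derivation.map_smul, Derivation.map_smul, Derivation.map_one_eq_zero, smul_zero] at h5
    exact (smul_eq_zero.mp h5).resolve_left (inv_ne_zero h0)
  have h6 : W = 0 := by
    rw [euler_apply] at h2
    simp only [h3, sumT_zero] at h2
    rw [← Nat.cast_smul_eq_nsmul ℂ, eq_comm, smul_eq_zero] at h2
    simpa using h2
  rw [defect_eq_smul B h0 (show P + 1 + 0 = P + 1 from rfl), h1, h6, smul_zero, map_zero, zero_smul]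

/-- The Jacobi identity for two operators and `L₋₁`. -/
theorem defect_jacobi {hbar : ℂ} (h0 : hbar ≠ 0) {M N : ℕ}
    (h : defect B hbar (M + 1) N (M + N) = 0) : defect B hbar M (N + 1) (M + N) = 0 := by
  have h1 : ∀ P, virOp B hbar (P + 1) * virOp B hbar 0 - virOp B hbar 0 * virOp B hbar (P + 1) =
      ((P : ℂ) + 1) • virOp B hbar P := fun P => by
    have : defect B hbar (P + 1) 0 P = 0 := LinearMap.ext fun f => defect_zero_right B h0 P f
    rw [defect, sub_eq_zero] at this
    simpa [Module.End.mul_eq_comp] using this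
  have hc : ∀ M N P, M + N = P + 1 → ∃ c : ℂ, virOp B hbar M * virOp B hbar N -
      virOp B hbar N * virOp B hbar M = ((M : ℂ) - N) • virOp B hbar P + c • 1 ∧
        (defect B hbar M N P = c • 1) := by
    intro M N P h
    have h2 : defect B hbar M N P = constantCoeff (defect B hbar M N P 1) • 1 :=
      LinearMap.ext fun f => defect_eq_smul B h0 h f
    refine ⟨_, ?_, h2⟩
    rw [← h2, defect, Module.End.mul_eq_comp, Module.End.mul_eq_comp]
    abel
  obtain ⟨x, hx, hx'⟩ := hc M (N + 1) (M + N) (by omega)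
  obtain ⟨c, h3, -⟩ := hc (M + 1) (N + 1) (M + N + 1) (by omega)
  have h2 : virOp B hbar (M + 1) * virOp B hbar N - virOp B hbar N * virOp B hbar (M + 1) =
      (((M + 1 : ℕ) : ℂ) - N) • virOp B hbar (M + N) := by
    rw [defect, sub_eq_zero] at h
    exact h
  have hJ : ∀ a b z : Module.End ℂ LPS, (a * b - b * a) * z - z * (a * b - b * a) =
      ((a * z - z * a) * b - b * (a * z - z * a)) +
        (a * (b * z - z * b) - (b * z - z * b) * a) := by
    intro a b z
    simp only [sub_mul, mul_sub, mul_assoc]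
    abel
  have h4 := hJ (virOp B hbar (M + 1)) (virOp B hbar (N + 1)) (virOp B hbar 0)
  rw [h3, h1, h1, add_mul, mul_add, smul_mul_assoc, smul_mul_assoc, mul_smul_comm, mul_smul_comm,
    smul_mul_assoc, mul_smul_comm, smul_mul_assoc, mul_smul_comm, one_mul, mul_one,
    add_sub_add_right_eq_sub] at h4
  have h1' := h1 (M + N)
  -- In the Jacobi identity the unknown scalar c for (M + 1, N + 1) is central and drops out, the
  -- operators cancel, and M + 1 times the scalar x for (M, N + 1) remains.
  have h5 : (((M : ℂ) + 1) * x) • (1 : Module.End ℂ LPS) = 0 := by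
    push_cast at h4 h1' hx h2
    linear_combination (norm := module) -h4 - ((M : ℂ) + 1) • hx - ((N : ℂ) + 1) • h2 +
      ((M : ℂ) - N) • h1'
  have h6 : x = 0 := by
    have h7 := congrArg (fun A : Module.End ℂ LPS => constantCoeff (A 1)) h5
    have h8 : ((M : ℂ) + 1) ≠ 0 := Nat.cast_add_one_ne_zero M
    simpa [h8] using h7
  rw [hx', h6, zero_smul]

/-- Two applications of `defect_jacobi` lead from brackets with L₋₁ to brackets with L₀ and then
with L₁. -/
theorem virOp_comm_two {hbar : ℂ} (h0 : hbar ≠ 0) (N : ℕ) :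
    virOp B hbar N * virOp B hbar 2 - virOp B hbar 2 * virOp B hbar N =
      ((N : ℂ) - 2) • virOp B hbar (N + 1) := by
  have h1 : ∀ M, defect B hbar M 1 M = 0 := fun M =>
    defect_jacobi B h0 (N := 0) (LinearMap.ext fun f => defect_zero_right B h0 M f)
  have h2 := defect_jacobi B h0 (N := 1) (h1 (N + 1))
  rw [defect, sub_eq_zero] at h2
  exact h2

theorem virOp_comm_zero {hbar : ℂ} (h0 : hbar ≠ 0) (N : ℕ) :
    virOp B hbar (N + 1) * virOp B hbar 0 - virOp B hbar 0 * virOp B hbar (N + 1) =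
      ((N : ℂ) + 1) • virOp B hbar N := by
  have : defect B hbar (N + 1) 0 N = 0 := LinearMap.ext fun f => defect_zero_right B h0 N f
  rw [defect, sub_eq_zero] at this
  simpa [Module.End.mul_eq_comp] using this

/-- A property of the operators that holds for `L₋₁` and `L₂` and is inherited by commutators holds
for all of them. -/
theorem virOp_induction {p : ℕ → Prop} (h0 : p 0) (h3 : p 3)
    (hc : ∀ M N P : ℕ, M + N = P + 1 → M ≠ N → (∀ hbar : ℂ, hbar ≠ 0 →
      virOp B hbar M * virOp B hbar N - virOp B hbar N * virOp B hbar M =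
        ((M : ℂ) - N) • virOp B hbar P) → p M → p N → p P) (N : ℕ) : p N := by
  have hz : ∀ N, p (N + 1) → p N := fun N h => hc (N + 1) 0 N rfl (by omega) (fun hbar hh => by
    rw [virOp_comm_zero B hh]; push_cast; ring_nf) h h0
  have h2 := hz 2 h3
  have h1 := hz 1 h2
  -- The bracket of L_n with L₁ is (n - 1)L_{n+1}, with nonzero factor from L₂ on; from L₋₁, L₀ and
  -- L₁ alone this step could not produce L₂.
  have h : ∀ N, p (N + 3) := fun N => by
    induction N with
    | zero => exact h3
    | succ N ih => exact hc (N + 3) 2 (N + 4) rfl (by omega) (fun hbar hh => virOp_comm_two B hh _) ih h2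
  rcases N with _ | _ | _ | N
  · exact h0
  · exact h1
  · exact h2
  · exact h N

section

attribute [local instance] LieRing.ofAssociativeRing

theorem virasoroOperator_mem {hbar : ℂ} (h0 : hbar ≠ 0) (n : ℤ) :
    virasoroOperator B hbar n ∈
      generatedLieAlgebra {virasoroOperator B hbar (-1), virasoroOperator B hbar 2} := by
  set S : Set (Module.End ℂ LPS) := {virasoroOperator B hbar (-1), virasoroOperator B hbar 2}
  change virOp B hbar (n + 1).toNat ∈ LieSubalgebra.lieSpan ℂ (Module.End ℂ LPS) S
  refine virOp_induction B (p := fun N => virOp B hbar N ∈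
    LieSubalgebra.lieSpan ℂ (Module.End ℂ LPS) S) ?_ ?_ ?_ _
  · exact LieSubalgebra.subset_lieSpan (Set.mem_insert _ _)
  · exact LieSubalgebra.subset_lieSpan (Set.mem_insert_of_mem _ rfl)
  · intro M N P _ hMN h hM hN
    have h1 := LieSubalgebra.lie_mem _ hM hN
    rw [Ring.lie_def, h hbar h0] at h1
    have h2 : (M : ℂ) - N ≠ 0 := sub_ne_zero.mpr (by exact_mod_cast hMN)
    have h3 := (LieSubalgebra.lieSpan ℂ (Module.End ℂ LPS) S).smul_mem ((M : ℂ) - N)⁻¹ h1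
    rwa [smul_smul, inv_mul_cancel₀ h2, one_smul] at h3

end

end

section

variable (B : Background)

/-! ### The Virasoro operators acting on exponentials -/

theorem bil_add (N : ℕ) (G G' H : Fin 2 × ℕ → LPS) :
    bil B N (fun i => G i + G' i) H = bil B N G H + bil B N G' H := by
  simp only [bil, low, smul_add, add_mul, Finset.sum_add_distrib]

theorem bil_mul (N : ℕ) (c : LPS) (G H : Fin 2 × ℕ → LPS) :
    bil B N (fun i => G i * c) H = c * bil B N G H := by
  simp only [bil, low, Finset.mul_sum]
  refine Finset.sum_congr rfl fun j _ => Finset.sum_congr rfl fun b _ => ?_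
  rw [← smul_mul_assoc]
  ring

/-- The pairing of the gradients of two functions. -/
def bilGrad (N : ℕ) (f g : LPS) : LPS :=
  bil B N (fun i => pderiv ℂ i f) (fun i => pderiv ℂ i g)

theorem bilGrad_comm (N : ℕ) (f g : LPS) : bilGrad B N f g = bilGrad B N g f := bil_comm B N _ _

theorem bilGrad_add_left (N : ℕ) (f f' g : LPS) :
    bilGrad B N (f + f') g = bilGrad B N f g + bilGrad B N f' g := by
  simp only [bilGrad, map_add, bil_add]

theorem bilGrad_smul_left (N : ℕ) (c : ℂ) (f g : LPS) :
    bilGrad B N (c • f) g = c • bilGrad B N f g := by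
  have : bilGrad B N (c • f) g = bil B N (fun i => pderiv ℂ i f * C c) (fun i => pderiv ℂ i g) := by
    rw [bilGrad]
    congr 1
    funext i
    rw [Derivation.map_smul, smul_eq_C_mul, mul_comm]
  rw [this, bil_mul, smul_eq_C_mul, bilGrad]

theorem bilGrad_add_right (N : ℕ) (f g g' : LPS) :
    bilGrad B N f (g + g') = bilGrad B N f g + bilGrad B N f g' := by
  rw [bilGrad_comm, bilGrad_add_left, bilGrad_comm, bilGrad_comm B N g']

theorem bilGrad_smul_right (N : ℕ) (c : ℂ) (f g : LPS) :
    bilGrad B N f (c • g) = c • bilGrad B N f g := by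
  rw [bilGrad_comm, bilGrad_smul_left, bilGrad_comm]

/-- `Z⁻¹ L Z` for `Z = exp f` and an operator `L = L_{N-1}`. -/
def expPart (hbar : ℂ) (f : LPS) (N : ℕ) : LPS :=
  hbar⁻¹ • virQuad B N + virVec B N f + hbar • ((1 / 2 : ℂ) • bilGrad B N f f + virBiLin B N f) +
    virConst B N • 1

/-- The conjugate of `L_{N-1}` by `exp f` is the sum of this operator and of the multiplication by
`expPart`. -/
def expOp (hbar : ℂ) (f : LPS) (N : ℕ) (p : LPS) : LPS :=
  virVec B N p + hbar • (bilGrad B N f p + virBiLin B N p)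

/-- Only the differential equation ∂E = E ∂f is used. Conjugation adds the gradient of f to the
vector field through the cross term of the second order part. -/
theorem virOp_exp (hbar : ℂ) {f E : LPS} (hE : ∀ i, pderiv ℂ i E = pderiv ℂ i f * E) (N : ℕ)
    (p : LPS) : virOp B hbar N (E * p) = E * (expPart B hbar f N * p + expOp B hbar f N p) := by
  have h1 : virVec B N E = E * virVec B N f := by
    have : grad E = E • grad f := by
      funext a k
      by_cases hk : 0 ≤ k
      · obtain ⟨k, rfl⟩ := Int.eq_ofNat_of_zero_le hk
        rw [Pi.smul_apply, Pi.smul_apply, grad_natCast, grad_natCast, pd, hE, smul_eq_mul, mul_comm]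
      · rw [Pi.smul_apply, Pi.smul_apply, grad_of_neg _ _ (by omega), grad_of_neg _ _ (by omega),
          smul_zero]
    rw [virVec_eq, virVec_eq, this]
    simp only [map_smul, Pi.smul_apply, smul_eq_mul, sumT_mul]
  have h2 : virBiLin B N E = E * ((1 / 2 : ℂ) • bilGrad B N f f + virBiLin B N f) := by
    have : (fun i j => pderiv ℂ i (pderiv ℂ j E)) =
        E • ((fun i j => pderiv ℂ i f * pderiv ℂ j f) + fun i j => pderiv ℂ i (pderiv ℂ j f)) := by
      funext i j
      simp only [Pi.add_apply, Pi.smul_apply, smul_eq_mul, hE, Derivation.leibniz]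
      ring
    rw [virBiLin_apply, this, map_smul, map_add, quad_mul, ← virBiLin_apply, smul_eq_mul, bilGrad]
  have h3 : bil B N (fun i => pderiv ℂ i E) (fun i => pderiv ℂ i p) = E * bilGrad B N f p := by
    simp only [hE, bil_mul, bilGrad]
  rw [virOp_apply, virVec_mul, virBiLin_mul, h1, h2, h3, expPart, expOp]
  simp only [smul_eq_C_mul, smul_add, mul_add, add_mul]
  ring

theorem expOp_mul_one (hbar : ℂ) (f : LPS) (N : ℕ) : expOp B hbar f N 1 = 0 := by
  rw [expOp, virVec_one, virBiLin_one, bilGrad_comm, bilGrad]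
  simp [bil, low]

/-- The relation between the functions `expPart` that follows from a commutation relation. -/
theorem expOp_expPart {hbar : ℂ} (f : LPS) {M N P : ℕ}
    (h : virOp B hbar M * virOp B hbar N - virOp B hbar N * virOp B hbar M =
      ((M : ℂ) - N) • virOp B hbar P) :
    expOp B hbar f M (expPart B hbar f N) - expOp B hbar f N (expPart B hbar f M) =
      ((M : ℂ) - N) • expPart B hbar f P := by
  obtain ⟨E, hu, hE⟩ := exists_exp f
  have h1 := LinearMap.congr_fun h (E * 1)
  simp only [LinearMap.sub_apply, Module.End.mul_apply, LinearMap.smul_apply,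
    virOp_exp B hbar hE, expOp_mul_one] at h1
  simp only [mul_one, add_zero] at h1
  rw [← mul_sub, ← mul_smul_comm] at h1
  have h2 := hu.mul_left_cancel h1
  rw [← h2]
  ring

/-! ### The parts of genus 1 and 2 -/

theorem virasoroPart_genusOne (F : ℕ → LPS) (n : ℤ) : virasoroPart B F n 1 =
    virVec B (n + 1).toNat (F 1) + bilGrad B (n + 1).toNat (F 0) (F 1) +
      virBiLin B (n + 1).toNat (F 0) + virConst B (n + 1).toNat • 1 := by
  have h1 : (fun i j => ∑ h ∈ Finset.range (1 + 1), pderiv ℂ i (F h) * pderiv ℂ j (F (1 - h))) =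
      (fun i j => pderiv ℂ i (F 0) * pderiv ℂ j (F 1)) +
        fun i j => pderiv ℂ i (F 1) * pderiv ℂ j (F 0) := by
    funext i j
    simp [Finset.sum_range_succ]
  rw [virasoroPart, h1, if_neg one_ne_zero, if_neg one_ne_zero, if_pos rfl, virPair_eq_quad,
    virPair_eq_quad, map_add, quad_mul, quad_mul, bil_comm B _ (fun i => pderiv ℂ i (F 1)),
    virBiLin_apply, bilGrad, show C (virConst B (n + 1).toNat) =
      virConst B (n + 1).toNat • (1 : LPS) by rw [smul_eq_C_mul, mul_one], Nat.sub_self]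
  module

theorem virasoroPart_genusTwo (F : ℕ → LPS) (n : ℤ) : virasoroPart B F n 2 =
    virVec B (n + 1).toNat (F 2) + bilGrad B (n + 1).toNat (F 0) (F 2) +
      ((1 / 2 : ℂ) • bilGrad B (n + 1).toNat (F 1) (F 1) + virBiLin B (n + 1).toNat (F 1)) := by
  have h1 : (fun i j => ∑ h ∈ Finset.range (2 + 1), pderiv ℂ i (F h) * pderiv ℂ j (F (2 - h))) =
      (fun i j => pderiv ℂ i (F 0) * pderiv ℂ j (F 2)) +
        (fun i j => pderiv ℂ i (F 1) * pderiv ℂ j (F 1)) +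
        fun i j => pderiv ℂ i (F 2) * pderiv ℂ j (F 0) := by
    funext i j
    simp [Finset.sum_range_succ]
  rw [virasoroPart, h1, if_neg two_ne_zero, if_neg two_ne_zero, if_neg (by norm_num),
    virPair_eq_quad, virPair_eq_quad, map_add, map_add, quad_mul, quad_mul, quad_mul,
    bil_comm B _ (fun i => pderiv ℂ i (F 2)), virBiLin_apply, bilGrad, bilGrad]
  module

/-- Truncating the free energy after F₂ does not affect the coefficients of ħ^{g-1} for g ≤ 2; the
remainder has order ħ². -/
theorem expPart_eq {hbar : ℂ} (h0 : hbar ≠ 0) (F : ℕ → LPS) (n : ℤ) :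
    expPart B hbar (hbar⁻¹ • F 0 + F 1 + hbar • F 2) (n + 1).toNat =
      hbar⁻¹ • virasoroPart B F n 0 + virasoroPart B F n 1 + hbar • virasoroPart B F n 2 +
        hbar ^ 2 • (bilGrad B (n + 1).toNat (F 1) (F 2) + virBiLin B (n + 1).toNat (F 2) +
          hbar • (1 / 2 : ℂ) • bilGrad B (n + 1).toNat (F 2) (F 2)) := by
  have h : ∀ N, expPart B hbar (hbar⁻¹ • F 0 + F 1 + hbar • F 2) N =
      hbar⁻¹ • genusZeroPart B (F 0) N + (virVec B N (F 1) + bilGrad B N (F 0) (F 1) +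
        virBiLin B N (F 0) + virConst B N • 1) + hbar • (virVec B N (F 2) +
        bilGrad B N (F 0) (F 2) + ((1 / 2 : ℂ) • bilGrad B N (F 1) (F 1) + virBiLin B N (F 1))) +
        hbar ^ 2 • (bilGrad B N (F 1) (F 2) + virBiLin B N (F 2) +
          hbar • (1 / 2 : ℂ) • bilGrad B N (F 2) (F 2)) := fun N => by
    have hv : virVec B N (hbar⁻¹ • F 0 + F 1 + hbar • F 2) =
        hbar⁻¹ • virVec B N (F 0) + virVec B N (F 1) + hbar • virVec B N (F 2) := by
      change virVecLin B N _ = hbar⁻¹ • virVecLin B N _ + virVecLin B N _ + hbar • virVecLin B N _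
      simp only [map_add, map_smul]
    rw [expPart, genusZeroPart, hv, ← bilGrad]
    simp only [bilGrad_add_left, bilGrad_add_right, bilGrad_smul_left, bilGrad_smul_right, map_add,
      map_smul, bilGrad_comm B N (F 1) (F 0), bilGrad_comm B N (F 2) (F 0),
      bilGrad_comm B N (F 2) (F 1)]
    match_scalars <;> field_simp <;> norm_num
  rw [h, virasoroPart_genusZero, virasoroPart_genusOne, virasoroPart_genusTwo]

/-- A polynomial in `ħ` that vanishes for `ħ ≠ 0` has vanishing coefficients. -/
theorem eq_zero_of_forall_sum_smul {n : ℕ} {a : ℕ → LPS}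
    (h : ∀ hbar : ℂ, hbar ≠ 0 → ∑ i ∈ Finset.range n, hbar ^ i • a i = 0) {i : ℕ} (hi : i < n) :
    a i = 0 := by
  ext m
  set p : Polynomial ℂ := ∑ i ∈ Finset.range n, Polynomial.monomial i (coeff m (a i)) with hp
  have h1 : p = 0 := by
    refine Polynomial.eq_zero_of_infinite_isRoot p ((Set.infinite_of_finite_compl
      (s := {x : ℂ | x ≠ 0}) ?_).mono fun x hx => ?_)
    · exact (Set.finite_singleton 0).subset fun x hx => by simpa using hx
    · have := congrArg (coeff m) (h x hx)
      simpa [hp, Polynomial.IsRoot, Polynomial.eval_finsetSum, mul_comm] using this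
  have h2 : p.coeff i = coeff m (a i) := by
    rw [hp, Polynomial.finsetSum_coeff]
    simp [Polynomial.coeff_monomial, hi]
  rw [← h2, h1, Polynomial.coeff_zero, map_zero]

/-- By assumption Z⁻¹LZ is ħ²(Q + ħR) for both operators, with Z truncated after genus 2. The
conjugated operators of `expOp` contain no negative power of ħ, as the pole ħ⁻¹F₀ is compensated by
the ħ of the second order part. So their bracket relation shows that Z⁻¹LZ for the third operator
also has order ħ², and its coefficients of ħ⁰ and ħ¹ are the parts of genus 1 and 2. -/
theorem virasoroPart_eq_zero_of_comm {F : ℕ → LPS} (hF : ∀ n, virasoroPart B F n 0 = 0)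
    {M N P : ℕ} (hMN : M ≠ N) (h : ∀ hbar : ℂ, hbar ≠ 0 →
      virOp B hbar M * virOp B hbar N - virOp B hbar N * virOp B hbar M =
        ((M : ℂ) - N) • virOp B hbar P)
    (hM : virasoroPart B F (M - 1) 1 = 0 ∧ virasoroPart B F (M - 1) 2 = 0)
    (hN : virasoroPart B F (N - 1) 1 = 0 ∧ virasoroPart B F (N - 1) 2 = 0) :
    virasoroPart B F (P - 1) 1 = 0 ∧ virasoroPart B F (P - 1) 2 = 0 := by
  have hc : (M : ℂ) - N ≠ 0 := sub_ne_zero.mpr (by exact_mod_cast hMN)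
  have ht : ∀ N : ℕ, ((N : ℤ) - 1 + 1).toNat = N := fun N => by simp
  have hK : ∀ hbar : ℂ, hbar ≠ 0 → ∀ N : ℕ,
      expPart B hbar (hbar⁻¹ • F 0 + F 1 + hbar • F 2) N = virasoroPart B F (N - 1) 1 +
        hbar • virasoroPart B F (N - 1) 2 + hbar ^ 2 • (bilGrad B N (F 1) (F 2) +
          virBiLin B N (F 2) + hbar • (1 / 2 : ℂ) • bilGrad B N (F 2) (F 2)) := fun hbar h0 N => by
    have := expPart_eq B h0 F (N - 1)
    rwa [ht, hF, smul_zero, zero_add] at this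
  set Q : ℕ → LPS := fun N => bilGrad B N (F 1) (F 2) + virBiLin B N (F 2) with hQ
  set R : ℕ → LPS := fun N => (1 / 2 : ℂ) • bilGrad B N (F 2) (F 2) with hR
  have hE : ∀ hbar : ℂ, hbar ≠ 0 → ∀ (N : ℕ) (q r : LPS),
      expOp B hbar (hbar⁻¹ • F 0 + F 1 + hbar • F 2) N (hbar ^ 2 • (q + hbar • r)) =
        hbar ^ 2 • (virVec B N q + bilGrad B N (F 0) q + hbar • (virVec B N r +
          bilGrad B N (F 0) r + bilGrad B N (F 1) q + virBiLin B N q) +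
          hbar ^ 2 • (bilGrad B N (F 1) r + bilGrad B N (F 2) q + virBiLin B N r) +
          hbar ^ 3 • bilGrad B N (F 2) r) := fun hbar h0 N q r => by
    have hv : virVec B N (hbar ^ 2 • (q + hbar • r)) =
        hbar ^ 2 • (virVec B N q + hbar • virVec B N r) := by
      change virVecLin B N _ = hbar ^ 2 • (virVecLin B N _ + hbar • virVecLin B N _)
      simp only [map_add, map_smul]
    rw [expOp, hv]
    simp only [bilGrad_add_left, bilGrad_add_right, bilGrad_smul_left, bilGrad_smul_right, map_add,
      map_smul]
    match_scalars <;> field_simp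
  -- The relation divided by M - N, with its right-hand side subtracted, is a polynomial of degree
  -- at most 5 in ħ; the entries of the list are its coefficients, and the first two are the ones
  -- wanted.
  have key : ∀ i < 6, [virasoroPart B F (P - 1) 1, virasoroPart B F (P - 1) 2,
      Q P - ((M : ℂ) - N)⁻¹ • (virVec B M (Q N) + bilGrad B M (F 0) (Q N) -
        (virVec B N (Q M) + bilGrad B N (F 0) (Q M))),
      R P - ((M : ℂ) - N)⁻¹ • (virVec B M (R N) + bilGrad B M (F 0) (R N) +
          bilGrad B M (F 1) (Q N) + virBiLin B M (Q N) - (virVec B N (R M) +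
          bilGrad B N (F 0) (R M) + bilGrad B N (F 1) (Q M) + virBiLin B N (Q M))),
      -((M : ℂ) - N)⁻¹ • (bilGrad B M (F 1) (R N) + bilGrad B M (F 2) (Q N) + virBiLin B M (R N) -
        (bilGrad B N (F 1) (R M) + bilGrad B N (F 2) (Q M) + virBiLin B N (R M))),
      -((M : ℂ) - N)⁻¹ • (bilGrad B M (F 2) (R N) - bilGrad B N (F 2) (R M))].getD i 0 = 0 := by
    intro i hi
    refine eq_zero_of_forall_sum_smul (n := 6) (a := fun i => List.getD _ i 0)
      (fun hbar h0 => ?_) hi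
    have h1 := expOp_expPart B (hbar⁻¹ • F 0 + F 1 + hbar • F 2) (h hbar h0)
    rw [hK hbar h0 M, hK hbar h0 N, hK hbar h0 P, hM.1, hM.2, hN.1, hN.2, smul_zero, zero_add,
      zero_add, zero_add, hE hbar h0, hE hbar h0] at h1
    have h2 := congrArg (fun x => ((M : ℂ) - N)⁻¹ • x) h1
    simp only [smul_smul, inv_mul_cancel₀ hc, one_smul] at h2
    simp only [Finset.sum_range_succ, Finset.sum_range_zero, List.getD_cons_zero,
      List.getD_cons_succ, hQ, hR]
    linear_combination (norm := module) -h2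
  exact ⟨key 0 (by norm_num), key 1 (by norm_num)⟩

theorem virasoroPart_congr (F : ℕ → LPS) {m n : ℤ} (h : (m + 1).toNat = (n + 1).toNat) (g : ℕ) :
    virasoroPart B F m g = virasoroPart B F n g := by
  rw [virasoroPart, virasoroPart, h]

/-- Genus 0 is tangency together with homogeneity. Genus 1 and 2 are known for L₋₁ and L₂ from the
canonical coordinates, and `virOp_induction` carries them to all the operators. -/
theorem virasoroPart_eq_zero {F : ℕ → LPS} (h₀ : IsTwoPrimaryCone B (F 0))
    (h₁ : F 1 = genusOne B (F 0)) (h₂ : F 2 = genusTwo B (F 0)) (n : ℤ) {g : ℕ} (hg : g ≤ 2) :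
    virasoroPart B F n g = 0 := by
  have hF : ∀ n, virasoroPart B F n 0 = 0 := fun n => by
    rw [virasoroPart_genusZero, genusZeroPart_eq_zero B h₀.euler (h₀.tangent _)]
  have hv : ∀ N H, virVec B N H + bilGrad B N (F 0) H = vir B (F 0) N H := fun N H =>
    (vir_apply B (F 0) N H).symm
  have hz : ∀ H H', bilGrad B 0 H H' = 0 := fun H H' => by simp [bilGrad, bil]
  have h : ∀ N : ℕ, virasoroPart B F (N - 1) 1 = 0 ∧ virasoroPart B F (N - 1) 2 = 0 := by
    refine virOp_induction B ?_ ?_ fun M N P _ hMN hc => virasoroPart_eq_zero_of_comm B hF hMN hc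
    · rw [virasoroPart_genusOne, virasoroPart_genusTwo]
      simp only [Nat.cast_zero, zero_sub, neg_add_cancel, Int.toNat_zero, hv, virBiLin_zero]
      rw [h₁, h₂, hz (genusOne B (F 0)), h₀.vir_zero_genusOne, h₀.vir_zero_genusTwo]
      simp [virConst]
    · have e : (((3 : ℕ) : ℤ) - 1 + 1).toNat = 3 := rfl
      rw [virasoroPart_genusOne, virasoroPart_genusTwo, e, hv, hv, h₁, h₂]
      refine ⟨?_, ?_⟩
      · rw [← h₀.vir_three_genusOne]
        simp [virConst]
        rfl
      · rw [← h₀.vir_three_genusTwo, virPair_mul]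
        rfl
  rw [virasoroPart_congr B F (n := ((n + 1).toNat : ℤ) - 1) (by omega)]
  interval_cases g
  · exact hF _
  · exact (h _).1
  · exact (h _).2

theorem IsGenusZeroPotential.isTwoPrimaryCone {F : ℕ → LPS} (h : IsGenusZeroPotential B F) :
    IsTwoPrimaryCone B (F 0) :=
  { h.isCone with structure_function := h.structure_function }

end

end TwoPrimary

end

theorem mainTheorem4 (B : TwoPrimary.Background) (F : ℕ → TwoPrimary.LPS)
    (hF₀ : TwoPrimary.IsGenusZeroPotential B F)
    (hF₁ : F 1 = TwoPrimary.genusOne B (F 0))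
    (hF₂ : F 2 = TwoPrimary.genusTwo B (F 0)) :
    TwoPrimary.virasoroPart B F 2 2 = 0 ∧
    (∀ hbar : ℂ, hbar ≠ 0 → ∀ n : ℤ, -1 ≤ n →
      TwoPrimary.virasoroOperator B hbar n ∈ TwoPrimary.generatedLieAlgebra
        {TwoPrimary.virasoroOperator B hbar (-1), TwoPrimary.virasoroOperator B hbar 2}) ∧
    (∀ n : ℤ, -1 ≤ n → ∀ g : ℕ, g ≤ 2 → TwoPrimary.virasoroPart B F n g = 0) := by
  have h := fun n g hg =>
    TwoPrimary.virasoroPart_eq_zero B hF₀.isTwoPrimaryCone hF₁ hF₂ n (g := g) hg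
  exact ⟨h 2 2 le_rfl, fun hbar h0 n _ => TwoPrimary.virasoroOperator_mem B h0 n,
    fun n _ g hg => h n g hg⟩
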